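/- Let $\mathbb T^2=\mathbb S^1\times\mathbb S^1$ with angular coordinates $(\theta,\varphi)$. For distinct $x,y\in\mathbb S^1$ let $[x,y]$ denote the closed arc from $x$ to $y$ in the positive direction and $(x,y)$ its interior. A rectangle is a subset $r=[\theta_1,\theta_2]\times[\varphi_1,\varphi_2]\subset\mathbb T^2$ with $\theta_1\ne\theta_2$, $\varphi_1\ne\varphi_2$; its vertices are the points of $\{\theta_1,\theta_2\}\times\{\varphi_1,\varphi_2\}$. Two rectangles $r_1,r_2$ are compatible if $r_1\cap r_2$ is empty, or is a subset of the vertices of $r_1$, or is a rectangle that contains no vertex of $r_1$ or $r_2$. A rectangular diagram of a surface is a finite set $\Pi$ of pairwise compatible rectangles such that every meridian $\{\theta\}\times\mathbb S^1$ and every longitude $\mathbb S^1\times\{\varphi\}$ contains at most two free vertices, a free vertex being a point that is a vertex of exactly one rectangle of $\Pi$. Its boundary $\partial\Pi$ is the set of its free vertices. A rectangular diagram of a link is a finite set $R\subset\mathbb T^2$ that meets every meridian and every longitude in no or exactly two points. Let $J:\mathbb T^2\times[0,1]\to\mathbb S^3\subset\mathbb R^4$ be the map $$J(\theta,\varphi,\tau)=\bigl(\cos\tfrac{\pi\tau}2\cos\varphi,\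 \cos\tfrac{\pi\tau}2\sin\varphi,\ \sin\tfrac{\pi\tau}2\cos\theta,\ \sin\tfrac{\pi\tau}2\sin\theta\bigr),$$ which presents $\mathbb S^3$ as the join $\mathbb S^1*\mathbb S^1$. For $R\subset\mathbb T^2$ put $\widehat R=\bigcup_{v\in R}J(\{v\}\times[0,1])$. For a rectangle $r=[\theta_1,\theta_2]\times[\varphi_1,\varphi_2]$ let $h_r$ be the unique bounded harmonic function on $\operatorname{int}(r)=(\theta_1,\theta_2)\times(\varphi_1,\varphi_2)$ that tends to $0$ as $\varphi$ tends to $\varphi_1$ or $\varphi_2$ with $\theta\in(\theta_1,\theta_2)$ fixed, and tends to $1$ as $\theta$ tends to $\theta_1$ or $\theta_2$ with $\varphi\in(\varphi_1,\varphi_2)$ fixed. Let $\widetilde h_r=\frac2\pi\arctan\sqrt{\tan(\pi h_r/2)}$. The tile $\widehat r$ is the image under $J$ of the closure of $\{(v,\widetilde h_r(v)) : v\in\operatorname{int}(r)\}$ in $\mathbb T^2\times[0,1]$, and $\widehat\Pi=\bigcup_{r\in\Pi}\widehat r$. A compact set $F\subset\mathbb S^3$ is a surface with corners if it is contained in a two-dimensional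 $C^1$-regularly embedded submanifold $M\subset\mathbb S^3$ and is bounded in $M$ by a finite (possibly empty) collection of mutually disjoint piecewise smooth simple closed curves without cusps: $F$ is the closure of its interior relative to $M$ and its frontier relative to $M$ is the union of these curves. A cusp of a curve is a point at which some local parametrization has opposite nonzero one-sided limits of the velocity. The boundary $\partial F$ is the set of points of $F$ near which $F$ is not a $C^1$-regularly embedded surface without boundary, i.e. the union of the bounding curves. **Proposition.** Let $\Pi$ be a rectangular diagram of a surface. Then $\widehat\Pi$ is a surface with corners in $\mathbb S^3$, the set $\partial\Pi$ is a rectangular diagram of a link, and $\partial\widehat\Pi=\widehat{\partial\Pi}$, the link associated with $\partial\Pi$. -/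

import Mathlib

open Set Filter Topology
open scoped ContDiff

namespace RectSurface

/-! ### Rectangles and rectangular diagrams on the torus -/

/-- The torus `𝕋² = 𝕊¹ × 𝕊¹`, with coordinates `(θ, φ)`. -/
abbrev Torus : Type := Real.Angle × Real.Angle

/-- A rectangle `[θ₁, θ₂] × [φ₁, φ₂]` in the torus. The four (ordered) endpoints are determined by
the subset `Rectangle.carrier` of the torus. -/
structure Rectangle where
  θ₁ : Real.Angle
  θ₂ : Real.Angle
  φ₁ : Real.Angle
  φ₂ : Real.Angle
  θ_ne : θ₁ ≠ θ₂
  φ_ne : φ₁ ≠ φ₂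

namespace Rectangle

/-- The rectangle as a subset of the torus; `cIcc x y` is the closed arc of the circle which goes
from `x` to `y` in the positive direction. -/
def carrier (r : Rectangle) : Set Torus := cIcc r.θ₁ r.θ₂ ×ˢ cIcc r.φ₁ r.φ₂

/-- The interior of the rectangle, a product of two open arcs. -/
def int (r : Rectangle) : Set Torus := cIoo r.θ₁ r.θ₂ ×ˢ cIoo r.φ₁ r.φ₂

/-- The four vertices of the rectangle. -/
def vertices (r : Rectangle) : Set Torus := {r.θ₁, r.θ₂} ×ˢ {r.φ₁, r.φ₂}

/-- Two rectangles are compatible if their intersection is empty, or consists of vertices, or is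
a rectangle that contains no vertex of either of them. -/
def Compatible (r₁ r₂ : Rectangle) : Prop :=
  r₁.carrier ∩ r₂.carrier = ∅ ∨
  r₁.carrier ∩ r₂.carrier ⊆ r₁.vertices ∨
  ∃ r : Rectangle, r₁.carrier ∩ r₂.carrier = r.carrier ∧
    Disjoint r.carrier r₁.vertices ∧ Disjoint r.carrier r₂.vertices

end Rectangle

/-- The free vertices of a collection of rectangles: the points that are a vertex of exactly one
rectangle of the collection. -/
def freeVertices (P : Finset Rectangle) : Set Torus :=
  {v | ∃! r : Rectangle, r ∈ P ∧ v ∈ r.vertices}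

/-- A rectangular diagram of a surface: a finite collection of pairwise compatible rectangles such
that every meridian and every longitude contains at most two free vertices. -/
structure SurfaceDiagram where
  rects : Finset Rectangle
  compatible : ∀ r₁ ∈ rects, ∀ r₂ ∈ rects, r₁ ≠ r₂ → r₁.Compatible r₂
  meridian : ∀ θ : Real.Angle, {v ∈ freeVertices rects | v.1 = θ}.encard ≤ 2
  longitude : ∀ φ : Real.Angle, {v ∈ freeVertices rects | v.2 = φ}.encard ≤ 2

/-- The boundary `∂Π` of a rectangular diagram of a surface: the set of its free vertices. -/
def SurfaceDiagram.boundary (P : SurfaceDiagram) : Set Torus := freeVertices P.rects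

/-- A rectangular diagram of a link: a finite set of points of the torus such that every meridian
and every longitude contains no or exactly two of them. -/
def IsLinkDiagram (R : Set Torus) : Prop :=
  R.Finite ∧
  (∀ θ : Real.Angle, {v ∈ R | v.1 = θ}.encard = 0 ∨ {v ∈ R | v.1 = θ}.encard = 2) ∧
  (∀ φ : Real.Angle, {v ∈ R | v.2 = φ}.encard = 0 ∨ {v ∈ R | v.2 = φ}.encard = 2)

/-! ### The three-sphere as a join, the link and the surface associated with a diagram -/

/-- The space `ℝ⁴` with its Euclidean norm. -/
abbrev E4 : Type := EuclideanSpace ℝ (Fin 4)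

/-- The sphere `𝕊³` as the unit sphere of `ℝ⁴`. -/
def sphere3 : Set E4 := Metric.sphere (0 : E4) 1

/-- The map `(θ, φ, τ) ↦ (cos(πτ/2) cos φ, cos(πτ/2) sin φ, sin(πτ/2) cos θ, sin(πτ/2) sin θ)`,
which on `𝕋² × [0, 1]` is the quotient map onto `𝕊¹ * 𝕊¹ = 𝕊³`. -/
noncomputable def joinMap (x : Torus × ℝ) : E4 :=
  !₂[Real.cos (Real.pi * x.2 / 2) * x.1.2.cos, Real.cos (Real.pi * x.2 / 2) * x.1.2.sin,
    Real.sin (Real.pi * x.2 / 2) * x.1.1.cos, Real.sin (Real.pi * x.2 / 2) * x.1.1.sin]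

/-- The arc of `𝕊³` which is the image of `v × [0, 1]`. -/
noncomputable def arc (v : Torus) : Set E4 := joinMap '' ({v} ×ˢ Icc (0 : ℝ) 1)

/-- The union of the arcs associated with the points of `R`; if `R` is a rectangular diagram of
a link, this is the link associated with `R`. -/
noncomputable def link (R : Set Torus) : Set E4 := ⋃ v ∈ R, arc v

/-- `h` is a bounded harmonic function on the interior of `r`, which tends to `0` as `φ` tends to
`φ₁` or `φ₂` with `θ` fixed in the open arc `(θ₁, θ₂)`, and tends to `1` as `θ` tends to `θ₁` or `θ₂`
with `φ` fixed in the open arc `(φ₁, φ₂)`. Harmonicity is with respect to the flat coordinates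
`(θ, φ)`, that is, it is harmonicity of the lift of `h` to the universal cover of the torus. -/
structure IsRectHarmonic (r : Rectangle) (h : Torus → ℝ) : Prop where
  bounded : ∃ C : ℝ, ∀ v ∈ r.int, |h v| ≤ C
  harmonic : InnerProductSpace.HarmonicOnNhd
    (fun z : ℂ => h ((z.re : Real.Angle), (z.im : Real.Angle)))
    {z : ℂ | ((z.re : Real.Angle), (z.im : Real.Angle)) ∈ r.int}
  tendsto_φ₁ : ∀ θ ∈ cIoo r.θ₁ r.θ₂,
    Tendsto (fun φ => h (θ, φ)) (𝓝[cIoo r.φ₁ r.φ₂] r.φ₁) (𝓝 0)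
  tendsto_φ₂ : ∀ θ ∈ cIoo r.θ₁ r.θ₂,
    Tendsto (fun φ => h (θ, φ)) (𝓝[cIoo r.φ₁ r.φ₂] r.φ₂) (𝓝 0)
  tendsto_θ₁ : ∀ φ ∈ cIoo r.φ₁ r.φ₂,
    Tendsto (fun θ => h (θ, φ)) (𝓝[cIoo r.θ₁ r.θ₂] r.θ₁) (𝓝 1)
  tendsto_θ₂ : ∀ φ ∈ cIoo r.φ₁ r.φ₂,
    Tendsto (fun θ => h (θ, φ)) (𝓝[cIoo r.θ₁ r.θ₂] r.θ₂) (𝓝 1)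

/-- The function `h_r`. A function with the property `IsRectHarmonic r` exists and its values on the
interior of `r`, the only ones that are used below, are uniquely determined. -/
noncomputable def harmonicFun (r : Rectangle) : Torus → ℝ := Classical.epsilon (IsRectHarmonic r)

/-- The function `(2/π) arctan √(tan(π h_r / 2))`, whose graph gives the tile. -/
noncomputable def tileFun (r : Rectangle) (v : Torus) : ℝ :=
  2 / Real.pi * Real.arctan (Real.sqrt (Real.tan (Real.pi * harmonicFun r v / 2)))

/-- The tile associated with `r`: the image in `𝕊³` of the closure of the graph of `tileFun r` over
the interior of `r`. -/
noncomputable def tile (r : Rectangle) : Set E4 :=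
  joinMap '' closure ((fun v => (v, tileFun r v)) '' r.int)

/-- The surface associated with a rectangular diagram of a surface: the union of its tiles. -/
noncomputable def SurfaceDiagram.surface (P : SurfaceDiagram) : Set E4 := ⋃ r ∈ P.rects, tile r

/-! ### Surfaces with corners -/

/-- Near its point `p` the set `M` is a regularly embedded surface of class `C¹` without boundary:
some neighbourhood of `p` in `M` is the homeomorphic image of an open subset of the plane under
a `C¹` map with injective differentials. -/
def IsC1SurfaceAt (M : Set E4) (p : E4) : Prop :=
  ∃ (U : Set E4) (V : Set (EuclideanSpace ℝ (Fin 2))) (f : EuclideanSpace ℝ (Fin 2) → E4),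
    IsOpen U ∧ p ∈ U ∧ IsOpen V ∧ ContDiffOn ℝ 1 f V ∧
    (∀ x ∈ V, Function.Injective (fderiv ℝ f x)) ∧
    IsEmbedding (V.domRestrict f) ∧ f '' V = M ∩ U

/-- `M` is a two-dimensional submanifold of `𝕊³`, without boundary, whose embedding is regular and
of class `C¹`. It need not be closed. -/
def IsC1Surface (M : Set E4) : Prop := M ⊆ sphere3 ∧ ∀ p ∈ M, IsC1SurfaceAt M p

/-- `K` is a piecewise smooth simple closed curve. -/
def IsPiecewiseSmoothSimpleClosedCurve (K : Set E4) : Prop :=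
  ∃ γ : ℝ → E4, ContinuousOn γ (Icc 0 1) ∧ γ 0 = γ 1 ∧ InjOn γ (Ico 0 1) ∧ γ '' Icc 0 1 = K ∧
    ∃ (n : ℕ) (t : Fin (n + 1) → ℝ), StrictMono t ∧ t 0 = 0 ∧ t (Fin.last n) = 1 ∧
      ∀ i : Fin n, ContDiffOn ℝ ∞ γ (Icc (t i.castSucc) (t i.succ)) ∧
        ∀ s ∈ Icc (t i.castSucc) (t i.succ),
          derivWithin γ (Icc (t i.castSucc) (t i.succ)) s ≠ 0

/-- The curve `K` has a cusp at `p`: it has a local parametrization on `(-1, 1)`, with `0` sent to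
`p`, whose velocity has opposite nonzero one-sided limits at `0`. -/
def HasCuspAt (K : Set E4) (p : E4) : Prop :=
  ∃ (U : Set E4) (γ : ℝ → E4), IsOpen U ∧ ContinuousOn γ (Ioo (-1) 1) ∧ InjOn γ (Ioo (-1) 1) ∧
    γ '' Ioo (-1) 1 = K ∩ U ∧ γ 0 = p ∧
    ∃ u : E4, u ≠ 0 ∧ Tendsto (deriv γ) (𝓝[<] 0) (𝓝 u) ∧ Tendsto (deriv γ) (𝓝[>] 0) (𝓝 (-u))

/-- The interior of `F` relative to `M`. -/
def relInterior (M F : Set E4) : Set E4 := {p ∈ F | F ∈ 𝓝[M] p}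

/-- The compact set `F ⊆ M` is bounded in `M` by the finite collection `𝒞` of mutually disjoint
piecewise smooth cusp-free simple closed curves: `F` is the closure of its interior relative to
`M`, and its frontier relative to `M` is the union of the curves. -/
structure IsBoundedInBy (M F : Set E4) (𝒞 : Set (Set E4)) : Prop where
  subset : F ⊆ M
  compact : IsCompact F
  subset_closure : F ⊆ closure (relInterior M F)
  finite : 𝒞.Finite
  disjoint : 𝒞.PairwiseDisjoint id
  curve : ∀ K ∈ 𝒞, IsPiecewiseSmoothSimpleClosedCurve K
  cuspFree : ∀ K ∈ 𝒞, ∀ p ∈ K, ¬ HasCuspAt K p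
  frontier_eq : F \ relInterior M F = ⋃₀ 𝒞

/-- `F` is a (compact) surface with corners in `𝕊³`. -/
def IsSurfaceWithCorners (F : Set E4) : Prop :=
  ∃ (M : Set E4) (𝒞 : Set (Set E4)), IsC1Surface M ∧ IsBoundedInBy M F 𝒞

/-- The boundary `∂F` of a surface with corners `F`: the points of `F` near which `F` is not
a surface without boundary. Whenever `F` is bounded by curves in a `C¹` surface `M`, this is the
union of those curves. -/
def surfaceBoundary (F : Set E4) : Set E4 := {p ∈ F | ¬ IsC1SurfaceAt F p}

end RectSurface

namespace RectSurface

/-! ### The functions whose quotient solves the Dirichlet problem in a rectangle -/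

/-! The Dirichlet problem in a rectangle has an explicit solution. Let f and g be functions on the
vertical and the horizontal side, zero at the ends, with f'² = (1 - P f²)(1 + Q f²) and g'² = (1 - Q
g²)(1 + P g²). Then (2/π) arctan (f(φ)/g(θ)) is harmonic with the required limits
(`harmonicAt_arctan_div`), and P, Q can be fitted to the lengths of the sides
(`exists_halfPeriod_eq`). A bounded solution is unique (`IsZeroDirichlet.eq_zero`), although limits
are prescribed only along normal lines to the sides. Hence, with z₁ and z₂ the two complex
coordinates of ℝ⁴, a tile is given on the sphere, over the sectors of its rectangle, by the equation
|z₁|² f(arg z₁) = |z₂|² g(arg z₂) (`tile_eq`).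

The gluing of tiles rests on this equation and on the fact that all profiles f, g are odd with
derivative 1 at the ends. Taken with suitable signs, the vertical profiles of the rectangles with a
side on a given meridian form one C¹ function (`contDiffAt_prof`), and the inverses of the
horizontal profiles also fit together (`contDiffAt_shift`). So near a point over an end of a side,
or on the circle z₁ = 0, the union of the tiles is the part of a C¹ graph over the sides of the
rectangles (`eventually_mem_surf_iff`). At a free vertex the graph goes on with sine as the profile,
which gives a surface M beyond the boundary (`isContinuedAt`, `exists_isC1Surface`). Exchanging the
two factors deals with longitudes. Tiles of crossing rectangles have disjoint interiors by the
maximum principle (`crossing_lt`).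

The frontier in M is the union of the arcs over the free vertices. It agrees with the intrinsic
boundary by the inverse function theorem (`mem_nhdsWithin_of_isC1SurfaceAt`). Counting ends of sides
on a meridian modulo 2 shows that the free vertices form a link diagram (`encard_meridian_ne_one`).
Its components are orbits of two fixed point free involutions (`exists_isClosedChain`), and there
are no cusps because two arcs that meet leave their common point in different directions
(`not_hasCuspAt_of_branches`). -/

/-- The integrand `1 / √(P + Q sin² s)`. -/
noncomputable def ellipticIntegrand (P Q s : ℝ) : ℝ := (Real.sqrt (P + Q * Real.sin s ^ 2))⁻¹

/-- The incomplete elliptic integral `∫₀ˣ ds / √(P + Q sin² s)`. -/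
noncomputable def ellipticIntegral (P Q x : ℝ) : ℝ := ∫ s in (0 : ℝ)..x, ellipticIntegrand P Q s

theorem ellipticRadicand_pos {P Q : ℝ} (hP : 0 < P) (hQ : 0 < Q) (s : ℝ) :
    0 < P + Q * Real.sin s ^ 2 := by positivity

theorem ellipticIntegrand_pos {P Q : ℝ} (hP : 0 < P) (hQ : 0 < Q) (s : ℝ) :
    0 < ellipticIntegrand P Q s :=
  inv_pos.2 (Real.sqrt_pos.2 (ellipticRadicand_pos hP hQ s))

theorem continuous_ellipticIntegrand {P Q : ℝ} (hP : 0 < P) (hQ : 0 < Q) :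
    Continuous (ellipticIntegrand P Q) := by
  unfold ellipticIntegrand
  refine Continuous.inv₀ (by fun_prop) fun s => ?_
  exact (Real.sqrt_pos.2 (ellipticRadicand_pos hP hQ s)).ne'

theorem hasDerivAt_ellipticIntegral {P Q : ℝ} (hP : 0 < P) (hQ : 0 < Q) (x : ℝ) :
    HasDerivAt (ellipticIntegral P Q) (ellipticIntegrand P Q x) x :=
  (continuous_ellipticIntegrand hP hQ).integral_hasStrictDerivAt 0 x |>.hasDerivAt

theorem ellipticIntegral_neg (P Q x : ℝ) : ellipticIntegral P Q (-x) = -ellipticIntegral P Q x := by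
  unfold ellipticIntegral
  have h := intervalIntegral.integral_comp_neg (a := 0) (b := x) (ellipticIntegrand P Q)
  have h2 : (fun s => ellipticIntegrand P Q (-s)) = ellipticIntegrand P Q := by
    funext s; simp [ellipticIntegrand]
  rw [h2, neg_zero] at h
  rw [h, intervalIntegral.integral_symm]

theorem ellipticIntegral_pi_sub {P Q : ℝ} (hP : 0 < P) (hQ : 0 < Q) (x : ℝ) :
    ellipticIntegral P Q (Real.pi - x) = ellipticIntegral P Q Real.pi - ellipticIntegral P Q x := by
  unfold ellipticIntegral
  have h := intervalIntegral.integral_comp_sub_left (a := 0) (b := x) (ellipticIntegrand P Q) Real.pi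
  have h2 : (fun s => ellipticIntegrand P Q (Real.pi - s)) = ellipticIntegrand P Q := by
    funext s; simp [ellipticIntegrand]
  simp only [h2, sub_zero] at h
  have hc := continuous_ellipticIntegrand hP hQ
  have := intervalIntegral.integral_add_adjacent_intervals
    (hc.intervalIntegrable (μ := MeasureTheory.volume) 0 (Real.pi - x))
    (hc.intervalIntegrable (Real.pi - x) Real.pi)
  linarith

theorem strictMono_ellipticIntegral {P Q : ℝ} (hP : 0 < P) (hQ : 0 < Q) :
    StrictMono (ellipticIntegral P Q) :=
  strictMono_of_deriv_pos fun x => by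
    rw [(hasDerivAt_ellipticIntegral hP hQ x).deriv]; exact ellipticIntegrand_pos hP hQ x

theorem continuous_ellipticIntegral {P Q : ℝ} (hP : 0 < P) (hQ : 0 < Q) :
    Continuous (ellipticIntegral P Q) :=
  continuous_iff_continuousAt.2 fun x => (hasDerivAt_ellipticIntegral hP hQ x).continuousAt

theorem ellipticIntegral_zero (P Q : ℝ) : ellipticIntegral P Q 0 = 0 := by
  simp [ellipticIntegral]

theorem mul_le_ellipticIntegral {P Q : ℝ} (hP : 0 < P) (hQ : 0 < Q) {x : ℝ} (hx : 0 ≤ x) :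
    (Real.sqrt (P + Q))⁻¹ * x ≤ ellipticIntegral P Q x := by
  have h := intervalIntegral.integral_mono_on (a := 0) (b := x) hx
    (f := fun _ => (Real.sqrt (P + Q))⁻¹) (g := ellipticIntegrand P Q) (μ := MeasureTheory.volume)
    (by simp) ((continuous_ellipticIntegrand hP hQ).intervalIntegrable _ _)
    (fun s _ => by
      unfold ellipticIntegrand
      apply inv_anti₀ (Real.sqrt_pos.2 (ellipticRadicand_pos hP hQ s))
      apply Real.sqrt_le_sqrt
      nlinarith [Real.sin_sq_le_one s])
  simp only [intervalIntegral.integral_const, sub_zero, smul_eq_mul] at h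
  rw [mul_comm]; exact h

theorem surjective_ellipticIntegral {P Q : ℝ} (hP : 0 < P) (hQ : 0 < Q) :
    Function.Surjective (ellipticIntegral P Q) := by
  have hc : 0 < (Real.sqrt (P + Q))⁻¹ := by positivity
  have htop : Tendsto (ellipticIntegral P Q) atTop atTop :=
    tendsto_atTop_mono' _ ((eventually_ge_atTop 0).mono fun x hx => mul_le_ellipticIntegral hP hQ hx)
      (tendsto_id.const_mul_atTop hc)
  refine (continuous_ellipticIntegral hP hQ).surjective htop ?_
  have := (tendsto_neg_atTop_atBot.comp (htop.comp tendsto_neg_atBot_atTop))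
  refine this.congr fun x => ?_
  simp [ellipticIntegral_neg]

/-- The half period of the solution of `f'² = (1 - P f²)(1 + Q f²)`. -/
noncomputable def halfPeriod (P Q : ℝ) : ℝ := ellipticIntegral P Q Real.pi

/-- The substitution f = sin ψ / √P turns the equation for f'² into ψ' = √(P + Q sin² ψ), so ψ is
the inverse of the elliptic integral. Oddness and the reflection symmetry of f come from those of
the integral. -/
theorem exists_elliptic_solution {P Q : ℝ} (hP : 0 < P) (hQ : 0 < Q) :
    ∃ f f' : ℝ → ℝ, (∀ x, HasDerivAt f (f' x) x) ∧
      (∀ x, HasDerivAt f' ((Q - P) * f x - 2 * P * Q * f x ^ 3) x) ∧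
      (∀ x, f' x ^ 2 = (1 - P * f x ^ 2) * (1 + Q * f x ^ 2)) ∧ f' 0 = 1 ∧
      (∀ x, f (-x) = -f x) ∧ (∀ x, f (halfPeriod P Q - x) = f x) ∧
      ∀ x ∈ Ioo 0 (halfPeriod P Q), 0 < f x := by
  set X := ellipticIntegral P Q with hX
  have hmono : StrictMono X := strictMono_ellipticIntegral hP hQ
  let e : ℝ ≃o ℝ := hmono.orderIsoOfSurjective X (surjective_ellipticIntegral hP hQ)
  have he : ∀ s, e s = X s := fun s => rfl
  set ψ : ℝ → ℝ := fun x => e.symm x with hψ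
  have hXψ : ∀ x, X (ψ x) = x := fun x => e.apply_symm_apply x
  have hψX : ∀ s, ψ (X s) = s := fun s => e.symm_apply_apply s
  have hψc : Continuous ψ := e.symm.continuous
  set w : ℝ → ℝ := fun x => Real.sqrt (P + Q * Real.sin (ψ x) ^ 2) with hw
  have hwpos : ∀ x, 0 < w x := fun x => Real.sqrt_pos.2 (ellipticRadicand_pos hP hQ _)
  have hwsq : ∀ x, w x ^ 2 = P + Q * Real.sin (ψ x) ^ 2 := fun x =>
    Real.sq_sqrt (ellipticRadicand_pos hP hQ _).le
  have hψd : ∀ x, HasDerivAt ψ (w x) x := fun x => by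
    have h := HasDerivAt.of_local_left_inverse (f := X) (g := ψ) (a := x) hψc.continuousAt
      (hasDerivAt_ellipticIntegral hP hQ (ψ x)) (ellipticIntegrand_pos hP hQ _).ne'
      (Eventually.of_forall hXψ)
    simpa [ellipticIntegrand] using h
  have hψ0 : ψ 0 = 0 := by
    have h := hψX 0
    rwa [show X 0 = 0 from ellipticIntegral_zero P Q] at h
  set p := (Real.sqrt P)⁻¹ with hp
  have hpp : 0 < p := by positivity
  have hp2 : P * p ^ 2 = 1 := by
    rw [hp, inv_pow, Real.sq_sqrt hP.le]; field_simp
  have hwd : ∀ x, HasDerivAt w (Q * Real.sin (ψ x) * Real.cos (ψ x)) x := fun x => by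
    have h1 : HasDerivAt (fun x => P + Q * Real.sin (ψ x) ^ 2)
        (Q * (2 * Real.sin (ψ x) * (Real.cos (ψ x) * w x))) x := by
      exact ((((hψd x).sin.pow 2).const_mul Q).const_add P).congr_deriv (by push_cast; ring)
    have h2 := h1.sqrt (ellipticRadicand_pos hP hQ _).ne'
    refine h2.congr_deriv ?_
    have h3 : Real.sqrt (P + Q * Real.sin (ψ x) ^ 2) = w x := rfl
    have := (hwpos x).ne'
    rw [h3]; field_simp
  refine ⟨fun x => p * Real.sin (ψ x), fun x => p * (Real.cos (ψ x) * w x), fun x => ?_,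
    fun x => ?_, fun x => ?_, ?_, fun x => ?_, fun x => ?_, fun x hx => ?_⟩
  · exact (hψd x).sin.const_mul p
  · have := (((hψd x).cos).mul (hwd x)).const_mul p
    refine this.congr_deriv ?_
    have h1 := hwsq x
    have h2 : Real.cos (ψ x) ^ 2 = 1 - Real.sin (ψ x) ^ 2 := Real.cos_sq' _
    linear_combination (2 * Q * p * Real.sin (ψ x) ^ 3) * hp2 - (p * Real.sin (ψ x)) * h1
      + (Q * p * Real.sin (ψ x)) * h2
  · have h1 := hwsq x
    have h2 : Real.cos (ψ x) ^ 2 = 1 - Real.sin (ψ x) ^ 2 := Real.cos_sq' _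
    have h3 : (p * (Real.cos (ψ x) * w x)) ^ 2 =
      p ^ 2 * (1 - Real.sin (ψ x) ^ 2) * (P + Q * Real.sin (ψ x) ^ 2) := by
      rw [← h1, ← h2]; ring
    rw [h3]
    linear_combination (1 + Q * p ^ 2 * Real.sin (ψ x) ^ 4) * hp2
  · have : w 0 = Real.sqrt P := by simp [hw, hψ0]
    simp only [hψ0, Real.cos_zero, this, hp, one_mul]
    exact inv_mul_cancel₀ (Real.sqrt_pos.2 hP).ne'
  · have : ψ (-x) = -ψ x := by
      apply hmono.injective
      rw [hXψ, hX, ellipticIntegral_neg, ← hX, hXψ]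
    simp [this]
  · have : ψ (halfPeriod P Q - x) = Real.pi - ψ x := by
      apply hmono.injective
      rw [hXψ, hX, ellipticIntegral_pi_sub hP hQ, ← hX, hXψ]; rfl
    simp [this]
  · have h1 : 0 < ψ x := by
      rw [← hψ0]; exact e.symm.strictMono hx.1
    have h2 : ψ x < Real.pi := by
      rw [← hψX Real.pi]; exact e.symm.strictMono hx.2
    exact mul_pos hpp (Real.sin_pos_of_pos_of_lt_pi h1 h2)

theorem halfPeriod_pos {P Q : ℝ} (hP : 0 < P) (hQ : 0 < Q) : 0 < halfPeriod P Q := by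
  have := strictMono_ellipticIntegral hP hQ Real.pi_pos
  rwa [ellipticIntegral_zero] at this

theorem halfPeriod_mul {l : ℝ} (hl : 0 < l) (P Q : ℝ) :
    halfPeriod (l * P) (l * Q) = (Real.sqrt l)⁻¹ * halfPeriod P Q := by
  unfold halfPeriod ellipticIntegral
  rw [← intervalIntegral.integral_const_mul]
  congr 1; funext s
  simp only [ellipticIntegrand]
  rw [← mul_inv, ← Real.sqrt_mul hl.le]; congr 2; ring

theorem continuous_halfPeriod_comp {u v : ℝ → ℝ} (hu : Continuous u) (hv : Continuous v)
    (hu0 : ∀ t, 0 < u t) (hv0 : ∀ t, 0 < v t) : Continuous fun t => halfPeriod (u t) (v t) := by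
  unfold halfPeriod ellipticIntegral
  apply intervalIntegral.continuous_parametric_intervalIntegral_of_continuous'
  unfold Function.uncurry ellipticIntegrand
  refine Continuous.inv₀ (by fun_prop) fun x => ?_
  exact (Real.sqrt_pos.2 (ellipticRadicand_pos (hu0 _) (hv0 _) _)).ne'

theorem halfPeriod_one_le {p : ℝ} (hp : 0 < p) : halfPeriod 1 p ≤ Real.pi := by
  unfold halfPeriod ellipticIntegral
  have h := intervalIntegral.integral_mono_on (a := 0) (b := Real.pi) Real.pi_pos.le
    (f := ellipticIntegrand 1 p) (g := fun _ => (1 : ℝ)) (μ := MeasureTheory.volume)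
    ((continuous_ellipticIntegrand one_pos hp).intervalIntegrable _ _) (by simp)
    (fun s _ => by
      unfold ellipticIntegrand
      apply inv_le_one_of_one_le₀
      rw [Real.one_le_sqrt]
      nlinarith [mul_nonneg hp.le (sq_nonneg (Real.sin s))])
  simpa using h

/-- As sin s ≤ s, the radicand ε² + sin² s is at most (ε + s)². The integral of 1/(ε + s) grows
logarithmically as ε tends to 0. -/
theorem log_le_halfPeriod {ε : ℝ} (hε : 0 < ε) :
    Real.log Real.pi - Real.log ε ≤ halfPeriod (ε ^ 2) 1 := by
  unfold halfPeriod ellipticIntegral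
  have hpos : ∀ s ∈ uIcc 0 Real.pi, 0 < ε + s := fun s hs => by
    rw [uIcc_of_le Real.pi_pos.le] at hs; linarith [hs.1]
  have hint : ∫ s in (0 : ℝ)..Real.pi, (ε + s)⁻¹ = Real.log (ε + Real.pi) - Real.log (ε + 0) := by
    apply intervalIntegral.integral_eq_sub_of_hasDerivAt (f := fun s => Real.log (ε + s))
    · intro s hs
      have := ((hasDerivAt_id s).const_add ε).log (hpos s hs).ne'
      simpa using this
    · refine ContinuousOn.intervalIntegrable (ContinuousOn.inv₀ (by fun_prop) fun s hs => ?_)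
      exact (hpos s hs).ne'
  have hcont : ContinuousOn (fun s => (ε + s)⁻¹) (uIcc 0 Real.pi) :=
    ContinuousOn.inv₀ (by fun_prop) fun s hs => (hpos s hs).ne'
  have h := intervalIntegral.integral_mono_on (a := 0) (b := Real.pi) Real.pi_pos.le
    (g := ellipticIntegrand (ε ^ 2) 1) (f := fun s => (ε + s)⁻¹) (μ := MeasureTheory.volume)
    hcont.intervalIntegrable
    ((continuous_ellipticIntegrand (by positivity) one_pos).intervalIntegrable _ _)
    (fun s hs => by
      unfold ellipticIntegrand
      have hq := ellipticRadicand_pos (P := ε ^ 2) (Q := 1) (by positivity) one_pos s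
      apply inv_anti₀ (Real.sqrt_pos.2 hq)
      apply Real.sqrt_le_iff.2
      refine ⟨by linarith [hs.1], ?_⟩
      have h1 := Real.sin_le hs.1
      have h2 := Real.sin_nonneg_of_mem_Icc hs
      nlinarith [mul_nonneg hε.le hs.1])
  rw [hint, add_zero] at h
  have : Real.log Real.pi ≤ Real.log (ε + Real.pi) :=
    Real.log_le_log Real.pi_pos (by linarith)
  linarith

/-- Scaling (P, Q) by l multiplies both half periods by 1/√l, so only their ratio has to be
adjusted. The ratio R is continuous, unbounded by the logarithmic estimate, and R(-t) = 1/R(t), so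
it takes every positive value. -/
theorem exists_halfPeriod_eq {a b : ℝ} (ha : 0 < a) (hb : 0 < b) :
    ∃ P Q : ℝ, 0 < P ∧ 0 < Q ∧ halfPeriod P Q = b ∧ halfPeriod Q P = a := by
  let R : ℝ → ℝ := fun t => halfPeriod (Real.exp t) 1 / halfPeriod 1 (Real.exp t)
  have hpos1 : ∀ t, 0 < halfPeriod (Real.exp t) 1 := fun t => halfPeriod_pos (Real.exp_pos t) one_pos
  have hpos2 : ∀ t, 0 < halfPeriod 1 (Real.exp t) := fun t => halfPeriod_pos one_pos (Real.exp_pos t)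
  have hRc : Continuous R :=
    (continuous_halfPeriod_comp Real.continuous_exp continuous_const Real.exp_pos
      (fun _ => one_pos)).div (continuous_halfPeriod_comp continuous_const Real.continuous_exp
      (fun _ => one_pos) Real.exp_pos) fun t => (hpos2 t).ne'
  have hRneg : ∀ t, R (-t) = (R t)⁻¹ := fun t => by
    have h1 := halfPeriod_mul (Real.exp_pos (-t)) 1 (Real.exp t)
    have h2 := halfPeriod_mul (Real.exp_pos (-t)) (Real.exp t) 1
    rw [mul_one, ← Real.exp_add, neg_add_cancel, Real.exp_zero] at h1 h2
    have : (Real.sqrt (Real.exp (-t)))⁻¹ ≠ 0 :=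
      inv_ne_zero (Real.sqrt_pos.2 (Real.exp_pos _)).ne'
    simp only [R, h1, h2, inv_div]
    rw [mul_div_mul_left _ _ this]
  have hbig : ∀ N : ℝ, ∃ t, N ≤ R t := fun N => by
    obtain ⟨t, ht0, ht⟩ : ∃ t : ℝ, t ≤ 0 ∧ |N| * Real.pi ≤ Real.log Real.pi - t :=
      ⟨min 0 (Real.log Real.pi - |N| * Real.pi), min_le_left _ _, by
        linarith [min_le_right 0 (Real.log Real.pi - |N| * Real.pi)]⟩
    -- The parameter at 2t is ε² with ε = exp t: the numerator of R is at least log π - t and the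
    -- denominator is at most π.
    refine ⟨2 * t, (le_abs_self N).trans ?_⟩
    rw [le_div_iff₀ (hpos2 _)]
    have h1 := log_le_halfPeriod (Real.exp_pos t)
    rw [Real.log_exp, ← Real.exp_nat_mul] at h1
    push_cast at h1
    calc |N| * halfPeriod 1 (Real.exp (2 * t)) ≤ |N| * Real.pi :=
          mul_le_mul_of_nonneg_left (halfPeriod_one_le (Real.exp_pos _)) (abs_nonneg _)
      _ ≤ _ := ht.trans h1
  obtain ⟨t, ht⟩ : ∃ t, R t = b / a := by
    obtain ⟨t₁, h₁⟩ := hbig (b / a)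
    obtain ⟨t₂, h₂⟩ := hbig (a / b)
    have h₃ : R (-t₂) ≤ b / a := by
      rw [hRneg, ← inv_div a b]
      exact inv_anti₀ (by positivity) h₂
    exact mem_range_of_exists_le_of_exists_ge hRc ⟨_, h₃⟩ ⟨_, h₁⟩
  have hr : halfPeriod (Real.exp t) 1 * a = b * halfPeriod 1 (Real.exp t) := by
    have := (div_eq_div_iff (hpos2 t).ne' ha.ne').1 ht
    exact this
  -- Multiplying both parameters by c² divides both half periods by c. This makes the first one
  -- equal to b, and the ratio then gives the second one.
  set c := halfPeriod (Real.exp t) 1 / b with hc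
  have hcpos : 0 < c := div_pos (hpos1 t) hb
  refine ⟨c ^ 2 * Real.exp t, c ^ 2 * 1, by positivity, by positivity, ?_, ?_⟩
  · rw [halfPeriod_mul (by positivity), Real.sqrt_sq hcpos.le, hc]
    have := (hpos1 t).ne'
    field_simp
  · rw [halfPeriod_mul (by positivity), Real.sqrt_sq hcpos.le, hc]
    have := (hpos1 t).ne'
    field_simp
    linarith

/-! ### The maximum principle and uniqueness of bounded harmonic functions in a rectangle -/

open InnerProductSpace Complex in
/-- The maximum principle, for functions with the mean value property at the points where they
exceed a given value. -/
theorem le_of_circleAverage {K : Set ℂ} (hK : IsCompact K) {v : ℂ → ℝ} {m : ℝ}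
    (hv : ContinuousOn v K)
    (h : ∀ z ∈ K, v z ≤ m ∨
      ∃ ρ > 0, Metric.closedBall z ρ ⊆ K ∧ v z ≤ Real.circleAverage v z ρ) :
    ∀ z ∈ K, v z ≤ m := by
  by_contra! hcon
  obtain ⟨z₀, hz₀, hm⟩ := hcon
  obtain ⟨z₁, hz₁, hmax⟩ := hK.exists_isMaxOn ⟨z₀, hz₀⟩ hv
  have hM : m < v z₁ := hm.trans_le (hmax hz₀)
  have hS : IsCompact (K ∩ v ⁻¹' {v z₁}) := by
    refine hK.of_isClosed_subset ?_ inter_subset_left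
    exact hv.preimage_isClosed_of_isClosed hK.isClosed isClosed_singleton
  -- At a maximum point with the largest real part, the point z + ρ of the circle is not a maximum
  -- point, so the average over the circle is strictly smaller than the maximum.
  obtain ⟨z, ⟨hzK, hzv⟩, hre⟩ := hS.exists_isMaxOn ⟨z₁, hz₁, rfl⟩ Complex.continuous_re.continuousOn
  have hzv' : v z = v z₁ := hzv
  rcases h z hzK with h1 | ⟨ρ, hρ, hball, hav⟩
  · linarith
  have hcirc : ∀ θ : ℝ, circleMap z ρ θ ∈ K := fun θ =>
    hball (by simp [circleMap, abs_of_pos hρ])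
  have hcont : ContinuousOn (fun θ : ℝ => v (circleMap z ρ θ)) (Icc 0 (2 * Real.pi)) :=
    hv.comp (by fun_prop) fun θ _ => hcirc θ
  have hlt : v (z + ρ) < v z₁ := by
    have hmem : z + ρ ∈ K := by simpa [circleMap] using hcirc 0
    refine lt_of_le_of_ne (hmax hmem) fun heq => ?_
    have := hre (show z + ρ ∈ K ∩ v ⁻¹' {v z₁} from ⟨hmem, heq⟩)
    simp at this
    linarith
  have hint := intervalIntegral.integral_lt_integral_of_continuousOn_of_le_of_exists_lt
    (f := fun θ => v (circleMap z ρ θ)) (g := fun _ => v z₁) Real.two_pi_pos hcont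
    continuousOn_const (fun θ _ => hmax (hcirc θ))
    ⟨0, ⟨le_rfl, Real.two_pi_pos.le⟩, by simpa [circleMap] using hlt⟩
  rw [Real.circleAverage_def, hzv', smul_eq_mul] at hav
  simp only [intervalIntegral.integral_const, sub_zero, smul_eq_mul] at hint
  have hpi := Real.two_pi_pos
  have : (2 * Real.pi)⁻¹ * ∫ θ in (0 : ℝ)..2 * Real.pi, v (circleMap z ρ θ) < v z₁ := by
    rw [inv_mul_lt_iff₀ hpi]; exact hint
  linarith

open InnerProductSpace in
theorem circleAverage_eq_of_harmonicAt {u : ℂ → ℝ} {z : ℂ} {ρ : ℝ} (hρ : 0 < ρ)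
    (h : ∀ w ∈ Metric.closedBall z ρ, HarmonicAt u w) : Real.circleAverage u z ρ = u z := by
  apply InnerProductSpace.HarmonicOnNhd.circleAverage_eq
  rwa [abs_of_pos hρ]

open InnerProductSpace in
/-- The maximum principle for a continuous function on a compact set which is harmonic at the
interior points where it exceeds a given value. -/
theorem le_of_harmonicAt {K : Set ℂ} (hK : IsCompact K) {v : ℂ → ℝ} {m : ℝ}
    (hv : ContinuousOn v K)
    (h : ∀ z ∈ K, v z ≤ m ∨ ∃ O, IsOpen O ∧ z ∈ O ∧ O ⊆ K ∧ ∀ w ∈ O, HarmonicAt v w) :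
    ∀ z ∈ K, v z ≤ m := by
  refine le_of_circleAverage hK hv fun z hz => (h z hz).imp_right ?_
  rintro ⟨O, hO, hzO, hOK, hw⟩
  obtain ⟨ρ, hρ, hball⟩ := Metric.nhds_basis_closedBall.mem_iff.1 (hO.mem_nhds hzO)
  exact ⟨ρ, hρ, hball.trans hOK,
    (circleAverage_eq_of_harmonicAt hρ fun w hwb => hw w (hball hwb)).ge⟩

-- The limit 0 is known on each vertical line separately, without uniformity, so the maximum
-- principle does not apply to u itself. Integrals of u over a short horizontal window are uniformly
-- small near the base by dominated convergence; these are compared with a quadratic harmonic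
-- barrier.
open InnerProductSpace in
theorem le_three_mul_of_tendsto_zero {u : ℂ → ℝ} {R C : ℝ}
    (hu : ∀ z : ℂ, |z.re| < R → 0 < z.im → z.im < R → HarmonicAt u z)
    (hb : ∀ z : ℂ, |z.re| < R → 0 < z.im → z.im < R → |u z| ≤ C)
    (hlim : ∀ x : ℝ, |x| < R → Tendsto (fun y : ℝ => u ⟨x, y⟩) (𝓝[>] 0) (𝓝 0))
    {r : ℝ} (hr : 0 < r) (hrR : r < R) {y : ℝ} (hy : 0 < y) (hyr : y ≤ r) :
    u ⟨0, y⟩ ≤ 3 * C * y / r := by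
  have hC : 0 ≤ C := (abs_nonneg _).trans
    (hb ⟨0, y⟩ (by simpa using hr.trans hrR) hy (hyr.trans_lt hrR))
  apply le_of_forall_pos_le_add
  intro ε' hε'
  obtain ⟨ε, hε, rfl⟩ : ∃ ε, 0 < ε ∧ ε' = 2 * ε := ⟨ε' / 2, by positivity, by ring⟩
  have hmk : Continuous fun p : ℝ × ℝ => (⟨p.1, p.2⟩ : ℂ) :=
    Complex.equivRealProdCLM.symm.continuous
  have hmk₁ : ∀ η : ℝ, Continuous fun t : ℝ => (⟨t, η⟩ : ℂ) := fun η =>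
    hmk.comp (continuous_id.prodMk continuous_const)
  -- The half width δ of the window is such that at height y the function u drops by at most ε from
  -- its value in the middle.
  obtain ⟨δ, hδ, hδR, hδu⟩ : ∃ δ, 0 < δ ∧ r + δ < R ∧
      ∀ t : ℝ, |t| ≤ δ → u ⟨0, y⟩ - ε ≤ u ⟨t, y⟩ := by
    have hc : ContinuousAt (fun t : ℝ => u ⟨t, y⟩) 0 := by
      have h1 : ContinuousAt u ⟨0, y⟩ :=
        (hu ⟨0, y⟩ (by simpa using hr.trans hrR) hy (hyr.trans_lt hrR)).1.continuousAt
      exact ContinuousAt.comp (f := fun t : ℝ => (⟨t, y⟩ : ℂ)) h1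
        (hmk₁ y).continuousAt
    have h1 : ∀ᶠ t in 𝓝 (0 : ℝ), u ⟨0, y⟩ - ε ≤ u ⟨t, y⟩ :=
      (hc.eventually (lt_mem_nhds (show u ⟨0, y⟩ - ε < u ⟨0, y⟩ by linarith))).mono
        fun t ht => ht.le
    obtain ⟨δ, hδ, h2⟩ := Metric.nhds_basis_closedBall.mem_iff.1 h1
    refine ⟨min δ ((R - r) / 2), lt_min hδ (by linarith), ?_, fun t ht => ?_⟩
    · linarith [min_le_right δ ((R - r) / 2)]
    · exact h2 (by simpa using ht.trans (min_le_left _ _))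
  set R' := r + δ with hR'
  have hcontu : ∀ z : ℂ, |z.re| < R → 0 < z.im → z.im < R → ContinuousAt u z :=
    fun z h1 h2 h3 => (hu z h1 h2 h3).1.continuousAt
  -- Bounded pointwise convergence gives convergence in L¹ over the base, which replaces uniform
  -- convergence.
  have hdom : Tendsto (fun η : ℝ => ∫ t in -R'..R', |u ⟨t, η⟩|) (𝓝[>] 0) (𝓝 0) := by
    have hR'0 : 0 < R' := by positivity
    have hsm : ∀ᶠ η : ℝ in 𝓝[>] 0, 0 < η ∧ η < R := by
      filter_upwards [Ioo_mem_nhdsGT (hr.trans hrR)] with η h using h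
    have habs : ∀ t ∈ uIoc (-R') R', |t| < R := fun t ht => by
      rw [uIoc_of_le (by linarith)] at ht
      exact (abs_le.2 ⟨ht.1.le, ht.2⟩).trans_lt hδR
    have := intervalIntegral.tendsto_integral_filter_of_dominated_convergence
      (μ := MeasureTheory.volume) (a := -R') (b := R') (l := 𝓝[>] (0 : ℝ))
      (F := fun η t => |u ⟨t, η⟩|) (f := fun _ => 0) (fun _ => C) ?_ ?_ ?_ ?_
    · simpa using this
    · filter_upwards [hsm] with η hη
      refine ContinuousOn.aestronglyMeasurable (fun t ht => ?_) measurableSet_uIoc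
      exact (ContinuousAt.comp (f := fun t : ℝ => (⟨t, η⟩ : ℂ)) (hcontu _ (habs t ht) hη.1 hη.2)
        (hmk₁ η).continuousAt).abs.continuousWithinAt
    · filter_upwards [hsm] with η hη
      refine Eventually.of_forall fun t ht => ?_
      rw [Real.norm_eq_abs, abs_abs]
      exact hb _ (habs t ht) hη.1 hη.2
    · simp
    · refine Eventually.of_forall fun t ht => ?_
      simpa using (hlim t (habs t ht)).abs
  obtain ⟨η, hη0, hηy, hηI⟩ : ∃ η, 0 < η ∧ η < y ∧
      ∫ t in -R'..R', |u ⟨t, η⟩| ≤ 2 * δ * ε := by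
    have h1 := hdom.eventually (gt_mem_nhds (show 0 < 2 * δ * ε by positivity))
    obtain ⟨η, h2, h3⟩ := (h1.and (Ioo_mem_nhdsGT hy)).exists
    exact ⟨η, h3.1, h3.2, h2.le⟩
  -- Clamping the coordinates to [-R', R'] × [η, r] extends u from there to a bounded continuous
  -- function on ℂ, so the window integrals are continuous everywhere.
  let cx : ℝ → ℝ := fun x => max (-R') (min x R')
  let cy : ℝ → ℝ := fun x => max η (min x r)
  have hR'0 : 0 < R' := by positivity
  have hcx : ∀ x, |cx x| < R := fun x =>
    (abs_le.2 ⟨le_max_left _ _, max_le (by linarith) (min_le_right _ _)⟩).trans_lt hδR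
  have hcy0 : ∀ x, 0 < cy x := fun x => hη0.trans_le (le_max_left _ _)
  have hcyR : ∀ x, cy x < R := fun x =>
    (max_le (hηy.le.trans hyr) (min_le_right _ _)).trans_lt hrR
  let ũ : ℂ → ℝ := fun z => u ⟨cx z.re, cy z.im⟩
  have hũc : Continuous ũ := by
    refine continuous_iff_continuousAt.2 fun z => ?_
    have h1 : Continuous fun z : ℂ => (⟨cx z.re, cy z.im⟩ : ℂ) :=
      hmk.comp (f := fun z : ℂ => (cx z.re, cy z.im)) (by simp only [cx, cy]; fun_prop)
    exact ContinuousAt.comp (f := fun z : ℂ => (⟨cx z.re, cy z.im⟩ : ℂ))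
      (hcontu _ (hcx _) (hcy0 _) (hcyR _)) h1.continuousAt
  have hũC : ∀ z, |ũ z| ≤ C := fun z => hb _ (hcx _) (hcy0 _) (hcyR _)
  have hũu : ∀ z : ℂ, |z.re| ≤ R' → η ≤ z.im → z.im ≤ r → ũ z = u z := fun z h1 h2 h3 => by
    have h4 : cx z.re = z.re := by
      simp only [cx]
      rw [min_eq_left (abs_le.1 h1).2, max_eq_right (abs_le.1 h1).1]
    have h5 : cy z.im = z.im := by
      simp only [cy]
      rw [min_eq_left h3, max_eq_right h2]
    simp only [ũ, h4, h5]
  let v : ℂ → ℝ := fun z => ∫ t in -δ..δ, ũ (z + t)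
  have hvc : Continuous v := by
    apply intervalIntegral.continuous_parametric_intervalIntegral_of_continuous'
    unfold Function.uncurry
    fun_prop
  let K : Set ℂ := Icc (-r) r ×ℂ Icc η r
  have hK : IsCompact K := isCompact_Icc.reProdIm isCompact_Icc
  have hKmem : ∀ z, z ∈ K ↔ |z.re| ≤ r ∧ η ≤ z.im ∧ z.im ≤ r := fun z => by
    rw [Complex.mem_reProdIm, mem_Icc, mem_Icc, abs_le]
  -- The barrier is the real part of a quadratic polynomial. It is nonnegative on K, at least C on
  -- all sides of K but the bottom one, and at most 3 C y / r on the imaginary axis.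
  let B : ℂ → ℝ := fun z => C / r ^ 2 * (z.re ^ 2 - z.im ^ 2 + 3 * r * z.im)
  have hBc : Continuous B := by simp only [B]; fun_prop
  have hBh : ∀ z, HarmonicAt B z := fun z => by
    have h1 : AnalyticAt ℂ (fun z : ℂ => (C / r ^ 2 : ℝ) * (z ^ 2 - (3 * r : ℝ) * Complex.I * z)) z := by
      fun_prop
    convert h1.harmonicAt_re using 1
    funext w
    simp only [B, Complex.re_ofReal_mul]
    congr 1
    simp [pow_two]
  have hmain := le_of_circleAverage hK (v := fun z => v z - 2 * δ * B z) (m := 2 * δ * ε)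
    (by fun_prop) ?_ ⟨0, y⟩ (by rw [hKmem]; simpa using ⟨hr.le, hηy.le, hyr⟩)
  · have hvlow : 2 * δ * (u ⟨0, y⟩ - ε) ≤ v ⟨0, y⟩ := by
      have h1 := intervalIntegral.integral_mono_on (a := -δ) (b := δ) (by linarith)
        (f := fun _ => u ⟨0, y⟩ - ε) (g := fun t : ℝ => ũ (⟨0, y⟩ + t)) (μ := MeasureTheory.volume)
        (by simp) (Continuous.intervalIntegrable (by fun_prop) _ _)
        (fun t ht => by
          have h2 : |t| ≤ δ := abs_le.2 ht
          have h3 : (⟨0, y⟩ + (t : ℂ) : ℂ) = ⟨t, y⟩ := by apply Complex.ext <;> simp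
          rw [h3, hũu _ (by simpa using h2.trans (by linarith)) hηy.le hyr]
          exact hδu t h2)
      simp only [intervalIntegral.integral_const, smul_eq_mul] at h1
      calc _ = (δ - -δ) * (u ⟨0, y⟩ - ε) := by ring
        _ ≤ _ := h1
    have hBy : B ⟨0, y⟩ ≤ 3 * C * y / r := by
      have : B ⟨0, y⟩ = 3 * C * y / r - C / r ^ 2 * y ^ 2 := by
        simp only [B]; field_simp; ring
      rw [this]
      have : 0 ≤ C / r ^ 2 * y ^ 2 := by positivity
      linarith
    have h2 : 2 * δ * (u ⟨0, y⟩ - ε - B ⟨0, y⟩ - ε) ≤ 0 := by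
      linarith
    have h3 : u ⟨0, y⟩ - ε - B ⟨0, y⟩ - ε ≤ 0 := by
      by_contra! h4
      have : 0 < 2 * δ * (u ⟨0, y⟩ - ε - B ⟨0, y⟩ - ε) := by positivity
      linarith
    linarith
  · intro z hz
    obtain ⟨h1, h2, h3⟩ := (hKmem z).1 hz
    have hvC : v z ≤ 2 * δ * C := by
      have h4 := intervalIntegral.norm_integral_le_of_norm_le_const (a := -δ) (b := δ)
        (f := fun t : ℝ => ũ (z + t)) (C := C) fun t _ => hũC _
      rw [show |δ - -δ| = 2 * δ by rw [abs_of_pos (by linarith)]; ring] at h4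
      calc v z ≤ ‖v z‖ := Real.le_norm_self _
        _ ≤ _ := h4
        _ = _ := by ring
    have hB0 : 0 ≤ B z := by
      refine mul_nonneg (by positivity) ?_
      nlinarith [sq_nonneg z.re, hη0.le.trans h2]
    have hBC : r ^ 2 ≤ z.re ^ 2 - z.im ^ 2 + 3 * r * z.im → C ≤ B z := fun h => by
      have : C = C / r ^ 2 * r ^ 2 := by field_simp
      calc C = C / r ^ 2 * r ^ 2 := this
        _ ≤ _ := mul_le_mul_of_nonneg_left h (by positivity)
    have hleft : C ≤ B z → v z - 2 * δ * B z ≤ 2 * δ * ε := fun h => by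
      have : 2 * δ * C ≤ 2 * δ * B z := mul_le_mul_of_nonneg_left h (by positivity)
      have : 0 < 2 * δ * ε := by positivity
      linarith
    have him0 : 0 < z.im := hη0.trans_le h2
    by_cases hre : |z.re| = r
    · left
      refine hleft (hBC ?_)
      rw [← sq_abs z.re, hre]; nlinarith
    by_cases him : z.im = r
    · left
      refine hleft (hBC ?_)
      rw [him]; nlinarith [sq_nonneg z.re]
    by_cases him2 : z.im = η
    · left
      have h5 : v z ≤ ∫ t in -δ..δ, |ũ (z + t)| :=
        intervalIntegral.integral_mono_on (by linarith)
          (Continuous.intervalIntegrable (by fun_prop) _ _)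
          (Continuous.intervalIntegrable (by fun_prop) _ _) fun t _ => le_abs_self _
      have h6 : ∫ t in -δ..δ, |ũ (z + t)| = ∫ s in (z.re - δ)..(z.re + δ), |ũ ⟨s, η⟩| := by
        have := intervalIntegral.integral_comp_add_left (a := -δ) (b := δ)
          (fun s : ℝ => |ũ ⟨s, η⟩|) z.re
        rw [← sub_eq_add_neg] at this
        rw [← this]
        congr 1; funext t
        congr 2
        apply Complex.ext <;> simp [him2]
      have h7 : ∫ s in (z.re - δ)..(z.re + δ), |ũ ⟨s, η⟩| ≤ ∫ s in -R'..R', |ũ ⟨s, η⟩| := by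
        refine intervalIntegral.integral_mono_interval (by linarith [(abs_le.1 h1).1]) (by linarith)
          (by linarith [(abs_le.1 h1).2]) (Eventually.of_forall fun s => abs_nonneg _)
          (Continuous.intervalIntegrable ?_ _ _)
        exact (hũc.comp (hmk₁ η)).abs
      have h8 : ∫ s in -R'..R', |ũ ⟨s, η⟩| = ∫ s in -R'..R', |u ⟨s, η⟩| := by
        refine intervalIntegral.integral_congr fun s hs => ?_
        rw [uIcc_of_le (by linarith)] at hs
        rw [hũu _ (show |(⟨s, η⟩ : ℂ).re| ≤ R' from abs_le.2 hs) le_rfl (hηy.le.trans hyr)]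
      have : 0 ≤ 2 * δ * B z := by positivity
      linarith
    right
    have hre' : |z.re| < r := lt_of_le_of_ne h1 hre
    have him' : z.im < r := lt_of_le_of_ne h3 him
    have him2' : η < z.im := lt_of_le_of_ne h2 (Ne.symm him2)
    refine ⟨min (r - |z.re|) (min (r - z.im) (z.im - η)) , ?_, ?_, ?_⟩
    · exact lt_min (by linarith) (lt_min (by linarith) (by linarith))
    · intro w hw
      have hd : ‖w - z‖ ≤ min (r - |z.re|) (min (r - z.im) (z.im - η)) := by simpa [dist_eq_norm] using hw
      have h4 := (Complex.abs_re_le_norm (w - z)).trans hd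
      have h5 := (Complex.abs_im_le_norm (w - z)).trans hd
      rw [Complex.sub_re] at h4
      rw [Complex.sub_im] at h5
      obtain ⟨h4a, h4b⟩ := le_min_iff.1 h4
      obtain ⟨h5a, h5b⟩ := le_min_iff.1 (le_min_iff.1 h5).2
      rw [hKmem]
      refine ⟨?_, ?_, ?_⟩
      · have := abs_sub_abs_le_abs_sub w.re z.re
        linarith
      · linarith [(abs_le.1 h5b).1]
      · linarith [(abs_le.1 h5a).2]
    · set ρ := min (r - |z.re|) (min (r - z.im) (z.im - η)) with hρ
      have hρ0 : 0 < ρ := lt_min (by linarith) (lt_min (by linarith) (by linarith))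
      have hBav : Real.circleAverage B z ρ = B z :=
        circleAverage_eq_of_harmonicAt hρ0 fun w _ => hBh w
      have hũav : ∀ t ∈ uIcc (-δ) δ, Real.circleAverage ũ (z + t) ρ = ũ (z + t) := by
        intro t ht
        rw [uIcc_of_le (by linarith)] at ht
        have htδ : |t| ≤ δ := abs_le.2 ht
        have hin : ∀ w ∈ Metric.closedBall (z + t) ρ, |w.re| ≤ R' ∧ η ≤ w.im ∧ w.im ≤ r := by
          intro w hw
          have hd : ‖w - (z + t)‖ ≤ ρ := by simpa [dist_eq_norm] using hw
          have h4 := (Complex.abs_re_le_norm (w - (z + t))).trans hd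
          have h5 := (Complex.abs_im_le_norm (w - (z + t))).trans hd
          rw [Complex.sub_re, Complex.add_re, Complex.ofReal_re] at h4
          rw [Complex.sub_im, Complex.add_im, Complex.ofReal_im, add_zero] at h5
          obtain ⟨h4a, h4b⟩ := le_min_iff.1 h4
          obtain ⟨h5a, h5b⟩ := le_min_iff.1 (le_min_iff.1 h5).2
          refine ⟨?_, ?_, ?_⟩
          · have h6 := abs_sub_abs_le_abs_sub w.re (z.re + t)
            have h7 := abs_add_le z.re t
            linarith
          · linarith [(abs_le.1 h5b).1]
          · linarith [(abs_le.1 h5a).2]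
        have hzt := hin (z + t) (Metric.mem_closedBall_self hρ0.le)
        rw [hũu _ hzt.1 hzt.2.1 hzt.2.2]
        rw [Real.circleAverage_congr_sphere (f₂ := u)]
        · refine circleAverage_eq_of_harmonicAt hρ0 fun w hw => ?_
          obtain ⟨h4, h5, h6⟩ := hin w hw
          exact hu w (h4.trans_lt hδR) (hη0.trans_le h5) (h6.trans_lt hrR)
        · intro w hw
          rw [abs_of_pos hρ0] at hw
          obtain ⟨h4, h5, h6⟩ := hin w (Metric.sphere_subset_closedBall hw)
          exact hũu w h4 h5 h6
      -- The mean value property passes from the translates of u to the window integral by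
      -- exchanging the two integrations.
      have hvav : Real.circleAverage v z ρ = v z := by
        rw [Real.circleAverage_def]
        simp only [v]
        rw [MeasureTheory.intervalIntegral_intervalIntegral_swap]
        · rw [smul_eq_mul, ← intervalIntegral.integral_const_mul]
          refine intervalIntegral.integral_congr fun t ht => ?_
          rw [← hũav t ht, Real.circleAverage_def, smul_eq_mul]
          congr 3; funext θ
          simp only [circleMap]; congr 1; ring
        · refine MeasureTheory.IntegrableOn.mono_set (ContinuousOn.integrableOn_compact
            (isCompact_uIcc.prod isCompact_uIcc) (Continuous.continuousOn ?_))
            (prod_mono uIoc_subset_uIcc uIoc_subset_uIcc)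
          unfold Function.uncurry
          fun_prop
      rw [Real.circleAverage_fun_sub, hvav]
      · have : Real.circleAverage (fun z => 2 * δ * B z) z ρ = 2 * δ * B z := by
          have := Real.circleAverage_fun_smul (a := 2 * δ) (f := B) (c := z) (R := ρ)
          simp only [smul_eq_mul] at this
          rw [this, hBav]
        rw [this]
      · exact hvc.continuousOn.circleIntegrable'
      · exact (continuous_const.mul hBc).continuousOn.circleIntegrable'

-- Locally u is the real part of an analytic function, and this is preserved by composition with φ.
open InnerProductSpace in
theorem harmonicAt_comp_analyticAt {u : ℂ → ℝ} {φ : ℂ → ℂ} {z : ℂ} (hu : HarmonicAt u (φ z))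
    (hφ : AnalyticAt ℂ φ z) : HarmonicAt (fun w => u (φ w)) z := by
  obtain ⟨R, hR, hball⟩ := Metric.eventually_nhds_iff_ball.1 hu.eventually
  obtain ⟨F, hF, hFu⟩ := HarmonicOnNhd.exists_analyticOnNhd_ball_re_eq hball
  have h1 : AnalyticAt ℂ (fun w => F (φ w)) z :=
    (hF (φ z) (Metric.mem_ball_self hR)).comp hφ
  refine (harmonicAt_congr_nhds ?_).1 h1.harmonicAt_re
  filter_upwards [hφ.continuousAt.eventually (Metric.ball_mem_nhds _ hR)] with w hw using hFu hw

-- The map w ↦ p + e w carries the model at the real axis to a side of a rectangle; e will be 1, -1,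
-- -i, i for the bottom, top, left and right side.
open InnerProductSpace in
theorem abs_le_of_tendsto_zero_side {u : ℂ → ℝ} (p e : ℂ) {R C : ℝ}
    (hu : ∀ s t : ℝ, |s| < R → 0 < t → t < R → HarmonicAt u (p + e * ⟨s, t⟩))
    (hb : ∀ s t : ℝ, |s| < R → 0 < t → t < R → |u (p + e * ⟨s, t⟩)| ≤ C)
    (hlim : ∀ s : ℝ, |s| < R → Tendsto (fun t : ℝ => u (p + e * ⟨s, t⟩)) (𝓝[>] 0) (𝓝 0))
    (hR : 0 < R) {t : ℝ} (ht : 0 < t) (htR : t ≤ R / 2) :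
    |u (p + e * ⟨0, t⟩)| ≤ 6 * C * t / R := by
  have hφ : ∀ z, AnalyticAt ℂ (fun w : ℂ => p + e * w) z := fun z => by fun_prop
  have h6 : 6 * C * t / R = 3 * C * t / (R / 2) := by field_simp; ring
  rw [abs_le', h6]
  constructor
  · exact le_three_mul_of_tendsto_zero (u := fun w => u (p + e * w)) (R := R) (C := C)
      (fun z h1 h2 h3 => harmonicAt_comp_analyticAt (φ := fun w => p + e * w) (hu z.re z.im h1 h2 h3) (hφ z))
      (fun z h1 h2 h3 => hb z.re z.im h1 h2 h3) hlim (by linarith) (by linarith) ht htR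
  · exact le_three_mul_of_tendsto_zero (u := fun w => -u (p + e * w)) (R := R) (C := C)
      (fun z h1 h2 h3 => (harmonicAt_comp_analyticAt (φ := fun w => p + e * w) (hu z.re z.im h1 h2 h3) (hφ z)).neg)
      (fun z h1 h2 h3 => by rw [abs_neg]; exact hb z.re z.im h1 h2 h3)
      (fun x hx => by simpa using (hlim x hx).neg) (by linarith) (by linarith) ht htR

/-! ### Vanishing of bounded harmonic functions with zero limits at the sides. -/

/-- `u` is a bounded harmonic function on `(0, a) × (0, b)` with limit `0` at the sides. -/
structure IsZeroDirichlet (a b C : ℝ) (u : ℂ → ℝ) : Prop where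
  harmonic : ∀ z : ℂ, z.re ∈ Ioo 0 a → z.im ∈ Ioo 0 b → InnerProductSpace.HarmonicAt u z
  bound : ∀ z : ℂ, z.re ∈ Ioo 0 a → z.im ∈ Ioo 0 b → |u z| ≤ C
  bottom : ∀ x ∈ Ioo 0 a, Tendsto (fun y : ℝ => u ⟨x, y⟩) (𝓝[>] 0) (𝓝 0)
  top : ∀ x ∈ Ioo 0 a, Tendsto (fun y : ℝ => u ⟨x, y⟩) (𝓝[<] b) (𝓝 0)
  left : ∀ y ∈ Ioo 0 b, Tendsto (fun x : ℝ => u ⟨x, y⟩) (𝓝[>] 0) (𝓝 0)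
  right : ∀ y ∈ Ioo 0 b, Tendsto (fun x : ℝ => u ⟨x, y⟩) (𝓝[<] a) (𝓝 0)

theorem tendsto_const_sub_nhdsGT_zero (b : ℝ) :
    Tendsto (fun t : ℝ => b - t) (𝓝[>] 0) (𝓝[<] b) := by
  refine tendsto_nhdsWithin_iff.2 ⟨?_, ?_⟩
  · have : Tendsto (fun t : ℝ => b - t) (𝓝 0) (𝓝 (b - 0)) :=
      (continuous_const.sub continuous_id).continuousAt
    rw [sub_zero] at this
    exact this.mono_left nhdsWithin_le_nhds
  · filter_upwards [self_mem_nhdsWithin] with t ht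
    simpa using ht

theorem IsZeroDirichlet.abs_le_near_side {a b C : ℝ} {u : ℂ → ℝ} (h : IsZeroDirichlet a b C u)
    {ρ : ℝ} (hρ : 0 < ρ) (hρa : ρ ≤ a) (hρb : ρ ≤ b) {t : ℝ} (ht : 0 < t) (htρ : t ≤ ρ / 2) :
    (∀ x, ρ ≤ x → x ≤ a - ρ → |u ⟨x, t⟩| ≤ 6 * C * t / ρ ∧ |u ⟨x, b - t⟩| ≤ 6 * C * t / ρ) ∧
    (∀ y, ρ ≤ y → y ≤ b - ρ → |u ⟨t, y⟩| ≤ 6 * C * t / ρ ∧ |u ⟨a - t, y⟩| ≤ 6 * C * t / ρ) := by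
  refine ⟨fun x hx hx' => ⟨?_, ?_⟩, fun y hy hy' => ⟨?_, ?_⟩⟩
  · have he : ∀ s t : ℝ, (⟨x, 0⟩ + 1 * ⟨s, t⟩ : ℂ) = ⟨x + s, t⟩ := fun s t => by
      apply Complex.ext <;> simp
    have := abs_le_of_tendsto_zero_side (u := u) (C := C) ⟨x, 0⟩ 1 (R := ρ) ?_ ?_ ?_ hρ ht htρ
    · rwa [he, add_zero] at this
    · intro s t hs h0 hR
      rw [he]; rw [abs_lt] at hs
      exact h.harmonic _ ⟨by simp; linarith, by simp; linarith⟩ ⟨h0, by simp; linarith⟩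
    · intro s t hs h0 hR
      rw [he]; rw [abs_lt] at hs
      exact h.bound _ ⟨by simp; linarith, by simp; linarith⟩ ⟨h0, by simp; linarith⟩
    · intro s hs
      simp only [he]; rw [abs_lt] at hs
      exact h.bottom _ ⟨by linarith, by linarith⟩
  · have he : ∀ s t : ℝ, (⟨x, b⟩ + (-1) * ⟨s, t⟩ : ℂ) = ⟨x - s, b - t⟩ := fun s t => by
      apply Complex.ext <;> simp [sub_eq_add_neg]
    have := abs_le_of_tendsto_zero_side (u := u) (C := C) ⟨x, b⟩ (-1) (R := ρ) ?_ ?_ ?_ hρ ht htρ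
    · rwa [he, sub_zero] at this
    · intro s t hs h0 hR
      rw [he]; rw [abs_lt] at hs
      exact h.harmonic _ ⟨by simp; linarith, by simp; linarith⟩ ⟨by simp; linarith, by simp; linarith⟩
    · intro s t hs h0 hR
      rw [he]; rw [abs_lt] at hs
      exact h.bound _ ⟨by simp; linarith, by simp; linarith⟩ ⟨by simp; linarith, by simp; linarith⟩
    · intro s hs
      simp only [he]; rw [abs_lt] at hs
      exact (h.top (x - s) ⟨by linarith, by linarith⟩).comp (tendsto_const_sub_nhdsGT_zero b)
  · have he : ∀ s t : ℝ, (⟨0, y⟩ + (-Complex.I) * ⟨s, t⟩ : ℂ) = ⟨t, y - s⟩ := fun s t => by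
      apply Complex.ext <;> simp [sub_eq_add_neg]
    have := abs_le_of_tendsto_zero_side (u := u) (C := C) ⟨0, y⟩ (-Complex.I) (R := ρ)
      ?_ ?_ ?_ hρ ht htρ
    · rwa [he, sub_zero] at this
    · intro s t hs h0 hR
      rw [he]; rw [abs_lt] at hs
      exact h.harmonic _ ⟨h0, by simp; linarith⟩ ⟨by simp; linarith, by simp; linarith⟩
    · intro s t hs h0 hR
      rw [he]; rw [abs_lt] at hs
      exact h.bound _ ⟨h0, by simp; linarith⟩ ⟨by simp; linarith, by simp; linarith⟩
    · intro s hs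
      simp only [he]; rw [abs_lt] at hs
      exact h.left (y - s) ⟨by linarith, by linarith⟩
  · have he : ∀ s t : ℝ, (⟨a, y⟩ + Complex.I * ⟨s, t⟩ : ℂ) = ⟨a - t, y + s⟩ := fun s t => by
      apply Complex.ext <;> simp [sub_eq_add_neg]
    have := abs_le_of_tendsto_zero_side (u := u) (C := C) ⟨a, y⟩ Complex.I (R := ρ)
      ?_ ?_ ?_ hρ ht htρ
    · rwa [he, add_zero] at this
    · intro s t hs h0 hR
      rw [he]; rw [abs_lt] at hs
      exact h.harmonic _ ⟨by simp; linarith, by simp; linarith⟩ ⟨by simp; linarith, by simp; linarith⟩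
    · intro s t hs h0 hR
      rw [he]; rw [abs_lt] at hs
      exact h.bound _ ⟨by simp; linarith, by simp; linarith⟩ ⟨by simp; linarith, by simp; linarith⟩
    · intro s hs
      simp only [he]; rw [abs_lt] at hs
      exact (h.right (y + s) ⟨by linarith, by linarith⟩).comp (tendsto_const_sub_nhdsGT_zero a)

theorem IsZeroDirichlet.neg {a b C : ℝ} {u : ℂ → ℝ} (h : IsZeroDirichlet a b C u) :
    IsZeroDirichlet a b C (fun z => -u z) where
  harmonic z h1 h2 := (h.harmonic z h1 h2).neg
  bound z h1 h2 := by rw [abs_neg]; exact h.bound z h1 h2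
  bottom x hx := by simpa using (h.bottom x hx).neg
  top x hx := by simpa using (h.top x hx).neg
  left y hy := by simpa using (h.left y hy).neg
  right y hy := by simpa using (h.right y hy).neg

-- An argument of Phragmén–Lindelöf type. The estimate near the sides fails at the corners, where
-- only boundedness is known. A small multiple of the nonnegative harmonic function β, which has
-- logarithmic poles at the corners, outweighs the bound C there.
open InnerProductSpace in
theorem IsZeroDirichlet.nonpos {a b C : ℝ} {u : ℂ → ℝ} (h : IsZeroDirichlet a b C u)
    {z : ℂ} (hz₁ : z.re ∈ Ioo 0 a) (hz₂ : z.im ∈ Ioo 0 b) : u z ≤ 0 := by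
  have hC : 0 ≤ C := (abs_nonneg _).trans (h.bound z hz₁ hz₂)
  have ha : 0 < a := hz₁.1.trans hz₁.2
  have hb : 0 < b := hz₂.1.trans hz₂.2
  let c : Fin 4 → ℂ := ![⟨0, 0⟩, ⟨a, 0⟩, ⟨0, b⟩, ⟨a, b⟩]
  set M := a + b with hM
  have hM0 : 0 < M := by positivity
  let β : ℂ → ℝ := fun w => ∑ j, (Real.log M - Real.log ‖w - c j‖)
  have hnorm : ∀ w : ℂ, ‖w‖ ≤ |w.re| + |w.im| := Complex.norm_le_abs_re_add_abs_im
  have hcne : ∀ w : ℂ, w.re ∈ Ioo 0 a → w.im ∈ Ioo 0 b → ∀ j, w - c j ≠ 0 := by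
    intro w h1 h2 j h3
    rw [sub_eq_zero] at h3
    fin_cases j <;> simp [c] at h3 <;> rw [h3] at h1 <;> simp at h1
  have hterm : ∀ w : ℂ, w.re ∈ Ioo 0 a → w.im ∈ Ioo 0 b → ∀ j,
      0 ≤ Real.log M - Real.log ‖w - c j‖ := by
    intro w h1 h2 j
    rw [sub_nonneg]
    refine Real.log_le_log (norm_pos_iff.2 (hcne w h1 h2 j)) ((hnorm _).trans ?_)
    obtain ⟨h1a, h1b⟩ := h1
    obtain ⟨h2a, h2b⟩ := h2
    rw [hM]
    refine add_le_add (abs_le.2 ?_) (abs_le.2 ?_) <;> fin_cases j <;> simp [c] <;>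
      constructor <;> linarith
  have hβ0 : ∀ w : ℂ, w.re ∈ Ioo 0 a → w.im ∈ Ioo 0 b → 0 ≤ β w := fun w h1 h2 =>
    Finset.sum_nonneg fun j _ => hterm w h1 h2 j
  have hβh : ∀ w : ℂ, w.re ∈ Ioo 0 a → w.im ∈ Ioo 0 b → HarmonicAt β w := by
    intro w h1 h2
    have hj : ∀ j, HarmonicAt (fun w => Real.log M - Real.log ‖w - c j‖) w := fun j =>
      (harmonicAt_const _).sub (AnalyticAt.harmonicAt_log_norm (f := fun w => w - c j)
        (by fun_prop) (hcne w h1 h2 j))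
    have h4 : β = (fun w => Real.log M - Real.log ‖w - c 0‖) + (fun w => Real.log M - Real.log ‖w - c 1‖)
        + (fun w => Real.log M - Real.log ‖w - c 2‖) + (fun w => Real.log M - Real.log ‖w - c 3‖) := by
      funext w
      simp only [β, Fin.sum_univ_four, Pi.add_apply]
    rw [h4]
    exact (((hj 0).add (hj 1)).add (hj 2)).add (hj 3)
  suffices hsuff : ∀ ε > 0, u z ≤ ε * β z + ε by
    by_contra! hpos
    have hβz := hβ0 z hz₁ hz₂
    have := hsuff (u z / (2 * (β z + 1))) (by positivity)
    have h2 : u z / (2 * (β z + 1)) * β z + u z / (2 * (β z + 1)) = u z / 2 := by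
      field_simp
    linarith
  intro ε hε
  -- At distance at most 2ρ from a corner one of the logarithmic terms is at least C / ε, so that ε
  -- β ≥ C.
  obtain ⟨ρ, hρ, hρa, hρb, hρM⟩ : ∃ ρ, 0 < ρ ∧ ρ ≤ a ∧ ρ ≤ b ∧ 2 * ρ ≤ M * Real.exp (-(C / ε)) := by
    have : 0 < M * Real.exp (-(C / ε)) := by positivity
    refine ⟨min (min a b) (M * Real.exp (-(C / ε)) / 2), by positivity, ?_, ?_, ?_⟩
    · exact (min_le_left _ _).trans (min_le_left _ _)
    · exact (min_le_left _ _).trans (min_le_right _ _)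
    · linarith [min_le_right (min a b) (M * Real.exp (-(C / ε)) / 2)]
  -- The rectangle shrunk by η still contains z. On its sides, farther than ρ from the corners, |u|
  -- ≤ 6 C η / ρ ≤ ε.
  obtain ⟨η, hη, hηρ, hηε, hη1, hη2, hη3, hη4⟩ : ∃ η, 0 < η ∧ η ≤ ρ / 2 ∧ 6 * C * η / ρ ≤ ε ∧
      η ≤ z.re ∧ η ≤ a - z.re ∧ η ≤ z.im ∧ η ≤ b - z.im := by
    have hev : ∀ᶠ η in 𝓝[>] (0 : ℝ), 6 * C * η / ρ < ε := by
      have : ContinuousAt (fun η : ℝ => 6 * C * η / ρ) 0 := by fun_prop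
      have := this.eventually (gt_mem_nhds (show 6 * C * 0 / ρ < ε by simpa using hε))
      exact nhdsWithin_le_nhds this
    have hpos : ∀ x : ℝ, 0 < x → ∀ᶠ η in 𝓝[>] (0 : ℝ), η < x := fun x hx =>
      nhdsWithin_le_nhds (gt_mem_nhds hx)
    obtain ⟨η, h1, h2, h3, h4, h5, h6, h7⟩ := (Eventually.and (eventually_mem_nhdsWithin (a := (0 : ℝ)) (s := Ioi 0)) ((hpos (ρ / 2) (by positivity)).and (hev.and ((hpos z.re hz₁.1).and
      ((hpos (a - z.re) (by linarith [hz₁.2])).and ((hpos z.im hz₂.1).and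
      (hpos (b - z.im) (by linarith [hz₂.2])))))))).exists
    exact ⟨η, h1, h2.le, h3.le, h4.le, h5.le, h6.le, h7.le⟩
  obtain ⟨hside1, hside2⟩ := h.abs_le_near_side hρ hρa hρb hη hηρ
  have hnear : ∀ w : ℂ, w.re ∈ Ioo 0 a → w.im ∈ Ioo 0 b → ∀ j, |w.re - (c j).re| ≤ ρ →
      |w.im - (c j).im| ≤ ρ → u w - ε * β w ≤ ε := by
    intro w h1 h2 j h3 h4
    have h5 : ‖w - c j‖ ≤ 2 * ρ := (hnorm _).trans (by
      rw [Complex.sub_re, Complex.sub_im]; linarith)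
    have h6 : Real.log ‖w - c j‖ ≤ Real.log M - C / ε := by
      refine (Real.log_le_log (norm_pos_iff.2 (hcne w h1 h2 j)) (h5.trans hρM)).trans ?_
      rw [Real.log_mul hM0.ne' (Real.exp_pos _).ne', Real.log_exp]
      linarith
    have h7 : C / ε ≤ β w :=
      (show C / ε ≤ Real.log M - Real.log ‖w - c j‖ by linarith).trans
        (Finset.single_le_sum (f := fun j => Real.log M - Real.log ‖w - c j‖)
          (fun j _ => hterm w h1 h2 j) (Finset.mem_univ j))
    have h8 : C ≤ ε * β w := by rwa [div_le_iff₀' hε] at h7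
    have h9 := (le_abs_self _).trans (h.bound w h1 h2)
    linarith
  have hfar : ∀ w : ℂ, w.re ∈ Ioo 0 a → w.im ∈ Ioo 0 b → |u w| ≤ 6 * C * η / ρ →
      u w - ε * β w ≤ ε := by
    intro w h1 h2 h3
    have h4 := mul_nonneg hε.le (hβ0 w h1 h2)
    have h5 := le_abs_self (u w)
    linarith
  have hmax := le_of_harmonicAt (K := Icc η (a - η) ×ℂ Icc η (b - η)) (m := ε)
    (v := fun w => u w - ε * β w) (isCompact_Icc.reProdIm isCompact_Icc) ?_ ?_ z
    (by rw [Complex.mem_reProdIm, mem_Icc, mem_Icc]; refine ⟨⟨?_, ?_⟩, ?_, ?_⟩ <;> linarith)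
  · linarith
  · intro w hw
    rw [Complex.mem_reProdIm, mem_Icc, mem_Icc] at hw
    obtain ⟨⟨h1, h2⟩, h3, h4⟩ := hw
    have hw1 : w.re ∈ Ioo 0 a := ⟨by linarith, by linarith⟩
    have hw2 : w.im ∈ Ioo 0 b := ⟨by linarith, by linarith⟩
    exact ((h.harmonic w hw1 hw2).1.continuousAt.sub
      (continuousAt_const.mul (hβh w hw1 hw2).1.continuousAt)).continuousWithinAt
  · intro w hw
    rw [Complex.mem_reProdIm, mem_Icc, mem_Icc] at hw
    obtain ⟨⟨h1, h2⟩, h3, h4⟩ := hw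
    have hw1 : w.re ∈ Ioo 0 a := ⟨by linarith, by linarith⟩
    have hw2 : w.im ∈ Ioo 0 b := ⟨by linarith, by linarith⟩
    have hn := hnear w hw1 hw2
    have hf := hfar w hw1 hw2
    have hη' : |η| ≤ ρ := by rw [abs_of_pos hη]; linarith
    by_cases e1 : w.re = η
    · left
      by_cases e2 : w.im ≤ ρ
      · exact hn 0 (by simpa [c, e1] using hη') (by simpa [c, abs_of_pos hw2.1] using e2)
      by_cases e3 : b - ρ ≤ w.im
      · exact hn 2 (by simpa [c, e1] using hη')
          (by simp only [c]; rw [abs_le]; constructor <;> simp <;> linarith [hw2.2])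
      · apply hf
        have := (hside2 w.im (by linarith) (by linarith)).1
        rwa [← e1] at this ⊢
    by_cases e1' : w.re = a - η
    · left
      by_cases e2 : w.im ≤ ρ
      · exact hn 1 (by simpa [c, e1'] using hη') (by simpa [c, abs_of_pos hw2.1] using e2)
      by_cases e3 : b - ρ ≤ w.im
      · exact hn 3 (by simpa [c, e1'] using hη')
          (by simp only [c]; rw [abs_le]; constructor <;> simp <;> linarith [hw2.2])
      · apply hf
        have := (hside2 w.im (by linarith) (by linarith)).2
        rwa [← e1'] at this
    by_cases e4 : w.im = η
    · left
      by_cases e2 : w.re ≤ ρ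
      · exact hn 0 (by simpa [c, abs_of_pos hw1.1] using e2) (by simpa [c, e4] using hη')
      by_cases e3 : a - ρ ≤ w.re
      · exact hn 1 (by simp only [c]; rw [abs_le]; constructor <;> simp <;> linarith [hw1.2])
          (by simpa [c, e4] using hη')
      · apply hf
        have := (hside1 w.re (by linarith) (by linarith)).1
        rwa [← e4] at this ⊢
    by_cases e4' : w.im = b - η
    · left
      by_cases e2 : w.re ≤ ρ
      · exact hn 2 (by simpa [c, abs_of_pos hw1.1] using e2) (by simpa [c, e4'] using hη')
      by_cases e3 : a - ρ ≤ w.re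
      · exact hn 3 (by simp only [c]; rw [abs_le]; constructor <;> simp <;> linarith [hw1.2])
          (by simpa [c, e4'] using hη')
      · apply hf
        have := (hside1 w.re (by linarith) (by linarith)).2
        rwa [← e4'] at this
    right
    refine ⟨Ioo η (a - η) ×ℂ Ioo η (b - η), isOpen_Ioo.reProdIm isOpen_Ioo, ?_, ?_, ?_⟩
    · exact ⟨⟨lt_of_le_of_ne h1 (Ne.symm e1), lt_of_le_of_ne h2 e1'⟩,
        lt_of_le_of_ne h3 (Ne.symm e4), lt_of_le_of_ne h4 e4'⟩
    · exact fun x hx => ⟨Ioo_subset_Icc_self hx.1, Ioo_subset_Icc_self hx.2⟩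
    · intro x hx
      have hx1 : x.re ∈ Ioo 0 a := ⟨hη.trans hx.1.1, hx.1.2.trans (by linarith)⟩
      have hx2 : x.im ∈ Ioo 0 b := ⟨hη.trans hx.2.1, hx.2.2.trans (by linarith)⟩
      exact (h.harmonic x hx1 hx2).sub ((hβh x hx1 hx2).const_smul (c := ε))

theorem IsZeroDirichlet.eq_zero {a b C : ℝ} {u : ℂ → ℝ} (h : IsZeroDirichlet a b C u)
    {z : ℂ} (hz₁ : z.re ∈ Ioo 0 a) (hz₂ : z.im ∈ Ioo 0 b) : u z = 0 :=
  le_antisymm (h.nonpos hz₁ hz₂) (neg_nonpos.1 (h.neg.nonpos hz₁ hz₂))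

/-! ### The explicit solution of the Dirichlet problem -/

theorem contDiff_two_of_hasDerivAt {f f' f'' : ℝ → ℝ} (h : ∀ x, HasDerivAt f (f' x) x)
    (h' : ∀ x, HasDerivAt f' (f'' x) x) (hc : Continuous f'') : ContDiff ℝ 2 f := by
  have e : deriv f = f' := funext fun x => (h x).deriv
  have e' : deriv f' = f'' := funext fun x => (h' x).deriv
  rw [show (2 : WithTop ℕ∞) = 1 + 1 from rfl, contDiff_succ_iff_deriv]
  refine ⟨fun x => (h x).differentiableAt, by simp, ?_⟩
  rw [e, contDiff_one_iff_deriv, e']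
  exact ⟨fun x => (h' x).differentiableAt, hc⟩

-- The Laplacian of arctan (F(y)/G(x)) is a fraction with denominator (F² + G²)²; `hid` says that
-- its numerator vanishes.
open InnerProductSpace in
theorem harmonicAt_arctan_div {F F' G G' : ℝ → ℝ} {F'' G'' : ℝ → ℝ}
    (hF : ∀ x, HasDerivAt F (F' x) x) (hF' : ∀ x, HasDerivAt F' (F'' x) x)
    (hG : ∀ x, HasDerivAt G (G' x) x) (hG' : ∀ x, HasDerivAt G' (G'' x) x)
    (hF'' : Continuous F'') (hG'' : Continuous G'')
    (hid : ∀ x y, (F'' y * G x - F y * G'' x) * (F y ^ 2 + G x ^ 2) =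
      2 * F y * G x * (F' y ^ 2 - G' x ^ 2))
    {z : ℂ} (hz : G z.re ≠ 0) :
    HarmonicAt (fun z : ℂ => Real.arctan (F z.im / G z.re)) z := by
  have hFd : ContDiff ℝ 2 F := contDiff_two_of_hasDerivAt hF hF' hF''
  have hGd : ContDiff ℝ 2 G := contDiff_two_of_hasDerivAt hG hG' hG''
  have hre : ContDiff ℝ 2 fun z : ℂ => z.re := Complex.reCLM.contDiff
  have him : ContDiff ℝ 2 fun z : ℂ => z.im := Complex.imCLM.contDiff
  refine ⟨?_, ?_⟩
  · exact ((hFd.comp him).contDiffAt.div (hGd.comp hre).contDiffAt hz).arctan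
  have hopen : ∀ᶠ w : ℂ in 𝓝 z, G w.re ≠ 0 :=
    ((hGd.continuous.comp Complex.continuous_re).continuousAt (x := z)).eventually_ne hz
  have hne : ∀ w : ℂ, G w.re ≠ 0 → F w.im ^ 2 + G w.re ^ 2 ≠ 0 := fun w hw => by positivity
  -- A and B are the partial derivatives in the real and the imaginary direction.
  let A : ℂ → ℝ := fun w => -(F w.im * G' w.re) / (F w.im ^ 2 + G w.re ^ 2)
  let B : ℂ → ℝ := fun w => F' w.im * G w.re / (F w.im ^ 2 + G w.re ^ 2)
  have hfd : ∀ w : ℂ, G w.re ≠ 0 → HasFDerivAt (fun z : ℂ => Real.arctan (F z.im / G z.re))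
      (A w • Complex.reCLM + B w • Complex.imCLM) w := by
    intro w hw
    have h1 : HasFDerivAt (fun z : ℂ => F z.im) (F' w.im • Complex.imCLM) w :=
      (hF w.im).comp_hasFDerivAt w Complex.imCLM.hasFDerivAt
    have h2 : HasFDerivAt (fun z : ℂ => (G z.re)⁻¹) ((-G' w.re / G w.re ^ 2) • Complex.reCLM) w :=
      ((hG w.re).inv hw).comp_hasFDerivAt w Complex.reCLM.hasFDerivAt
    have h3 := (h1.mul h2).arctan
    have hn := hne w hw
    have hn2 : 1 + (F w.im * (G w.re)⁻¹) ^ 2 ≠ 0 := by positivity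
    have e : (fun z : ℂ => Real.arctan (F z.im / G z.re)) =
        fun z : ℂ => Real.arctan (F z.im * (G z.re)⁻¹) := by funext z; rw [div_eq_mul_inv]
    rw [e]
    refine h3.congr_fderiv ?_
    ext
    simp [A, B]; field_simp; ring
  filter_upwards [hopen.eventually_nhds] with w hw
  have hw0 : G w.re ≠ 0 := hw.self_of_nhds
  have hn := hne w hw0
  have hev : fderiv ℝ (fun z : ℂ => Real.arctan (F z.im / G z.re)) =ᶠ[𝓝 w]
      fun w => A w • Complex.reCLM + B w • Complex.imCLM := by
    filter_upwards [hw] with x hx using (hfd x hx).fderiv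
  have d1 : Differentiable ℝ fun z : ℂ => z.re := hre.differentiable (by norm_num)
  have d2 : Differentiable ℝ fun z : ℂ => z.im := him.differentiable (by norm_num)
  have dF : Differentiable ℝ fun z : ℂ => F z.im := fun x =>
    DifferentiableAt.comp x (hF _).differentiableAt (d2 x)
  have dF' : Differentiable ℝ fun z : ℂ => F' z.im := fun x =>
    DifferentiableAt.comp x (hF' _).differentiableAt (d2 x)
  have dG : Differentiable ℝ fun z : ℂ => G z.re := fun x =>
    DifferentiableAt.comp x (hG _).differentiableAt (d1 x)
  have dG' : Differentiable ℝ fun z : ℂ => G' z.re := fun x =>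
    DifferentiableAt.comp x (hG' _).differentiableAt (d1 x)
  have dN : DifferentiableAt ℝ (fun w : ℂ => F w.im ^ 2 + G w.re ^ 2) w :=
    ((dF w).pow 2).add ((dG w).pow 2)
  have dA : DifferentiableAt ℝ A w := by
    simp only [A, div_eq_mul_inv]
    exact ((dF w).mul (dG' w)).neg.mul (dN.inv hn)
  have dB : DifferentiableAt ℝ B w := by
    simp only [B, div_eq_mul_inv]
    exact ((dF' w).mul (dG w)).mul (dN.inv hn)
  have hsecond : HasFDerivAt (fun w => A w • Complex.reCLM + B w • Complex.imCLM)
      ((fderiv ℝ A w).smulRight Complex.reCLM + (fderiv ℝ B w).smulRight Complex.imCLM) w :=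
    (dA.hasFDerivAt.smul_const Complex.reCLM).add (dB.hasFDerivAt.smul_const Complex.imCLM)
  have hA1 : fderiv ℝ A w 1 = (-(F w.im * G'' w.re) * (F w.im ^ 2 + G w.re ^ 2) -
      -(F w.im * G' w.re) * (2 * G w.re * G' w.re)) / (F w.im ^ 2 + G w.re ^ 2) ^ 2 := by
    have hline : HasDerivAt (fun x : ℝ => (⟨x, w.im⟩ : ℂ)) 1 w.re := by
      have := (Complex.ofRealCLM.hasDerivAt (x := w.re)).add_const ((w.im : ℂ) * Complex.I)
      simp only [Complex.ofRealCLM_apply, Complex.ofReal_one] at this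
      refine this.congr_of_eventuallyEq (Eventually.of_forall fun x => ?_)
      exact Complex.mk_eq_add_mul_I _ _
    have h1 := HasFDerivAt.comp_hasDerivAt (f := fun x : ℝ => (⟨x, w.im⟩ : ℂ)) w.re
      (l := A) (l' := fderiv ℝ A w) dA.hasFDerivAt hline
    have h2 : HasDerivAt (A ∘ fun x : ℝ => (⟨x, w.im⟩ : ℂ)) _ w.re :=
      ((hG' w.re).const_mul (F w.im)).neg.div (((hG w.re).pow 2).const_add (F w.im ^ 2)) hn
    rw [h1.unique h2]
    congr 1
    simp
  have hB1 : fderiv ℝ B w Complex.I = ((F'' w.im * G w.re) * (F w.im ^ 2 + G w.re ^ 2) -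
      (F' w.im * G w.re) * (2 * F w.im * F' w.im)) / (F w.im ^ 2 + G w.re ^ 2) ^ 2 := by
    have hline : HasDerivAt (fun x : ℝ => (⟨w.re, x⟩ : ℂ)) Complex.I w.im := by
      have := ((Complex.ofRealCLM.hasDerivAt (x := w.im)).mul_const Complex.I).const_add (w.re : ℂ)
      simp only [Complex.ofRealCLM_apply, Complex.ofReal_one, one_mul] at this
      refine this.congr_of_eventuallyEq (Eventually.of_forall fun x => ?_)
      exact Complex.mk_eq_add_mul_I _ _
    have h1 := HasFDerivAt.comp_hasDerivAt (f := fun x : ℝ => (⟨w.re, x⟩ : ℂ)) w.im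
      (l := B) (l' := fderiv ℝ B w) dB.hasFDerivAt hline
    have h2 : HasDerivAt (B ∘ fun x : ℝ => (⟨w.re, x⟩ : ℂ)) _ w.im :=
      ((hF' w.im).mul_const (G w.re)).div (((hF w.im).pow 2).add_const (G w.re ^ 2)) hn
    rw [h1.unique h2]
    congr 1
    simp
  rw [laplacian_eq_iteratedFDeriv_complexPlane]
  simp only [iteratedFDeriv_two_apply, hev.fderiv_eq, hsecond.fderiv, Pi.zero_apply]
  simp [hA1, hB1]
  rw [← add_div, div_eq_zero_iff]
  left
  linear_combination hid w.re w.im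

/-- The properties of the functions on a side `[0, L]` whose quotients appear in the description of
the tiles. -/
structure IsProfile (L : ℝ) (f : ℝ → ℝ) : Prop where
  pos : 0 < L
  contDiff : ContDiff ℝ 2 f
  hasDerivAt : HasDerivAt f 1 0
  odd : ∀ x, f (-x) = -f x
  symm : ∀ x, f (L - x) = f x
  fn_pos : ∀ x ∈ Ioo 0 L, 0 < f x

/-- The profiles `f`, `g` solve the Dirichlet problem: `arctan (f y / g x)` is harmonic. -/
def IsHarmonicPair (f g : ℝ → ℝ) : Prop :=
  ∀ (p z : ℂ), g (z.re - p.re) ≠ 0 → InnerProductSpace.HarmonicAt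
    (fun z : ℂ => Real.arctan (f (z.im - p.im) / g (z.re - p.re))) z

/-- The two profiles solve the same differential equation with P and Q exchanged, which makes the
identity required by `harmonicAt_arctan_div` polynomial. The half periods are the lengths of the
sides. -/
theorem exists_isHarmonicPair {a b : ℝ} (ha : 0 < a) (hb : 0 < b) :
    ∃ f g : ℝ → ℝ, IsProfile b f ∧ IsProfile a g ∧ IsHarmonicPair f g := by
  obtain ⟨P, Q, hP, hQ, hPQ, hQP⟩ := exists_halfPeriod_eq ha hb
  obtain ⟨f, f', f1, f2, f3, f4, f5, f6, f7⟩ := exists_elliptic_solution hP hQ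
  obtain ⟨g, g', g1, g2, g3, g4, g5, g6, g7⟩ := exists_elliptic_solution hQ hP
  rw [hPQ] at f6 f7
  rw [hQP] at g6 g7
  have hfc : Continuous f := continuous_iff_continuousAt.2 fun x => (f1 x).continuousAt
  have hgc : Continuous g := continuous_iff_continuousAt.2 fun x => (g1 x).continuousAt
  refine ⟨f, g, ⟨hb, contDiff_two_of_hasDerivAt f1 f2 (by fun_prop), f4 ▸ f1 0, f5, f6, f7⟩,
    ⟨ha, contDiff_two_of_hasDerivAt g1 g2 (by fun_prop), g4 ▸ g1 0, g5, g6, g7⟩,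
    fun p z hz => ?_⟩
  have hh : InnerProductSpace.HarmonicAt (fun z : ℂ => Real.arctan (f z.im / g z.re)) (z - p) :=
    harmonicAt_arctan_div f1 f2 g1 g2 (by fun_prop) (by fun_prop)
      (fun x y => by rw [f3, g3]; ring) (by simpa using hz)
  simpa using harmonicAt_comp_analyticAt (φ := fun w => w - p) hh (by fun_prop)

/-! ### Arcs of the circle -/

theorem coe_angle_injOn {u v : ℝ} (hu : u ∈ Ico 0 (2 * Real.pi)) (hv : v ∈ Ico 0 (2 * Real.pi))
    (h : (u : Real.Angle) = v) : u = v := by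
  obtain ⟨k, hk⟩ := Real.Angle.angle_eq_iff_two_pi_dvd_sub.1 h
  have hpi := Real.two_pi_pos
  have h1 : (k : ℝ) < 1 := by
    by_contra! h1
    nlinarith [hu.2, hv.1]
  have h2 : (-1 : ℝ) < k := by
    by_contra! h1
    nlinarith [hu.1, hv.2]
  have h3 : k = 0 := by
    have h1' : k < 1 := by exact_mod_cast h1
    have h2' : -1 < k := by exact_mod_cast h2
    omega
  rw [h3] at hk
  simp at hk
  linarith

theorem exists_mem_Ico_coe_angle (θ : Real.Angle) : ∃ u ∈ Ico 0 (2 * Real.pi), (u : Real.Angle) = θ :=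
  have : Fact (0 < 2 * Real.pi) := ⟨Real.two_pi_pos⟩
  AddCircle.eq_coe_Ico (p := 2 * Real.pi) θ

theorem btw_coe_add_iff (t : ℝ) {u v : ℝ} (hu : u ∈ Ico 0 (2 * Real.pi))
    (hv : v ∈ Ioc 0 (2 * Real.pi)) :
    btw (t : Real.Angle) (t + u : ℝ) (t + v : ℝ) ↔ u ≤ v := by
  have : Fact (0 < 2 * Real.pi) := ⟨Real.two_pi_pos⟩
  refine (QuotientAddGroup.btw_coe_iff (p := 2 * Real.pi) (x₁ := t) (x₂ := t + u)
    (x₃ := t + v)).trans ?_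
  rw [(toIcoMod_eq_self _).2 ⟨by linarith [hu.1], by linarith [hu.2]⟩,
    (toIocMod_eq_self _).2 ⟨by linarith [hv.1], by linarith [hv.2]⟩]
  simp

theorem mem_cIcc_add_iff (θ : Real.Angle) {u a : ℝ} (ha : a ∈ Ioo 0 (2 * Real.pi))
    (hu : u ∈ Ico 0 (2 * Real.pi)) : θ + u ∈ cIcc θ (θ + a) ↔ u ≤ a := by
  induction θ using Real.Angle.induction_on with | _ t
  exact btw_coe_add_iff t hu ⟨ha.1, ha.2.le⟩

theorem mem_cIoo_add_iff (θ : Real.Angle) {u a : ℝ} (ha : a ∈ Ioo 0 (2 * Real.pi))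
    (hu : u ∈ Ico 0 (2 * Real.pi)) : θ + u ∈ cIoo θ (θ + a) ↔ 0 < u ∧ u < a := by
  induction θ using Real.Angle.induction_on with | _ t
  rw [mem_cIoo, sbtw_iff_not_btw, btw_cyclic]
  rcases hu.1.eq_or_lt with rfl | h0
  · have h1 := btw_coe_add_iff t (u := a) (v := 2 * Real.pi) ⟨ha.1.le, ha.2⟩ ⟨Real.two_pi_pos, le_rfl⟩
    have h2 : ((t + 2 * Real.pi : ℝ) : Real.Angle) = (t : Real.Angle) + ((0 : ℝ) : Real.Angle) := by
      simp
    rw [h2, Real.Angle.coe_add] at h1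
    simp only [h1, ha.2.le, lt_irrefl, false_and, not_true_eq_false]
  · have h1 := btw_coe_add_iff t (u := a) (v := u) ⟨ha.1.le, ha.2⟩ ⟨h0, hu.2.le⟩
    rw [Real.Angle.coe_add, Real.Angle.coe_add] at h1
    rw [h1, not_le]
    exact ⟨fun h => ⟨h0, h⟩, fun h => h.2⟩

theorem IsProfile.zero {L : ℝ} {f : ℝ → ℝ} (h : IsProfile L f) : f 0 = 0 := by
  have := h.odd 0
  rw [neg_zero] at this
  linarith

theorem IsProfile.len {L : ℝ} {f : ℝ → ℝ} (h : IsProfile L f) : f L = 0 := by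
  have := h.symm 0
  rwa [sub_zero, h.zero] at this

/-- An arc of the circle with a profile on it. -/
structure TArc where
  start : Real.Angle
  len : ℝ
  fn : ℝ → ℝ
  isProfile : IsProfile len fn
  len_lt : len < 2 * Real.pi

namespace TArc

theorem len_mem (A : TArc) : A.len ∈ Ioo 0 (2 * Real.pi) := ⟨A.isProfile.pos, A.len_lt⟩

/-- The arc as a closed subset of the circle. -/
def carrier (A : TArc) : Set Real.Angle := {φ | ∃ u ∈ Icc 0 A.len, φ = A.start + u}

/-- The interior of the arc. -/
def interior (A : TArc) : Set Real.Angle := {φ | ∃ u ∈ Ioo 0 A.len, φ = A.start + u}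

/-- The sign `1` at the beginning of an arc and `-1` at its end. -/
noncomputable def sgn (e : Bool) : ℝ := if e then 1 else -1

/-- The end points of an arc. -/
noncomputable def endpt (A : TArc) (e : Bool) : Real.Angle := if e then A.start else A.start + A.len

/-- The profile as a function on the circle, extended by `0`. -/
noncomputable def val (A : TArc) (φ : Real.Angle) : ℝ :=
  haveI : Fact (0 < 2 * Real.pi) := ⟨Real.two_pi_pos⟩
  AddCircle.liftIco (2 * Real.pi) 0 (fun x => A.fn (min x A.len)) (φ - A.start)

theorem sgn_mul_self (e : Bool) : sgn e * sgn e = 1 := by cases e <;> simp [sgn]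

theorem abs_sgn (e : Bool) : |sgn e| = 1 := by cases e <;> simp [sgn]

theorem sgn_not (e : Bool) : sgn (!e) = -sgn e := by cases e <;> simp [sgn]

theorem carrier_eq_cIcc (A : TArc) : A.carrier = cIcc A.start (A.start + A.len) := by
  ext φ
  obtain ⟨u, hu, hφ⟩ := exists_mem_Ico_coe_angle (φ - A.start)
  obtain rfl : φ = A.start + u := by rw [hφ]; abel
  rw [mem_cIcc_add_iff _ A.len_mem hu]
  constructor
  · rintro ⟨v, hv, h⟩
    rw [coe_angle_injOn hu ⟨hv.1, hv.2.trans_lt A.len_lt⟩ (add_left_cancel h)]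
    exact hv.2
  · exact fun h => ⟨u, ⟨hu.1, h⟩, rfl⟩

theorem interior_eq_cIoo (A : TArc) : A.interior = cIoo A.start (A.start + A.len) := by
  ext φ
  obtain ⟨u, hu, hφ⟩ := exists_mem_Ico_coe_angle (φ - A.start)
  obtain rfl : φ = A.start + u := by rw [hφ]; abel
  rw [mem_cIoo_add_iff _ A.len_mem hu]
  constructor
  · rintro ⟨v, hv, h⟩
    rw [coe_angle_injOn hu ⟨hv.1.le, hv.2.trans A.len_lt⟩ (add_left_cancel h)]
    exact hv
  · exact fun h => ⟨u, h, rfl⟩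

theorem val_start_add (A : TArc) {u : ℝ} (hu : u ∈ Icc 0 A.len) : A.val (A.start + u) = A.fn u := by
  have : Fact (0 < 2 * Real.pi) := ⟨Real.two_pi_pos⟩
  unfold val
  rw [add_sub_cancel_left]
  refine (AddCircle.liftIco_coe_apply (p := 2 * Real.pi) (a := 0) (x := u) ?_).trans ?_
  · exact ⟨hu.1, by linarith [hu.2, A.len_lt]⟩
  · rw [min_eq_left hu.2]

theorem continuous_val (A : TArc) : Continuous A.val := by
  have : Fact (0 < 2 * Real.pi) := ⟨Real.two_pi_pos⟩
  refine Continuous.comp (AddCircle.liftIco_zero_continuous ?_ ?_)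
    (continuous_id.sub continuous_const)
  · rw [min_eq_left A.isProfile.pos.le, min_eq_right A.len_lt.le, A.isProfile.zero, A.isProfile.len]
  · exact (A.isProfile.contDiff.continuous.comp (continuous_id.min continuous_const)).continuousOn

theorem endpt_add (A : TArc) (e : Bool) {u : ℝ} :
    A.endpt e + ((sgn e * u : ℝ) : Real.Angle) = A.start + ((if e then u else A.len - u : ℝ) : Real.Angle) := by
  cases e
  · simp [endpt, sgn, sub_eq_add_neg, add_assoc]
  · simp [endpt, sgn]

theorem mem_carrier_iff (A : TArc) (e : Bool) {φ : Real.Angle} :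
    φ ∈ A.carrier ↔ ∃ u ∈ Icc 0 A.len, φ = A.endpt e + ((sgn e * u : ℝ) : Real.Angle) := by
  simp only [endpt_add]
  cases e
  · constructor
    · rintro ⟨u, hu, rfl⟩
      exact ⟨A.len - u, ⟨by linarith [hu.2], by linarith [hu.1]⟩, by simp⟩
    · rintro ⟨u, hu, rfl⟩
      exact ⟨A.len - u, ⟨by linarith [hu.2], by linarith [hu.1]⟩, by simp⟩
  · exact Iff.rfl

theorem mem_interior_iff (A : TArc) (e : Bool) {φ : Real.Angle} :
    φ ∈ A.interior ↔ ∃ u ∈ Ioo 0 A.len, φ = A.endpt e + ((sgn e * u : ℝ) : Real.Angle) := by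
  simp only [endpt_add]
  cases e
  · constructor
    · rintro ⟨u, hu, rfl⟩
      exact ⟨A.len - u, ⟨by linarith [hu.2], by linarith [hu.1]⟩, by simp⟩
    · rintro ⟨u, hu, rfl⟩
      exact ⟨A.len - u, ⟨by linarith [hu.2], by linarith [hu.1]⟩, by simp⟩
  · exact Iff.rfl

theorem val_endpt_add (A : TArc) (e : Bool) {u : ℝ} (hu : u ∈ Icc 0 A.len) :
    A.val (A.endpt e + ((sgn e * u : ℝ) : Real.Angle)) = A.fn u := by
  rw [endpt_add]
  cases e
  · simp only [Bool.false_eq_true, if_false]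
    rw [A.val_start_add ⟨by linarith [hu.2], by linarith [hu.1]⟩, A.isProfile.symm]
  · exact A.val_start_add hu

theorem endpt_mem (A : TArc) (e : Bool) : A.endpt e ∈ A.carrier :=
  (A.mem_carrier_iff e).2 ⟨0, ⟨le_rfl, A.isProfile.pos.le⟩, by simp⟩

theorem val_endpt (A : TArc) (e : Bool) : A.val (A.endpt e) = 0 := by
  have := A.val_endpt_add e (u := 0) ⟨le_rfl, A.isProfile.pos.le⟩
  simpa [A.isProfile.zero] using this

theorem isCompact_carrier (A : TArc) : IsCompact A.carrier := by
  have : A.carrier = (fun u : ℝ => A.start + (u : Real.Angle)) '' Icc 0 A.len := by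
    ext φ; simp only [carrier, mem_ofPred_eq, mem_image, eq_comm]
  rw [this]
  exact isCompact_Icc.image (by fun_prop)

theorem isClosed_carrier (A : TArc) : IsClosed A.carrier := by
  have : IsClosed (id '' A.carrier) := (A.isCompact_carrier.image continuous_id).isClosed
  rwa [image_id] at this

theorem interior_subset (A : TArc) : A.interior ⊆ A.carrier := by
  rintro φ ⟨u, hu, rfl⟩
  exact ⟨u, Ioo_subset_Icc_self hu, rfl⟩

theorem val_pos (A : TArc) {φ : Real.Angle} (h : φ ∈ A.interior) : 0 < A.val φ := by
  obtain ⟨u, hu, rfl⟩ := h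
  rw [A.val_start_add (Ioo_subset_Icc_self hu)]
  exact A.isProfile.fn_pos u hu

theorem mem_carrier_cases (A : TArc) {φ : Real.Angle} (h : φ ∈ A.carrier) :
    φ ∈ A.interior ∨ ∃ e, φ = A.endpt e := by
  obtain ⟨u, hu, rfl⟩ := h
  rcases hu.1.eq_or_lt with rfl | h0
  · exact Or.inr ⟨true, by simp [endpt]⟩
  rcases hu.2.eq_or_lt with h1 | h1
  · exact Or.inr ⟨false, by simp [endpt, h1]⟩
  · exact Or.inl ⟨u, ⟨h0, h1⟩, rfl⟩

theorem val_nonneg (A : TArc) {φ : Real.Angle} (h : φ ∈ A.carrier) : 0 ≤ A.val φ := by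
  rcases A.mem_carrier_cases h with h | ⟨e, rfl⟩
  · exact (A.val_pos h).le
  · exact (A.val_endpt e).ge

theorem endpt_notMem_interior (A : TArc) (e : Bool) : A.endpt e ∉ A.interior := fun h =>
  (A.val_pos h).ne' (A.val_endpt e)

theorem endpt_injective (A : TArc) : Function.Injective A.endpt := by
  have : A.endpt true ≠ A.endpt false := fun h => by
    have h1 : ((0 : ℝ) : Real.Angle) = A.len := by simpa [endpt, eq_comm] using h
    have := coe_angle_injOn ⟨le_rfl, Real.two_pi_pos⟩ ⟨A.isProfile.pos.le, A.len_lt⟩ h1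
    exact A.isProfile.pos.ne this
  intro e e' h
  cases e <;> cases e' <;> simp_all [eq_comm]

/-- The interior is the set where the extended profile is positive. -/
theorem isOpen_interior (A : TArc) : IsOpen A.interior := by
  rw [isOpen_iff_mem_nhds]
  rintro φ h
  have h1 : A.interior = {φ | 0 < A.val φ} := by
    ext ψ
    refine ⟨A.val_pos, fun h => ?_⟩
    obtain ⟨u, hu, hψ⟩ := exists_mem_Ico_coe_angle (ψ - A.start)
    obtain rfl : ψ = A.start + u := by rw [hψ]; abel
    by_cases hmem : (A.start + u : Real.Angle) ∈ A.carrier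
    · rcases A.mem_carrier_cases hmem with h2 | ⟨e, h2⟩
      · exact h2
      · rw [h2] at h
        exact absurd (A.val_endpt e) (ne_of_gt h)
    · exfalso
      have hlt : A.len < u := by
        by_contra! hle
        exact hmem ⟨u, ⟨hu.1, hle⟩, rfl⟩
      have : Fact (0 < 2 * Real.pi) := ⟨Real.two_pi_pos⟩
      have : A.val (A.start + u) = 0 := by
        unfold val
        rw [add_sub_cancel_left]
        refine (AddCircle.liftIco_coe_apply (p := 2 * Real.pi) (a := 0) (x := u)
          (by simpa using hu)).trans ?_
        rw [min_eq_right hlt.le, A.isProfile.len]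
      rw [mem_ofPred_eq, this] at h
      exact lt_irrefl _ h
  rw [h1]
  exact (isOpen_lt continuous_const A.continuous_val).mem_nhds (A.val_pos h)

end TArc

/-- The arcs which are the factors of a rectangle, with their profiles. -/
theorem Rectangle.exists_arcs (r : Rectangle) : ∃ A B : TArc,
    A.start = r.θ₁ ∧ A.start + A.len = r.θ₂ ∧ B.start = r.φ₁ ∧ B.start + B.len = r.φ₂ ∧
    IsHarmonicPair B.fn A.fn := by
  have key : ∀ x y : Real.Angle, x ≠ y → ∃ a : ℝ, 0 < a ∧ a < 2 * Real.pi ∧ x + a = y := by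
    intro x y hxy
    obtain ⟨u, hu, h⟩ := exists_mem_Ico_coe_angle (y - x)
    refine ⟨u, lt_of_le_of_ne hu.1 ?_, hu.2, by rw [h]; abel⟩
    rintro rfl
    rw [Real.Angle.coe_zero, eq_comm, sub_eq_zero] at h
    exact hxy h.symm
  obtain ⟨a, ha, ha', hθ⟩ := key _ _ r.θ_ne
  obtain ⟨b, hb, hb', hφ⟩ := key _ _ r.φ_ne
  obtain ⟨f, g, hf, hg, hfg⟩ := exists_isHarmonicPair ha hb
  exact ⟨⟨r.θ₁, a, g, hg, ha'⟩, ⟨r.φ₁, b, f, hf, hb'⟩, rfl, hθ, rfl, hφ, hfg⟩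

namespace Rectangle

/-- The horizontal side of a rectangle. -/
noncomputable def θArc (r : Rectangle) : TArc := r.exists_arcs.choose

/-- The vertical side of a rectangle. -/
noncomputable def φArc (r : Rectangle) : TArc := r.exists_arcs.choose_spec.choose

theorem θArc_start (r : Rectangle) : r.θArc.start = r.θ₁ :=
  r.exists_arcs.choose_spec.choose_spec.1

theorem θArc_end (r : Rectangle) : r.θArc.start + r.θArc.len = r.θ₂ :=
  r.exists_arcs.choose_spec.choose_spec.2.1

theorem φArc_start (r : Rectangle) : r.φArc.start = r.φ₁ :=
  r.exists_arcs.choose_spec.choose_spec.2.2.1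

theorem φArc_end (r : Rectangle) : r.φArc.start + r.φArc.len = r.φ₂ :=
  r.exists_arcs.choose_spec.choose_spec.2.2.2.1

theorem isHarmonicPair (r : Rectangle) : IsHarmonicPair r.φArc.fn r.θArc.fn :=
  r.exists_arcs.choose_spec.choose_spec.2.2.2.2

theorem carrier_eq (r : Rectangle) : r.carrier = r.θArc.carrier ×ˢ r.φArc.carrier := by
  rw [carrier, r.θArc.carrier_eq_cIcc, r.φArc.carrier_eq_cIcc, θArc_end, φArc_end, θArc_start,
    φArc_start]

theorem int_eq (r : Rectangle) : r.int = r.θArc.interior ×ˢ r.φArc.interior := by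
  rw [int, r.θArc.interior_eq_cIoo, r.φArc.interior_eq_cIoo, θArc_end, φArc_end, θArc_start,
    φArc_start]

theorem mem_vertices_iff (r : Rectangle) {v : Torus} :
    v ∈ r.vertices ↔ (∃ e, v.1 = r.θArc.endpt e) ∧ ∃ e, v.2 = r.φArc.endpt e := by
  simp [vertices, mem_prod, TArc.endpt, ← θArc_end, ← φArc_end, ← θArc_start, ← φArc_start, or_comm]

end Rectangle

/-! ### The harmonic function of a rectangle -/

theorem tendsto_arctan_div_pi_div_two {α : Type*} {l : Filter α} {c : ℝ} (hc : 0 < c) {g : α → ℝ}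
    (hg : Tendsto g l (𝓝[>] 0)) : Tendsto (fun x => Real.arctan (c / g x)) l (𝓝 (Real.pi / 2)) := by
  have h1 : Tendsto (fun x => c / g x) l atTop := by
    simp only [div_eq_mul_inv]
    exact (tendsto_inv_nhdsGT_zero.comp hg).const_mul_atTop hc
  exact (Real.tendsto_arctan_atTop.mono_right nhdsWithin_le_nhds).comp h1

namespace TArc

theorem tendsto_val_endpt (A : TArc) (e : Bool) :
    Tendsto A.val (𝓝[A.interior] (A.endpt e)) (𝓝[>] 0) := by
  refine tendsto_nhdsWithin_iff.2 ⟨?_, ?_⟩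
  · rw [← A.val_endpt e]
    exact A.continuous_val.continuousAt.mono_left nhdsWithin_le_nhds
  · filter_upwards [self_mem_nhdsWithin] with φ hφ using A.val_pos hφ

theorem tendsto_start_add_nhdsGT (A : TArc) :
    Tendsto (fun u : ℝ => A.start + (u : Real.Angle)) (𝓝[>] 0) (𝓝[A.interior] (A.endpt true)) := by
  refine tendsto_nhdsWithin_iff.2 ⟨?_, ?_⟩
  · have : Continuous (fun u : ℝ => A.start + (u : Real.Angle)) := by fun_prop
    have h := this.tendsto 0
    simp only [Real.Angle.coe_zero, add_zero] at h
    exact h.mono_left nhdsWithin_le_nhds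
  · filter_upwards [Ioo_mem_nhdsGT A.isProfile.pos] with u hu using ⟨u, hu, rfl⟩

theorem tendsto_start_add_nhdsLT (A : TArc) :
    Tendsto (fun u : ℝ => A.start + (u : Real.Angle)) (𝓝[<] A.len)
      (𝓝[A.interior] (A.endpt false)) := by
  refine tendsto_nhdsWithin_iff.2 ⟨?_, ?_⟩
  · have : Continuous (fun u : ℝ => A.start + (u : Real.Angle)) := by fun_prop
    exact (this.tendsto A.len).mono_left nhdsWithin_le_nhds
  · filter_upwards [Ioo_mem_nhdsLT A.isProfile.pos] with u hu using ⟨u, hu, rfl⟩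

end TArc

/-- The explicit formula for the harmonic function of a rectangle. -/
noncomputable def Rectangle.solution (r : Rectangle) (v : Torus) : ℝ :=
  2 / Real.pi * Real.arctan (r.φArc.val v.2 / r.θArc.val v.1)

theorem Rectangle.endpts (r : Rectangle) : r.θArc.endpt true = r.θ₁ ∧ r.θArc.endpt false = r.θ₂ ∧
    r.φArc.endpt true = r.φ₁ ∧ r.φArc.endpt false = r.φ₂ :=
  ⟨r.θArc_start, r.θArc_end, r.φArc_start, r.φArc_end⟩

theorem Rectangle.interiors (r : Rectangle) :
    cIoo r.θ₁ r.θ₂ = r.θArc.interior ∧ cIoo r.φ₁ r.φ₂ = r.φArc.interior := by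
  rw [r.θArc.interior_eq_cIoo, r.φArc.interior_eq_cIoo, θArc_end, φArc_end, θArc_start, φArc_start]
  exact ⟨rfl, rfl⟩

/-- In a lift of the arc to ℝ the profile is a translate of `fn`; this brings the explicit solution
into the form that `IsHarmonicPair` speaks of. -/
theorem TArc.eventually_val_eq (A : TArc) {x : ℝ} (h : (x : Real.Angle) ∈ A.interior) :
    ∃ s : ℝ, 0 < A.fn (x - s) ∧ ∀ᶠ y : ℝ in 𝓝 x, A.val y = A.fn (y - s) := by
  obtain ⟨u, hu, hx⟩ := h
  have hs : ((x - u : ℝ) : Real.Angle) = A.start := by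
    rw [Real.Angle.coe_sub, hx]; abel
  refine ⟨x - u, by simpa using A.isProfile.fn_pos u hu, ?_⟩
  have h1 : ∀ᶠ y : ℝ in 𝓝 x, y - (x - u) ∈ Ioo 0 A.len := by
    have : ContinuousAt (fun y : ℝ => y - (x - u)) x := by fun_prop
    exact this.eventually (isOpen_Ioo.mem_nhds (by simpa using hu))
  filter_upwards [h1] with y hy
  rw [← A.val_start_add (Ioo_subset_Icc_self hy), ← hs, ← Real.Angle.coe_add]
  congr 2; ring

theorem Rectangle.isRectHarmonic_solution (r : Rectangle) : IsRectHarmonic r r.solution := by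
  obtain ⟨e1, e2, e3, e4⟩ := r.endpts
  obtain ⟨i1, i2⟩ := r.interiors
  have hφ : ∀ e, ∀ θ ∈ r.θArc.interior, Tendsto (fun φ => r.solution (θ, φ))
      (𝓝[r.φArc.interior] (r.φArc.endpt e)) (𝓝 0) := by
    intro e θ _
    have : Continuous fun φ => r.solution (θ, φ) := by
      unfold solution
      exact continuous_const.mul (Real.continuous_arctan.comp
        (r.φArc.continuous_val.div_const (r.θArc.val θ)))
    have h := this.tendsto (r.φArc.endpt e)
    simp only [solution, TArc.val_endpt, zero_div, Real.arctan_zero, mul_zero] at h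
    exact h.mono_left nhdsWithin_le_nhds
  have hθ : ∀ e, ∀ φ ∈ r.φArc.interior, Tendsto (fun θ => r.solution (θ, φ))
      (𝓝[r.θArc.interior] (r.θArc.endpt e)) (𝓝 1) := by
    intro e φ h
    have := (tendsto_arctan_div_pi_div_two (r.φArc.val_pos h)
      (r.θArc.tendsto_val_endpt e)).const_mul (2 / Real.pi)
    rwa [show 2 / Real.pi * (Real.pi / 2) = 1 by field_simp] at this
  refine ⟨⟨1, fun v _ => ?_⟩, fun z hz => ?_, ?_, ?_, ?_, ?_⟩
  · have h1 := Real.arctan_lt_pi_div_two (r.φArc.val v.2 / r.θArc.val v.1)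
    have h2 := Real.neg_pi_div_two_lt_arctan (r.φArc.val v.2 / r.θArc.val v.1)
    have hpi := Real.pi_pos
    rw [solution, abs_mul, abs_of_pos (by positivity), div_mul_eq_mul_div, div_le_one hpi]
    have := abs_lt.2 ⟨by linarith, h1⟩
    linarith
  · rw [mem_ofPred_eq, int_eq] at hz
    obtain ⟨s, hs, hs'⟩ := r.θArc.eventually_val_eq hz.1
    obtain ⟨t, ht, ht'⟩ := r.φArc.eventually_val_eq hz.2
    have h1 := (r.isHarmonicPair ⟨s, t⟩ z hs.ne').const_smul (c := 2 / Real.pi)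
    refine (InnerProductSpace.harmonicAt_congr_nhds ?_).1 h1
    filter_upwards [Complex.continuous_re.continuousAt.eventually hs',
      Complex.continuous_im.continuousAt.eventually ht'] with w hw1 hw2
    simp only [solution, hw1, hw2, Pi.smul_apply, smul_eq_mul]
  · rw [i1, i2, ← e3]; exact hφ true
  · rw [i1, i2, ← e4]; exact hφ false
  · rw [i1, i2, ← e1]; exact hθ true
  · rw [i1, i2, ← e2]; exact hθ false

/-- In coordinates based at the corner (θ₁, φ₁) the difference is bounded and harmonic with limit 0
at all four sides. This identifies `harmonicFun`, known only as some solution, with the explicit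
one. -/
theorem IsRectHarmonic.eqOn {r : Rectangle} {h₁ h₂ : Torus → ℝ} (H₁ : IsRectHarmonic r h₁)
    (H₂ : IsRectHarmonic r h₂) : EqOn h₁ h₂ r.int := by
  obtain ⟨e1, e2, e3, e4⟩ := r.endpts
  obtain ⟨i1, i2⟩ := r.interiors
  obtain ⟨t, ht⟩ : ∃ t : ℝ, (t : Real.Angle) = r.θArc.start :=
    (exists_mem_Ico_coe_angle _).imp fun _ h => h.2
  obtain ⟨s, hs⟩ : ∃ s : ℝ, (s : Real.Angle) = r.φArc.start :=
    (exists_mem_Ico_coe_angle _).imp fun _ h => h.2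
  obtain ⟨C₁, hC₁⟩ := H₁.bounded
  obtain ⟨C₂, hC₂⟩ := H₂.bounded
  let P : ℂ → Torus := fun z => (r.θArc.start + z.re, r.φArc.start + z.im)
  have hP : ∀ z : ℂ, z.re ∈ Ioo 0 r.θArc.len → z.im ∈ Ioo 0 r.φArc.len → P z ∈ r.int := by
    intro z h1 h2
    rw [r.int_eq]
    exact ⟨⟨_, h1, rfl⟩, ⟨_, h2, rfl⟩⟩
  have hharm : ∀ {h : Torus → ℝ}, IsRectHarmonic r h → ∀ z : ℂ, z.re ∈ Ioo 0 r.θArc.len →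
      z.im ∈ Ioo 0 r.φArc.len → InnerProductSpace.HarmonicAt (fun z => h (P z)) z := by
    intro h H z h1 h2
    have e : ∀ w : ℂ, (((w + ⟨t, s⟩ : ℂ).re : Real.Angle), ((w + ⟨t, s⟩ : ℂ).im : Real.Angle)) = P w := by
      intro w
      simp [P, ← ht, ← hs, add_comm]
    have h3 := harmonicAt_comp_analyticAt (z := z) (φ := fun w => w + ⟨t, s⟩)
      (H.harmonic (z + ⟨t, s⟩) (by rw [mem_ofPred_eq, e]; exact hP z h1 h2)) (by fun_prop)
    simpa only [e] using h3
  have hz : IsZeroDirichlet r.θArc.len r.φArc.len (C₁ + C₂) (fun z => h₁ (P z) - h₂ (P z)) := by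
    refine ⟨fun z h1 h2 => (hharm H₁ z h1 h2).sub (hharm H₂ z h1 h2), fun z h1 h2 => ?_,
      fun x hx => ?_, fun x hx => ?_, fun y hy => ?_, fun y hy => ?_⟩
    · exact (abs_sub _ _).trans (add_le_add (hC₁ _ (hP z h1 h2)) (hC₂ _ (hP z h1 h2)))
    · have hm : (r.θArc.start + x : Real.Angle) ∈ cIoo r.θ₁ r.θ₂ := i1 ▸ ⟨x, hx, rfl⟩
      have := (H₁.tendsto_φ₁ _ hm).sub (H₂.tendsto_φ₁ _ hm)
      rw [i2, ← e3, sub_zero] at this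
      exact this.comp r.φArc.tendsto_start_add_nhdsGT
    · have hm : (r.θArc.start + x : Real.Angle) ∈ cIoo r.θ₁ r.θ₂ := i1 ▸ ⟨x, hx, rfl⟩
      have := (H₁.tendsto_φ₂ _ hm).sub (H₂.tendsto_φ₂ _ hm)
      rw [i2, ← e4, sub_zero] at this
      exact this.comp r.φArc.tendsto_start_add_nhdsLT
    · have hm : (r.φArc.start + y : Real.Angle) ∈ cIoo r.φ₁ r.φ₂ := i2 ▸ ⟨y, hy, rfl⟩
      have := (H₁.tendsto_θ₁ _ hm).sub (H₂.tendsto_θ₁ _ hm)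
      rw [i1, ← e1, sub_self] at this
      exact this.comp r.θArc.tendsto_start_add_nhdsGT
    · have hm : (r.φArc.start + y : Real.Angle) ∈ cIoo r.φ₁ r.φ₂ := i2 ▸ ⟨y, hy, rfl⟩
      have := (H₁.tendsto_θ₂ _ hm).sub (H₂.tendsto_θ₂ _ hm)
      rw [i1, ← e2, sub_self] at this
      exact this.comp r.θArc.tendsto_start_add_nhdsLT
  rintro ⟨θ, φ⟩ hv
  rw [r.int_eq] at hv
  obtain ⟨⟨x, hx, h1⟩, ⟨y, hy, h2⟩⟩ := hv
  simp only at h1 h2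
  have := hz.eq_zero (z := ⟨x, y⟩) hx hy
  rw [h1, h2]
  exact sub_eq_zero.1 this

theorem harmonicFun_eqOn (r : Rectangle) : EqOn (harmonicFun r) r.solution r.int :=
  (Classical.epsilon_spec (p := IsRectHarmonic r) ⟨_, r.isRectHarmonic_solution⟩).eqOn
    r.isRectHarmonic_solution

/-- The number tan (π h / 2) is the quotient of the profiles, so the squared tangent of π/2 times
the tile function is that quotient too. This is the source of the equation in `disc`. -/
theorem tileFun_eq {r : Rectangle} {v : Torus} (hv : v ∈ r.int) :
    tileFun r v = 2 / Real.pi * Real.arctan (Real.sqrt (r.φArc.val v.2 / r.θArc.val v.1)) := by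
  rw [tileFun, harmonicFun_eqOn r hv, Rectangle.solution]
  congr 3
  rw [show Real.pi * (2 / Real.pi * Real.arctan (r.φArc.val v.2 / r.θArc.val v.1)) / 2 =
    Real.arctan (r.φArc.val v.2 / r.θArc.val v.1) by field_simp, Real.tan_arctan]

/-! ### The tiles -/

/-- The identification of `ℂ × ℂ` with `ℝ⁴`. -/
noncomputable def toE4 (q : ℂ × ℂ) : E4 := !₂[q.1.re, q.1.im, q.2.re, q.2.im]

/-- The closed sector with the given set of directions. -/
def sector (S : Set Real.Angle) : Set ℂ := {z | z = 0 ∨ (z.arg : Real.Angle) ∈ S}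

/-- The tile of the rectangle with horizontal side `A` and vertical side `B`, as a subset
of `ℂ × ℂ`. -/
def disc (A B : TArc) : Set (ℂ × ℂ) :=
  {q | ‖q.1‖ ^ 2 + ‖q.2‖ ^ 2 = 1 ∧ q.1 ∈ sector B.carrier ∧ q.2 ∈ sector A.carrier ∧
    ‖q.1‖ ^ 2 * B.val q.1.arg = ‖q.2‖ ^ 2 * A.val q.2.arg}

/-- The interior of a tile. -/
def openDisc (A B : TArc) : Set (ℂ × ℂ) :=
  {q | q ∈ disc A B ∧ q.1 ≠ 0 ∧ q.2 ≠ 0 ∧ (q.1.arg : Real.Angle) ∈ B.interior ∧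
    (q.2.arg : Real.Angle) ∈ A.interior}

theorem arg_mul_toCircle {c : ℝ} (hc : 0 < c) (φ : Real.Angle) :
    ((c * φ.toCircle : ℂ).arg : Real.Angle) = φ := by
  rw [Real.Angle.coe_toCircle]
  exact Complex.arg_mul_cos_add_sin_mul_I_coe_angle hc φ

theorem norm_mul_toCircle {c : ℝ} (hc : 0 ≤ c) (φ : Real.Angle) : ‖(c * φ.toCircle : ℂ)‖ = c := by
  simp [abs_of_nonneg hc, Circle.norm_coe]

theorem eq_norm_mul_toCircle (z : ℂ) : z = ‖z‖ * (z.arg : Real.Angle).toCircle := by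
  conv_lhs => rw [← Complex.norm_mul_exp_arg_mul_I z]
  simp [Circle.coe_exp]

theorem mul_toCircle_mem_sector {c : ℝ} (hc : 0 ≤ c) {φ : Real.Angle} {S : Set Real.Angle}
    (hφ : φ ∈ S) : (c * φ.toCircle : ℂ) ∈ sector S := by
  rcases hc.eq_or_lt with rfl | h
  · exact Or.inl (by simp)
  · exact Or.inr (by rwa [arg_mul_toCircle h])

theorem continuous_toCircle : Continuous fun φ : Real.Angle => (φ.toCircle : ℂ) := by
  simp only [Real.Angle.coe_toCircle]
  have h1 := Real.Angle.continuous_cos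
  have h2 := Real.Angle.continuous_sin
  fun_prop

theorem continuousAt_argAngle {z : ℂ} (hz : z ≠ 0) :
    ContinuousAt (fun z : ℂ => (z.arg : Real.Angle)) z :=
  Complex.continuousAt_arg_coe_angle hz

theorem isClosed_sector {S : Set Real.Angle} (hS : IsClosed S) : IsClosed (sector S) := by
  rw [← isOpen_compl_iff, isOpen_iff_mem_nhds]
  intro z hz
  simp only [sector, mem_compl_iff, mem_ofPred_eq, not_or] at hz
  filter_upwards [isOpen_ne.mem_nhds hz.1,
    (continuousAt_argAngle hz.1).eventually (hS.isOpen_compl.mem_nhds hz.2)] with w h1 h2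
  simp only [sector, mem_compl_iff, mem_ofPred_eq, not_or]
  exact ⟨h1, h2⟩

/-- The argument, as an angle, is continuous away from 0, and at 0 the factor ‖z‖² suppresses the
bounded function k. -/
theorem continuous_normSq_mul_arg {k : Real.Angle → ℝ} (hk : Continuous k) :
    Continuous fun z : ℂ => ‖z‖ ^ 2 * k z.arg := by
  refine continuous_iff_continuousAt.2 fun z => ?_
  by_cases hz : z = 0
  · subst hz
    have : CompactSpace Real.Angle :=
      have : Fact (0 < 2 * Real.pi) := ⟨Real.two_pi_pos⟩
      inferInstanceAs (CompactSpace (AddCircle (2 * Real.pi)))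
    obtain ⟨C, hC⟩ := (isCompact_univ (X := Real.Angle)).exists_bound_of_continuousOn hk.continuousOn
    have h0 : Tendsto (fun z : ℂ => ‖z‖ ^ 2 * C) (𝓝 0) (𝓝 0) := by
      have : Continuous fun z : ℂ => ‖z‖ ^ 2 * C := by fun_prop
      simpa using this.tendsto 0
    have h1 : Tendsto (fun z : ℂ => ‖z‖ ^ 2 * k z.arg) (𝓝 0) (𝓝 0) := by
      refine squeeze_zero_norm (fun z => ?_) h0
      rw [norm_mul, norm_pow, norm_norm]
      exact mul_le_mul_of_nonneg_left (hC _ (mem_univ _)) (by positivity)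
    simpa [ContinuousAt] using h1
  · exact (continuous_norm.pow 2).continuousAt.mul
      (hk.continuousAt.comp (f := fun z : ℂ => (z.arg : Real.Angle)) (continuousAt_argAngle hz))

theorem isClosed_disc (A B : TArc) : IsClosed (disc A B) := by
  have h1 := continuous_normSq_mul_arg B.continuous_val
  have h2 := continuous_normSq_mul_arg A.continuous_val
  have h3 : IsClosed {q : ℂ × ℂ | ‖q.1‖ ^ 2 + ‖q.2‖ ^ 2 = 1} :=
    isClosed_eq (by fun_prop) continuous_const
  exact h3.inter (((isClosed_sector B.isClosed_carrier).preimage continuous_fst).inter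
    (((isClosed_sector A.isClosed_carrier).preimage continuous_snd).inter
    (isClosed_eq (h1.comp continuous_fst) (h2.comp continuous_snd))))

theorem isCompact_disc (A B : TArc) : IsCompact (disc A B) := by
  refine Metric.isCompact_of_isClosed_isBounded (isClosed_disc A B) ?_
  refine (Metric.isBounded_closedBall (x := (0 : ℂ × ℂ)) (r := 1)).subset fun q hq => ?_
  have h := hq.1
  rw [mem_closedBall_zero_iff, Prod.norm_def, sup_le_iff]
  constructor <;> nlinarith [sq_nonneg ‖q.1‖, sq_nonneg ‖q.2‖, norm_nonneg q.1, norm_nonneg q.2]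

theorem swap_mem_disc {A B : TArc} {q : ℂ × ℂ} : q.swap ∈ disc B A ↔ q ∈ disc A B := by
  simp only [disc, mem_ofPred_eq, Prod.fst_swap, Prod.snd_swap]
  rw [add_comm, eq_comm (a := ‖q.2‖ ^ 2 * _)]
  tauto

theorem swap_mem_openDisc {A B : TArc} {q : ℂ × ℂ} : q.swap ∈ openDisc B A ↔ q ∈ openDisc A B := by
  simp only [openDisc, mem_ofPred_eq, swap_mem_disc, Prod.fst_swap, Prod.snd_swap]
  tauto

/-- A point of a tile which does not lie on one of the axes is an interior point or lies over
a vertex. -/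
theorem mem_disc_cases {A B : TArc} {q : ℂ × ℂ} (hq : q ∈ disc A B) (h1 : q.1 ≠ 0) (h2 : q.2 ≠ 0) :
    q ∈ openDisc A B ∨ (∃ e, (q.1.arg : Real.Angle) = B.endpt e) ∧
      ∃ e, (q.2.arg : Real.Angle) = A.endpt e := by
  have hB := hq.2.1.resolve_left h1
  have hA := hq.2.2.1.resolve_left h2
  have heq := hq.2.2.2
  have n1 : 0 < ‖q.1‖ ^ 2 := by positivity
  have n2 : 0 < ‖q.2‖ ^ 2 := by positivity
  rcases B.mem_carrier_cases hB with hB' | ⟨e, he⟩ <;>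
    rcases A.mem_carrier_cases hA with hA' | ⟨e', he'⟩
  · exact Or.inl ⟨hq, h1, h2, hB', hA'⟩
  · rw [he', A.val_endpt, mul_zero] at heq
    exact absurd heq (mul_pos n1 (B.val_pos hB')).ne'
  · rw [he, B.val_endpt, mul_zero] at heq
    exact absurd heq (mul_pos n2 (A.val_pos hA')).ne
  · exact Or.inr ⟨⟨e, he⟩, ⟨e', he'⟩⟩

theorem exists_fn_eq (A : TArc) {ε t : ℝ} (hε : 0 < ε) (ht : 0 < t)
    (htf : t ≤ A.fn ε) : ∃ u, 0 < u ∧ u ≤ ε ∧ A.fn u = t := by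
  obtain ⟨u, hu, h⟩ := intermediate_value_Icc hε.le A.isProfile.contDiff.continuous.continuousOn
    (show t ∈ Icc (A.fn 0) (A.fn ε) from ⟨by rw [A.isProfile.zero]; exact ht.le, htf⟩)
  refine ⟨u, lt_of_le_of_ne hu.1 ?_, hu.2, h⟩
  rintro rfl
  rw [A.isProfile.zero] at h
  exact ht.ne h

/-- Both profiles vanish at the ends of the sides, so c² f(u) = s² g(v) has arbitrarily small
positive solutions u, v for any given c and s. Thus the closure of the interior of a tile contains
the whole arc over each vertex. -/
theorem mem_closure_openDisc_of_vertex (A B : TArc) (e e' : Bool) {c s : ℝ} (hc : 0 < c) (hs : 0 < s)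
    (hcs : c ^ 2 + s ^ 2 = 1) :
    ((c * (B.endpt e).toCircle, s * (A.endpt e').toCircle) : ℂ × ℂ) ∈ closure (openDisc A B) := by
  let F : ℝ × ℝ → ℂ × ℂ := fun p =>
    (c * (B.endpt e + ((TArc.sgn e * p.1 : ℝ) : Real.Angle)).toCircle,
      s * (A.endpt e' + ((TArc.sgn e' * p.2 : ℝ) : Real.Angle)).toCircle)
  have hF : Continuous F := by
    have := continuous_toCircle
    refine Continuous.prodMk (continuous_const.mul (this.comp ?_))
      (continuous_const.mul (this.comp ?_)) <;> fun_prop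
  have h0 : F (0, 0) = (c * ((B.endpt e).toCircle : ℂ), s * ((A.endpt e').toCircle : ℂ)) := by simp [F]
  rw [← h0]
  refine closure_mono (s := F '' {p | 0 < p.1 ∧ p.1 < B.len ∧
    0 < p.2 ∧ p.2 < A.len ∧ c ^ 2 * B.fn p.1 = s ^ 2 * A.fn p.2}) (image_subset_iff.2 ?_)
    (mem_closure_image hF.continuousAt ?_)
  · rintro ⟨u, v⟩ ⟨hu, hu', hv, hv', heq⟩
    simp only at hu hu' hv hv' heq
    have hB := (B.mem_interior_iff e).2 ⟨u, ⟨hu, hu'⟩, rfl⟩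
    have hA := (A.mem_interior_iff e').2 ⟨v, ⟨hv, hv'⟩, rfl⟩
    have n1 := norm_mul_toCircle hc.le (B.endpt e + ((TArc.sgn e * u : ℝ) : Real.Angle))
    have n2 := norm_mul_toCircle hs.le (A.endpt e' + ((TArc.sgn e' * v : ℝ) : Real.Angle))
    refine ⟨⟨?_, mul_toCircle_mem_sector hc.le (B.interior_subset hB),
      mul_toCircle_mem_sector hs.le (A.interior_subset hA), ?_⟩, ?_, ?_, ?_, ?_⟩
    · simp only [F, n1, n2, hcs]
    · simp only [F, n1, n2, arg_mul_toCircle hc, arg_mul_toCircle hs,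
        B.val_endpt_add e ⟨hu.le, hu'.le⟩, A.val_endpt_add e' ⟨hv.le, hv'.le⟩, heq]
    · rw [← norm_ne_zero_iff]; exact n1.trans_ne hc.ne'
    · rw [← norm_ne_zero_iff]; exact n2.trans_ne hs.ne'
    · simp only [F, arg_mul_toCircle hc, hB]
    · simp only [F, arg_mul_toCircle hs, hA]
  · rw [Metric.mem_closure_iff]
    intro ε₀ hε₀
    obtain ⟨ε, hε, h1, h2, h3⟩ : ∃ ε, 0 < ε ∧ ε < ε₀ ∧ ε < B.len ∧ ε < A.len := by
      have := B.isProfile.pos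
      have := A.isProfile.pos
      have hm : 0 < min ε₀ (min B.len A.len) := by positivity
      refine ⟨min ε₀ (min B.len A.len) / 2, by positivity, ?_, ?_, ?_⟩
      · linarith [min_le_left ε₀ (min B.len A.len)]
      · linarith [min_le_right ε₀ (min B.len A.len), min_le_left B.len A.len]
      · linarith [min_le_right ε₀ (min B.len A.len), min_le_right B.len A.len]
    have hfB := B.isProfile.fn_pos ε ⟨hε, h2⟩
    have hfA := A.isProfile.fn_pos ε ⟨hε, h3⟩
    -- The solution is found through a common parameter l, with f(u) = s² l and g(v) = c² l; l is so
    -- small that both values are attained on [0, ε].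
    have hl : 0 < min (B.fn ε / s ^ 2) (A.fn ε / c ^ 2) := by positivity
    set l := min (B.fn ε / s ^ 2) (A.fn ε / c ^ 2) with hldef
    obtain ⟨u, hu, huε, huf⟩ := exists_fn_eq B hε (t := s ^ 2 * l) (by positivity)
      (by rw [← le_div_iff₀' (by positivity)]; exact min_le_left _ _)
    obtain ⟨v, hv, hvε, hvf⟩ := exists_fn_eq A hε (t := c ^ 2 * l) (by positivity)
      (by rw [← le_div_iff₀' (by positivity)]; exact min_le_right _ _)
    refine ⟨(u, v), ⟨hu, huε.trans_lt h2, hv, hvε.trans_lt h3, by rw [huf, hvf]; ring⟩, ?_⟩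
    rw [dist_comm, Prod.dist_eq, Real.dist_eq, Real.dist_eq, sub_zero, sub_zero, abs_of_pos hu,
      abs_of_pos hv]
    exact max_lt (huε.trans_lt h1) (hvε.trans_lt h1)

/-- The equation with z₁ = 0 forces arg z₂ to be an end of the horizontal side, so the point is a
limit of points of an arc over a vertex, treated before. -/
theorem mem_closure_openDisc_of_fst_eq_zero {A B : TArc} {q : ℂ × ℂ} (hq : q ∈ disc A B)
    (h : q.1 = 0) : q ∈ closure (openDisc A B) := by
  have hn : ‖q.2‖ = 1 := by
    have := hq.1
    rw [h, norm_zero] at this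
    nlinarith [norm_nonneg q.2]
  have hq2 : q.2 ≠ 0 := norm_ne_zero_iff.1 (by rw [hn]; exact one_ne_zero)
  obtain ⟨e, he⟩ : ∃ e, (q.2.arg : Real.Angle) = A.endpt e := by
    rcases A.mem_carrier_cases (hq.2.2.1.resolve_left hq2) with h1 | h1
    · have := hq.2.2.2
      rw [h, norm_zero, hn] at this
      have h3 := A.val_pos h1
      norm_num at this
      exact absurd this h3.ne
    · exact h1
  let F : ℝ → ℂ × ℂ := fun c => (c * (B.endpt true).toCircle,
    (Real.sqrt (1 - c ^ 2) : ℝ) * (A.endpt e).toCircle)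
  have hF : Continuous F := by fun_prop
  have h0 : F 0 = q := by
    refine Prod.ext (by simp [F, h]) ?_
    conv_rhs => rw [eq_norm_mul_toCircle q.2, hn, he]
    simp [F]
  rw [← h0, ← closure_closure]
  refine closure_mono (s := F '' Ioo 0 1) (image_subset_iff.2 fun c hc => ?_)
    (mem_closure_image hF.continuousAt ?_)
  · have h1 : 0 < 1 - c ^ 2 := by nlinarith [hc.1, hc.2]
    exact mem_closure_openDisc_of_vertex A B true e hc.1 (Real.sqrt_pos.2 h1)
      (by rw [Real.sq_sqrt h1.le]; ring)
  · rw [closure_Ioo (by norm_num)]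
    exact ⟨le_rfl, zero_le_one⟩

theorem disc_subset_closure (A B : TArc) : disc A B ⊆ closure (openDisc A B) := by
  intro q hq
  by_cases h1 : q.1 = 0
  · exact mem_closure_openDisc_of_fst_eq_zero hq h1
  by_cases h2 : q.2 = 0
  · have h := mem_closure_openDisc_of_fst_eq_zero (swap_mem_disc.2 hq) h2
    have h3 := mem_closure_image (f := Prod.swap) continuous_swap.continuousAt h
    rw [Prod.swap_swap] at h3
    refine closure_mono (image_subset_iff.2 fun p hp => ?_) h3
    exact swap_mem_openDisc.2 hp
  rcases mem_disc_cases hq h1 h2 with h | ⟨⟨e, he⟩, ⟨e', he'⟩⟩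
  · exact subset_closure h
  · have := mem_closure_openDisc_of_vertex A B e e' (norm_pos_iff.2 h1) (norm_pos_iff.2 h2) hq.1
    rwa [← he, ← he', ← eq_norm_mul_toCircle, ← eq_norm_mul_toCircle] at this

theorem joinMap_eq (v : Torus) (τ : ℝ) : joinMap (v, τ) =
    toE4 (Real.cos (Real.pi * τ / 2) * v.2.toCircle, Real.sin (Real.pi * τ / 2) * v.1.toCircle) := by
  simp only [joinMap, toE4, Complex.re_ofReal_mul, Complex.im_ofReal_mul, Real.Angle.coe_toCircle]
  simp

theorem continuous_toE4 : Continuous toE4 := by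
  unfold toE4
  fun_prop

theorem continuous_joinMap : Continuous joinMap := by
  have : joinMap = fun x : Torus × ℝ => toE4 (Real.cos (Real.pi * x.2 / 2) * x.1.2.toCircle,
      Real.sin (Real.pi * x.2 / 2) * x.1.1.toCircle) := funext fun x => joinMap_eq x.1 x.2
  rw [this]
  refine continuous_toE4.comp (Continuous.prodMk ?_ ?_)
  · exact (by fun_prop : Continuous fun x : Torus × ℝ => (Real.cos (Real.pi * x.2 / 2) : ℂ)).mul
      (continuous_toCircle.comp (by fun_prop))
  · exact (by fun_prop : Continuous fun x : Torus × ℝ => (Real.sin (Real.pi * x.2 / 2) : ℂ)).mul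
      (continuous_toCircle.comp (by fun_prop))

/-- The graph over the open rectangle is mapped onto `openDisc`, since the angles and the quotient
of the profiles determine the moduli. Its closure is compact, so taking closures commutes with the
map, and `disc` is the closure of `openDisc`. -/
theorem tile_eq (r : Rectangle) : tile r = toE4 '' disc r.θArc r.φArc := by
  set G := (fun v => (v, tileFun r v)) '' r.int with hG
  have hGint : joinMap '' G = toE4 '' openDisc r.θArc r.φArc := by
    rw [hG, image_image, r.int_eq]
    have hpt : ∀ (v : Torus), v ∈ r.θArc.interior ×ˢ r.φArc.interior → ∀ c s : ℝ, 0 < c → 0 < s →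
        c ^ 2 + s ^ 2 = 1 → c ^ 2 * r.φArc.val v.2 = s ^ 2 * r.θArc.val v.1 →
        joinMap (v, tileFun r v) = toE4 (c * v.2.toCircle, s * v.1.toCircle) := by
      intro v hv c s hc hs hcs heq
      rw [joinMap_eq, tileFun_eq (by rwa [r.int_eq])]
      have hA := r.θArc.val_pos hv.1
      have e1 : r.φArc.val v.2 / r.θArc.val v.1 = (s / c) ^ 2 := by
        rw [div_pow, div_eq_div_iff hA.ne' (by positivity)]
        linarith
      have e2 : ∀ x, Real.pi * (2 / Real.pi * x) / 2 = x := fun x => by field_simp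
      rw [e1, Real.sqrt_sq (by positivity), e2, Real.cos_arctan, Real.sin_arctan]
      have e3 : Real.sqrt (1 + (s / c) ^ 2) = 1 / c := by
        rw [show 1 + (s / c) ^ 2 = (1 / c) ^ 2 by field_simp; linarith, Real.sqrt_sq (by positivity)]
      rw [e3]
      have e4 : s / c / (1 / c) = s := by field_simp
      rw [e4, one_div_one_div]
    apply Subset.antisymm
    · rintro _ ⟨v, hv, rfl⟩
      have hA := r.θArc.val_pos hv.1
      have hB := r.φArc.val_pos hv.2
      set f := r.φArc.val v.2
      set g := r.θArc.val v.1
      -- The positive solutions of c² + s² = 1, c² f = s² g are given by c² = g / (f + g) and s² = f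
      -- / (f + g).
      have hc : 0 < Real.sqrt (g / (f + g)) := by positivity
      have hs : 0 < Real.sqrt (f / (f + g)) := by positivity
      have hc2 : Real.sqrt (g / (f + g)) ^ 2 = g / (f + g) := Real.sq_sqrt (by positivity)
      have hs2 : Real.sqrt (f / (f + g)) ^ 2 = f / (f + g) := Real.sq_sqrt (by positivity)
      have h1 : Real.sqrt (g / (f + g)) ^ 2 + Real.sqrt (f / (f + g)) ^ 2 = 1 := by
        rw [hc2, hs2]; field_simp; ring
      have h2 : Real.sqrt (g / (f + g)) ^ 2 * f = Real.sqrt (f / (f + g)) ^ 2 * g := by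
        rw [hc2, hs2]; field_simp
      refine ⟨_, ?_, (hpt v hv _ _ hc hs h1 h2).symm⟩
      have n1 := norm_mul_toCircle hc.le v.2
      have n2 := norm_mul_toCircle hs.le v.1
      refine ⟨⟨?_, mul_toCircle_mem_sector hc.le (r.φArc.interior_subset hv.2),
        mul_toCircle_mem_sector hs.le (r.θArc.interior_subset hv.1), ?_⟩, ?_, ?_, ?_, ?_⟩
      · simp only [n1, n2, h1]
      · simp only [n1, n2, arg_mul_toCircle hc, arg_mul_toCircle hs]; exact h2
      · rw [← norm_ne_zero_iff]; exact n1.trans_ne hc.ne'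
      · rw [← norm_ne_zero_iff]; exact n2.trans_ne hs.ne'
      · simp only [arg_mul_toCircle hc]; exact hv.2
      · simp only [arg_mul_toCircle hs]; exact hv.1
    · rintro _ ⟨q, ⟨hq, h1, h2, h3, h4⟩, rfl⟩
      refine ⟨(q.2.arg, q.1.arg), ⟨h4, h3⟩, ?_⟩
      simp only
      rw [hpt _ ⟨h4, h3⟩ ‖q.1‖ ‖q.2‖ (norm_pos_iff.2 h1) (norm_pos_iff.2 h2) hq.1 hq.2.2.2]
      simp only
      rw [← eq_norm_mul_toCircle, ← eq_norm_mul_toCircle]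
  have hcomp : IsCompact (closure G) := by
    have : CompactSpace Real.Angle :=
      have : Fact (0 < 2 * Real.pi) := ⟨Real.two_pi_pos⟩
      inferInstanceAs (CompactSpace (AddCircle (2 * Real.pi)))
    refine ((isCompact_univ (X := Torus)).prod (isCompact_Icc (a := (0 : ℝ)) (b := 1))).closure_of_subset ?_
    rintro _ ⟨v, -, rfl⟩
    refine ⟨mem_univ _, ?_⟩
    simp only [tileFun]
    have h1 := Real.arctan_lt_pi_div_two (Real.sqrt (Real.tan (Real.pi * harmonicFun r v / 2)))
    have h2 := Real.arctan_nonneg.2 (Real.sqrt_nonneg (Real.tan (Real.pi * harmonicFun r v / 2)))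
    have hpi := Real.pi_pos
    refine ⟨by positivity, ?_⟩
    rw [div_mul_eq_mul_div, div_le_one hpi]
    linarith
  rw [tile, ← hG, image_closure_of_isCompact hcomp continuous_joinMap.continuousOn, hGint]
  apply Subset.antisymm
  · exact closure_minimal (image_mono fun q hq => hq.1)
      ((isCompact_disc _ _).image continuous_toE4).isClosed
  · exact (image_mono (disc_subset_closure _ _)).trans (image_closure_subset_closure_image continuous_toE4)

/-! ### Compatible rectangles -/

namespace TArc

theorem notMem_interior_of_eq {A : TArc} {e : Bool} {x : Real.Angle} (h : x = A.endpt e) :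
    x ∉ A.interior := h ▸ A.endpt_notMem_interior e

theorem exists_endpt_add_mem {A : TArc} {e : Bool} {O : Set Real.Angle} (hO : IsOpen O)
    (h : A.endpt e ∈ O) {d : ℝ} (hd : 0 < d) :
    ∃ u, 0 < u ∧ u < d ∧ A.endpt e + ((sgn e * u : ℝ) : Real.Angle) ∈ O ∧
      A.endpt e + ((sgn e * (-u) : ℝ) : Real.Angle) ∈ O := by
  have h1 : Continuous fun u : ℝ => A.endpt e + ((sgn e * u : ℝ) : Real.Angle) := by fun_prop
  have h2 : Continuous fun u : ℝ => A.endpt e + ((sgn e * (-u) : ℝ) : Real.Angle) := by fun_prop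
  have e1 : ∀ᶠ u in 𝓝 (0 : ℝ), A.endpt e + ((sgn e * u : ℝ) : Real.Angle) ∈ O :=
    h1.continuousAt.eventually (hO.mem_nhds (by simpa using h))
  have e2 : ∀ᶠ u in 𝓝 (0 : ℝ), A.endpt e + ((sgn e * (-u) : ℝ) : Real.Angle) ∈ O :=
    h2.continuousAt.eventually (hO.mem_nhds (by simpa using h))
  have e3 : ∀ᶠ u : ℝ in 𝓝 0, u < d := gt_mem_nhds hd
  have e4 : ∀ᶠ u : ℝ in 𝓝[>] 0, 0 < u := self_mem_nhdsWithin
  obtain ⟨u, ⟨⟨h1, h2⟩, h3⟩, h4⟩ :=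
    ((((e1.and e2).and e3).filter_mono nhdsWithin_le_nhds).and e4).exists
  exact ⟨u, h4, h3, h1, h2⟩

/-- An arc is not a neighbourhood of its end points. -/
theorem endpt_notMem_of_isOpen {A : TArc} {e : Bool} {O : Set Real.Angle} (hO : IsOpen O)
    (hA : O ⊆ A.carrier) : A.endpt e ∉ O := fun h => by
  have hpos := A.isProfile.pos
  -- The point at distance u beyond the end, with u less than the length of the complementary arc,
  -- would have to lie on the arc.
  obtain ⟨u, hu, hlt, -, hmem⟩ := exists_endpt_add_mem hO h (sub_pos.2 A.len_lt)
  obtain ⟨v, hv, h1⟩ := (A.mem_carrier_iff e).1 (hA hmem)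
  have h2 := add_left_cancel h1
  have h3 : ((2 * Real.pi - u : ℝ) : Real.Angle) = v := by
    cases e <;> simp only [sgn, if_true, Bool.false_eq_true, if_false, one_mul, neg_one_mul,
      Real.Angle.coe_neg, neg_neg] at h2
    · rw [Real.Angle.coe_sub, Real.Angle.coe_two_pi, zero_sub, h2, neg_neg]
    · rw [Real.Angle.coe_sub, Real.Angle.coe_two_pi, zero_sub, h2]
  have h4 := coe_angle_injOn ⟨by linarith [A.len_lt], by linarith⟩ ⟨hv.1, hv.2.trans_lt A.len_lt⟩ h3
  linarith [hv.2]

/-- If an end point of an arc lies on another arc, then the arcs overlap or are adjacent there. -/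
theorem overlap_or_eq_endpt {A B : TArc} {e : Bool} (h : A.endpt e ∈ B.carrier) :
    (∃ x ∈ A.interior, x ∈ B.carrier) ∨ A.endpt e = B.endpt (!e) := by
  rcases B.mem_carrier_cases h with h1 | ⟨e', h1⟩
  · obtain ⟨u, hu, hlt, hmem, -⟩ := exists_endpt_add_mem B.isOpen_interior h1 A.isProfile.pos
    exact Or.inl ⟨_, (A.mem_interior_iff e).2 ⟨u, ⟨hu, hlt⟩, rfl⟩, B.interior_subset hmem⟩
  · by_cases he : e' = !e
    · exact Or.inr (he ▸ h1)
    · obtain rfl : e' = e := by cases e <;> cases e' <;> simp_all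
      left
      have hm := lt_min A.isProfile.pos B.isProfile.pos
      refine ⟨A.endpt e' + ((sgn e' * (min A.len B.len / 2) : ℝ) : Real.Angle),
        (A.mem_interior_iff e').2 ⟨_, ⟨by positivity, ?_⟩, rfl⟩, ?_⟩
      · linarith [min_le_left A.len B.len]
      · rw [h1]
        refine (B.mem_carrier_iff e').2 ⟨_, ⟨by positivity, ?_⟩, rfl⟩
        linarith [min_le_right A.len B.len]

theorem interior_subset_of_subset {A B : TArc} (h : A.carrier ⊆ B.carrier) :
    A.interior ⊆ B.interior := fun x hx => by
  rcases B.mem_carrier_cases (h (A.interior_subset hx)) with h1 | ⟨e, rfl⟩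
  · exact h1
  · exact absurd hx (endpt_notMem_of_isOpen A.isOpen_interior (A.interior_subset.trans h))

/-- An end point of the intersection of two arcs is an end point of one of them. -/
theorem endpt_of_inter {A B C : TArc} (h : A.carrier = B.carrier ∩ C.carrier) (e : Bool) :
    (∃ e', A.endpt e = B.endpt e') ∨ ∃ e', A.endpt e = C.endpt e' := by
  have hm := h ▸ A.endpt_mem e
  rcases B.mem_carrier_cases hm.1 with h1 | h1
  · rcases C.mem_carrier_cases hm.2 with h2 | h2
    · refine absurd ⟨h1, h2⟩ (endpt_notMem_of_isOpen (B.isOpen_interior.inter C.isOpen_interior) ?_)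
      rw [h]
      exact inter_subset_inter B.interior_subset C.interior_subset
    · exact Or.inr h2
  · exact Or.inl h1

end TArc

namespace Rectangle

/-- A vertex on the intersection excludes that the latter is empty or a rectangle without vertices.
If it consists of vertices of r, the sides cannot overlap in an interior point, so at this vertex
they are adjacent end to end in both directions. -/
theorem Compatible.vertex {r s : Rectangle} (h : r.Compatible s) {e e' : Bool}
    (h1 : r.θArc.endpt e ∈ s.θArc.carrier) (h2 : r.φArc.endpt e' ∈ s.φArc.carrier) :
    r.θArc.endpt e = s.θArc.endpt (!e) ∧ r.φArc.endpt e' = s.φArc.endpt (!e') := by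
  have hv : (r.θArc.endpt e, r.φArc.endpt e') ∈ r.vertices :=
    r.mem_vertices_iff.2 ⟨⟨e, rfl⟩, e', rfl⟩
  have hm : (r.θArc.endpt e, r.φArc.endpt e') ∈ r.carrier ∩ s.carrier := by
    rw [r.carrier_eq, s.carrier_eq]
    exact ⟨⟨TArc.endpt_mem _ _, TArc.endpt_mem _ _⟩, h1, h2⟩
  rcases h with h | h | ⟨ρ, h, h', -⟩
  · exact absurd hm (h ▸ notMem_empty _)
  · rw [r.carrier_eq, s.carrier_eq] at h
    constructor
    · rcases TArc.overlap_or_eq_endpt h1 with ⟨x, hx, hx'⟩ | h3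
      · obtain ⟨⟨e₀, he₀⟩, -⟩ := r.mem_vertices_iff.1
          (@h (x, _) ⟨⟨TArc.interior_subset _ hx, TArc.endpt_mem _ e'⟩, hx', h2⟩)
        exact absurd hx (TArc.notMem_interior_of_eq he₀)
      · exact h3
    · rcases TArc.overlap_or_eq_endpt h2 with ⟨x, hx, hx'⟩ | h3
      · obtain ⟨-, e₀, he₀⟩ := r.mem_vertices_iff.1
          (@h (_, x) ⟨⟨TArc.endpt_mem _ e, TArc.interior_subset _ hx⟩, h1, hx'⟩)
        exact absurd hx (TArc.notMem_interior_of_eq he₀)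
      · exact h3
  · exact absurd hv (disjoint_left.1 h' (h ▸ hm))

theorem inter_eq {r s ρ : Rectangle} (h : r.carrier ∩ s.carrier = ρ.carrier) :
    ρ.θArc.carrier = r.θArc.carrier ∩ s.θArc.carrier ∧
      ρ.φArc.carrier = r.φArc.carrier ∩ s.φArc.carrier := by
  rw [r.carrier_eq, s.carrier_eq, ρ.carrier_eq, prod_inter_prod, eq_comm, prod_eq_prod_iff_of_nonempty] at h
  · exact h
  · exact ⟨(_, _), ρ.θArc.endpt_mem true, ρ.φArc.endpt_mem true⟩

/-- If the intersection were a rectangle ρ, an end of its vertical side would be an end of the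
vertical side of r or s. At that height, on the common meridian, ρ would contain a vertex. -/
theorem Compatible.meridian {r s : Rectangle} (h : r.Compatible s) {e e' : Bool} {φ : Real.Angle}
    (hθ : r.θArc.endpt e = s.θArc.endpt e') (h1 : φ ∈ r.φArc.carrier) (h2 : φ ∈ s.φArc.carrier) :
    ∃ b, φ = r.φArc.endpt b := by
  have hm : (r.θArc.endpt e, φ) ∈ r.carrier ∩ s.carrier := by
    rw [r.carrier_eq, s.carrier_eq]
    exact ⟨⟨TArc.endpt_mem _ _, h1⟩, hθ ▸ TArc.endpt_mem _ _, h2⟩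
  rcases h with h | h | ⟨ρ, h, hr, hs⟩
  · exact absurd hm (h ▸ notMem_empty _)
  · exact (r.mem_vertices_iff.1 (h hm)).2
  · exfalso
    rw [h, ρ.carrier_eq] at hm
    have hm' : (r.θArc.endpt e, ρ.φArc.endpt true) ∈ ρ.carrier := by
      rw [ρ.carrier_eq]
      exact ⟨hm.1, ρ.φArc.endpt_mem true⟩
    rcases TArc.endpt_of_inter (inter_eq h).2 true with h3 | h3
    · exact disjoint_left.1 hr hm' (r.mem_vertices_iff.2 ⟨⟨e, rfl⟩, h3⟩)
    · exact disjoint_left.1 hs hm' (s.mem_vertices_iff.2 ⟨⟨e', hθ⟩, h3⟩)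

theorem Compatible.longitude {r s : Rectangle} (h : r.Compatible s) {e e' : Bool} {θ : Real.Angle}
    (hφ : r.φArc.endpt e = s.φArc.endpt e') (h1 : θ ∈ r.θArc.carrier) (h2 : θ ∈ s.θArc.carrier) :
    ∃ b, θ = r.θArc.endpt b := by
  have hm : (θ, r.φArc.endpt e) ∈ r.carrier ∩ s.carrier := by
    rw [r.carrier_eq, s.carrier_eq]
    exact ⟨⟨h1, TArc.endpt_mem _ _⟩, h2, hφ ▸ TArc.endpt_mem _ _⟩
  rcases h with h | h | ⟨ρ, h, hr, hs⟩
  · exact absurd hm (h ▸ notMem_empty _)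
  · exact (r.mem_vertices_iff.1 (h hm)).1
  · exfalso
    rw [h, ρ.carrier_eq] at hm
    have hm' : (ρ.θArc.endpt true, r.φArc.endpt e) ∈ ρ.carrier := by
      rw [ρ.carrier_eq]
      exact ⟨ρ.θArc.endpt_mem true, hm.2⟩
    rcases TArc.endpt_of_inter (inter_eq h).1 true with h3 | h3
    · exact disjoint_left.1 hr hm' (r.mem_vertices_iff.2 ⟨h3, ⟨e, rfl⟩⟩)
    · exact disjoint_left.1 hs hm' (s.mem_vertices_iff.2 ⟨h3, ⟨e', hφ⟩⟩)

/-- The comparison of the profiles of two crossing rectangles. -/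
theorem crossing_lt {r s ρ : Rectangle} (hρ : r.carrier ∩ s.carrier = ρ.carrier)
    (hθ : ∀ e, ∃ e', ρ.θArc.endpt e = r.θArc.endpt e')
    (hφ : ∀ e, ∃ e', ρ.φArc.endpt e = s.φArc.endpt e')
    (hB : ρ.φArc.carrier ⊆ r.φArc.interior) (hA : ρ.θArc.carrier ⊆ s.θArc.interior)
    {θ φ : Real.Angle} (hθr : θ ∈ r.θArc.interior) (hθρ : θ ∈ ρ.θArc.carrier)
    (hφs : φ ∈ s.φArc.interior) (hφρ : φ ∈ ρ.φArc.carrier) :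
    r.θArc.val θ * s.φArc.val φ < r.φArc.val φ * s.θArc.val θ := by
  obtain ⟨hρθ, hρφ⟩ := inter_eq hρ
  obtain ⟨t, ht⟩ : ∃ t : ℝ, (t : Real.Angle) = ρ.θArc.start :=
    Real.Angle.induction_on ρ.θArc.start fun t => ⟨t, rfl⟩
  obtain ⟨p, hp⟩ : ∃ p : ℝ, (p : Real.Angle) = ρ.φArc.start :=
    Real.Angle.induction_on ρ.φArc.start fun t => ⟨t, rfl⟩
  set a := ρ.θArc.len with ha
  set b := ρ.φArc.len with hb
  have ha0 : 0 < a := ρ.θArc.isProfile.pos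
  have hb0 : 0 < b := ρ.φArc.isProfile.pos
  have memθ : ∀ x ∈ Icc t (t + a), (x : Real.Angle) ∈ ρ.θArc.carrier := fun x hx =>
    ⟨x - t, ⟨by linarith [hx.1], by linarith [hx.2]⟩, by rw [Real.Angle.coe_sub, ht]; abel⟩
  have memφ : ∀ x ∈ Icc p (p + b), (x : Real.Angle) ∈ ρ.φArc.carrier := fun x hx =>
    ⟨x - p, ⟨by linarith [hx.1], by linarith [hx.2]⟩, by rw [Real.Angle.coe_sub, hp]; abel⟩
  have intθ : ∀ x ∈ Ioo t (t + a), (x : Real.Angle) ∈ ρ.θArc.interior := fun x hx =>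
    ⟨x - t, ⟨by linarith [hx.1], by linarith [hx.2]⟩, by rw [Real.Angle.coe_sub, ht]; abel⟩
  have intφ : ∀ x ∈ Ioo p (p + b), (x : Real.Angle) ∈ ρ.φArc.interior := fun x hx =>
    ⟨x - p, ⟨by linarith [hx.1], by linarith [hx.2]⟩, by rw [Real.Angle.coe_sub, hp]; abel⟩
  -- Where the horizontal profile of r is positive, v < π/2 is equivalent to the desired inequality
  -- of quotients. On each side of ρ one of the two arctangents vanishes, so v < π/2 there, and v is
  -- harmonic inside.
  let v : ℂ → ℝ := fun z => Real.arctan (r.θArc.val z.re / r.φArc.val z.im) +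
    Real.arctan (s.φArc.val z.im / s.θArc.val z.re)
  let K : Set ℂ := Icc t (t + a) ×ℂ Icc p (p + b)
  have hK : IsCompact K := isCompact_Icc.reProdIm isCompact_Icc
  have posB : ∀ z ∈ K, 0 < r.φArc.val z.im := fun z hz => r.φArc.val_pos (hB (memφ _ hz.2))
  have posA : ∀ z ∈ K, 0 < s.θArc.val z.re := fun z hz => s.θArc.val_pos (hA (memθ _ hz.1))
  have cre : ∀ A : TArc, Continuous fun z : ℂ => A.val z.re := fun A =>
    A.continuous_val.comp (Real.Angle.continuous_coe.comp Complex.continuous_re)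
  have cim : ∀ A : TArc, Continuous fun z : ℂ => A.val z.im := fun A =>
    A.continuous_val.comp (Real.Angle.continuous_coe.comp Complex.continuous_im)
  have hv : ContinuousOn v K := by
    refine ContinuousOn.add (Real.continuous_arctan.comp_continuousOn ?_)
      (Real.continuous_arctan.comp_continuousOn ?_)
    · exact (cre _).continuousOn.div (cim _).continuousOn fun z hz => (posB z hz).ne'
    · exact (cim _).continuousOn.div (cre _).continuousOn fun z hz => (posA z hz).ne'
  have hpiece : ∀ z ∈ K, (r.θArc.val z.re = 0 ∨ s.φArc.val z.im = 0) → v z < Real.pi / 2 := by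
    rintro z hz (h | h)
    · simp only [v, h, zero_div, Real.arctan_zero, zero_add]
      exact Real.arctan_lt_pi_div_two _
    · simp only [v, h, zero_div, Real.arctan_zero, add_zero]
      exact Real.arctan_lt_pi_div_two _
  have hbd : ∀ z ∈ K, z ∈ Ioo t (t + a) ×ℂ Ioo p (p + b) ∨
      (r.θArc.val z.re = 0 ∨ s.φArc.val z.im = 0) := by
    intro z hz
    rcases hz.1.1.eq_or_lt with h1 | h1
    · right; left
      obtain ⟨e', he'⟩ := hθ true
      rw [← h1, ht, show ρ.θArc.start = ρ.θArc.endpt true by simp [TArc.endpt], he', TArc.val_endpt]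
    rcases hz.1.2.eq_or_lt with h2 | h2
    · right; left
      obtain ⟨e', he'⟩ := hθ false
      rw [h2, Real.Angle.coe_add, ht,
        show ρ.θArc.start + a = ρ.θArc.endpt false by simp [TArc.endpt, ha], he', TArc.val_endpt]
    rcases hz.2.1.eq_or_lt with h3 | h3
    · right; right
      obtain ⟨e', he'⟩ := hφ true
      rw [← h3, hp, show ρ.φArc.start = ρ.φArc.endpt true by simp [TArc.endpt], he', TArc.val_endpt]
    rcases hz.2.2.eq_or_lt with h4 | h4
    · right; right
      obtain ⟨e', he'⟩ := hφ false
      rw [h4, Real.Angle.coe_add, hp,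
        show ρ.φArc.start + b = ρ.φArc.endpt false by simp [TArc.endpt, hb], he', TArc.val_endpt]
    exact Or.inl ⟨⟨h1, h2⟩, h3, h4⟩
  -- The maximum principle preserves only weak inequalities; compactness supplies a bound m strictly
  -- below π/2.
  obtain ⟨m, hm, hmle⟩ : ∃ m, m < Real.pi / 2 ∧
      ∀ z ∈ K, (r.θArc.val z.re = 0 ∨ s.φArc.val z.im = 0) → v z ≤ m := by
    have hK' : IsCompact (K ∩ {z | r.θArc.val z.re = 0 ∨ s.φArc.val z.im = 0}) :=
      hK.inter_right ((isClosed_eq (cre _) continuous_const).union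
        (isClosed_eq (cim _) continuous_const))
    rcases (K ∩ {z : ℂ | r.θArc.val z.re = 0 ∨ s.φArc.val z.im = 0}).eq_empty_or_nonempty with h | h
    · refine ⟨0, by positivity, fun z hz hz' => ?_⟩
      exact absurd ⟨hz, hz'⟩ (h ▸ notMem_empty z)
    · obtain ⟨z₀, hz₀, hmax⟩ := hK'.exists_isMaxOn h (hv.mono inter_subset_left)
      exact ⟨v z₀, hpiece _ hz₀.1 hz₀.2, fun z hz hz' => hmax ⟨hz, hz'⟩⟩
  have hrρ : ρ.θArc.interior ⊆ r.θArc.interior :=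
    TArc.interior_subset_of_subset (hρθ ▸ inter_subset_left)
  have hsρ : ρ.φArc.interior ⊆ s.φArc.interior :=
    TArc.interior_subset_of_subset (hρφ ▸ inter_subset_right)
  have key := le_of_harmonicAt hK hv (m := m) fun z hz => ?_
  · obtain ⟨x, hx, hθx⟩ := hθρ
    obtain ⟨y, hy, hφy⟩ := hφρ
    have h1 := key ⟨t + x, p + y⟩ ⟨⟨by simpa using hx.1, by simpa using hx.2⟩,
      ⟨by simpa using hy.1, by simpa using hy.2⟩⟩
    have h2 := h1.trans_lt hm
    simp only [v, Real.Angle.coe_add, ht, hp, ← hθx, ← hφy] at h2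
    have hg := r.θArc.val_pos hθr
    have hf := s.φArc.val_pos hφs
    have hf' := r.φArc.val_pos (hB ⟨y, hy, hφy⟩)
    have hg' := s.θArc.val_pos (hA ⟨x, hx, hθx⟩)
    rw [← lt_sub_iff_add_lt, ← Real.arctan_inv_of_pos (by positivity), Real.arctan_lt_arctan_iff,
      inv_div, div_lt_div_iff₀ hf' hf] at h2
    linarith
  · rcases hbd z hz with h | h
    · refine Or.inr ⟨Ioo t (t + a) ×ℂ Ioo p (p + b), isOpen_Ioo.reProdIm isOpen_Ioo, h,
        fun w hw => ⟨Ioo_subset_Icc_self hw.1, Ioo_subset_Icc_self hw.2⟩, fun w hw => ?_⟩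
      have hO := (isOpen_Ioo.reProdIm isOpen_Ioo).mem_nhds hw
      have hw1 := r.isRectHarmonic_solution.harmonic w (by
        rw [mem_ofPred_eq, r.int_eq]
        exact ⟨hrρ (intθ _ hw.1), hB (memφ _ (Ioo_subset_Icc_self hw.2))⟩)
      have hw2 := s.isRectHarmonic_solution.harmonic w (by
        rw [mem_ofPred_eq, s.int_eq]
        exact ⟨hA (memθ _ (Ioo_subset_Icc_self hw.1)), hsρ (intφ _ hw.2)⟩)
      have hw3 := ((hw2.add (hw1.const_smul (c := -1))).const_smul (c := Real.pi / 2)).add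
        (InnerProductSpace.harmonicAt_const (c := Real.pi / 2))
      refine (InnerProductSpace.harmonicAt_congr_nhds ?_).1 hw3
      filter_upwards [hO] with w' hw'
      have hf := r.φArc.val_pos (hB (memφ _ (Ioo_subset_Icc_self hw'.2)))
      have hg := r.θArc.val_pos (hrρ (intθ _ hw'.1))
      simp only [v, Pi.add_apply, Pi.smul_apply, Rectangle.solution, smul_eq_mul]
      rw [← inv_div (r.φArc.val _), Real.arctan_inv_of_pos (by positivity)]
      have hpi := Real.pi_ne_zero
      field_simp
      ring
    · exact Or.inl (hmle z hz h)

/-- If ρ shares an end of its horizontal side with r, then, having no vertices of r, it keeps away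
from the horizontal edges of r and reaches from one horizontal edge of s to the other. The same
reasoning for s shows that ρ has the full width of r: the rectangles cross. -/
theorem crossing_aux {r s ρ : Rectangle} (hρ : r.carrier ∩ s.carrier = ρ.carrier)
    (hr : Disjoint ρ.carrier r.vertices) (hs : Disjoint ρ.carrier s.vertices)
    {θ φ : Real.Angle} (hθr : θ ∈ r.θArc.interior) (hθs : θ ∈ s.θArc.interior)
    (hφr : φ ∈ r.φArc.interior) (hφs : φ ∈ s.φArc.interior)
    (h0 : ∃ e', ρ.θArc.endpt true = r.θArc.endpt e') :
    r.θArc.val θ * s.φArc.val φ < r.φArc.val φ * s.θArc.val θ := by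
  obtain ⟨hρθ, hρφ⟩ := inter_eq hρ
  have hB : ρ.φArc.carrier ⊆ r.φArc.interior := fun ψ hψ => by
    rcases r.φArc.mem_carrier_cases (hρφ.subset hψ).1 with h | h
    · exact h
    · refine absurd (r.mem_vertices_iff (v := (_, _)).2 ⟨h0, h⟩) (disjoint_left.1 hr ?_)
      rw [ρ.carrier_eq]
      exact ⟨ρ.θArc.endpt_mem true, hψ⟩
  have hφ : ∀ e, ∃ e', ρ.φArc.endpt e = s.φArc.endpt e' := fun e => by
    rcases TArc.endpt_of_inter hρφ e with ⟨e', h⟩ | h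
    · exact absurd (h ▸ hB (TArc.endpt_mem _ e)) (TArc.endpt_notMem_interior _ _)
    · exact h
  have hA : ρ.θArc.carrier ⊆ s.θArc.interior := fun ψ hψ => by
    rcases s.θArc.mem_carrier_cases (hρθ.subset hψ).2 with h | h
    · exact h
    · refine absurd (s.mem_vertices_iff (v := (_, _)).2 ⟨h, hφ true⟩) (disjoint_left.1 hs ?_)
      rw [ρ.carrier_eq]
      exact ⟨hψ, ρ.φArc.endpt_mem true⟩
  have hθ : ∀ e, ∃ e', ρ.θArc.endpt e = r.θArc.endpt e' := fun e => by
    rcases TArc.endpt_of_inter hρθ e with h | ⟨e', h⟩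
    · exact h
    · exact absurd (h ▸ hA (TArc.endpt_mem _ e)) (TArc.endpt_notMem_interior _ _)
  refine crossing_lt hρ hθ hφ hB hA hθr ?_ hφs ?_
  · rw [hρθ]
    exact ⟨TArc.interior_subset _ hθr, TArc.interior_subset _ hθs⟩
  · rw [hρφ]
    exact ⟨TArc.interior_subset _ hφr, TArc.interior_subset _ hφs⟩

/-- At a common point the equations of the two tiles give equal quotients of profiles over a common
interior point of the rectangles. This forces a crossing, where the quotients are different. -/
theorem Compatible.disjoint_openDisc {r s : Rectangle} (h : r.Compatible s) :
    Disjoint (openDisc r.θArc r.φArc) (openDisc s.θArc s.φArc) := by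
  refine disjoint_left.2 fun q ⟨hq, h1, h2, h3, h4⟩ ⟨hq', _, _, h3', h4'⟩ => ?_
  have hm : ((q.2.arg : Real.Angle), (q.1.arg : Real.Angle)) ∈ r.carrier ∩ s.carrier := by
    rw [r.carrier_eq, s.carrier_eq]
    exact ⟨⟨TArc.interior_subset _ h4, TArc.interior_subset _ h3⟩,
      TArc.interior_subset _ h4', TArc.interior_subset _ h3'⟩
  have e1 := hq.2.2.2
  have e2 := hq'.2.2.2
  have n1 : 0 < ‖q.1‖ ^ 2 := by positivity
  have n2 : 0 < ‖q.2‖ ^ 2 := by positivity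
  have hne : r.θArc.val q.2.arg * s.φArc.val q.1.arg = r.φArc.val q.1.arg * s.θArc.val q.2.arg := by
    refine mul_left_cancel₀ (mul_pos n1 n2).ne' ?_
    calc _ = (‖q.2‖ ^ 2 * r.θArc.val q.2.arg) * (‖q.1‖ ^ 2 * s.φArc.val q.1.arg) := by ring
      _ = _ := by rw [← e1, e2]; ring
  rcases h with h | h | ⟨ρ, h, hr, hs⟩
  · exact absurd hm (h ▸ notMem_empty _)
  · obtain ⟨-, e, he⟩ := r.mem_vertices_iff.1 (h hm)
    exact absurd h3 (TArc.notMem_interior_of_eq he)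
  · rcases TArc.endpt_of_inter (inter_eq h).1 true with h0 | h0
    · exact (crossing_aux h hr hs h4 h4' h3 h3' h0).ne hne
    · have := crossing_aux (inter_comm _ _ ▸ h) hs hr h4' h4 h3' h3 h0
      linarith

end Rectangle

/-! ### Systems of tiles -/

/-- The points that are a vertex of exactly one of the products of arcs `A i × B i`. -/
def freeSet {ι : Type} (A B : ι → TArc) : Set Torus :=
  {v | ∃! i, (∃ e, v.1 = (A i).endpt e) ∧ ∃ e, v.2 = (B i).endpt e}

/-- A collection of products of arcs with the properties of the rectangles of a diagram of
a surface. -/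
structure TileSystem (ι : Type) where
  A : ι → TArc
  B : ι → TArc
  vertex : ∀ {i j}, i ≠ j → ∀ {e e'}, (A i).endpt e ∈ (A j).carrier → (B i).endpt e' ∈ (B j).carrier →
    (A i).endpt e = (A j).endpt (!e) ∧ (B i).endpt e' = (B j).endpt (!e')
  meridian : ∀ {i j}, i ≠ j → ∀ {e e' φ}, (A i).endpt e = (A j).endpt e' → φ ∈ (B i).carrier →
    φ ∈ (B j).carrier → ∃ b, φ = (B i).endpt b
  longitude : ∀ {i j}, i ≠ j → ∀ {e e' θ}, (B i).endpt e = (B j).endpt e' → θ ∈ (A i).carrier →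
    θ ∈ (A j).carrier → ∃ b, θ = (A i).endpt b
  disjoint : ∀ {i j}, i ≠ j → Disjoint (openDisc (A i) (B i)) (openDisc (A j) (B j))
  meridian_le : ∀ θ, {v ∈ freeSet A B | v.1 = θ}.encard ≤ 2
  longitude_le : ∀ φ, {v ∈ freeSet A B | v.2 = φ}.encard ≤ 2

theorem swap_mem_freeSet {ι : Type} {A B : ι → TArc} {v : Torus} :
    v.swap ∈ freeSet B A ↔ v ∈ freeSet A B := by
  simp only [freeSet, mem_ofPred_eq, Prod.fst_swap, Prod.snd_swap, and_comm]

theorem encard_freeSet_swap {ι : Type} (A B : ι → TArc) (θ : Real.Angle) :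
    {v ∈ freeSet B A | v.2 = θ}.encard = {v ∈ freeSet A B | v.1 = θ}.encard := by
  rw [← (Prod.swap_injective).encard_image]
  congr 1
  ext v
  simp only [image_swap_eq_preimage_swap, mem_preimage, mem_ofPred_eq, swap_mem_freeSet, Prod.snd_swap]

namespace TileSystem

variable {ι : Type} (T : TileSystem ι)

/-- The system with the roles of the two factors of the torus exchanged. -/
def swap : TileSystem ι where
  A := T.B
  B := T.A
  vertex h _ _ h1 h2 := (T.vertex h h2 h1).symm
  meridian := T.longitude
  longitude := T.meridian
  disjoint h := disjoint_left.2 fun _ h1 h2 => disjoint_left.1 (T.disjoint h)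
    (swap_mem_openDisc.2 h1) (swap_mem_openDisc.2 h2)
  meridian_le θ := (encard_freeSet_swap _ _ _).symm.trans_le (T.longitude_le θ)
  longitude_le φ := (encard_freeSet_swap _ _ _).trans_le (T.meridian_le φ)

/-- The set of free vertices. -/
def free : Set Torus := freeSet T.A T.B

theorem swap_mem_free {v : Torus} : v.swap ∈ T.swap.free ↔ v ∈ T.free := swap_mem_freeSet

theorem mem_free_iff {v : Torus} : v ∈ T.free ↔
    ∃! i, (∃ e, v.1 = (T.A i).endpt e) ∧ ∃ e, v.2 = (T.B i).endpt e := Iff.rfl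

theorem finite_free [Finite ι] : T.free.Finite := by
  refine (finite_range fun x : ι × Bool × Bool =>
    (((T.A x.1).endpt x.2.1, (T.B x.1).endpt x.2.2) : Torus)).subset ?_
  rintro v ⟨i, ⟨⟨e, he⟩, e', he'⟩, -⟩
  exact ⟨(i, e, e'), Prod.ext he.symm he'.symm⟩

/-- Two rectangles with a common side on a meridian lie on different sides of it, and the sides
meet only in end points, at opposite ends. -/
theorem meridian_endpt {i j : ι} (h : i ≠ j) {e e' : Bool} {φ : Real.Angle}
    (hA : (T.A i).endpt e = (T.A j).endpt e') (h1 : φ ∈ (T.B i).carrier) (h2 : φ ∈ (T.B j).carrier) :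
    e' = (!e) ∧ ∃ b, φ = (T.B i).endpt b ∧ φ = (T.B j).endpt (!b) := by
  obtain ⟨b, rfl⟩ := T.meridian h hA h1 h2
  obtain ⟨h3, h4⟩ := T.vertex h (e := e) (hA ▸ (T.A j).endpt_mem e') h2
  exact ⟨(T.A j).endpt_injective (hA.symm.trans h3), b, rfl, h4⟩

/-- A parity argument. The sides on the meridian have an even number of ends in all, counted with
multiplicity. Rectangles that share an end lie pairwise on opposite sides of the meridian, so at
most two do. The free vertices are the ends counted once, hence their number is even. -/
theorem encard_meridian_ne_one [Finite ι] (θ : Real.Angle) :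
    {v ∈ T.free | v.1 = θ}.encard ≠ 1 := by
  classical
  have := Fintype.ofFinite ι
  let I : Finset ι := Finset.univ.filter fun i => ∃ e, (T.A i).endpt e = θ
  let X : Finset (ι × Bool) := I ×ˢ Finset.univ
  let f : ι × Bool → Real.Angle := fun x => (T.B x.1).endpt x.2
  have hmem : ∀ x : ι × Bool, x ∈ X ↔ ∃ e, (T.A x.1).endpt e = θ := fun x => by
    simp only [X, I, Finset.mem_product, Finset.mem_filter, Finset.mem_univ, true_and, and_true]
  have hX : Even X.card := by
    rw [Finset.card_product]
    exact Even.mul_left (by decide) _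
  rw [Finset.card_eq_sum_card_image f X, ← Nat.not_odd_iff_even, Finset.odd_sum_iff_odd_card_odd,
    Nat.not_odd_iff_even] at hX
  have hle : ∀ φ, (X.filter fun x => f x = φ).card ≤ 2 := by
    intro φ
    by_contra! h
    obtain ⟨x, hx, y, hy, z, hz, hxy, hxz, hyz⟩ := Finset.two_lt_card.1 h
    simp only [Finset.mem_filter, hmem] at hx hy hz
    obtain ⟨⟨ex, hx⟩, hx'⟩ := hx
    obtain ⟨⟨ey, hy⟩, hy'⟩ := hy
    obtain ⟨⟨ez, hz⟩, hz'⟩ := hz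
    have key : ∀ {x y : ι × Bool} {ex ey : Bool}, x ≠ y → (T.A x.1).endpt ex = θ →
        (T.A y.1).endpt ey = θ → f x = φ → f y = φ → ey = !ex := by
      intro x y ex ey hxy hx hy hx' hy'
      have hne : x.1 ≠ y.1 := fun h => by
        refine hxy (Prod.ext h ((T.B x.1).endpt_injective ?_))
        have h2 : f x = f y := hx'.trans hy'.symm
        simpa only [f, h] using h2
      exact (T.meridian_endpt hne (hx.trans hy.symm) (hx'.subst ((T.B x.1).endpt_mem x.2))
        (hy'.subst ((T.B y.1).endpt_mem y.2))).1
    have h1 := key hxy hx hy hx' hy'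
    have h2 := key hxz hx hz hx' hz'
    have h3 := key hyz hy hz hy' hz'
    rw [h1, h2] at h3
    cases ex <;> simp at h3
  have himg : {v ∈ T.free | v.1 = θ} = (fun φ => ((θ, φ) : Torus)) ''
      (((X.image f).filter fun φ => Odd (X.filter fun x => f x = φ).card : Finset Real.Angle) :
        Set Real.Angle) := by
    have hone : ∀ φ, Odd (X.filter fun x => f x = φ).card ↔ ((θ, φ) : Torus) ∈ T.free := by
      intro φ
      have h1 : Odd (X.filter fun x => f x = φ).card ↔ (X.filter fun x => f x = φ).card = 1 := by
        have := hle φ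
        interval_cases (X.filter fun x => f x = φ).card <;> decide
      rw [h1, Finset.card_eq_one, mem_free_iff]
      constructor
      · rintro ⟨⟨i, b⟩, h⟩
        have hx : (i, b) ∈ X.filter fun x => f x = φ := h ▸ Finset.mem_singleton_self _
        simp only [Finset.mem_filter, hmem] at hx
        refine ⟨i, ⟨hx.1.imp fun _ => Eq.symm, b, hx.2.symm⟩, ?_⟩
        rintro j ⟨⟨e, he⟩, b', hb'⟩
        have hy : (j, b') ∈ X.filter fun x => f x = φ := by
          simp only [Finset.mem_filter, hmem]
          exact ⟨⟨e, he.symm⟩, hb'.symm⟩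
        rw [h, Finset.mem_singleton] at hy
        exact congrArg Prod.fst hy
      · rintro ⟨i, ⟨⟨e, he⟩, b, hb⟩, huniq⟩
        refine ⟨(i, b), Finset.eq_singleton_iff_unique_mem.2 ⟨?_, ?_⟩⟩
        · simp only [Finset.mem_filter, hmem]
          exact ⟨⟨e, he.symm⟩, hb.symm⟩
        · rintro ⟨j, b'⟩ hy
          simp only [Finset.mem_filter, hmem] at hy
          obtain rfl := huniq j ⟨hy.1.imp fun _ => Eq.symm, b', hy.2.symm⟩
          exact Prod.ext rfl ((T.B j).endpt_injective (hy.2.trans hb))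
    ext ⟨θ', φ⟩
    simp only [mem_ofPred_eq, mem_image, Finset.coe_filter, Prod.mk.injEq, hone]
    constructor
    · rintro ⟨h, rfl⟩
      refine ⟨φ, ⟨?_, h⟩, rfl, rfl⟩
      obtain ⟨i, ⟨⟨e, he⟩, b, hb⟩, -⟩ := T.mem_free_iff.1 h
      exact Finset.mem_image.2 ⟨(i, b), (hmem _).2 ⟨e, he.symm⟩, hb.symm⟩
    · rintro ⟨φ', ⟨-, h⟩, rfl, rfl⟩
      exact ⟨h, rfl⟩
  rw [himg, Function.Injective.encard_image (fun _ _ h => (Prod.ext_iff.1 h).2), encard_coe_eq_coe_finsetCard]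
  intro h
  have h1 : (((X.image f).filter fun φ => Odd (X.filter fun x => f x = φ).card).card) = 1 := by
    exact_mod_cast h
  rw [h1] at hX
  exact absurd hX (by decide)

theorem encard_eq_zero_or_two {s : Set Torus} (h : s.encard ≤ 2) (h1 : s.encard ≠ 1) :
    s.encard = 0 ∨ s.encard = 2 := by
  have hf : s.Finite := finite_of_encard_le_coe (k := 2) h
  rw [← hf.cast_ncard_eq] at *
  norm_cast at *
  omega

theorem isLinkDiagram_free [Finite ι] : IsLinkDiagram T.free := by
  refine ⟨T.finite_free, fun θ => encard_eq_zero_or_two (T.meridian_le θ) (T.encard_meridian_ne_one θ),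
    fun φ => encard_eq_zero_or_two (T.longitude_le φ) ?_⟩
  have := T.swap.encard_meridian_ne_one φ
  rwa [free, ← encard_freeSet_swap] at this

end TileSystem

/-! ### From diagrams of surfaces to systems of tiles. -/

theorem SurfaceDiagram.freeVertices_eq (P : SurfaceDiagram) : freeVertices P.rects =
    freeSet (fun r : P.rects => r.1.θArc) (fun r : P.rects => r.1.φArc) := by
  ext v
  simp only [freeVertices, freeSet, mem_ofPred_eq, Rectangle.mem_vertices_iff]
  constructor
  · rintro ⟨r, ⟨h1, h2⟩, h3⟩
    exact ⟨⟨r, h1⟩, h2, fun s hs => Subtype.ext (h3 s.1 ⟨s.2, hs⟩)⟩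
  · rintro ⟨r, h1, h2⟩
    exact ⟨r.1, ⟨r.2, h1⟩, fun s hs => congrArg Subtype.val (h2 ⟨s, hs.1⟩ hs.2)⟩

/-- The system of tiles of a diagram of a surface. -/
noncomputable def SurfaceDiagram.system (P : SurfaceDiagram) : TileSystem P.rects where
  A r := r.1.θArc
  B r := r.1.φArc
  vertex {i j} h _ _ h1 h2 :=
    (P.compatible i.1 i.2 j.1 j.2 fun h' => h (Subtype.ext h')).vertex h1 h2
  meridian {i j} h _ _ _ h0 h1 h2 :=
    (P.compatible i.1 i.2 j.1 j.2 fun h' => h (Subtype.ext h')).meridian h0 h1 h2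
  longitude {i j} h _ _ _ h0 h1 h2 :=
    (P.compatible i.1 i.2 j.1 j.2 fun h' => h (Subtype.ext h')).longitude h0 h1 h2
  disjoint {i j} h :=
    (P.compatible i.1 i.2 j.1 j.2 fun h' => h (Subtype.ext h')).disjoint_openDisc
  meridian_le := by
    rw [← P.freeVertices_eq]; exact P.meridian
  longitude_le := by
    rw [← P.freeVertices_eq]; exact P.longitude

theorem SurfaceDiagram.system_free (P : SurfaceDiagram) : P.system.free = P.boundary :=
  P.freeVertices_eq.symm

theorem SurfaceDiagram.surface_eq (P : SurfaceDiagram) :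
    P.surface = toE4 '' ⋃ i, disc (P.system.A i) (P.system.B i) := by
  rw [surface, image_iUnion, iUnion_subtype]
  exact iUnion₂_congr fun r _ => tile_eq r

/-! ### Tools from analysis -/

theorem continuousAt_deriv_of_contDiffAt {f : ℝ → ℝ} {x : ℝ} (hf : ContDiffAt ℝ 1 f x) :
    ContinuousAt (deriv f) x := by
  have h := (hf.fderiv_right (m := 0) (by norm_num)).continuousAt
  have : deriv f = fun x => fderiv ℝ f x 1 := funext fun x => fderiv_apply_one_eq_deriv.symm
  rw [this]
  exact h.clm_apply continuousAt_const

/-- Functions of a `C¹` function `t` which have the same derivative at `0`, and of which the one in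
use changes only where `t` vanishes, fit together. -/
theorem contDiffAt_glue {E : Type*} [NormedAddCommGroup E] [NormedSpace ℝ E] {κ : Type*} [Finite κ]
    {t : E → ℝ} {x₀ : E} (ht : ContDiffAt ℝ 1 t x₀) (ht₀ : t x₀ = 0) {u : κ → ℝ → ℝ}
    (hu : ∀ i, ContDiffAt ℝ 1 (u i) 0) (hu₀ : ∀ i, u i 0 = 0) {σ : ℝ} (hσ : ∀ i, deriv (u i) 0 = σ)
    {j : E → κ} (hj : ∀ᶠ x in 𝓝 x₀, t x ≠ 0 → ∀ᶠ x' in 𝓝 x, j x' = j x) :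
    ContDiffAt ℝ 1 (fun x => u (j x) (t x)) x₀ := by
  have hN : ∀ᶠ y in 𝓝 (0 : ℝ), ∀ i, ContDiffAt ℝ 1 (u i) y :=
    eventually_all.2 fun i => (hu i).eventually (by simp)
  have hN' : ∀ᶠ x in 𝓝 x₀, ∀ i, ContDiffAt ℝ 1 (u i) (t x) := by
    have := ht.continuousAt
    rw [ContinuousAt, ht₀] at this
    exact this.eventually hN
  have ht' : ∀ᶠ x in 𝓝 x₀, ContDiffAt ℝ 1 t x := ht.eventually (by simp)
  rw [contDiffAt_one_iff]
  refine ⟨fun x => deriv (u (j x)) (t x) • fderiv ℝ t x, _, hj.and (hN'.and ht'),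
    fun x hx => ContinuousAt.continuousWithinAt ?_, ?_⟩
  · obtain ⟨h1, h2, h3⟩ := hx
    have hcd : ContinuousAt (fderiv ℝ t) x := (h3.fderiv_right (m := 0) (by norm_num)).continuousAt
    suffices hsuff : ContinuousAt (fun x => deriv (u (j x)) (t x)) x from hsuff.smul hcd
    -- Where t vanishes the derivatives of all the `u i` have the same value σ, so the choice made
    -- by j does not matter; elsewhere j is locally constant.
    by_cases hx : t x = 0
    · have hc : ∀ i, Tendsto (fun y => deriv (u i) (t y)) (𝓝 x) (𝓝 σ) := fun i => by
        have h4 : ContinuousAt (fun y => deriv (u i) (t y)) x :=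
          (continuousAt_deriv_of_contDiffAt (h2 i)).comp (f := t) h3.continuousAt
        simpa [ContinuousAt, hx, hσ] using h4
      rw [ContinuousAt, hx, hσ]
      rw [Metric.tendsto_nhds]
      intro ε hε
      filter_upwards [eventually_all.2 fun i => Metric.tendsto_nhds.1 (hc i) ε hε] with y hy
      exact hy _
    · have h4 : ContinuousAt (fun y => deriv (u (j x)) (t y)) x :=
        (continuousAt_deriv_of_contDiffAt (h2 (j x))).comp (f := t) h3.continuousAt
      refine h4.congr ?_
      filter_upwards [h1 hx] with y hy
      rw [hy]
  · rintro x ⟨h1, h2, h3⟩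
    have hd := (h3.differentiableAt (by simp)).hasFDerivAt
    beta_reduce
    by_cases hx : t x = 0
    · rw [hx, hσ]
      have hlo : (fun y => u (j y) (t y) - σ * t y) =o[𝓝 x] fun y => t y - t x := by
        rw [Asymptotics.isLittleO_iff]
        intro c hc
        have h4 : ∀ i, ∀ᶠ τ in 𝓝 (0 : ℝ), ‖u i τ - σ * τ‖ ≤ c * ‖τ‖ := fun i => by
          have h5 := ((hu i).differentiableAt (by simp)).hasDerivAt
          rw [hσ, hasDerivAt_iff_isLittleO, Asymptotics.isLittleO_iff] at h5
          filter_upwards [h5 hc] with τ hτ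
          simpa [hu₀, mul_comm] using hτ
        have h6 : Tendsto t (𝓝 x) (𝓝 0) := hx ▸ h3.continuousAt.tendsto
        filter_upwards [h6.eventually (eventually_all.2 h4)] with y hy
        rw [hx, sub_zero]
        exact hy _
      have h7 := hlo.trans_isBigO hd.isBigO_sub
      have h8 := hd.const_mul σ
      rw [hasFDerivAt_iff_isLittleO] at h8 ⊢
      refine (h7.add h8).congr_left fun y => ?_
      rw [hx, hu₀]
      ring
    · have h4 := ((h2 (j x)).differentiableAt (by simp)).hasDerivAt.comp_hasFDerivAt x hd
      refine h4.congr_of_eventuallyEq ?_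
      filter_upwards [h1 hx] with y hy
      rw [hy]
      rfl

/-- A function which is homogeneous of degree two is `C¹` if it is so away from `0`. -/
theorem contDiff_of_homogeneous {f : ℂ → ℝ} (hf : ∀ (c : ℝ) (z : ℂ), 0 < c → f (c * z) = c ^ 2 * f z)
    (h : ∀ z, z ≠ 0 → ContDiffAt ℝ 1 f z) : ContDiff ℝ 1 f := by
  have h0 : f 0 = 0 := by
    have := hf 2 0 (by norm_num)
    rw [mul_zero] at this
    linarith
  have hcomp : IsCompact (Metric.sphere (0 : ℂ) 1) := isCompact_sphere _ _
  have hne : ∀ z ∈ Metric.sphere (0 : ℂ) 1, z ≠ 0 := fun z hz => by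
    rintro rfl
    simp at hz
  obtain ⟨C, hC⟩ := hcomp.exists_bound_of_continuousOn (f := f)
    fun z hz => (h z (hne z hz)).continuousAt.continuousWithinAt
  obtain ⟨D, hD⟩ := hcomp.exists_bound_of_continuousOn (f := fderiv ℝ f)
    fun z hz => ((h z (hne z hz)).fderiv_right (m := 0) (by norm_num)).continuousAt.continuousWithinAt
  have hdec : ∀ z : ℂ, z ≠ 0 → ∃ w ∈ Metric.sphere (0 : ℂ) 1, z = (‖z‖ : ℝ) * w := fun z hz => by
    have : (‖z‖ : ℂ) ≠ 0 := by simpa using hz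
    refine ⟨z / ‖z‖, by simp [hz], by field_simp⟩
  -- The differential is homogeneous of degree one, hence bounded by D ‖z‖, which gives its
  -- continuity at the origin.
  have hfd : ∀ (c : ℝ) (w : ℂ), 0 < c → w ≠ 0 → fderiv ℝ f (c * w) = c • fderiv ℝ f w := by
    intro c w hc hw
    have hcw : (c : ℂ) * w ≠ 0 := mul_ne_zero (by exact_mod_cast hc.ne') hw
    have h1 := ((h _ hcw).differentiableAt (by simp)).hasFDerivAt
    have h2 : HasFDerivAt (fun z : ℂ => (c : ℂ) * z) (c • ContinuousLinearMap.id ℝ ℂ) w := by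
      have := (hasFDerivAt_id (𝕜 := ℝ) w).const_smul c
      refine this.congr_of_eventuallyEq (Eventually.of_forall fun z => ?_)
      simp
    have h3 := h1.comp w h2
    have h4 := (((h w hw).differentiableAt (by simp)).hasFDerivAt).const_mul (c ^ 2)
    have h5 : f ∘ (fun z : ℂ => (c : ℂ) * z) = fun z => c ^ 2 * f z := funext fun z => hf c z hc
    rw [h5] at h3
    have h6 := h3.unique h4
    ext v
    have h7 := congrArg (fun L => L v) h6
    simp only [ContinuousLinearMap.comp_apply, smul_apply,
      ContinuousLinearMap.id_apply, map_smul, smul_eq_mul] at h7 ⊢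
    have hc' := hc.ne'
    refine mul_left_cancel₀ hc' ?_
    rw [h7]
    ring
  have hb : ∀ z, |f z| ≤ C * ‖z‖ ^ 2 := by
    intro z
    by_cases hz : z = 0
    · simp [hz, h0]
    · obtain ⟨w, hw, hzw⟩ := hdec z hz
      rw [hzw, hf _ _ (norm_pos_iff.2 hz), ← hzw, abs_mul, abs_of_nonneg (by positivity), mul_comm]
      exact mul_le_mul_of_nonneg_right (hC w hw) (by positivity)
  have hfb : ∀ z, z ≠ 0 → ‖fderiv ℝ f z‖ ≤ D * ‖z‖ := by
    intro z hz
    obtain ⟨w, hw, hzw⟩ := hdec z hz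
    conv_lhs => rw [hzw]
    rw [hfd _ _ (norm_pos_iff.2 hz) (hne w hw), norm_smul, norm_norm, mul_comm]
    exact mul_le_mul_of_nonneg_right (hD w hw) (norm_nonneg _)
  have hd0 : HasFDerivAt f (0 : ℂ →L[ℝ] ℝ) 0 := by
    rw [hasFDerivAt_iff_isLittleO]
    have h1 : (fun z : ℂ => f z - f 0 - (0 : ℂ →L[ℝ] ℝ) (z - 0)) =O[𝓝 0] fun z => ‖z‖ ^ 2 := by
      refine Asymptotics.IsBigO.of_bound C (Eventually.of_forall fun z => ?_)
      simpa [h0] using hb z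
    refine h1.trans_isLittleO ?_
    have := Asymptotics.isLittleO_pow_id (𝕜 := ℝ) (n := 2) (by norm_num)
    have h2 := (this.comp_tendsto (k := fun z : ℂ => ‖z‖) (l' := 𝓝 0)
      (by simpa using (continuous_norm (E := ℂ)).tendsto 0))
    refine Asymptotics.IsLittleO.trans_isBigO h2 ?_
    refine Asymptotics.IsBigO.of_bound 1 (Eventually.of_forall fun z => ?_)
    simp
  rw [contDiff_one_iff_fderiv]
  refine ⟨fun z => ?_, continuous_iff_continuousAt.2 fun z => ?_⟩
  · by_cases hz : z = 0
    · exact hz ▸ hd0.differentiableAt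
    · exact (h z hz).differentiableAt (by simp)
  · by_cases hz : z = 0
    · rw [hz, ContinuousAt, hd0.fderiv]
      have h0 : Tendsto (fun z : ℂ => D * ‖z‖) (𝓝 0) (𝓝 0) := by
        have : Continuous fun z : ℂ => D * ‖z‖ := by fun_prop
        simpa using this.tendsto 0
      refine squeeze_zero_norm (fun z => ?_) h0
      by_cases hz : z = 0
      · simp [hz, hd0.fderiv]
      · exact hfb z hz
    · exact ((h z hz).fderiv_right (m := 0) (by norm_num)).continuousAt

/-- After rotation by -φ the point z₀ lies on the positive real axis, where the principal argument
is smooth. The result is a real coordinate for the angle near z₀. -/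
theorem exists_angle_eq_add_arg {z₀ : ℂ} (hz₀ : z₀ ≠ 0) (φ : Real.Angle)
    (hφ : (z₀.arg : Real.Angle) = φ) : ∃ y : ℂ → ℝ, ContDiffAt ℝ ∞ y z₀ ∧ y z₀ = 0 ∧
      ∀ z, z ≠ 0 → (z.arg : Real.Angle) = φ + (y z : Real.Angle) := by
  have hc : ((-φ).toCircle : ℂ) ≠ 0 := by simp
  have harg : ∀ z, z ≠ 0 → ((z * (-φ).toCircle : ℂ).arg : Real.Angle) = z.arg - φ := by
    intro z hz
    rw [Complex.arg_mul_coe_angle hz hc]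
    have := arg_mul_toCircle one_pos (-φ)
    rw [Complex.ofReal_one, one_mul] at this
    rw [this, sub_eq_add_neg]
  have hz1 : z₀ * (-φ).toCircle = (‖z₀‖ : ℂ) := by
    have h1 := eq_norm_mul_toCircle z₀
    rw [hφ] at h1
    conv_lhs => rw [h1]
    rw [mul_assoc, ← Circle.coe_mul, ← Real.Angle.toCircle_add]
    simp
  refine ⟨fun z => (z * (-φ).toCircle).arg, ?_, ?_, ?_⟩
  · have h1 : (z₀ * (-φ).toCircle : ℂ) ∈ Complex.slitPlane := by
      rw [hz1]
      exact Complex.ofReal_mem_slitPlane.2 (norm_pos_iff.2 hz₀)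
    have h2 : (fun z : ℂ => (z * (-φ).toCircle).arg) =
        fun z => (Complex.log (z * (-φ).toCircle)).im := by
      funext z; rw [Complex.log_im]
    rw [h2]
    have h0 : ContDiffAt ℂ ∞ (fun z : ℂ => z * ((-φ).toCircle : ℂ)) z₀ :=
      contDiffAt_id.mul contDiffAt_const
    have h3 : ContDiffAt ℂ ∞ (fun z : ℂ => Complex.log (z * (-φ).toCircle)) z₀ :=
      ContDiffAt.comp (g := Complex.log) z₀ (Complex.contDiffAt_log h1) h0
    exact Complex.imCLM.contDiff.contDiffAt.comp z₀ (h3.restrict_scalars ℝ)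
  · simp only [hz1]
    exact Complex.arg_ofReal_of_nonneg (norm_nonneg _)
  · intro z hz
    simp only [harg z hz]
    abel

/-- By homogeneity of degree two only points other than the origin matter, and there the angle is a
smooth coordinate. -/
theorem contDiff_normSq_mul_arg {k : Real.Angle → ℝ}
    (hk : ∀ φ : Real.Angle, ContDiffAt ℝ 1 (fun y : ℝ => k (φ + y)) 0) :
    ContDiff ℝ 1 fun z : ℂ => ‖z‖ ^ 2 * k z.arg := by
  refine contDiff_of_homogeneous (fun c z hc => ?_) fun z hz => ?_
  · simp only [norm_mul, Complex.norm_real, Real.norm_of_nonneg hc.le, Complex.arg_real_mul z hc]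
    ring
  · obtain ⟨y, hy, hy0, hyeq⟩ := exists_angle_eq_add_arg hz _ rfl
    refine ContDiffAt.mul ((contDiff_norm_sq ℝ).contDiffAt) ?_
    have h1 := hk z.arg
    rw [← hy0] at h1
    refine (h1.comp z (hy.of_le (by simp))).congr_of_eventuallyEq ?_
    filter_upwards [isOpen_ne.mem_nhds hz] with w hw
    simp only [Function.comp, hyeq w hw]

/-! ### Surfaces -/

/-- The inverse of `toE4`. -/
noncomputable def ofE4 (p : E4) : ℂ × ℂ := (⟨p 0, p 1⟩, ⟨p 2, p 3⟩)

/-- The identification of `ℂ × ℂ` with `ℝ⁴`, as a linear map. -/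
noncomputable def toE4L : (ℂ × ℂ) ≃L[ℝ] E4 :=
  LinearEquiv.toContinuousLinearEquiv
    { toFun := toE4
      invFun := ofE4
      map_add' := fun p q => by ext i; fin_cases i <;> simp [toE4]
      map_smul' := fun c q => by ext i; fin_cases i <;> simp [toE4]
      left_inv := fun q => by simp [toE4, ofE4]
      right_inv := fun p => by ext i; fin_cases i <;> simp [toE4, ofE4] }

theorem toE4L_apply (q : ℂ × ℂ) : toE4L q = toE4 q := rfl

/-- A left inverse differentiable at the points of the image yields both the injectivity of the
differentials and the embedding property. -/
theorem isC1SurfaceAt_of_leftInverse {S : Set (ℂ × ℂ)} {p : ℂ × ℂ} {U : Set (ℂ × ℂ)} {V : Set ℂ}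
    {g : ℂ → ℂ × ℂ} {l : ℂ × ℂ → ℂ} (hU : IsOpen U) (hp : p ∈ U) (hV : IsOpen V)
    (hg : ContDiffOn ℝ 1 g V) (hl : ∀ x ∈ V, DifferentiableAt ℝ l (g x))
    (hl' : ∀ x ∈ V, l (g x) = x) (him : g '' V = S ∩ U) : IsC1SurfaceAt (toE4 '' S) (toE4 p) := by
  let e : EuclideanSpace ℝ (Fin 2) ≃L[ℝ] ℂ :=
    Complex.orthonormalBasisOneI.repr.symm.toContinuousLinearEquiv
  have hmaps : MapsTo e (e ⁻¹' V) V := fun x hx => hx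
  have hf : ContDiffOn ℝ 1 (toE4L ∘ g ∘ e) (e ⁻¹' V) :=
    toE4L.contDiff.comp_contDiffOn (hg.comp e.contDiff.contDiffOn hmaps)
  have hopen : IsOpen (e ⁻¹' V) := hV.preimage e.continuous
  have hleft : ∀ x ∈ e ⁻¹' V, (e.symm ∘ l ∘ toE4L.symm) ((toE4L ∘ g ∘ e) x) = x := by
    intro x hx
    simp [hl' _ hx]
  have hld : ∀ x ∈ e ⁻¹' V, DifferentiableAt ℝ (e.symm ∘ l ∘ toE4L.symm) ((toE4L ∘ g ∘ e) x) := by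
    intro x hx
    have h1 : DifferentiableAt ℝ l (toE4L.symm ((toE4L ∘ g ∘ e) x)) := by
      simpa using hl _ hx
    exact e.symm.differentiableAt.comp _ (h1.comp _ toE4L.symm.differentiableAt)
  refine ⟨toE4L '' U, e ⁻¹' V, toE4L ∘ g ∘ e, toE4L.toHomeomorph.isOpenMap U hU, ⟨p, hp, rfl⟩, hopen,
    hf, fun x hx => ?_, ⟨?_, ?_⟩, ?_⟩
  · have h1 : DifferentiableAt ℝ (toE4L ∘ g ∘ e) x :=
      (hf.contDiffAt (hopen.mem_nhds hx)).differentiableAt (by simp)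
    have h2 := (hld x hx).hasFDerivAt.comp x h1.hasFDerivAt
    have h3 : HasFDerivAt ((e.symm ∘ l ∘ toE4L.symm) ∘ (toE4L ∘ g ∘ e))
        (ContinuousLinearMap.id ℝ _) x := by
      refine (hasFDerivAt_id x).congr_of_eventuallyEq ?_
      filter_upwards [hopen.mem_nhds hx] with y hy using hleft y hy
    have h4 := h2.unique h3
    refine Function.LeftInverse.injective (g := fderiv ℝ (e.symm ∘ l ∘ toE4L.symm) ((toE4L ∘ g ∘ e) x))
      fun v => ?_
    exact congrArg (fun L => L v) h4
  · rw [isInducing_iff_nhds]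
    intro x
    apply le_antisymm
    · exact (continuousOn_iff_continuous_domRestrict.1 hf.continuousOn).continuousAt.tendsto.le_comap
    · rw [nhds_subtype, ← tendsto_iff_comap]
      have h1 := (hld x x.2).continuousAt.tendsto
      rw [hleft x x.2] at h1
      refine (h1.comp (tendsto_comap (f := (e ⁻¹' V).domRestrict (toE4L ∘ g ∘ e)))).congr fun y => ?_
      exact hleft y y.2
  · intro x y hxy
    have h1 : (toE4L ∘ g ∘ e) x = (toE4L ∘ g ∘ e) y := hxy
    have h2 := congrArg (e.symm ∘ l ∘ toE4L.symm) h1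
    rw [hleft x x.2, hleft y y.2] at h2
    exact Subtype.ext h2
  · have h1 : (g ∘ e) '' (e ⁻¹' V) = g '' V := by
      rw [image_comp, image_preimage_eq V e.surjective]
    rw [image_comp, h1, him]
    exact image_inter toE4L.injective

theorem IsC1SurfaceAt.congr {S S' : Set E4} {p : E4} (h : IsC1SurfaceAt S p)
    (hS : ∀ᶠ q in 𝓝 p, q ∈ S ↔ q ∈ S') : IsC1SurfaceAt S' p := by
  obtain ⟨U, V, f, hU, hp, hV, hf, hinj, hemb, him⟩ := h
  obtain ⟨O, hO, hOopen, hpO⟩ := eventually_nhds_iff.1 hS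
  have hcont := hf.continuousOn
  have hopen : IsOpen (V ∩ f ⁻¹' O) := hcont.isOpen_inter_preimage hV hOopen
  refine ⟨U ∩ O, V ∩ f ⁻¹' O, f, hU.inter hOopen, ⟨hp, hpO⟩, hopen, hf.mono inter_subset_left,
    fun x hx => hinj x hx.1, ?_, ?_⟩
  · have : (V ∩ f ⁻¹' O).domRestrict f = V.domRestrict f ∘ inclusion inter_subset_left := rfl
    rw [this]
    exact hemb.comp (IsEmbedding.inclusion inter_subset_left)
  · rw [image_inter_preimage, him]
    ext q
    constructor
    · rintro ⟨⟨h1, h2⟩, h3⟩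
      exact ⟨(hO q h3).1 h1, h2, h3⟩
    · rintro ⟨h1, h2, h3⟩
      exact ⟨⟨(hO q h3).2 h1, h2⟩, h3⟩

/-! ### The profiles along a meridian -/

theorem map_add_coe_nhds (φ : Real.Angle) :
    map (fun y : ℝ => φ + (y : Real.Angle)) (𝓝 0) = 𝓝 φ := by
  have h1 : IsOpenMap fun y : ℝ => φ + (y : Real.Angle) :=
    (isOpenMap_add_left φ).comp (QuotientAddGroup.isOpenMap_coe (N := AddSubgroup.zmultiples (2 * Real.pi)))
  have h2 : Continuous fun y : ℝ => φ + (y : Real.Angle) := by fun_prop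
  have h3 := h1.map_nhds_eq h2.continuousAt (x := 0)
  simpa using h3

theorem eventually_angle_iff {φ : Real.Angle} {p : Real.Angle → Prop} :
    (∀ᶠ ψ in 𝓝 φ, p ψ) ↔ ∀ᶠ y : ℝ in 𝓝 0, p (φ + (y : Real.Angle)) := by
  rw [← map_add_coe_nhds φ, eventually_map]

theorem coe_angle_inj_of_abs_lt {x y : ℝ} (hx : |x| < Real.pi) (hy : |y| < Real.pi)
    (h : (x : Real.Angle) = y) : x = y := by
  rw [abs_lt] at hx hy
  rw [← Real.Angle.toReal_coe_eq_self_iff.2 ⟨hx.1, hx.2.le⟩,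
    ← Real.Angle.toReal_coe_eq_self_iff.2 ⟨hy.1, hy.2.le⟩, h]

/-- A function with derivative one at the fixed point `0` has an inverse of class `C¹` there. -/
theorem exists_localInverse {f : ℝ → ℝ} (hf : ContDiffAt ℝ 1 f 0) (h0 : f 0 = 0)
    (h1 : HasDerivAt f 1 0) : ∃ u : ℝ → ℝ, ContDiffAt ℝ 1 u 0 ∧ u 0 = 0 ∧ deriv u 0 = 1 ∧
      (∀ᶠ x in 𝓝 0, u (f x) = x) ∧ ∀ᶠ t in 𝓝 0, f (u t) = t := by
  have h2 : HasFDerivAt f ((ContinuousLinearEquiv.refl ℝ ℝ : ℝ ≃L[ℝ] ℝ) : ℝ →L[ℝ] ℝ) 0 := by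
    refine h1.hasFDerivAt.congr_fderiv ?_
    ext
    simp
  have h3 := hf.hasStrictFDerivAt' h2 (by simp)
  have e1 := h3.eventually_right_inverse
  have e2 := h3.to_localInverse.hasFDerivAt.hasDerivAt.deriv
  have e3 := hf.to_localInverse h2 (by simp)
  rw [h0] at e1 e2 e3
  refine ⟨h3.localInverse f _ 0, e3, ?_, ?_, h3.eventually_left_inverse, e1⟩
  · have h4 := h3.localInverse_apply_image
    rwa [h0] at h4
  · rw [e2]
    simp

namespace TArc

/-- The shape of an arc and of its profile near an end point. -/
theorem eventually_endpt (A : TArc) (e : Bool) : ∀ᶠ y : ℝ in 𝓝 0,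
    (A.endpt e + (y : Real.Angle) ∈ A.carrier ↔ 0 ≤ sgn e * y) ∧
    (0 ≤ sgn e * y → A.val (A.endpt e + (y : Real.Angle)) = sgn e * A.fn y) ∧
    (0 ≤ sgn e * A.fn y ↔ 0 ≤ sgn e * y) := by
  have hpos := A.isProfile.pos
  have hlt := A.len_lt
  have hm : 0 < min A.len (2 * Real.pi - A.len) := lt_min hpos (sub_pos.2 hlt)
  filter_upwards [Metric.ball_mem_nhds 0 hm] with y hy
  rw [mem_ball_zero_iff, Real.norm_eq_abs, lt_min_iff] at hy
  have hfn : sgn e * A.fn y = A.fn (sgn e * y) := by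
    cases e
    · simp [sgn, A.isProfile.odd]
    · simp [sgn]
  have hy' : y = sgn e * (sgn e * y) := by rw [← mul_assoc, sgn_mul_self, one_mul]
  have habs : |sgn e * y| = |y| := by rw [abs_mul, abs_sgn, one_mul]
  rw [hfn]
  set u := sgn e * y with hu
  rw [← habs] at hy
  refine ⟨⟨fun h => ?_, fun h => ?_⟩, fun h => ?_, ⟨fun h => ?_, fun h => ?_⟩⟩
  · by_contra! hneg
    rw [abs_of_neg hneg] at hy
    obtain ⟨v, hv, h1⟩ := (A.mem_carrier_iff e).1 h
    have h2 := add_left_cancel h1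
    rw [hy'] at h2
    have h3 : ((2 * Real.pi + u : ℝ) : Real.Angle) = v := by
      cases e <;> simp only [sgn, if_true, Bool.false_eq_true, if_false, one_mul, neg_one_mul,
        Real.Angle.coe_neg, neg_inj] at h2 <;>
      rw [Real.Angle.coe_add, Real.Angle.coe_two_pi, zero_add, h2]
    have h4 := coe_angle_injOn ⟨by linarith, by linarith⟩ ⟨hv.1, hv.2.trans_lt A.len_lt⟩ h3
    linarith [hv.2]
  · rw [abs_of_nonneg h] at hy
    exact (A.mem_carrier_iff e).2 ⟨u, ⟨h, hy.1.le⟩, by rw [← hy']⟩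
  · rw [abs_of_nonneg h] at hy
    rw [← A.val_endpt_add e ⟨h, hy.1.le⟩, ← hy']
  · by_contra! hneg
    rw [abs_of_neg hneg] at hy
    have h1 := A.isProfile.fn_pos (-u) ⟨by linarith, hy.1⟩
    rw [A.isProfile.odd] at h1
    linarith
  · rcases h.eq_or_lt with h | h
    · rw [← h, A.isProfile.zero]
    · rw [abs_of_pos h] at hy
      exact (A.isProfile.fn_pos u ⟨h, hy.1⟩).le

theorem contDiffAt_val_add (A : TArc) {φ : Real.Angle} (h : φ ∈ A.interior) :
    ContDiffAt ℝ 1 (fun y : ℝ => A.val (φ + (y : Real.Angle))) 0 := by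
  obtain ⟨u, hu, rfl⟩ := h
  have h1 : ContDiff ℝ 1 fun y : ℝ => A.fn (u + y) :=
    (A.isProfile.contDiff.of_le (by norm_num)).comp (contDiff_const.add contDiff_id)
  refine h1.contDiffAt.congr_of_eventuallyEq ?_
  have h2 : ∀ᶠ y : ℝ in 𝓝 0, u + y ∈ Ioo 0 A.len := by
    have : Continuous fun y : ℝ => u + y := by fun_prop
    exact this.continuousAt.eventually (isOpen_Ioo.mem_nhds (by simpa using hu))
  filter_upwards [h2] with y hy
  rw [add_assoc, ← Real.Angle.coe_add, A.val_start_add (Ioo_subset_Icc_self hy)]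

end TArc

/-- Interpolation by functions on the circle which are multiples of sines near given points. -/
theorem exists_interpolation {Φ : Set Real.Angle} (hΦ : Φ.Finite) (σ : Real.Angle → ℝ) :
    ∃ s : Real.Angle → ℝ, (∀ φ : Real.Angle, ContDiffAt ℝ 1 (fun y : ℝ => s (φ + y)) 0) ∧
      ∀ φ ∈ Φ, ∀ᶠ y : ℝ in 𝓝 0, s (φ + y) = σ φ * Real.sin y := by
  classical
  have hcos : ∀ ψ : Real.Angle, ψ ≠ 0 → ψ.cos < 1 := by
    intro ψ hψ
    rw [← Real.Angle.cos_toReal]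
    refine lt_of_le_of_ne (Real.cos_le_one _) fun h => hψ ?_
    rw [Real.cos_eq_one_iff_of_lt_of_lt (by linarith [ψ.neg_pi_lt_toReal, Real.pi_pos])
      (by linarith [ψ.toReal_le_pi, Real.pi_pos])] at h
    exact Real.Angle.toReal_eq_zero_iff.1 h
  obtain ⟨c, hc, hc'⟩ : ∃ c < 1, ∀ φ ∈ Φ, ∀ ψ ∈ Φ, φ ≠ ψ → (φ - ψ).cos < c := by
    have hfin := (hΦ.prod hΦ).subset (show {x : Real.Angle × Real.Angle | x ∈ Φ ×ˢ Φ ∧ x.1 ≠ x.2} ⊆ _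
      from fun x hx => hx.1)
    have hev : ∀ᶠ c : ℝ in 𝓝[<] 1, ∀ x ∈ {x : Real.Angle × Real.Angle | x ∈ Φ ×ˢ Φ ∧ x.1 ≠ x.2},
        (x.1 - x.2).cos < c :=
      (eventually_all_finite hfin).2 fun x hx =>
        mem_nhdsWithin_of_mem_nhds (lt_mem_nhds (hcos _ (sub_ne_zero.2 hx.2)))
    obtain ⟨c, h1, h2⟩ := (hev.and self_mem_nhdsWithin).exists
    exact ⟨c, h2, fun φ hφ ψ hψ h => h1 (φ, ψ) ⟨⟨hφ, hψ⟩, h⟩⟩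
  -- A cut-off equal to 1 where cos φ ≥ (1 + c)/2 and to 0 where cos φ ≤ c. The latter holds near
  -- the difference of any two distinct points of Φ.
  let β : Real.Angle → ℝ := fun φ => Real.smoothTransition ((φ.cos - c) / ((1 - c) / 2))
  have hd : 0 < (1 - c) / 2 := by linarith
  refine ⟨fun φ => ∑ ψ ∈ hΦ.toFinset, σ ψ * (φ - ψ).sin * β (φ - ψ), fun φ => ?_, fun φ hφ => ?_⟩
  · refine ContDiffAt.sum fun ψ _ => ?_
    obtain ⟨t, ht⟩ : ∃ t : ℝ, (t : Real.Angle) = φ - ψ :=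
      Real.Angle.induction_on (φ - ψ) fun t => ⟨t, rfl⟩
    have h1 : ∀ y : ℝ, φ + (y : Real.Angle) - ψ = ((t + y : ℝ) : Real.Angle) := fun y => by
      rw [Real.Angle.coe_add, ht]; abel
    simp only [β, h1, Real.Angle.sin_coe, Real.Angle.cos_coe]
    have h2 : ContDiff ℝ 1 fun y : ℝ => (Real.cos (t + y) - c) / ((1 - c) / 2) := by fun_prop
    exact ContDiffAt.mul (by fun_prop)
      (Real.smoothTransition.contDiffAt.comp (0 : ℝ) h2.contDiffAt)
  · have e1 : ∀ᶠ y : ℝ in 𝓝 0, (1 + c) / 2 < Real.cos y :=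
      Real.continuous_cos.continuousAt.eventually (lt_mem_nhds (by rw [Real.cos_zero]; linarith))
    have e2 : ∀ ψ ∈ hΦ.toFinset, φ ≠ ψ → ∀ᶠ y : ℝ in 𝓝 0, (φ + (y : Real.Angle) - ψ).cos < c := by
      intro ψ hψ hne
      have hcont : Continuous fun y : ℝ => (φ + (y : Real.Angle) - ψ).cos :=
        Real.Angle.continuous_cos.comp (by fun_prop)
      refine hcont.continuousAt.eventually (gt_mem_nhds ?_)
      simpa using hc' φ hφ ψ (hΦ.mem_toFinset.1 hψ) hne
    have e3 : ∀ᶠ y : ℝ in 𝓝 0, ∀ ψ ∈ hΦ.toFinset, φ ≠ ψ → (φ + (y : Real.Angle) - ψ).cos < c := by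
      rw [Finset.eventually_all]
      intro ψ hψ
      by_cases h : φ = ψ
      · exact Eventually.of_forall fun _ h' => absurd h h'
      · filter_upwards [e2 ψ hψ h] with y hy _ using hy
    filter_upwards [e1, e3] with y h1 h2
    rw [Finset.sum_eq_single_of_mem φ (hΦ.mem_toFinset.2 hφ)]
    · have : β (φ + (y : Real.Angle) - φ) = 1 := by
        refine Real.smoothTransition.one_of_one_le ?_
        rw [add_sub_cancel_left, Real.Angle.cos_coe, le_div_iff₀ hd]
        linarith
      rw [this, add_sub_cancel_left, Real.Angle.sin_coe, mul_one]
    · intro ψ hψ hne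
      have : β (φ + (y : Real.Angle) - ψ) = 0 := by
        refine Real.smoothTransition.zero_of_nonpos (div_nonpos_of_nonpos_of_nonneg ?_ hd.le)
        linarith [h2 ψ hψ hne.symm]
      rw [this, mul_zero]

/-! ### The signed vertical profiles on a meridian as one C¹ function. -/

namespace TileSystem

variable {ι : Type} (T : TileSystem ι)

/-- The rectangles with a side on the meridian `θ`. -/
def adj (θ : Real.Angle) : Set (ι × Bool) := {x | (T.A x.1).endpt x.2 = θ}

/-- The union of the sides on a meridian. -/
def sides (θ : Real.Angle) : Set Real.Angle := {φ | ∃ x ∈ T.adj θ, φ ∈ (T.B x.1).carrier}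

/-- The end points of the sides on a meridian. -/
def ends (θ : Real.Angle) : Set Real.Angle := {φ | ∃ x ∈ T.adj θ, ∃ b, φ = (T.B x.1).endpt b}

open Classical in
/-- The side on a meridian which contains a given point. -/
noncomputable def idx (θ φ : Real.Angle) : Option (ι × Bool) :=
  if h : ∃ x ∈ T.adj θ, φ ∈ (T.B x.1).carrier then some h.choose else none

open Classical in
/-- The sign of a vertex: whether it is on the main diagonal of the rectangle or not. -/
noncomputable def sign (v : Torus) : ℝ :=
  if h : ∃ x : ι × Bool × Bool, v = ((T.A x.1).endpt x.2.1, (T.B x.1).endpt x.2.2) then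
    TArc.sgn h.choose.2.1 * TArc.sgn h.choose.2.2 else 0

theorem exists_fill [Finite ι] (θ : Real.Angle) :
    ∃ s : Real.Angle → ℝ, (∀ φ : Real.Angle, ContDiffAt ℝ 1 (fun y : ℝ => s (φ + y)) 0) ∧
      ∀ φ, (θ, φ) ∈ T.free → ∀ᶠ y : ℝ in 𝓝 0, s (φ + y) = T.sign (θ, φ) * Real.sin y := by
  obtain ⟨s, h1, h2⟩ := exists_interpolation (Φ := (fun φ => ((θ, φ) : Torus)) ⁻¹' T.free)
    (T.finite_free.preimage fun _ _ _ _ h => (Prod.ext_iff.1 h).2) fun φ => T.sign (θ, φ)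
  exact ⟨s, h1, h2⟩

/-- A function which continues the profiles to the complement of the sides. -/
noncomputable def fill [Finite ι] (θ : Real.Angle) : Real.Angle → ℝ := (T.exists_fill θ).choose

theorem contDiffAt_fill [Finite ι] (θ φ : Real.Angle) :
    ContDiffAt ℝ 1 (fun y : ℝ => T.fill θ (φ + y)) 0 := (T.exists_fill θ).choose_spec.1 φ

theorem fill_eq [Finite ι] {θ φ : Real.Angle} (h : (θ, φ) ∈ T.free) :
    ∀ᶠ y : ℝ in 𝓝 0, T.fill θ (φ + y) = T.sign (θ, φ) * Real.sin y :=
  (T.exists_fill θ).choose_spec.2 φ h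

/-- The functions whose graphs are the horizontal profiles of the rectangles along a meridian. -/
noncomputable def hprof (o : Option (ι × Bool)) : ℝ → ℝ := o.elim Real.sin fun x => (T.A x.1).fn

/-- The vertical profiles of the rectangles along a meridian. -/
noncomputable def vprof (o : Option (ι × Bool)) : ℝ → ℝ := o.elim Real.sin fun x => (T.B x.1).fn

/-- The vertical profiles as a function on a meridian. -/
noncomputable def prof [Finite ι] (θ φ : Real.Angle) : ℝ :=
  (T.idx θ φ).elim (T.fill θ φ) fun x => TArc.sgn x.2 * (T.B x.1).val φ

theorem prof_spec (o : Option (ι × Bool)) :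
    (ContDiff ℝ 1 (T.hprof o) ∧ T.hprof o 0 = 0 ∧ HasDerivAt (T.hprof o) 1 0) ∧
    (ContDiff ℝ 1 (T.vprof o) ∧ T.vprof o 0 = 0 ∧ HasDerivAt (T.vprof o) 1 0) := by
  cases o with
  | none =>
    have h := Real.hasDerivAt_sin 0
    rw [Real.cos_zero] at h
    exact ⟨⟨Real.contDiff_sin, Real.sin_zero, h⟩, Real.contDiff_sin, Real.sin_zero, h⟩
  | some x =>
    exact ⟨⟨(T.A x.1).isProfile.contDiff.of_le (by norm_num), (T.A x.1).isProfile.zero,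
      (T.A x.1).isProfile.hasDerivAt⟩, (T.B x.1).isProfile.contDiff.of_le (by norm_num),
      (T.B x.1).isProfile.zero, (T.B x.1).isProfile.hasDerivAt⟩

/-- Two sides on a meridian overlap at most in a common end, so the choice made by `idx` is
ambiguous only at points of `ends`. -/
theorem adj_unique {θ φ : Real.Angle} {x y : ι × Bool} (hx : x ∈ T.adj θ) (hy : y ∈ T.adj θ)
    (hφx : φ ∈ (T.B x.1).carrier) (hφy : φ ∈ (T.B y.1).carrier) :
    x = y ∨ y.2 = (!x.2) ∧ ∃ b, φ = (T.B x.1).endpt b ∧ φ = (T.B y.1).endpt (!b) := by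
  have h := Eq.trans hx (Eq.symm hy)
  by_cases hne : x.1 = y.1
  · refine Or.inl (Prod.ext hne ((T.A x.1).endpt_injective ?_))
    rwa [← hne] at h
  · exact Or.inr (T.meridian_endpt hne h hφx hφy)

theorem endpt_of_mem_ends {θ φ : Real.Angle} {x : ι × Bool} (hφ : φ ∈ T.ends θ) (hx : x ∈ T.adj θ)
    (h : φ ∈ (T.B x.1).carrier) : ∃ b, φ = (T.B x.1).endpt b := by
  obtain ⟨y, hy, b, hb⟩ := hφ
  rcases T.adj_unique hx hy h (hb ▸ TArc.endpt_mem _ _) with rfl | ⟨-, b, hb, -⟩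
  · exact ⟨b, hb⟩
  · exact ⟨b, hb⟩

theorem idx_eq_none_iff {θ φ : Real.Angle} : T.idx θ φ = none ↔ φ ∉ T.sides θ := by
  unfold idx sides
  split_ifs with h <;> simpa using h

theorem idx_spec {θ φ : Real.Angle} {x : ι × Bool} (h : T.idx θ φ = some x) :
    x ∈ T.adj θ ∧ φ ∈ (T.B x.1).carrier := by
  unfold idx at h
  split_ifs at h with h1
  simp only [Option.some.injEq] at h
  exact h ▸ h1.choose_spec

theorem idx_eq_some {θ φ : Real.Angle} {x : ι × Bool} (hx : x ∈ T.adj θ)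
    (h : φ ∈ (T.B x.1).carrier) (hφ : φ ∉ T.ends θ) : T.idx θ φ = some x := by
  cases ho : T.idx θ φ with
  | none => exact absurd ⟨x, hx, h⟩ (T.idx_eq_none_iff.1 ho)
  | some y =>
    obtain ⟨hy, hy'⟩ := T.idx_spec ho
    rcases T.adj_unique hx hy h hy' with rfl | ⟨-, b, hb, -⟩
    · rfl
    · exact absurd ⟨x, hx, b, hb⟩ hφ

theorem isClosed_sides [Finite ι] (θ : Real.Angle) : IsClosed (T.sides θ) := by
  have : T.sides θ = ⋃ x ∈ T.adj θ, (T.B x.1).carrier := by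
    ext φ; simp [sides]
  rw [this]
  exact (toFinite _).isClosed_biUnion fun x _ => TArc.isClosed_carrier _

theorem finite_ends [Finite ι] (θ : Real.Angle) : (T.ends θ).Finite := by
  refine (finite_range fun x : ι × Bool => (T.B x.1).endpt x.2).subset ?_
  rintro _ ⟨x, -, b, rfl⟩
  exact ⟨(x.1, b), rfl⟩

theorem eventually_idx_eq [Finite ι] {θ φ : Real.Angle} (hφ : φ ∉ T.ends θ) :
    ∀ᶠ ψ in 𝓝 φ, T.idx θ ψ = T.idx θ φ := by
  cases ho : T.idx θ φ with
  | none =>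
    filter_upwards [(T.isClosed_sides θ).isOpen_compl.mem_nhds (T.idx_eq_none_iff.1 ho)] with ψ hψ
    exact T.idx_eq_none_iff.2 hψ
  | some x =>
    obtain ⟨hx, hx'⟩ := T.idx_spec ho
    have hint : φ ∈ (T.B x.1).interior := by
      rcases (T.B x.1).mem_carrier_cases hx' with h | h
      · exact h
      · exact absurd ⟨x, hx, h⟩ hφ
    filter_upwards [(T.B x.1).isOpen_interior.mem_nhds hint,
      (T.finite_ends θ).isClosed.isOpen_compl.mem_nhds hφ] with ψ h1 h2
    exact T.idx_eq_some hx ((T.B x.1).interior_subset h1) h2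

theorem prof_eq [Finite ι] {θ φ : Real.Angle} {x : ι × Bool} (hx : x ∈ T.adj θ)
    (h : φ ∈ (T.B x.1).carrier) : T.prof θ φ = TArc.sgn x.2 * (T.B x.1).val φ := by
  cases ho : T.idx θ φ with
  | none => exact absurd ⟨x, hx, h⟩ (T.idx_eq_none_iff.1 ho)
  | some y =>
    obtain ⟨hy, hy'⟩ := T.idx_spec ho
    rw [prof, ho, Option.elim_some]
    rcases T.adj_unique hx hy h hy' with rfl | ⟨-, b, hb, hb'⟩
    · rfl
    · rw [hb, (T.B x.1).val_endpt, ← hb, hb', (T.B y.1).val_endpt, mul_zero, mul_zero]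

theorem prof_eq_zero [Finite ι] {θ φ : Real.Angle} (h : φ ∈ T.ends θ) : T.prof θ φ = 0 := by
  obtain ⟨x, hx, b, rfl⟩ := h
  rw [T.prof_eq hx (TArc.endpt_mem _ _), TArc.val_endpt, mul_zero]

theorem prof_eq_fill [Finite ι] {θ φ : Real.Angle} (h : φ ∉ T.sides θ) :
    T.prof θ φ = T.fill θ φ := by
  rw [prof, T.idx_eq_none_iff.2 h, Option.elim_none]

/-- Rectangles with a common vertex occupy opposite quadrants at it. Passing from one to the other
changes both factors, so the product does not depend on the chosen rectangle. -/
theorem sign_eq (i : ι) (e b : Bool) :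
    T.sign ((T.A i).endpt e, (T.B i).endpt b) = TArc.sgn e * TArc.sgn b := by
  have h : ∃ x : ι × Bool × Bool, (((T.A i).endpt e, (T.B i).endpt b) : Torus) =
      ((T.A x.1).endpt x.2.1, (T.B x.1).endpt x.2.2) := ⟨(i, e, b), rfl⟩
  rw [sign, dif_pos h]
  have hs := h.choose_spec
  generalize h.choose = x at hs
  obtain ⟨h1, h2⟩ := Prod.ext_iff.1 hs
  simp only at h1 h2
  by_cases hne : i = x.1
  · rw [← hne] at h1 h2
    rw [(T.A i).endpt_injective h1, (T.B i).endpt_injective h2]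
  · obtain ⟨h3, h4⟩ := T.vertex hne (h1 ▸ TArc.endpt_mem _ _ : (T.A i).endpt e ∈ (T.A x.1).carrier)
      (h2 ▸ TArc.endpt_mem _ _ : (T.B i).endpt b ∈ (T.B x.1).carrier)
    rw [(T.A x.1).endpt_injective (h1.symm.trans h3), (T.B x.1).endpt_injective (h2.symm.trans h4),
      TArc.sgn_not, TArc.sgn_not, neg_mul_neg]

/-- An end point of a side which is not a free vertex is in the interior of the union of the
sides. -/
theorem sides_mem_nhds {θ φ : Real.Angle} (hφ : φ ∈ T.ends θ) (h : (θ, φ) ∉ T.free) :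
    T.sides θ ∈ 𝓝 φ := by
  obtain ⟨x, hx, b, rfl⟩ := hφ
  obtain ⟨j, ⟨⟨e, he⟩, b', hb'⟩, hne⟩ : ∃ j, ((∃ e, θ = (T.A j).endpt e) ∧
      ∃ e, (T.B x.1).endpt b = (T.B j).endpt e) ∧ j ≠ x.1 := by
    by_contra! hcon
    exact h ⟨x.1, ⟨⟨x.2, Eq.symm hx⟩, b, rfl⟩, fun j hj => hcon j hj⟩
  obtain ⟨-, h2⟩ := T.vertex hne.symm (e := x.2) (e' := b) (j := j)
    (Eq.trans hx he ▸ TArc.endpt_mem _ _) (hb' ▸ TArc.endpt_mem _ _)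
  rw [← eventually_mem_set, eventually_angle_iff]
  filter_upwards [(T.B x.1).eventually_endpt b, (T.B j).eventually_endpt (!b)] with y h3 h4
  rw [← h2, TArc.sgn_not] at h4
  rcases le_total 0 (TArc.sgn b * y) with h5 | h5
  · exact ⟨x, hx, h3.1.2 h5⟩
  · exact ⟨(j, e), he.symm, h4.1.2 (by linarith)⟩

theorem sides_mem_nhds_of_notMem_ends {θ φ : Real.Angle} (hφ : φ ∉ T.ends θ) (h : φ ∈ T.sides θ) :
    T.sides θ ∈ 𝓝 φ := by
  obtain ⟨x, hx, h⟩ := h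
  rcases (T.B x.1).mem_carrier_cases h with h | h
  · filter_upwards [(T.B x.1).isOpen_interior.mem_nhds h] with ψ hψ
    exact ⟨x, hx, (T.B x.1).interior_subset hψ⟩
  · exact absurd ⟨x, hx, h⟩ hφ

/-- Everywhere else on the sides, their union is a neighbourhood of the point. -/
theorem free_of_mem_closure_compl {θ φ : Real.Angle} (h : φ ∈ T.sides θ)
    (h' : φ ∈ closure (T.sides θ)ᶜ) : φ ∈ T.ends θ ∧ (θ, φ) ∈ T.free := by
  have h1 : T.sides θ ∉ 𝓝 φ := fun h1 => by
    rw [closure_compl, mem_compl_iff, mem_interior_iff_mem_nhds] at h'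
    exact h' h1
  have h2 : φ ∈ T.ends θ := by_contra fun h2 => h1 (T.sides_mem_nhds_of_notMem_ends h2 h)
  exact ⟨h2, by_contra fun h3 => h1 (T.sides_mem_nhds h2 h3)⟩

/-- At the end b of a side of type e the oddness of the profile gives sgn e · sgn b · f(y), where y
is the deviation from the end. The factor is the sign of the vertex, the same for the sides on both
sides of it and, at a free vertex, for the filling. -/
theorem eventually_prof_eq [Finite ι] {θ φ : Real.Angle} (hφ : φ ∈ T.ends θ) :
    ∀ᶠ y : ℝ in 𝓝 0, T.prof θ (φ + y) = T.sign (θ, φ) * T.vprof (T.idx θ (φ + y)) y := by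
  have key : ∀ x ∈ T.adj θ, ∀ᶠ y : ℝ in 𝓝 0, φ + (y : Real.Angle) ∈ (T.B x.1).carrier →
      TArc.sgn x.2 * (T.B x.1).val (φ + y) = T.sign (θ, φ) * (T.B x.1).fn y := by
    intro x hx
    by_cases hm : φ ∈ (T.B x.1).carrier
    · obtain ⟨b, rfl⟩ := T.endpt_of_mem_ends hφ hx hm
      filter_upwards [(T.B x.1).eventually_endpt b] with y hy hmem
      rw [hy.2.1 (hy.1.1 hmem), ← Eq.trans (by rfl) hx, T.sign_eq, mul_assoc]
    · have h1 := (T.B x.1).isClosed_carrier.isOpen_compl.mem_nhds hm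
      rw [← eventually_mem_set, eventually_angle_iff] at h1
      filter_upwards [h1] with y hy hmem using absurd hmem hy
  have hall := (eventually_all_finite (toFinite (T.adj θ))).2 key
  have hnone : ∀ᶠ y : ℝ in 𝓝 0, φ + (y : Real.Angle) ∉ T.sides θ →
      T.fill θ (φ + y) = T.sign (θ, φ) * Real.sin y := by
    by_cases hf : (θ, φ) ∈ T.free
    · filter_upwards [T.fill_eq hf] with y hy _ using hy
    · have h1 := T.sides_mem_nhds hφ hf
      rw [← eventually_mem_set, eventually_angle_iff] at h1
      filter_upwards [h1] with y hy hmem using absurd hy hmem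
  filter_upwards [hall, hnone] with y h1 h2
  cases ho : T.idx θ (φ + y) with
  | none =>
    have h3 := T.idx_eq_none_iff.1 ho
    rw [T.prof_eq_fill h3, h2 h3]
    rfl
  | some x =>
    obtain ⟨hx, hx'⟩ := T.idx_spec ho
    rw [T.prof_eq hx hx', h1 x hx hx']
    rfl

/-- Near an end all the functions in use are the sign of the vertex times a function with value 0
and derivative 1 at 0, so `contDiffAt_glue` applies. Away from the ends the index is locally
constant. -/
theorem contDiffAt_prof [Finite ι] (θ φ : Real.Angle) :
    ContDiffAt ℝ 1 (fun y : ℝ => T.prof θ (φ + y)) 0 := by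
  by_cases hφ : φ ∈ T.ends θ
  · have h1 : ContDiffAt ℝ 1 (fun y : ℝ => (fun o y => T.sign (θ, φ) * T.vprof o y)
        (T.idx θ (φ + y)) (id y)) 0 := by
      refine contDiffAt_glue contDiffAt_id rfl (u := fun o y => T.sign (θ, φ) * T.vprof o y)
        (j := fun y : ℝ => T.idx θ (φ + y)) (σ := T.sign (θ, φ)) (fun o => ?_) (fun o => ?_)
        (fun o => ?_) ?_
      · exact contDiffAt_const.mul (T.prof_spec o).2.1.contDiffAt
      · rw [(T.prof_spec o).2.2.1, mul_zero]
      · rw [((T.prof_spec o).2.2.2.const_mul _).deriv, mul_one]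
      · have h2 : ∀ᶠ ψ in 𝓝 φ, ψ ∉ T.ends θ \ {φ} :=
          ((T.finite_ends θ).subset sdiff_subset).isClosed.isOpen_compl.mem_nhds fun h => h.2 rfl
        rw [eventually_angle_iff] at h2
        filter_upwards [h2, Metric.ball_mem_nhds 0 Real.pi_pos] with y hy hπ hne
        have h3 : φ + (y : Real.Angle) ∉ T.ends θ := fun h3 => by
          refine hy ⟨h3, fun h4 => hne ?_⟩
          have h5 : (y : Real.Angle) = ((0 : ℝ) : Real.Angle) := by
            rw [Real.Angle.coe_zero]
            exact left_eq_add.1 (Eq.symm h4)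
          rw [mem_ball_zero_iff, Real.norm_eq_abs] at hπ
          exact coe_angle_inj_of_abs_lt hπ (by simpa using Real.pi_pos) h5
        have h6 : Continuous fun y : ℝ => φ + (y : Real.Angle) := by fun_prop
        exact h6.continuousAt.eventually (T.eventually_idx_eq h3)
    exact h1.congr_of_eventuallyEq (T.eventually_prof_eq hφ)
  · have h1 := T.eventually_idx_eq hφ
    rw [eventually_angle_iff] at h1
    cases ho : T.idx θ φ with
    | none =>
      rw [ho] at h1
      refine (T.contDiffAt_fill θ φ).congr_of_eventuallyEq ?_
      filter_upwards [h1] with y hy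
      rw [prof, hy, Option.elim_none]
    | some x =>
      rw [ho] at h1
      obtain ⟨hx, hx'⟩ := T.idx_spec ho
      have hint : φ ∈ (T.B x.1).interior := by
        rcases (T.B x.1).mem_carrier_cases hx' with h | h
        · exact h
        · exact absurd ⟨x, hx, h⟩ hφ
      refine (contDiffAt_const.mul ((T.B x.1).contDiffAt_val_add hint)).congr_of_eventuallyEq
        (f := fun y : ℝ => TArc.sgn x.2 * (T.B x.1).val (φ + y)) ?_
      filter_upwards [h1] with y hy
      rw [prof, hy, Option.elim_some]

end TileSystem

/-! ### The surface near a point over a meridian with vertices -/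

/-- The unit sphere of `ℂ × ℂ` with the Hermitian norm. -/
def sphereC : Set (ℂ × ℂ) := {q | ‖q.1‖ ^ 2 + ‖q.2‖ ^ 2 = 1}

theorem isClosed_sphereC : IsClosed sphereC := isClosed_eq (by fun_prop) continuous_const

theorem toE4_mem_image {S : Set (ℂ × ℂ)} {q : ℂ × ℂ} : toE4 q ∈ toE4 '' S ↔ q ∈ S :=
  Function.Injective.mem_set_image toE4L.injective

theorem eventually_toE4_iff {p : ℂ × ℂ} {P : E4 → Prop} :
    (∀ᶠ q in 𝓝 (toE4 p), P q) ↔ ∀ᶠ q in 𝓝 p, P (toE4 q) := by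
  have := toE4L.toHomeomorph.map_nhds_eq p
  change map toE4 (𝓝 p) = 𝓝 (toE4 p) at this
  rw [← this, eventually_map]

theorem IsC1SurfaceAt.congr_image {S S' : Set (ℂ × ℂ)} {p : ℂ × ℂ}
    (h : IsC1SurfaceAt (toE4 '' S) (toE4 p)) (hS : ∀ᶠ q in 𝓝 p, q ∈ S ↔ q ∈ S') :
    IsC1SurfaceAt (toE4 '' S') (toE4 p) := by
  refine h.congr (eventually_toE4_iff.2 ?_)
  simpa only [toE4_mem_image] using hS

theorem contDiff_toCircle_add (θ : Real.Angle) :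
    ContDiff ℝ ∞ fun y : ℝ => ((θ + (y : Real.Angle)).toCircle : ℂ) := by
  obtain ⟨t, rfl⟩ : ∃ t : ℝ, (t : Real.Angle) = θ := Real.Angle.induction_on θ fun t => ⟨t, rfl⟩
  have : (fun y : ℝ => (((t : Real.Angle) + (y : Real.Angle)).toCircle : ℂ)) =
      fun y : ℝ => Complex.exp (((t + y : ℝ) : ℂ) * Complex.I) := by
    funext y
    rw [← Real.Angle.coe_add, Real.Angle.toCircle_coe, Circle.coe_exp]
  rw [this]
  have h1 : ContDiff ℝ ∞ fun y : ℝ => ((t + y : ℝ) : ℂ) :=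
    Complex.ofRealCLM.contDiff.comp (contDiff_const.add contDiff_id)
  exact (h1.mul contDiff_const).cexp

namespace TileSystem

variable {ι : Type} (T : TileSystem ι)

theorem exists_invProf (o : Option (ι × Bool)) : ∃ u : ℝ → ℝ, ContDiffAt ℝ 1 u 0 ∧ u 0 = 0 ∧
    deriv u 0 = 1 ∧ (∀ᶠ x in 𝓝 0, u (T.hprof o x) = x) ∧ ∀ᶠ t in 𝓝 0, T.hprof o (u t) = t :=
  exists_localInverse (T.prof_spec o).1.1.contDiffAt (T.prof_spec o).1.2.1 (T.prof_spec o).1.2.2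

/-- The local inverses of the horizontal profiles. -/
noncomputable def invProf (o : Option (ι × Bool)) : ℝ → ℝ := (T.exists_invProf o).choose

theorem invProf_spec (o : Option (ι × Bool)) : ContDiffAt ℝ 1 (T.invProf o) 0 ∧ T.invProf o 0 = 0 ∧
    deriv (T.invProf o) 0 = 1 ∧ (∀ᶠ x in 𝓝 0, T.invProf o (T.hprof o x) = x) ∧
    ∀ᶠ t in 𝓝 0, T.hprof o (T.invProf o t) = t :=
  (T.exists_invProf o).choose_spec

/-- The union of the tiles. -/
def surf : Set (ℂ × ℂ) := ⋃ i, disc (T.A i) (T.B i)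

theorem mem_surf {q : ℂ × ℂ} : q ∈ T.surf ↔ ∃ i, q ∈ disc (T.A i) (T.B i) := mem_iUnion

theorem surf_subset : T.surf ⊆ sphereC := iUnion_subset fun _ _ hq => hq.1

theorem isCompact_surf [Finite ι] : IsCompact T.surf := isCompact_iUnion fun _ => isCompact_disc _ _

/-- At points over a vertex or on the axis, the surface consists of the tiles with a side on the
meridian. -/
theorem exists_adj_of_mem_disc {θ : Real.Angle} {p : ℂ × ℂ} (hp2 : p.2 ≠ 0)
    (hθ : (p.2.arg : Real.Angle) = θ) (h : p.1 = 0 ∨ (p.1.arg : Real.Angle) ∈ T.ends θ) {i : ι}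
    (hi : p ∈ disc (T.A i) (T.B i)) : ∃ e, (i, e) ∈ T.adj θ := by
  have hA := hi.2.2.1.resolve_left hp2
  have n2 : 0 < ‖p.2‖ ^ 2 := by positivity
  rcases (T.A i).mem_carrier_cases hA with h1 | ⟨e, he⟩
  · exfalso
    have hv := (T.A i).val_pos h1
    have heq := hi.2.2.2
    by_cases hz : p.1 = 0
    · rw [hz, norm_zero] at heq
      have := mul_pos n2 hv
      norm_num at heq
      rcases heq with h2 | h2
      · exact hp2 h2
      · exact hv.ne' h2
    · obtain ⟨x, hx, b, hb⟩ := h.resolve_left hz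
      have hx' : (T.A x.1).endpt x.2 = θ := hx
      have hB := hi.2.1.resolve_left hz
      by_cases hne : x.1 = i
      · rw [← hne, hθ, ← hx'] at h1
        exact (T.A x.1).endpt_notMem_interior _ h1
      · obtain ⟨h3, -⟩ := T.vertex hne (e := x.2) (e' := b)
          (by rw [hx', ← hθ]; exact hA) (by rw [← hb]; exact hB)
        rw [hθ, ← hx', h3] at h1
        exact (T.A i).endpt_notMem_interior _ h1
  · exact ⟨e, he.symm.trans hθ⟩

variable [Finite ι]

/-- The value of the horizontal profile at a point of the surface. -/
noncomputable def height (θ : Real.Angle) (z : ℂ) : ℝ :=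
  -- On the sphere the denominator is ‖q.2‖², so the equation of a tile says that its horizontal
  -- profile, as an odd function of the deviation from θ, equals the height.
  ‖z‖ ^ 2 * T.prof θ z.arg / (1 - ‖z‖ ^ 2)

/-- The deviation of the surface from the meridian. -/
noncomputable def shift (θ : Real.Angle) (z : ℂ) : ℝ :=
  T.invProf (T.idx θ z.arg) (T.height θ z)

/-- The surface near a meridian as a graph. -/
def graph (θ : Real.Angle) : Set (ℂ × ℂ) :=
  {q | q ∈ sphereC ∧ q.2 ≠ 0 ∧ (q.2.arg : Real.Angle) = θ + (T.shift θ q.1 : Real.Angle)}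

theorem shift_eq_zero {θ : Real.Angle} {z : ℂ} (h : T.height θ z = 0) : T.shift θ z = 0 := by
  rw [shift, h, (T.invProf_spec _).2.1]

theorem contDiffAt_height {θ : Real.Angle} {z : ℂ} (hz : ‖z‖ < 1) :
    ContDiffAt ℝ 1 (T.height θ) z := by
  refine ContDiffAt.div (contDiff_normSq_mul_arg fun φ => T.contDiffAt_prof θ φ).contDiffAt
    (contDiffAt_const.sub (contDiff_norm_sq ℝ).contDiffAt) ?_
  nlinarith [norm_nonneg z]

/-- The inverse profiles all have derivative 1 at 0, and the index changes only at z = 0 and over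
the ends of sides, where the height vanishes. -/
theorem contDiffAt_shift {θ : Real.Angle} {z : ℂ} (hz : ‖z‖ < 1) (h : T.height θ z = 0) :
    ContDiffAt ℝ 1 (T.shift θ) z := by
  refine contDiffAt_glue (T.contDiffAt_height hz) h (u := T.invProf)
    (j := fun z : ℂ => T.idx θ z.arg) (fun o => (T.invProf_spec o).1)
    (fun o => (T.invProf_spec o).2.1) (fun o => (T.invProf_spec o).2.2.1) ?_
  refine Eventually.of_forall fun w hw => ?_
  have hw0 : w ≠ 0 := by
    rintro rfl
    simp [height] at hw
  have hend : (w.arg : Real.Angle) ∉ T.ends θ := fun hend => by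
    simp [height, T.prof_eq_zero hend] at hw
  exact (continuousAt_argAngle hw0).eventually (T.eventually_idx_eq hend)

theorem norm_fst_lt {q : ℂ × ℂ} (hq : q ∈ sphereC) (h : q.2 ≠ 0) : ‖q.1‖ < 1 := by
  have h1 : 0 < ‖q.2‖ := norm_pos_iff.2 h
  have h2 : ‖q.1‖ ^ 2 + ‖q.2‖ ^ 2 = 1 := hq
  nlinarith [norm_nonneg q.1]

theorem isC1SurfaceAt_graph {θ : Real.Angle} {p : ℂ × ℂ} (hp : p ∈ sphereC) (hp2 : p.2 ≠ 0)
    (h : T.height θ p.1 = 0) :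
    IsC1SurfaceAt (toE4 '' T.graph θ) (toE4 p) := by
  have hz := norm_fst_lt hp hp2
  have hev : ∀ᶠ z in 𝓝 p.1, ContDiffAt ℝ 1 (T.shift θ) z ∧ ‖z‖ < 1 :=
    ((T.contDiffAt_shift hz h).eventually (by simp)).and
      (continuous_norm.continuousAt.eventually (gt_mem_nhds hz))
  obtain ⟨V, hV, hVo, hpV⟩ := eventually_nhds_iff.1 hev
  have hs : ∀ z ∈ V, 0 < 1 - ‖z‖ ^ 2 := fun z hz => by
    nlinarith [norm_nonneg z, (hV z hz).2]
  refine isC1SurfaceAt_of_leftInverse (U := V ×ˢ univ) (V := V) (l := Prod.fst)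
    (g := fun z => (z, (Real.sqrt (1 - ‖z‖ ^ 2) : ℂ) * ((θ + (T.shift θ z : Real.Angle)).toCircle : ℂ)))
    (hVo.prod isOpen_univ) ⟨hpV, mem_univ _⟩ hVo (fun z hz => ContDiffAt.contDiffWithinAt ?_)
    (fun z _ => differentiableAt_fst) (fun z _ => rfl) ?_
  · refine contDiffAt_id.prodMk (ContDiffAt.mul ?_ ?_)
    · have h1 : ContDiffAt ℝ 1 (fun z : ℂ => Real.sqrt (1 - ‖z‖ ^ 2)) z :=
        (contDiffAt_const.sub (contDiff_norm_sq ℝ).contDiffAt).sqrt (hs z hz).ne'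
      exact Complex.ofRealCLM.contDiff.contDiffAt.comp z h1
    · exact ((contDiff_toCircle_add θ).of_le (by simp)).contDiffAt.comp z (hV z hz).1
  · ext q
    constructor
    · rintro ⟨z, hz, rfl⟩
      have h1 := Real.sqrt_pos.2 (hs z hz)
      have h2 := norm_mul_toCircle h1.le (θ + (T.shift θ z : Real.Angle))
      refine ⟨⟨?_, ?_, arg_mul_toCircle h1 _⟩, hz, mem_univ _⟩
      · simp only [sphereC, mem_ofPred_eq, h2]
        rw [Real.sq_sqrt (hs z hz).le]
        ring
      · rw [← norm_ne_zero_iff]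
        exact h2.trans_ne h1.ne'
    · rintro ⟨⟨h1, h2, h3⟩, h4, -⟩
      refine ⟨q.1, h4, Prod.ext rfl ?_⟩
      have h5 : Real.sqrt (1 - ‖q.1‖ ^ 2) = ‖q.2‖ := by
        rw [← Real.sqrt_sq (norm_nonneg q.2)]
        congr 1
        have h6 : ‖q.1‖ ^ 2 + ‖q.2‖ ^ 2 = 1 := h1
        linarith
      simp only
      rw [h5, ← h3, ← eq_norm_mul_toCircle]

/-- At height 0 any index serves, because all profiles vanish at 0. This is why the index need not
be the one chosen by `idx` at the ends. -/
theorem hprof_eq_height_iff {θ : Real.Angle} {z : ℂ} {x : ℝ} {o : Option (ι × Bool)}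
    (ho : T.height θ z ≠ 0 → T.idx θ z.arg = o) (h1 : T.invProf o (T.hprof o x) = x)
    (h2 : T.hprof o (T.invProf o (T.height θ z)) = T.height θ z) :
    T.hprof o x = T.height θ z ↔ x = T.shift θ z := by
  by_cases h : T.height θ z = 0
  · rw [T.shift_eq_zero h, h]
    constructor
    · intro h3
      rw [← h1, h3, (T.invProf_spec o).2.1]
    · rintro rfl
      exact (T.prof_spec o).1.2.1
  · rw [shift, ho h]
    constructor
    · intro h3
      rw [← h3, h1]
    · intro h3
      rw [h3, h2]

/-- Near p the angle of q.2 is replaced by a small real deviation x from θ, for which all the local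
inverses of profiles are valid at once. -/
theorem eventually_exists_angle {θ : Real.Angle} {p : ℂ × ℂ} (hp : p ∈ sphereC) (hp2 : p.2 ≠ 0)
    (hθ : (p.2.arg : Real.Angle) = θ) (h : T.height θ p.1 = 0) {P : ℝ → Prop}
    (hP : ∀ᶠ x in 𝓝 0, P x) : ∀ᶠ q in 𝓝 p, ∃ x : ℝ, P x ∧ q.2 ≠ 0 ∧
      (q.2.arg : Real.Angle) = θ + (x : Real.Angle) ∧
      (q ∈ T.graph θ ↔ q ∈ sphereC ∧ x = T.shift θ q.1) ∧
      ∀ o, T.invProf o (T.hprof o x) = x ∧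
        T.hprof o (T.invProf o (T.height θ q.1)) = T.height θ q.1 := by
  have hz := norm_fst_lt hp hp2
  obtain ⟨x, hx, hx0, hxeq⟩ := exists_angle_eq_add_arg hp2 θ hθ
  have c1 : Tendsto (fun q : ℂ × ℂ => x q.2) (𝓝 p) (𝓝 0) := by
    have := hx.continuousAt.tendsto
    rw [hx0] at this
    exact this.comp continuous_snd.continuousAt
  have c2 : Tendsto (fun q : ℂ × ℂ => T.shift θ q.1) (𝓝 p) (𝓝 0) := by
    have := (T.contDiffAt_shift hz h).continuousAt.tendsto
    rw [T.shift_eq_zero h] at this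
    exact this.comp continuous_fst.continuousAt
  have c3 : Tendsto (fun q : ℂ × ℂ => T.height θ q.1) (𝓝 p) (𝓝 0) := by
    have := (T.contDiffAt_height (θ := θ) hz).continuousAt.tendsto
    rw [h] at this
    exact this.comp continuous_fst.continuousAt
  have hπ : ∀ᶠ x : ℝ in 𝓝 0, |x| < Real.pi := by
    filter_upwards [Metric.ball_mem_nhds (0 : ℝ) Real.pi_pos] with x hx
    simpa using hx
  have e1 : ∀ᶠ x in 𝓝 0, ∀ o, T.invProf o (T.hprof o x) = x :=
    eventually_all.2 fun o => (T.invProf_spec o).2.2.2.1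
  have e2 : ∀ᶠ t in 𝓝 0, ∀ o, T.hprof o (T.invProf o t) = t :=
    eventually_all.2 fun o => (T.invProf_spec o).2.2.2.2
  filter_upwards [c1.eventually hP, c1.eventually hπ, c2.eventually hπ, c1.eventually e1,
    c3.eventually e2, continuous_snd.continuousAt.eventually (isOpen_ne.mem_nhds hp2)]
    with q h1 h2 h3 h4 h5 h6
  refine ⟨x q.2, h1, h6, hxeq _ h6, ?_, fun o => ⟨h4 o, h5 o⟩⟩
  have h7 := hxeq _ h6
  constructor
  · rintro ⟨h8, -, h9⟩
    exact ⟨h8, coe_angle_inj_of_abs_lt h2 h3 (add_left_cancel (h7.symm.trans h9))⟩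
  · rintro ⟨h8, h9⟩
    exact ⟨h8, h6, by rw [h7, h9]⟩

theorem height_eq_zero_of_base {θ : Real.Angle} {z : ℂ} (h : z = 0 ∨ (z.arg : Real.Angle) ∈ T.ends θ) :
    T.height θ z = 0 := by
  rcases h with rfl | h
  · simp [height]
  · simp [height, T.prof_eq_zero h]

/-- Only rectangles with a side on the meridian come near p. In terms of the deviation y the
equation of such a tile is y = `T.shift θ q.1`. That q.2 is on the correct side of the meridian
needs no extra condition: the vertical profile is nonnegative on its side, and this determines the
sign of y. -/
theorem eventually_mem_surf_iff {θ : Real.Angle} {p : ℂ × ℂ} (hp : p ∈ sphereC) (hp2 : p.2 ≠ 0)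
    (hθ : (p.2.arg : Real.Angle) = θ) (h : p.1 = 0 ∨ (p.1.arg : Real.Angle) ∈ T.ends θ)
    (hne : (T.adj θ).Nonempty) :
    ∀ᶠ q in 𝓝 p, q ∈ T.surf ↔ q ∈ T.graph θ ∧ q.1 ∈ sector (T.sides θ) := by
  have hfar : ∀ᶠ q in 𝓝 p, ∀ i, q ∈ disc (T.A i) (T.B i) → ∃ e, (i, e) ∈ T.adj θ := by
    refine eventually_all.2 fun i => ?_
    by_cases hi : p ∈ disc (T.A i) (T.B i)
    · exact Eventually.of_forall fun _ _ => T.exists_adj_of_mem_disc hp2 hθ h hi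
    · filter_upwards [(isClosed_disc _ _).isOpen_compl.mem_nhds hi] with q hq hq'
      exact absurd hq' hq
  have hP : ∀ᶠ y : ℝ in 𝓝 0, ∀ x ∈ T.adj θ,
      (θ + (y : Real.Angle) ∈ (T.A x.1).carrier ↔ 0 ≤ TArc.sgn x.2 * y) ∧
      (0 ≤ TArc.sgn x.2 * y → (T.A x.1).val (θ + (y : Real.Angle)) = TArc.sgn x.2 * (T.A x.1).fn y) ∧
      (0 ≤ TArc.sgn x.2 * (T.A x.1).fn y ↔ 0 ≤ TArc.sgn x.2 * y) := by
    refine (eventually_all_finite (toFinite (T.adj θ))).2 fun x hx => ?_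
    have := (T.A x.1).eventually_endpt x.2
    rwa [show (T.A x.1).endpt x.2 = θ from hx] at this
  filter_upwards [hfar, T.eventually_exists_angle hp hp2 hθ (T.height_eq_zero_of_base h) hP]
    with q hq1 ⟨y, hy, hq2, hqy, hqg, hinv⟩
  rw [hqg]
  have n2 : 0 < ‖q.2‖ ^ 2 := by positivity
  have key : ∀ x ∈ T.adj θ, q ∈ sphereC → q.1 ∈ sector (T.B x.1).carrier →
      (‖q.1‖ ^ 2 * (T.B x.1).val q.1.arg = ‖q.2‖ ^ 2 * (TArc.sgn x.2 * (T.A x.1).fn y) ↔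
        y = T.shift θ q.1) := by
    intro x hx hs hsec
    have hprof : ‖q.1‖ ^ 2 * T.prof θ q.1.arg =
        TArc.sgn x.2 * (‖q.1‖ ^ 2 * (T.B x.1).val q.1.arg) := by
      rcases hsec with h0 | h1
      · simp [h0]
      · rw [T.prof_eq hx h1]; ring
    rw [← T.hprof_eq_height_iff (o := some x) ?_ (hinv _).1 (hinv _).2, height, hprof,
      show 1 - ‖q.1‖ ^ 2 = ‖q.2‖ ^ 2 by
        have : ‖q.1‖ ^ 2 + ‖q.2‖ ^ 2 = 1 := hs
        linarith, eq_div_iff n2.ne']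
    · change _ ↔ (T.A x.1).fn y * _ = _
      have hsg := TArc.sgn_mul_self x.2
      constructor
      · intro h1
        rw [h1]
        linear_combination (-(T.A x.1).fn y * ‖q.2‖ ^ 2) * hsg
      · intro h1
        linear_combination (-TArc.sgn x.2) * h1 - (‖q.1‖ ^ 2 * (T.B x.1).val q.1.arg) * hsg
    · intro hh
      rcases hsec with h0 | h1
      · exact absurd (T.height_eq_zero_of_base (Or.inl h0)) hh
      · exact T.idx_eq_some hx h1 fun h2 => hh (T.height_eq_zero_of_base (Or.inr h2))
  constructor
  · intro hs
    obtain ⟨i, hi⟩ := T.mem_surf.1 hs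
    obtain ⟨e, hx⟩ := hq1 i hi
    obtain ⟨k1, k2, -⟩ := hy (i, e) hx
    have hA := hi.2.2.1.resolve_left hq2
    rw [hqy] at hA
    have heq := hi.2.2.2
    rw [hqy, k2 (k1.1 hA)] at heq
    exact ⟨⟨hi.1, (key (i, e) hx hi.1 hi.2.1).1 heq⟩, hi.2.1.imp_right fun h1 => ⟨_, hx, h1⟩⟩
  · rintro ⟨⟨hs, hsh⟩, hsec⟩
    obtain ⟨x, hx, hsecx⟩ : ∃ x ∈ T.adj θ, q.1 ∈ sector (T.B x.1).carrier := by
      rcases hsec with h0 | ⟨x, hx, h1⟩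
      · obtain ⟨x, hx⟩ := hne
        exact ⟨x, hx, Or.inl h0⟩
      · exact ⟨x, hx, Or.inr h1⟩
    obtain ⟨k1, k2, k3⟩ := hy x hx
    have heq := (key x hx hs hsecx).2 hsh
    have hnn : 0 ≤ ‖q.1‖ ^ 2 * (T.B x.1).val q.1.arg := by
      rcases hsecx with h0 | h1
      · simp [h0]
      · exact mul_nonneg (by positivity) ((T.B x.1).val_nonneg h1)
    rw [heq] at hnn
    have hy0 := k3.1 (nonneg_of_mul_nonneg_right hnn n2)
    refine T.mem_surf.2 ⟨x.1, hs, hsecx, Or.inr ?_, ?_⟩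
    · rw [hqy]
      exact k1.2 hy0
    · rw [hqy, k2 hy0, heq]

/-! ### Continuation of the graph beyond the sides. -/

/-- A piece of a surface which continues the surface across the free sides of a meridian. -/
def ext (c : ℝ) (θ : Real.Angle) : Set (ℂ × ℂ) :=
  -- The two inequalities for ‖q.1‖ and the cosine keep the piece near the meridian; the equation is
  -- that of the graph with sine as horizontal profile. The factors ‖q.2‖² make the conditions on
  -- the angle closed ones.
  {q | q ∈ sphereC ∧ ‖q.1‖ ≤ 2 * ‖q.2‖ ∧ q.1 ∈ sector (closure (T.sides θ)ᶜ) ∧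
    ‖q.2‖ ^ 2 * c ≤ ‖q.2‖ ^ 2 * ((q.2.arg : Real.Angle) - θ).cos ∧
    ‖q.2‖ ^ 2 * ((q.2.arg : Real.Angle) - θ).sin = ‖q.1‖ ^ 2 * T.fill θ q.1.arg}

theorem prof_eq_fill_of_mem_closure {θ φ : Real.Angle} (h : φ ∈ closure (T.sides θ)ᶜ) :
    T.prof θ φ = T.fill θ φ := by
  by_cases h1 : φ ∈ T.sides θ
  · obtain ⟨h2, h3⟩ := T.free_of_mem_closure_compl h1 h
    have h4 := (T.fill_eq h3).self_of_nhds
    rw [T.prof_eq_zero h2]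
    simpa [eq_comm] using h4
  · exact T.prof_eq_fill h1

theorem eventually_mem_ext_iff {c : ℝ} (hc : c < 1) {θ : Real.Angle} {p : ℂ × ℂ} (hp : p ∈ sphereC)
    (hp2 : p.2 ≠ 0) (hθ : (p.2.arg : Real.Angle) = θ)
    (h : p.1 = 0 ∨ (p.1.arg : Real.Angle) ∈ T.ends θ) (hlt : ‖p.1‖ < 2 * ‖p.2‖) :
    ∀ᶠ q in 𝓝 p, q ∈ T.ext c θ ↔ q ∈ T.graph θ ∧ q.1 ∈ sector (closure (T.sides θ)ᶜ) := by
  have hP : ∀ᶠ y : ℝ in 𝓝 0, c < Real.cos y :=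
    Real.continuous_cos.continuousAt.eventually (lt_mem_nhds (by rwa [Real.cos_zero]))
  have hlt' : ∀ᶠ q : ℂ × ℂ in 𝓝 p, ‖q.1‖ < 2 * ‖q.2‖ := by
    have h1 : Continuous fun q : ℂ × ℂ => ‖q.1‖ := by fun_prop
    have h2 : Continuous fun q : ℂ × ℂ => 2 * ‖q.2‖ := by fun_prop
    exact h1.continuousAt.eventually_lt h2.continuousAt hlt
  filter_upwards [hlt', T.eventually_exists_angle hp hp2 hθ (T.height_eq_zero_of_base h) hP]
    with q hq1 ⟨y, hy, hq2, hqy, hqg, hinv⟩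
  rw [hqg]
  have n2 : 0 < ‖q.2‖ ^ 2 := by positivity
  simp only [ext, mem_ofPred_eq, hqy, add_sub_cancel_left, Real.Angle.cos_coe, Real.Angle.sin_coe]
  have key : q ∈ sphereC → q.1 ∈ sector (closure (T.sides θ)ᶜ) →
      (‖q.2‖ ^ 2 * Real.sin y = ‖q.1‖ ^ 2 * T.fill θ q.1.arg ↔ y = T.shift θ q.1) := by
    intro hs hsec
    have hprof : ‖q.1‖ ^ 2 * T.prof θ q.1.arg = ‖q.1‖ ^ 2 * T.fill θ q.1.arg := by
      rcases hsec with h0 | h1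
      · simp [h0]
      · rw [T.prof_eq_fill_of_mem_closure h1]
    rw [← T.hprof_eq_height_iff (o := none) ?_ (hinv _).1 (hinv _).2, height, hprof,
      show 1 - ‖q.1‖ ^ 2 = ‖q.2‖ ^ 2 by
        have : ‖q.1‖ ^ 2 + ‖q.2‖ ^ 2 = 1 := hs
        linarith, eq_div_iff n2.ne', mul_comm]
    · rfl
    · intro hh
      rw [T.idx_eq_none_iff]
      intro h2
      rcases hsec with h0 | h1
      · exact hh (T.height_eq_zero_of_base (Or.inl h0))
      · exact hh (T.height_eq_zero_of_base (Or.inr (T.free_of_mem_closure_compl h2 h1).1))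
  constructor
  · rintro ⟨h1, -, h3, -, h5⟩
    exact ⟨⟨h1, (key h1 h3).1 h5⟩, h3⟩
  · rintro ⟨⟨h1, h2⟩, h3⟩
    exact ⟨h1, hq1.le, h3, mul_le_mul_of_nonneg_left hy.le n2.le, (key h1 h3).2 h2⟩

end TileSystem

/-! ### Surfaces: further tools -/

theorem isC1SurfaceAt_of_eventually {S : Set (ℂ × ℂ)} {p : ℂ × ℂ} {ξ₀ : ℂ} {g : ℂ → ℂ × ℂ}
    {l : ℂ × ℂ → ℂ} (hg₀ : g ξ₀ = p)
    (h : ∀ᶠ ξ in 𝓝 ξ₀, ContDiffAt ℝ 1 g ξ ∧ DifferentiableAt ℝ l (g ξ) ∧ l (g ξ) = ξ ∧ g ξ ∈ S)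
    (hS : ∀ᶠ q in 𝓝 p, q ∈ S → g (l q) = q) : IsC1SurfaceAt (toE4 '' S) (toE4 p) := by
  obtain ⟨V, hV, hVo, hξV⟩ := eventually_nhds_iff.1 h
  have hl0 : l p = ξ₀ := hg₀ ▸ (hV ξ₀ hξV).2.2.1
  have hlc : ContinuousAt l p := hg₀ ▸ (hV ξ₀ hξV).2.1.continuousAt
  have hlV : ∀ᶠ q in 𝓝 p, l q ∈ V := hlc.eventually (hVo.mem_nhds (hl0.symm ▸ hξV))
  obtain ⟨U, hU, hUo, hpU⟩ := eventually_nhds_iff.1 (hS.and hlV)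
  have hcont : ContinuousOn g V := fun ξ hξ => (hV ξ hξ).1.continuousAt.continuousWithinAt
  refine isC1SurfaceAt_of_leftInverse hUo hpU (hcont.isOpen_inter_preimage hVo hUo)
    (fun ξ hξ => (hV ξ hξ.1).1.contDiffWithinAt) (fun ξ hξ => (hV ξ hξ.1).2.1)
    (fun ξ hξ => (hV ξ hξ.1).2.2.1) ?_
  ext q
  constructor
  · rintro ⟨ξ, hξ, rfl⟩
    exact ⟨(hV ξ hξ.1).2.2.2, hξ.2⟩
  · rintro ⟨h1, h2⟩
    have h3 := (hU q h2).1 h1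
    exact ⟨l q, ⟨(hU q h2).2, by rwa [mem_preimage, h3]⟩, h3⟩

theorem IsC1SurfaceAt.image {M : Set E4} {p : E4} (h : IsC1SurfaceAt M p) (L : E4 ≃L[ℝ] E4) :
    IsC1SurfaceAt (L '' M) (L p) := by
  obtain ⟨U, V, f, hU, hp, hV, hf, hinj, hemb, him⟩ := h
  refine ⟨L '' U, V, L ∘ f, L.toHomeomorph.isOpenMap U hU, ⟨p, hp, rfl⟩, hV,
    L.contDiff.comp_contDiffOn hf, fun x hx => ?_, ?_, ?_⟩
  · have h1 : DifferentiableAt ℝ f x := (hf.contDiffAt (hV.mem_nhds hx)).differentiableAt (by simp)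
    have h2 : fderiv ℝ (L ∘ f) x = (L : E4 →L[ℝ] E4).comp (fderiv ℝ f x) :=
      ((L : E4 →L[ℝ] E4).hasFDerivAt.comp x h1.hasFDerivAt).fderiv
    rw [h2]
    exact L.injective.comp (hinj x hx)
  · have : V.domRestrict (L ∘ f) = L ∘ V.domRestrict f := rfl
    rw [this]
    exact L.toHomeomorph.isEmbedding.comp hemb
  · rw [image_comp, him, image_inter L.injective]

theorem isC1SurfaceAt_swap {S : Set (ℂ × ℂ)} {p : ℂ × ℂ}
    (h : IsC1SurfaceAt (toE4 '' (Prod.swap ⁻¹' S)) (toE4 p.swap)) :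
    IsC1SurfaceAt (toE4 '' S) (toE4 p) := by
  let e : (ℂ × ℂ) ≃L[ℝ] (ℂ × ℂ) := ContinuousLinearEquiv.prodComm ℝ ℂ ℂ
  let L : E4 ≃L[ℝ] E4 := (toE4L.symm.trans e).trans toE4L
  have hL : ∀ q, L (toE4 q) = toE4 q.swap := fun q => by
    change toE4L (e (toE4L.symm (toE4L q))) = toE4L q.swap
    rw [ContinuousLinearEquiv.symm_apply_apply]
    rfl
  have h1 := h.image L
  rw [hL, Prod.swap_swap, image_image] at h1
  simp only [hL] at h1
  rwa [← image_image toE4 Prod.swap, image_preimage_eq _ Prod.swap_surjective] at h1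

/-- The interior of a tile is a surface. -/
theorem isC1SurfaceAt_of_mem_openDisc {A B : TArc} {p : ℂ × ℂ} (hp : p ∈ openDisc A B) :
    IsC1SurfaceAt (toE4 '' disc A B) (toE4 p) := by
  obtain ⟨hpd, hp1, hp2, hpB, hpA⟩ := hp
  obtain ⟨y, hy, hy0, hyeq⟩ := exists_angle_eq_add_arg hp1 _ rfl
  obtain ⟨x, hx, hx0, hxeq⟩ := exists_angle_eq_add_arg hp2 _ rfl
  set φ₀ : Real.Angle := (p.1.arg : Real.Angle)
  set θ₀ : Real.Angle := (p.2.arg : Real.Angle)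
  let f : ℂ → ℝ := fun ξ => B.val (φ₀ + (ξ.im : Real.Angle))
  let g : ℂ → ℝ := fun ξ => A.val (θ₀ + (ξ.re : Real.Angle))
  -- The two angles serve as coordinates: the moduli are found from c² + s² = 1 and c² f = s² g, and
  -- l recovers the angles.
  let G : ℂ → ℂ × ℂ := fun ξ =>
    ((Real.sqrt (g ξ / (f ξ + g ξ)) : ℂ) * ((φ₀ + (ξ.im : Real.Angle)).toCircle : ℂ),
      (Real.sqrt (f ξ / (f ξ + g ξ)) : ℂ) * ((θ₀ + (ξ.re : Real.Angle)).toCircle : ℂ))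
  let l : ℂ × ℂ → ℂ := fun q => (x q.2 : ℂ) + (y q.1 : ℂ) * Complex.I
  have hf : ContDiffAt ℝ 1 f 0 :=
    ContDiffAt.comp (0 : ℂ) (g := fun t : ℝ => B.val (φ₀ + (t : Real.Angle)))
      (by simpa using B.contDiffAt_val_add hpB) Complex.imCLM.contDiff.contDiffAt
  have hg : ContDiffAt ℝ 1 g 0 :=
    ContDiffAt.comp (0 : ℂ) (g := fun t : ℝ => A.val (θ₀ + (t : Real.Angle)))
      (by simpa using A.contDiffAt_val_add hpA) Complex.reCLM.contDiff.contDiffAt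
  have hfpos : ∀ᶠ ξ in 𝓝 (0 : ℂ), φ₀ + (ξ.im : Real.Angle) ∈ B.interior := by
    have hc : Continuous fun ξ : ℂ => φ₀ + (ξ.im : Real.Angle) :=
      continuous_const.add (Real.Angle.continuous_coe.comp Complex.continuous_im)
    exact hc.continuousAt.eventually (B.isOpen_interior.mem_nhds (by simpa using hpB))
  have hgpos : ∀ᶠ ξ in 𝓝 (0 : ℂ), θ₀ + (ξ.re : Real.Angle) ∈ A.interior := by
    have hc : Continuous fun ξ : ℂ => θ₀ + (ξ.re : Real.Angle) :=
      continuous_const.add (Real.Angle.continuous_coe.comp Complex.continuous_re)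
    exact hc.continuousAt.eventually (A.isOpen_interior.mem_nhds (by simpa using hpA))
  have hG : ∀ ξ : ℂ, 0 < f ξ → 0 < g ξ →
      (0 < Real.sqrt (g ξ / (f ξ + g ξ)) ∧ 0 < Real.sqrt (f ξ / (f ξ + g ξ))) ∧
      Real.sqrt (g ξ / (f ξ + g ξ)) ^ 2 = g ξ / (f ξ + g ξ) ∧
      Real.sqrt (f ξ / (f ξ + g ξ)) ^ 2 = f ξ / (f ξ + g ξ) := fun ξ h1 h2 =>
    ⟨⟨by positivity, by positivity⟩, Real.sq_sqrt (by positivity), Real.sq_sqrt (by positivity)⟩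
  have hnorm : ∀ q ∈ disc A B, q.1 ≠ 0 → q.2 ≠ 0 → (q.1.arg : Real.Angle) ∈ B.interior →
      (q.2.arg : Real.Angle) ∈ A.interior → G (l q) = q := by
    intro q hq h1 h2 h3 h4
    have hre : (l q).re = x q.2 := by simp [l]
    have him : (l q).im = y q.1 := by simp [l]
    have hs := hq.1
    have heq := hq.2.2.2
    have hfq : f (l q) = B.val q.1.arg := by simp only [f, him, ← hyeq q.1 h1]
    have hgq : g (l q) = A.val q.2.arg := by simp only [g, hre, ← hxeq q.2 h2]
    have hfp := B.val_pos h3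
    have hgp := A.val_pos h4
    have e1 : g (l q) / (f (l q) + g (l q)) = ‖q.1‖ ^ 2 := by
      rw [hfq, hgq, div_eq_iff (by positivity)]
      linear_combination (-A.val q.2.arg) * hs - heq
    have e2 : f (l q) / (f (l q) + g (l q)) = ‖q.2‖ ^ 2 := by
      rw [hfq, hgq, div_eq_iff (by positivity)]
      linear_combination (-B.val q.1.arg) * hs + heq
    simp only [G, e1, e2, Real.sqrt_sq (norm_nonneg _), hre, him]
    rw [← hyeq q.1 h1, ← hxeq q.2 h2, ← eq_norm_mul_toCircle, ← eq_norm_mul_toCircle]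
  have hlp : l p = 0 := by simp [l, hx0, hy0]
  have hGp : G 0 = p := hlp ▸ hnorm p hpd hp1 hp2 hpB hpA
  have e1 : ∀ᶠ q : ℂ × ℂ in 𝓝 p, q.1 ≠ 0 ∧ (q.1.arg : Real.Angle) ∈ B.interior ∧
      ContDiffAt ℝ 1 y q.1 ∧ |y q.1| < Real.pi := by
    have h1 : ∀ᶠ z in 𝓝 p.1, z ≠ 0 ∧ (z.arg : Real.Angle) ∈ B.interior ∧
        ContDiffAt ℝ 1 y z ∧ |y z| < Real.pi := by
      have h0 : ∀ᶠ z in 𝓝 p.1, z ≠ 0 := isOpen_ne.mem_nhds hp1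
      refine h0.and (((continuousAt_argAngle hp1).eventually (B.isOpen_interior.mem_nhds hpB)).and
        (((hy.of_le (by simp)).eventually (by simp)).and ?_))
      exact hy.continuousAt.abs.eventually (gt_mem_nhds (by simpa [hy0] using Real.pi_pos))
    exact continuous_fst.continuousAt.eventually h1
  have e2 : ∀ᶠ q : ℂ × ℂ in 𝓝 p, q.2 ≠ 0 ∧ (q.2.arg : Real.Angle) ∈ A.interior ∧
      ContDiffAt ℝ 1 x q.2 ∧ |x q.2| < Real.pi := by
    have h1 : ∀ᶠ z in 𝓝 p.2, z ≠ 0 ∧ (z.arg : Real.Angle) ∈ A.interior ∧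
        ContDiffAt ℝ 1 x z ∧ |x z| < Real.pi := by
      have h0 : ∀ᶠ z in 𝓝 p.2, z ≠ 0 := isOpen_ne.mem_nhds hp2
      refine h0.and (((continuousAt_argAngle hp2).eventually (A.isOpen_interior.mem_nhds hpA)).and
        (((hx.of_le (by simp)).eventually (by simp)).and ?_))
      exact hx.continuousAt.abs.eventually (gt_mem_nhds (by simpa [hx0] using Real.pi_pos))
    exact continuous_snd.continuousAt.eventually h1
  have hGc : ContDiffAt ℝ 1 G 0 := by
    have h1 := B.val_pos hfpos.self_of_nhds
    have h2 := A.val_pos hgpos.self_of_nhds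
    have hne : f 0 + g 0 ≠ 0 := (add_pos h1 h2).ne'
    refine ContDiffAt.prodMk (ContDiffAt.mul ?_ ?_) (ContDiffAt.mul ?_ ?_)
    · exact Complex.ofRealCLM.contDiff.contDiffAt.comp (0 : ℂ)
        ((hg.div (hf.add hg) hne).sqrt (div_pos h2 (add_pos h1 h2)).ne')
    · exact ((contDiff_toCircle_add φ₀).of_le (by simp)).contDiffAt.comp (0 : ℂ)
        Complex.imCLM.contDiff.contDiffAt
    · exact Complex.ofRealCLM.contDiff.contDiffAt.comp (0 : ℂ)
        ((hf.div (hf.add hg) hne).sqrt (div_pos h1 (add_pos h1 h2)).ne')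
    · exact ((contDiff_toCircle_add θ₀).of_le (by simp)).contDiffAt.comp (0 : ℂ)
        Complex.reCLM.contDiff.contDiffAt
  have hGt : Tendsto G (𝓝 0) (𝓝 p) := hGp ▸ hGc.continuousAt.tendsto
  have hre : ∀ᶠ ξ in 𝓝 (0 : ℂ), |ξ.re| < Real.pi :=
    Complex.continuous_re.abs.continuousAt.eventually (gt_mem_nhds (by simpa using Real.pi_pos))
  have him : ∀ᶠ ξ in 𝓝 (0 : ℂ), |ξ.im| < Real.pi :=
    Complex.continuous_im.abs.continuousAt.eventually (gt_mem_nhds (by simpa using Real.pi_pos))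
  refine isC1SurfaceAt_of_eventually (g := G) (l := l) hGp ?_ ?_
  · filter_upwards [hGc.eventually (by simp), hGt.eventually e1, hGt.eventually e2, hfpos, hgpos,
      hre, him] with ξ h1 h2 h3 h4 h5 h6 h7
    have hfp : 0 < f ξ := B.val_pos h4
    have hgp : 0 < g ξ := A.val_pos h5
    obtain ⟨⟨hc, hs⟩, hc2, hs2⟩ := hG ξ hfp hgp
    have a1 : ((G ξ).1.arg : Real.Angle) = φ₀ + (ξ.im : Real.Angle) := arg_mul_toCircle hc _
    have a2 : ((G ξ).2.arg : Real.Angle) = θ₀ + (ξ.re : Real.Angle) := arg_mul_toCircle hs _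
    have n1 : ‖(G ξ).1‖ = Real.sqrt (g ξ / (f ξ + g ξ)) := norm_mul_toCircle hc.le _
    have n2 : ‖(G ξ).2‖ = Real.sqrt (f ξ / (f ξ + g ξ)) := norm_mul_toCircle hs.le _
    refine ⟨h1, ?_, ?_, ?_, Or.inr (B.interior_subset h2.2.1), Or.inr (A.interior_subset h3.2.1), ?_⟩
    · have d1 : DifferentiableAt ℝ (fun q : ℂ × ℂ => (x q.2 : ℂ)) (G ξ) :=
        Complex.ofRealCLM.differentiableAt.comp (G ξ)
          ((h3.2.2.1.differentiableAt (by simp)).comp (G ξ) differentiableAt_snd)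
      have d2 : DifferentiableAt ℝ (fun q : ℂ × ℂ => (y q.1 : ℂ)) (G ξ) :=
        Complex.ofRealCLM.differentiableAt.comp (G ξ)
          ((h2.2.2.1.differentiableAt (by simp)).comp (G ξ) differentiableAt_fst)
      exact d1.add (d2.mul (differentiableAt_const _))
    · have b1 := coe_angle_inj_of_abs_lt h2.2.2.2 h7
        (add_left_cancel ((hyeq _ h2.1).symm.trans a1))
      have b2 := coe_angle_inj_of_abs_lt h3.2.2.2 h6
        (add_left_cancel ((hxeq _ h3.1).symm.trans a2))
      simp only [l, b1, b2]
      exact Complex.re_add_im ξ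
    · rw [n1, n2, hc2, hs2]
      field_simp
      ring
    · rw [n1, n2, hc2, hs2, a1, a2]
      change _ * f ξ = _ * g ξ
      field_simp
  · filter_upwards [e1, e2] with q h1 h2 h3
    exact hnorm q h3 h1.1 h2.1 h1.2.1 h2.2.1

/-- A criterion for a compact set to be bounded by its closed subset `L` in some surface. -/
theorem exists_isC1Surface {F L E : Set E4} (hF : IsCompact F) (hFs : F ⊆ sphere3)
    (hL : IsClosed L) (hLF : L ⊆ F) (hE : IsClosed E) (hEs : E ⊆ sphere3)
    (h1 : ∀ p ∈ F, p ∉ L → IsC1SurfaceAt F p) (h2 : ∀ p ∈ L, IsC1SurfaceAt (F ∪ E) p)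
    (h3 : ∀ p ∈ L, ∀ᶠ q in 𝓝 p, q ∈ E → q ∈ F → q ∈ L) (h4 : ∀ p ∈ L, p ∈ closure (E \ F)) :
    ∃ M, IsC1Surface M ∧ F ⊆ M ∧ relInterior M F = F \ L := by
  have hLc : IsCompact L := hF.of_isClosed_subset hL hLF
  -- Far from L the continuation E might meet F elsewhere. Only its part in a compact neighbourhood
  -- N of L is kept, where E ∩ F lies in L.
  obtain ⟨O, hO, hLO, hOE⟩ : ∃ O, IsOpen O ∧ L ⊆ O ∧ ∀ q ∈ O, q ∈ E → q ∈ F → q ∈ L := by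
    refine ⟨interior {q | q ∈ E → q ∈ F → q ∈ L}, isOpen_interior, fun p hp => ?_,
      fun q hq => interior_subset hq⟩
    exact mem_interior_iff_mem_nhds.2 (h3 p hp)
  obtain ⟨N, hN, hNc, hNO⟩ := exists_compact_between hLc hO hLO
  set X := F ∪ (E ∩ N) with hX
  have hXs : X ⊆ sphere3 := union_subset hFs (inter_subset_left.trans hEs)
  have hXF : ∀ p ∈ F, p ∉ L → ∀ᶠ q in 𝓝 p, q ∈ F ↔ q ∈ X := by
    intro p hpF hpL
    have hp : p ∉ E ∩ N := fun hp => hpL (hOE p (hNO hp.2) hp.1 hpF)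
    filter_upwards [(hE.inter hN.isClosed).isOpen_compl.mem_nhds hp] with q hq
    exact ⟨Or.inl, fun h => h.resolve_right hq⟩
  have hXL : ∀ p ∈ L, ∀ᶠ q in 𝓝 p, q ∈ F ∪ E ↔ q ∈ X := by
    intro p hp
    filter_upwards [isOpen_interior.mem_nhds (hNc hp)] with q hq
    exact ⟨fun h => h.imp_right fun h => ⟨h, interior_subset hq⟩, fun h => h.imp_right And.left⟩
  have hC1 : ∀ p ∈ F, IsC1SurfaceAt X p := by
    intro p hp
    by_cases hpL : p ∈ L
    · exact (h2 p hpL).congr (hXL p hpL)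
    · exact (h1 p hp hpL).congr (hXF p hp hpL)
  have hopen : ∀ p, IsC1SurfaceAt X p → ∀ᶠ q in 𝓝 p, q ∈ X → IsC1SurfaceAt X q := by
    rintro p ⟨U, V, f, hU, hp, hV, hf, hinj, hemb, him⟩
    filter_upwards [hU.mem_nhds hp] with q hq _
    exact ⟨U, V, f, hU, hq, hV, hf, hinj, hemb, him⟩
  have hM : ∀ p, IsC1SurfaceAt X p → ∀ᶠ q in 𝓝 p, q ∈ X ↔ q ∈ {q ∈ X | IsC1SurfaceAt X q} := by
    intro p hp
    filter_upwards [hopen p hp] with q hq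
    exact ⟨fun h => ⟨h, hq h⟩, And.left⟩
  -- Cutting by N may leave rough edges; M consists of the points near which X is a surface, and
  -- these form a relatively open subset of X that contains F.
  refine ⟨{q ∈ X | IsC1SurfaceAt X q}, ⟨fun q hq => hXs hq.1, fun p hp => hp.2.congr (hM p hp.2)⟩,
    fun p hp => ⟨Or.inl hp, hC1 p hp⟩, ?_⟩
  ext p
  constructor
  · rintro ⟨hpF, hp⟩
    refine ⟨hpF, fun hpL => ?_⟩
    rw [← eventually_mem_set, eventually_nhdsWithin_iff] at hp
    obtain ⟨q, hq, ⟨h5, h6⟩, h7⟩ := ((mem_closure_iff_frequently.1 (h4 p hpL)).and_eventually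
      ((hp.and (hM p (hC1 p hpF))).and (hXL p hpL))).exists
    exact hq.2 (h5 (h6.1 (h7.1 (Or.inr hq.1))))
  · rintro ⟨hpF, hpL⟩
    refine ⟨hpF, ?_⟩
    rw [← eventually_mem_set, eventually_nhdsWithin_iff]
    filter_upwards [hXF p hpF hpL] with q hq hqM
    exact hq.2 hqM.1

/-! ### The surface is a surface -/

theorem mem_closure_iff_frequently_angle {φ : Real.Angle} {S : Set Real.Angle} :
    φ ∈ closure S ↔ ∃ᶠ y : ℝ in 𝓝 0, φ + (y : Real.Angle) ∈ S := by
  rw [mem_closure_iff_frequently, ← map_add_coe_nhds φ, frequently_map]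

theorem frequently_mul_sgn_neg (b : Bool) : ∃ᶠ y : ℝ in 𝓝 0, TArc.sgn b * y < 0 := by
  refine (mem_closure_iff_frequently (s := {y : ℝ | TArc.sgn b * y < 0})).1 ?_
  cases b
  · have : {y : ℝ | TArc.sgn false * y < 0} = Ioi 0 := by ext y; simp [TArc.sgn]
    rw [this, closure_Ioi]
    exact self_mem_Ici
  · have : {y : ℝ | TArc.sgn true * y < 0} = Iio 0 := by ext y; simp [TArc.sgn]
    rw [this, closure_Iio]
    exact self_mem_Iic

namespace TileSystem

variable {ι : Type} (T : TileSystem ι)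

theorem swap_mem_surf {q : ℂ × ℂ} : q.swap ∈ T.swap.surf ↔ q ∈ T.surf := by
  rw [mem_surf, mem_surf]
  exact exists_congr fun i => swap_mem_disc

theorem preimage_swap_surf : Prod.swap ⁻¹' T.surf = T.swap.surf := by
  ext q
  rw [mem_preimage, ← T.swap_mem_surf, Prod.swap_swap]

theorem swap_mem_sphereC {q : ℂ × ℂ} : q.swap ∈ sphereC ↔ q ∈ sphereC := by
  simp only [sphereC, mem_ofPred_eq, Prod.fst_swap, Prod.snd_swap, add_comm]

theorem sign_swap (i : ι) (e b : Bool) :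
    T.swap.sign ((T.B i).endpt b, (T.A i).endpt e) = T.sign ((T.A i).endpt e, (T.B i).endpt b) := by
  rw [T.sign_eq, mul_comm]
  exact T.swap.sign_eq i b e

/-- The link associated with the free vertices. -/
def edge : Set (ℂ × ℂ) :=
  {q | q ∈ sphereC ∧ ∃ v ∈ T.free, q.1 ∈ sector {v.2} ∧ q.2 ∈ sector {v.1}}

theorem swap_mem_edge {q : ℂ × ℂ} : q.swap ∈ T.swap.edge ↔ q ∈ T.edge := by
  refine and_congr swap_mem_sphereC ⟨?_, ?_⟩
  · rintro ⟨v, hv, h1, h2⟩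
    exact ⟨v.swap, T.swap_mem_free.1 (by rwa [Prod.swap_swap]), h2, h1⟩
  · rintro ⟨v, hv, h1, h2⟩
    exact ⟨v.swap, T.swap_mem_free.2 hv, h2, h1⟩

theorem exists_of_free {v : Torus} (hv : v ∈ T.free) : ∃ i e b, (T.A i).endpt e = v.1 ∧
    (T.B i).endpt b = v.2 ∧ ∀ j, (∃ e, v.1 = (T.A j).endpt e) → (∃ e, v.2 = (T.B j).endpt e) → j = i := by
  obtain ⟨i, ⟨⟨e, he⟩, b, hb⟩, huniq⟩ := hv
  exact ⟨i, e, b, he.symm, hb.symm, fun j h1 h2 => huniq j ⟨h1, h2⟩⟩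

theorem edge_subset : T.edge ⊆ T.surf := by
  rintro q ⟨hq, v, hv, h1, h2⟩
  obtain ⟨i, e, b, he, hb, -⟩ := T.exists_of_free hv
  refine T.mem_surf.2 ⟨i, hq, h1.imp_right ?_, h2.imp_right ?_, ?_⟩
  · rintro h
    rw [mem_singleton_iff] at h
    rw [h, ← hb]
    exact TArc.endpt_mem _ _
  · rintro h
    rw [mem_singleton_iff] at h
    rw [h, ← he]
    exact TArc.endpt_mem _ _
  · have e1 : ‖q.1‖ ^ 2 * (T.B i).val q.1.arg = 0 := by
      rcases h1 with h | h
      · simp [h]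
      · rw [mem_singleton_iff] at h
        rw [h, ← hb, TArc.val_endpt, mul_zero]
    have e2 : ‖q.2‖ ^ 2 * (T.A i).val q.2.arg = 0 := by
      rcases h2 with h | h
      · simp [h]
      · rw [mem_singleton_iff] at h
        rw [h, ← he, TArc.val_endpt, mul_zero]
    rw [e1, e2]

theorem edge_base {v : Torus} (hv : v ∈ T.free) {q : ℂ × ℂ} (h1 : q.1 ∈ sector {v.2}) :
    (q.1 = 0 ∨ (q.1.arg : Real.Angle) ∈ T.ends v.1) ∧ (T.adj v.1).Nonempty := by
  obtain ⟨i, e, b, he, hb, -⟩ := T.exists_of_free hv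
  refine ⟨h1.imp_right fun h => ⟨(i, e), he, b, ?_⟩, (i, e), he⟩
  rw [mem_singleton_iff] at h
  rw [h, hb]

theorem isClosed_edge [Finite ι] : IsClosed T.edge := by
  have : T.edge = sphereC ∩ ⋃ v ∈ T.free, {q | q.1 ∈ sector {v.2} ∧ q.2 ∈ sector {v.1}} := by
    ext q
    simp only [edge, mem_ofPred_eq, mem_inter_iff, mem_iUnion, exists_prop]
  rw [this]
  refine isClosed_sphereC.inter (T.finite_free.isClosed_biUnion fun v _ => ?_)
  exact ((isClosed_sector isClosed_singleton).preimage continuous_fst).inter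
    ((isClosed_sector isClosed_singleton).preimage continuous_snd)

theorem notMem_edge_of_mem_openDisc {i : ι} {q : ℂ × ℂ} (hq : q ∈ openDisc (T.A i) (T.B i)) :
    q ∉ T.edge := by
  rintro ⟨-, v, hv, h1, h2⟩
  obtain ⟨-, h3, h4, h5, h6⟩ := hq
  rw [h1.resolve_left h3] at h5
  rw [h2.resolve_left h4] at h6
  obtain ⟨j, e, b, he, hb, -⟩ := T.exists_of_free hv
  rw [← he] at h6
  rw [← hb] at h5
  by_cases hne : j = i
  · rw [hne] at h6
    exact (T.A i).endpt_notMem_interior _ h6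
  · obtain ⟨h7, -⟩ := T.vertex hne ((T.A i).interior_subset h6) ((T.B i).interior_subset h5)
    rw [h7] at h6
    exact (T.A i).endpt_notMem_interior _ h6

theorem surf_subset_closure : T.surf ⊆ closure (T.surf \ T.edge) := by
  refine iUnion_subset fun i => (disc_subset_closure _ _).trans (closure_mono fun q hq => ?_)
  exact ⟨T.mem_surf.2 ⟨i, hq.1⟩, T.notMem_edge_of_mem_openDisc hq⟩

/-- The sides and their complement near a free vertex. -/
theorem eventually_mem_sides_iff [Finite ι] {i : ι} {e b : Bool}
    (hf : ((T.A i).endpt e, (T.B i).endpt b) ∈ T.free) : ∀ᶠ y : ℝ in 𝓝 0,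
    ((T.B i).endpt b + (y : Real.Angle) ∈ T.sides ((T.A i).endpt e) ↔ 0 ≤ TArc.sgn b * y) ∧
    ((T.B i).endpt b + (y : Real.Angle) ∈ closure (T.sides ((T.A i).endpt e))ᶜ ↔
      TArc.sgn b * y ≤ 0) := by
  set θ := (T.A i).endpt e with hθ
  set φ := (T.B i).endpt b with hφ
  have hadj : (i, e) ∈ T.adj θ := rfl
  have hend : φ ∈ T.ends θ := ⟨(i, e), hadj, b, rfl⟩
  have hfar : ∀ᶠ y : ℝ in 𝓝 0, ∀ x ∈ T.adj θ, φ + (y : Real.Angle) ∈ (T.B x.1).carrier → x.1 = i := by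
    refine (eventually_all_finite (toFinite _)).2 fun x hx => ?_
    by_cases hm : φ ∈ (T.B x.1).carrier
    · refine Eventually.of_forall fun _ _ => hf.unique ⟨⟨x.2, Eq.symm hx⟩, ?_⟩ ⟨⟨e, rfl⟩, b, rfl⟩
      exact T.endpt_of_mem_ends hend hx hm
    · have h1 := (T.B x.1).isClosed_carrier.isOpen_compl.mem_nhds hm
      rw [← eventually_mem_set, eventually_angle_iff] at h1
      filter_upwards [h1] with y hy hmem using absurd hmem hy
  have h1 : ∀ᶠ y : ℝ in 𝓝 0, φ + (y : Real.Angle) ∈ T.sides θ ↔ 0 ≤ TArc.sgn b * y := by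
    filter_upwards [hfar, (T.B i).eventually_endpt b] with y h1 h2
    rw [← h2.1]
    constructor
    · rintro ⟨x, hx, hm⟩
      rwa [h1 x hx hm] at hm
    · exact fun h => ⟨(i, e), hadj, h⟩
  filter_upwards [h1, h1.eventually_nhds] with y h2 h3
  refine ⟨h2, ?_, ?_⟩
  · intro hm
    by_contra! hpos
    rw [closure_compl, mem_compl_iff, mem_interior_iff_mem_nhds] at hm
    refine hm ?_
    have h4 : ∀ᶠ u : ℝ in 𝓝 y, 0 < TArc.sgn b * u := by
      have : Continuous fun u : ℝ => TArc.sgn b * u := by fun_prop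
      exact this.continuousAt.eventually (lt_mem_nhds hpos)
    have h5 : ∀ᶠ u : ℝ in 𝓝 0, φ + (y : Real.Angle) + (u : Real.Angle) ∈ T.sides θ := by
      have h6 : Tendsto (fun u : ℝ => y + u) (𝓝 0) (𝓝 y) := by
        have : Continuous fun u : ℝ => y + u := by fun_prop
        simpa using this.tendsto 0
      filter_upwards [h6.eventually h3, h6.eventually h4] with u h7 h8
      rw [add_assoc, ← Real.Angle.coe_add]
      exact h7.2 h8.le
    rw [← eventually_mem_set, eventually_angle_iff]
    exact h5
  · intro hle
    rcases hle.lt_or_eq with hlt | heq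
    · refine subset_closure fun hm => ?_
      exact absurd (h2.1 hm) (not_le.2 hlt)
    · have hy : y = 0 := by
        have := congrArg (TArc.sgn b * ·) heq
        simpa [← mul_assoc, TArc.sgn_mul_self] using this
      rw [hy, Real.Angle.coe_zero, add_zero, mem_closure_iff_frequently_angle]
      refine ((frequently_mul_sgn_neg b).and_eventually h1).mono fun u hu hm => ?_
      exact absurd (hu.2.1 hm) (not_le.2 hu.1)

variable [Finite ι]

theorem isClosed_ext (c : ℝ) (θ : Real.Angle) : IsClosed (T.ext c θ) := by
  have hcos : Continuous fun w : ℂ => ‖w‖ ^ 2 * ((w.arg : Real.Angle) - θ).cos :=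
    continuous_normSq_mul_arg (k := fun φ => (φ - θ).cos)
      (Real.Angle.continuous_cos.comp (by fun_prop))
  have hsin : Continuous fun w : ℂ => ‖w‖ ^ 2 * ((w.arg : Real.Angle) - θ).sin :=
    continuous_normSq_mul_arg (k := fun φ => (φ - θ).sin)
      (Real.Angle.continuous_sin.comp (by fun_prop))
  have hfill : Continuous fun z : ℂ => ‖z‖ ^ 2 * T.fill θ z.arg :=
    (contDiff_normSq_mul_arg fun φ => T.contDiffAt_fill θ φ).continuous
  refine isClosed_sphereC.inter ((isClosed_le (f := fun q : ℂ × ℂ => ‖q.1‖) (g := fun q => 2 * ‖q.2‖)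
    (by fun_prop) (by fun_prop)).inter
    (((isClosed_sector isClosed_closure).preimage continuous_fst).inter
    ((isClosed_le (f := fun q : ℂ × ℂ => ‖q.2‖ ^ 2 * c) (by fun_prop)
      (hcos.comp continuous_snd)).inter
    (isClosed_eq (hsin.comp continuous_snd) (hfill.comp continuous_fst)))))

/-- The union of the pieces which continue the surface. -/
def exts (c : ℝ) : Set (ℂ × ℂ) :=
  {q | (∃ v ∈ T.free, q ∈ T.ext c v.1) ∨ ∃ v ∈ T.free, q.swap ∈ T.swap.ext c v.2}

theorem isClosed_exts (c : ℝ) : IsClosed (T.exts c) := by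
  have : T.exts c = (⋃ v ∈ T.free, T.ext c v.1) ∪ ⋃ v ∈ T.free, Prod.swap ⁻¹' T.swap.ext c v.2 := by
    ext q
    simp only [exts, mem_ofPred_eq, mem_union, mem_iUnion, exists_prop, mem_preimage]
  rw [this]
  exact (T.finite_free.isClosed_biUnion fun v _ => T.isClosed_ext c _).union
    (T.finite_free.isClosed_biUnion fun v _ => (T.swap.isClosed_ext c _).preimage continuous_swap)

theorem swap_mem_exts {c : ℝ} {q : ℂ × ℂ} : q.swap ∈ T.swap.exts c ↔ q ∈ T.exts c := by
  have h1 : (∃ v ∈ T.swap.free, q.swap ∈ T.swap.ext c v.1) ↔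
      ∃ v ∈ T.free, q.swap ∈ T.swap.ext c v.2 :=
    ⟨fun ⟨v, hv, h⟩ => ⟨v.swap, T.swap_mem_free.1 (by rwa [Prod.swap_swap]), h⟩,
      fun ⟨v, hv, h⟩ => ⟨v.swap, T.swap_mem_free.2 hv, h⟩⟩
  have h2 : (∃ v ∈ T.swap.free, q.swap.swap ∈ T.swap.swap.ext c v.2) ↔
      ∃ v ∈ T.free, q ∈ T.ext c v.1 :=
    ⟨fun ⟨v, hv, h⟩ => ⟨v.swap, T.swap_mem_free.1 (by rwa [Prod.swap_swap]), h⟩,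
      fun ⟨v, hv, h⟩ => ⟨v.swap, T.swap_mem_free.2 hv, h⟩⟩
  exact (or_congr h1 h2).trans or_comm

theorem exts_subset (c : ℝ) : T.exts c ⊆ sphereC := by
  rintro q (⟨v, -, h⟩ | ⟨v, -, h⟩)
  · exact h.1
  · exact swap_mem_sphereC.1 h.1

/-- With this c the continuation across one meridian contains no point over another meridian with
free vertices, and likewise for longitudes. -/
theorem exists_separation : ∃ c < 1, ∀ v ∈ T.free, ∀ v' ∈ T.free,
    (v.1 ≠ v'.1 → (v.1 - v'.1).cos < c) ∧ (v.2 ≠ v'.2 → (v.2 - v'.2).cos < c) := by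
  have hcos : ∀ ψ : Real.Angle, ψ ≠ 0 → ψ.cos < 1 := by
    intro ψ hψ
    rw [← Real.Angle.cos_toReal]
    refine lt_of_le_of_ne (Real.cos_le_one _) fun h => hψ ?_
    rw [Real.cos_eq_one_iff_of_lt_of_lt (by linarith [ψ.neg_pi_lt_toReal, Real.pi_pos])
      (by linarith [ψ.toReal_le_pi, Real.pi_pos])] at h
    exact Real.Angle.toReal_eq_zero_iff.1 h
  have key : ∀ ψ ψ' : Real.Angle, ∀ᶠ c : ℝ in 𝓝[<] 1, ψ ≠ ψ' → (ψ - ψ').cos < c := by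
    intro ψ ψ'
    by_cases h : ψ = ψ'
    · exact Eventually.of_forall fun _ h' => absurd h h'
    · filter_upwards [mem_nhdsWithin_of_mem_nhds (lt_mem_nhds (hcos _ (sub_ne_zero.2 h)))]
        with c hc _ using hc
  have hev : ∀ᶠ c : ℝ in 𝓝[<] 1, ∀ v ∈ T.free, ∀ v' ∈ T.free,
      (v.1 ≠ v'.1 → (v.1 - v'.1).cos < c) ∧ (v.2 ≠ v'.2 → (v.2 - v'.2).cos < c) :=
    (eventually_all_finite T.finite_free).2 fun v _ =>
      (eventually_all_finite T.finite_free).2 fun v' _ => (key _ _).and (key _ _)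
  obtain ⟨c, h1, h2⟩ := (hev.and self_mem_nhdsWithin).exists
  exact ⟨c, h2, h1⟩

/-- The two continuations across an edge agree. -/
theorem eventually_ext_of_swap_ext {c : ℝ} (hc : c < 1) {v : Torus} (hv : v ∈ T.free) {p : ℂ × ℂ}
    (hp1 : p.1 ≠ 0) (hp2 : p.2 ≠ 0) (h1 : (p.1.arg : Real.Angle) = v.2)
    (h2 : (p.2.arg : Real.Angle) = v.1) (hlt : ‖p.1‖ < 2 * ‖p.2‖) :
    ∀ᶠ q in 𝓝 p, q.swap ∈ T.swap.ext c v.2 → q ∈ T.ext c v.1 := by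
  obtain ⟨y, hy, hy0, hyeq⟩ := exists_angle_eq_add_arg hp1 _ h1
  obtain ⟨x, hx, hx0, hxeq⟩ := exists_angle_eq_add_arg hp2 _ h2
  have c1 : Tendsto (fun q : ℂ × ℂ => y q.1) (𝓝 p) (𝓝 0) := by
    have := hy.continuousAt.tendsto
    rw [hy0] at this
    exact this.comp continuous_fst.continuousAt
  have c2 : Tendsto (fun q : ℂ × ℂ => x q.2) (𝓝 p) (𝓝 0) := by
    have := hx.continuousAt.tendsto
    rw [hx0] at this
    exact this.comp continuous_snd.continuousAt
  obtain ⟨i, e, b, he, hb, -⟩ := T.exists_of_free hv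
  obtain rfl : v = ((T.A i).endpt e, (T.B i).endpt b) := Prod.ext he.symm hb.symm
  have hv' : ((T.B i).endpt b, (T.A i).endpt e) ∈ T.swap.free := T.swap_mem_free.2 hv
  have hlt' : ∀ᶠ q : ℂ × ℂ in 𝓝 p, ‖q.1‖ < 2 * ‖q.2‖ := by
    have h1 : Continuous fun q : ℂ × ℂ => ‖q.1‖ := by fun_prop
    have h2 : Continuous fun q : ℂ × ℂ => 2 * ‖q.2‖ := by fun_prop
    exact h1.continuousAt.eventually_lt h2.continuousAt hlt
  have hcos : ∀ᶠ y : ℝ in 𝓝 0, c < Real.cos y :=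
    Real.continuous_cos.continuousAt.eventually (lt_mem_nhds (by rwa [Real.cos_zero]))
  have hsin : ∀ᶠ y : ℝ in 𝓝 0, ∀ e, (TArc.sgn e * Real.sin y ≤ 0 ↔ TArc.sgn e * y ≤ 0) := by
    filter_upwards [Metric.ball_mem_nhds (0 : ℝ) Real.pi_pos] with y hy e
    rw [mem_ball_zero_iff, Real.norm_eq_abs, abs_lt] at hy
    rcases lt_trichotomy y 0 with h | rfl | h
    · have := Real.sin_neg_of_neg_of_neg_pi_lt h hy.1
      cases e <;> simp [TArc.sgn, h.le, h.not_ge, this.le, this.not_ge]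
    · simp
    · have := Real.sin_pos_of_pos_of_lt_pi h hy.2
      cases e <;> simp [TArc.sgn, h.le, h.not_ge, this.le, this.not_ge]
  filter_upwards [hlt', continuous_fst.continuousAt.eventually (isOpen_ne.mem_nhds hp1),
    continuous_snd.continuousAt.eventually (isOpen_ne.mem_nhds hp2),
    c1.eventually (T.eventually_mem_sides_iff hv), c2.eventually (T.swap.eventually_mem_sides_iff hv'),
    c1.eventually (T.fill_eq hv), c2.eventually (T.swap.fill_eq hv'), c2.eventually hcos,
    c1.eventually hsin, c2.eventually hsin]
    with q k1 k2 k3 k4 k5 k6 k7 k8 k9 k10 hq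
  have n1 : 0 < ‖q.1‖ ^ 2 := by positivity
  have n2 : 0 < ‖q.2‖ ^ 2 := by positivity
  obtain ⟨g1, -, g3, -, g5⟩ := hq
  simp only [Prod.fst_swap, Prod.snd_swap, hxeq q.2 k3, hyeq q.1 k2, add_sub_cancel_left,
    Real.Angle.sin_coe] at g3 g5
  have hσ : T.swap.sign ((T.B i).endpt b, (T.A i).endpt e) = TArc.sgn e * TArc.sgn b := by
    rw [T.sign_swap, T.sign_eq]
  rw [k7, hσ] at g5
  have se := TArc.sgn_mul_self e
  have sb := TArc.sgn_mul_self b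
  have g3' := g3.resolve_left k3
  rw [hxeq q.2 k3] at g3'
  replace g3' := k5.2.1 g3'
  have g6 := (k10 e).2 g3'
  -- Near a free vertex both fillings are the sign times the sine of the deviation, so both
  -- continuations have the equation ‖q.1‖² sgn b sin y = ‖q.2‖² sgn e sin x, which is symmetric in
  -- the two factors. The sign of one deviation determines that of the other.
  have g7 : ‖q.1‖ ^ 2 * (TArc.sgn b * Real.sin (y q.1)) = ‖q.2‖ ^ 2 * (TArc.sgn e * Real.sin (x q.2)) := by
    linear_combination TArc.sgn b * g5 + ‖q.2‖ ^ 2 * TArc.sgn e * Real.sin (x q.2) * sb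
  have g8 : TArc.sgn b * Real.sin (y q.1) ≤ 0 := by
    have : ‖q.1‖ ^ 2 * (TArc.sgn b * Real.sin (y q.1)) ≤ 0 := by
      rw [g7]
      exact mul_nonpos_of_nonneg_of_nonpos n2.le g6
    exact nonpos_of_mul_nonpos_right this n1
  refine ⟨swap_mem_sphereC.1 g1, k1.le, Or.inr ?_, ?_, ?_⟩
  · rw [hyeq q.1 k2]
    exact k4.2.2 ((k9 b).1 g8)
  · rw [hxeq q.2 k3, add_sub_cancel_left, Real.Angle.cos_coe]
    exact mul_le_mul_of_nonneg_left k8.le n2.le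
  · rw [hxeq q.2 k3, hyeq q.1 k2, add_sub_cancel_left, Real.Angle.sin_coe]
    rw [k6, T.sign_eq]
    linear_combination (-TArc.sgn e * TArc.sgn b) * g5 - ‖q.2‖ ^ 2 * Real.sin (x q.2) * sb -
      ‖q.2‖ ^ 2 * Real.sin (x q.2) * (TArc.sgn b * TArc.sgn b) * se

/-- The surface and its continuation near a boundary point. -/
theorem eventually_mem_exts_iff {c : ℝ} (hc : c < 1)
    (hsep : ∀ v ∈ T.free, ∀ v' ∈ T.free,
      (v.1 ≠ v'.1 → (v.1 - v'.1).cos < c) ∧ (v.2 ≠ v'.2 → (v.2 - v'.2).cos < c))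
    {v : Torus} (hv : v ∈ T.free) {p : ℂ × ℂ} (hp : p ∈ sphereC) (h1 : p.1 ∈ sector {v.2})
    (h2 : p.2 ∈ sector {v.1}) (hlt : ‖p.1‖ < 2 * ‖p.2‖) :
    ∀ᶠ q in 𝓝 p, q ∈ T.exts c ↔ q ∈ T.graph v.1 ∧ q.1 ∈ sector (closure (T.sides v.1)ᶜ) := by
  have hp2 : p.2 ≠ 0 := fun h => by
    rw [h, norm_zero, mul_zero] at hlt
    exact absurd hlt (not_lt.2 (norm_nonneg _))
  have h2' : (p.2.arg : Real.Angle) = v.1 := h2.resolve_left hp2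
  have n2 : 0 < ‖p.2‖ ^ 2 := by positivity
  have e1 : ∀ᶠ q in 𝓝 p, ∀ v' ∈ T.free, q ∈ T.ext c v'.1 → q ∈ T.ext c v.1 := by
    refine (eventually_all_finite T.finite_free).2 fun v' hv' => ?_
    by_cases h : v.1 = v'.1
    · exact Eventually.of_forall fun q hq => h ▸ hq
    · have hnot : p ∉ T.ext c v'.1 := fun hmem => by
        have h3 := hmem.2.2.2.1
        rw [h2'] at h3
        exact absurd (le_of_mul_le_mul_left h3 n2) (not_le.2 ((hsep v hv v' hv').1 h))
      filter_upwards [(T.isClosed_ext c v'.1).isOpen_compl.mem_nhds hnot] with q hq hq'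
      exact absurd hq' hq
  -- A continuation across a longitude that contains p has p off the circle z₁ = 0, belongs to the
  -- longitude of v by separation, and agrees near p with the continuation across the meridian.
  have e2 : ∀ᶠ q in 𝓝 p, ∀ v' ∈ T.free, q.swap ∈ T.swap.ext c v'.2 → q ∈ T.ext c v.1 := by
    refine (eventually_all_finite T.finite_free).2 fun v' hv' => ?_
    by_cases hmem : p.swap ∈ T.swap.ext c v'.2
    · have hp1 : p.1 ≠ 0 := fun h => by
        have h3 : ‖p.2‖ ≤ 2 * ‖p.1‖ := hmem.2.1
        rw [h, norm_zero, mul_zero] at h3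
        exact absurd h3 (not_le.2 (norm_pos_iff.2 hp2))
      have h1' : (p.1.arg : Real.Angle) = v.2 := h1.resolve_left hp1
      have h : v.2 = v'.2 := by
        by_contra h
        have h3 := hmem.2.2.2.1
        simp only [Prod.snd_swap] at h3
        rw [h1'] at h3
        have n1 : 0 < ‖p.1‖ ^ 2 := by positivity
        exact absurd (le_of_mul_le_mul_left h3 n1) (not_le.2 ((hsep v hv v' hv').2 h))
      rw [← h]
      exact T.eventually_ext_of_swap_ext hc hv hp1 hp2 h1' h2' hlt
    · have : IsClosed (Prod.swap ⁻¹' T.swap.ext c v'.2) :=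
        (T.swap.isClosed_ext c v'.2).preimage continuous_swap
      filter_upwards [this.isOpen_compl.mem_nhds hmem] with q hq hq'
      exact absurd hq' hq
  filter_upwards [e1, e2, T.eventually_mem_ext_iff hc hp hp2 h2' (T.edge_base hv h1).1 hlt]
    with q k1 k2 k3
  rw [← k3]
  constructor
  · rintro (⟨v', hv', h⟩ | ⟨v', hv', h⟩)
    · exact k1 v' hv' h
    · exact k2 v' hv' h
  · exact fun h => Or.inl ⟨v, hv, h⟩

/-- The continuation leaves the surface at the boundary. -/
theorem frequently_compl_sides {v : Torus} (hv : v ∈ T.free) {z : ℂ} (hz : z ∈ sector {v.2}) :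
    ∃ᶠ w in 𝓝 z, w ≠ 0 ∧ (w.arg : Real.Angle) ∉ T.sides v.1 := by
  obtain ⟨i, e, b, he, hb, -⟩ := T.exists_of_free hv
  obtain rfl : v = ((T.A i).endpt e, (T.B i).endpt b) := Prod.ext he.symm hb.symm
  have h1 : ∃ᶠ y : ℝ in 𝓝 0, (T.B i).endpt b + (y : Real.Angle) ∉ T.sides ((T.A i).endpt e) := by
    refine ((frequently_mul_sgn_neg b).and_eventually (T.eventually_mem_sides_iff hv)).mono ?_
    intro y hy hm
    exact absurd (hy.2.1.1 hm) (not_le.2 hy.1)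
  rcases eq_or_ne z 0 with rfl | hz0
  · obtain ⟨y, hy⟩ := h1.exists
    set ψ := (T.B i).endpt b + (y : Real.Angle)
    have h2 : Tendsto (fun c : ℝ => (c : ℂ) * (ψ.toCircle : ℂ)) (𝓝[>] 0) (𝓝 0) := by
      have : Continuous fun c : ℝ => (c : ℂ) * (ψ.toCircle : ℂ) := by fun_prop
      simpa using (this.tendsto 0).mono_left nhdsWithin_le_nhds
    have h3 : ∀ᶠ c : ℝ in 𝓝[>] 0, (c : ℂ) * (ψ.toCircle : ℂ) ≠ 0 ∧
        (((c : ℂ) * (ψ.toCircle : ℂ)).arg : Real.Angle) ∉ T.sides ((T.A i).endpt e) := by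
      filter_upwards [self_mem_nhdsWithin] with c hc
      refine ⟨?_, by rwa [arg_mul_toCircle hc]⟩
      rw [← norm_ne_zero_iff, norm_mul_toCircle (le_of_lt hc)]
      exact ne_of_gt hc
    exact h2.frequently h3.frequently
  · have hn : 0 < ‖z‖ := norm_pos_iff.2 hz0
    have harg : (z.arg : Real.Angle) = (T.B i).endpt b := hz.resolve_left hz0
    have h2 : Tendsto (fun y : ℝ => (‖z‖ : ℂ) * (((T.B i).endpt b + (y : Real.Angle)).toCircle : ℂ))
        (𝓝 0) (𝓝 z) := by
      have h3 : Continuous fun y : ℝ =>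
          (‖z‖ : ℂ) * (((T.B i).endpt b + (y : Real.Angle)).toCircle : ℂ) :=
        continuous_const.mul (contDiff_toCircle_add _).continuous
      have h4 := h3.tendsto 0
      have h5 : (‖z‖ : ℂ) * (((T.B i).endpt b).toCircle : ℂ) = z := by
        rw [← harg, ← eq_norm_mul_toCircle]
      rwa [Real.Angle.coe_zero, add_zero, h5] at h4
    refine h2.frequently (h1.mono fun y hy => ⟨?_, by rwa [arg_mul_toCircle hn]⟩)
    rw [← norm_ne_zero_iff, norm_mul_toCircle hn.le]
    exact hn.ne'

/-- The properties of the continued surface at a point of the boundary. -/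
def IsContinuedAt (c : ℝ) (p : ℂ × ℂ) : Prop :=
  IsC1SurfaceAt (toE4 '' (T.surf ∪ T.exts c)) (toE4 p) ∧
    (∀ᶠ q in 𝓝 p, q ∈ T.exts c → q ∈ T.surf → q ∈ T.edge) ∧ p ∈ closure (T.exts c \ T.surf)

/-- Near p the surface and its continuation are parts of one C¹ graph, over the sector of the sides
and over that of the closure of their complement. The two sectors cover the plane. They meet at 0
and over free vertices, and there the shift is 0, so the common points belong to the link. -/
theorem isContinuedAt_of_lt {c : ℝ} (hc : c < 1)
    (hsep : ∀ v ∈ T.free, ∀ v' ∈ T.free,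
      (v.1 ≠ v'.1 → (v.1 - v'.1).cos < c) ∧ (v.2 ≠ v'.2 → (v.2 - v'.2).cos < c))
    {p : ℂ × ℂ} (hp : p ∈ T.edge) (hlt : ‖p.1‖ < 2 * ‖p.2‖) : T.IsContinuedAt c p := by
  obtain ⟨hps, v, hv, h1, h2⟩ := hp
  have hp2 : p.2 ≠ 0 := fun h => by
    rw [h, norm_zero, mul_zero] at hlt
    exact absurd hlt (not_lt.2 (norm_nonneg _))
  have h2' : (p.2.arg : Real.Angle) = v.1 := h2.resolve_left hp2
  obtain ⟨hbase, hne⟩ := T.edge_base hv h1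
  have hh := T.height_eq_zero_of_base hbase
  have k1 := T.eventually_mem_surf_iff hps hp2 h2' hbase hne
  have k2 := T.eventually_mem_exts_iff hc hsep hv hps h1 h2 hlt
  have hsec : ∀ z : ℂ, z ∈ sector (T.sides v.1) ∨ z ∈ sector (closure (T.sides v.1)ᶜ) := fun z => by
    by_cases h : (z.arg : Real.Angle) ∈ T.sides v.1
    · exact Or.inl (Or.inr h)
    · exact Or.inr (Or.inr (subset_closure h))
  refine ⟨?_, ?_, ?_⟩
  · refine (T.isC1SurfaceAt_graph hps hp2 hh).congr_image ?_
    filter_upwards [k1, k2] with q h3 h4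
    rw [mem_union, h3, h4, ← and_or_left]
    exact ⟨fun h => ⟨h, hsec _⟩, And.left⟩
  · filter_upwards [k1, k2] with q h3 h4 h5 h6
    obtain ⟨⟨hs, hq2, harg⟩, h7⟩ := h3.1 h6
    have h8 := (h4.1 h5).2
    rcases eq_or_ne q.1 0 with h0 | h0
    · rw [T.shift_eq_zero (T.height_eq_zero_of_base (Or.inl h0)), Real.Angle.coe_zero,
        add_zero] at harg
      exact ⟨hs, v, hv, Or.inl h0, Or.inr harg⟩
    · obtain ⟨h9, h10⟩ := T.free_of_mem_closure_compl (h7.resolve_left h0) (h8.resolve_left h0)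
      rw [T.shift_eq_zero (T.height_eq_zero_of_base (Or.inr h9)), Real.Angle.coe_zero,
        add_zero] at harg
      exact ⟨hs, _, h10, Or.inr rfl, Or.inr harg⟩
  · have hz := norm_fst_lt hps hp2
    let g : ℂ → ℂ × ℂ := fun z =>
      (z, (Real.sqrt (1 - ‖z‖ ^ 2) : ℂ) * ((v.1 + (T.shift v.1 z : Real.Angle)).toCircle : ℂ))
    have hn : Real.sqrt (1 - ‖p.1‖ ^ 2) = ‖p.2‖ := by
      rw [← Real.sqrt_sq (norm_nonneg p.2)]
      congr 1
      have h6 : ‖p.1‖ ^ 2 + ‖p.2‖ ^ 2 = 1 := hps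
      linarith
    have hgp : g p.1 = p := by
      refine Prod.ext rfl ?_
      simp only [g]
      rw [T.shift_eq_zero hh, hn, Real.Angle.coe_zero, add_zero, ← h2', ← eq_norm_mul_toCircle]
    have hgc : ContinuousAt g p.1 := by
      refine continuousAt_id.prodMk (ContinuousAt.mul ?_ ?_)
      · have : Continuous fun z : ℂ => (Real.sqrt (1 - ‖z‖ ^ 2) : ℂ) := by fun_prop
        exact this.continuousAt
      · exact (contDiff_toCircle_add v.1).continuous.continuousAt.comp
          (T.contDiffAt_shift hz hh).continuousAt
    have hgt : Tendsto g (𝓝 p.1) (𝓝 p) := by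
      have := hgc.tendsto
      rwa [hgp] at this
    have hev : ∀ᶠ z in 𝓝 p.1, ‖z‖ < 1 := continuous_norm.continuousAt.eventually (gt_mem_nhds hz)
    rw [mem_closure_iff_frequently]
    refine hgt.frequently (((T.frequently_compl_sides hv h1).and_eventually
      (hev.and ((hgt.eventually k1).and (hgt.eventually k2)))).mono ?_)
    rintro z ⟨⟨hz0, hzs⟩, hz1, h3, h4⟩
    have hpos : 0 < Real.sqrt (1 - ‖z‖ ^ 2) := Real.sqrt_pos.2 (by nlinarith [norm_nonneg z])
    have hgr : g z ∈ T.graph v.1 := by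
      have h5 := norm_mul_toCircle hpos.le (v.1 + (T.shift v.1 z : Real.Angle))
      refine ⟨?_, ?_, arg_mul_toCircle hpos _⟩
      · simp only [sphereC, mem_ofPred_eq, g, h5]
        rw [Real.sq_sqrt (by nlinarith [norm_nonneg z])]
        ring
      · rw [← norm_ne_zero_iff]
        exact h5.trans_ne hpos.ne'
    refine ⟨h4.2 ⟨hgr, Or.inr (subset_closure hzs)⟩, fun h5 => ?_⟩
    exact hzs ((h3.1 h5).2.resolve_left hz0)

/-- On the sphere ‖p.1‖ < 2 ‖p.2‖ or ‖p.2‖ < 2 ‖p.1‖, and exchanging the factors reduces the second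
case to the first. -/
theorem isContinuedAt {c : ℝ} (hc : c < 1)
    (hsep : ∀ v ∈ T.free, ∀ v' ∈ T.free,
      (v.1 ≠ v'.1 → (v.1 - v'.1).cos < c) ∧ (v.2 ≠ v'.2 → (v.2 - v'.2).cos < c))
    {p : ℂ × ℂ} (hp : p ∈ T.edge) : T.IsContinuedAt c p := by
  by_cases hlt : ‖p.1‖ < 2 * ‖p.2‖
  · exact T.isContinuedAt_of_lt hc hsep hp hlt
  · have hps : ‖p.1‖ ^ 2 + ‖p.2‖ ^ 2 = 1 := hp.1
    have hlt' : ‖p.2‖ < 2 * ‖p.1‖ := by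
      by_contra! h
      nlinarith [norm_nonneg p.1, norm_nonneg p.2]
    obtain ⟨h1, h2, h3⟩ := T.swap.isContinuedAt_of_lt hc (fun v hv v' hv' =>
      (hsep v.swap (T.swap_mem_free.1 (by rwa [Prod.swap_swap])) v'.swap
        (T.swap_mem_free.1 (by rwa [Prod.swap_swap]))).symm) (T.swap_mem_edge.2 hp) hlt'
    refine ⟨isC1SurfaceAt_swap ?_, ?_, ?_⟩
    · convert h1 using 2
      ext q
      rw [mem_preimage, mem_union, mem_union, ← T.swap_mem_surf, ← T.swap_mem_exts, Prod.swap_swap]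
    · filter_upwards [continuous_swap.continuousAt.eventually h2] with q hq h4 h5
      exact T.swap_mem_edge.1 (hq (T.swap_mem_exts.2 h4) (T.swap_mem_surf.2 h5))
    · have h4 := mem_closure_image (f := Prod.swap) continuous_swap.continuousAt h3
      rw [Prod.swap_swap] at h4
      refine closure_mono (image_subset_iff.2 fun q hq => ?_) h4
      exact ⟨T.swap_mem_exts.1 (by rw [Prod.swap_swap]; exact hq.1),
        fun h => hq.2 (by rw [← Prod.swap_swap q]; exact T.swap_mem_surf.2 h)⟩

/-- When no end is free the union of the sides is open as well as closed, and the circle is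
connected. -/
theorem sides_eq_univ {θ : Real.Angle} (h : ∀ φ, (θ, φ) ∉ T.free) (hne : (T.adj θ).Nonempty) :
    T.sides θ = univ := by
  have : PreconnectedSpace Real.Angle := by
    have h1 : Function.Surjective ((↑) : ℝ → Real.Angle) := fun θ =>
      Real.Angle.induction_on θ fun t => ⟨t, rfl⟩
    refine ⟨?_⟩
    rw [← h1.range_eq]
    exact isPreconnected_range Real.Angle.continuous_coe
  have hopen : IsOpen (T.sides θ) := by
    rw [isOpen_iff_mem_nhds]
    intro φ hφ
    by_cases hend : φ ∈ T.ends θ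
    · exact T.sides_mem_nhds hend (h φ)
    · exact T.sides_mem_nhds_of_notMem_ends hend hφ
  refine IsClopen.eq_univ ⟨T.isClosed_sides θ, hopen⟩ ?_
  obtain ⟨x, hx⟩ := hne
  exact ⟨_, x, hx, TArc.endpt_mem _ true⟩

/-- Off the link the sides fill a neighbourhood of arg z₁, or the entire circle if z₁ = 0, so the
surface is locally the whole graph. -/
theorem isC1SurfaceAt_of_base {p : ℂ × ℂ} (hp : p ∈ T.surf) (hpe : p ∉ T.edge) (hp2 : p.2 ≠ 0)
    (hbase : p.1 = 0 ∨ (p.1.arg : Real.Angle) ∈ T.ends p.2.arg) :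
    IsC1SurfaceAt (toE4 '' T.surf) (toE4 p) := by
  have hps := T.surf_subset hp
  obtain ⟨i, hi⟩ := T.mem_surf.1 hp
  obtain ⟨e, hie⟩ := T.exists_adj_of_mem_disc hp2 rfl hbase hi
  have k1 := T.eventually_mem_surf_iff hps hp2 rfl hbase ⟨_, hie⟩
  refine (T.isC1SurfaceAt_graph hps hp2 (T.height_eq_zero_of_base hbase)).congr_image ?_
  have hsec : ∀ᶠ q : ℂ × ℂ in 𝓝 p, q.1 ∈ sector (T.sides p.2.arg) := by
    rcases eq_or_ne p.1 0 with h0 | h0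
    · have hno : ∀ φ, ((p.2.arg : Real.Angle), φ) ∉ T.free := fun φ hφ =>
        hpe ⟨hps, _, hφ, Or.inl h0, Or.inr rfl⟩
      rw [T.sides_eq_univ hno ⟨_, hie⟩]
      exact Eventually.of_forall fun q => Or.inr (mem_univ _)
    · have hno : ((p.2.arg : Real.Angle), (p.1.arg : Real.Angle)) ∉ T.free := fun hφ =>
        hpe ⟨hps, _, hφ, Or.inr rfl, Or.inr rfl⟩
      have h1 := T.sides_mem_nhds (hbase.resolve_left h0) hno
      have h2 : ∀ᶠ z in 𝓝 p.1, z ∈ sector (T.sides p.2.arg) :=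
        ((continuousAt_argAngle h0).eventually h1).mono fun z hz => Or.inr hz
      exact continuous_fst.continuousAt.eventually h2
  filter_upwards [k1, hsec] with q h1 h2
  rw [h1]
  exact ⟨fun h => ⟨h, h2⟩, And.left⟩

/-- A point of the surface is on one of the circles z₁ = 0, z₂ = 0, or over a vertex, or in the
interior of a tile. In the last case the other tiles, being closed, stay away from it. -/
theorem isC1SurfaceAt_of_notMem_edge {p : ℂ × ℂ} (hp : p ∈ T.surf) (hpe : p ∉ T.edge) :
    IsC1SurfaceAt (toE4 '' T.surf) (toE4 p) := by
  by_cases h2 : p.2 = 0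
  · have h1 : p.swap.2 ≠ 0 := fun h => by
      have h3 : ‖p.1‖ ^ 2 + ‖p.2‖ ^ 2 = 1 := T.surf_subset hp
      rw [Prod.snd_swap] at h
      rw [h, h2] at h3
      norm_num at h3
    refine isC1SurfaceAt_swap ?_
    rw [preimage_swap_surf]
    exact T.swap.isC1SurfaceAt_of_base (T.swap_mem_surf.2 hp) (fun h => hpe (T.swap_mem_edge.1 h))
      h1 (Or.inl h2)
  by_cases h1 : p.1 = 0
  · exact T.isC1SurfaceAt_of_base hp hpe h2 (Or.inl h1)
  obtain ⟨i, hi⟩ := T.mem_surf.1 hp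
  rcases mem_disc_cases hi h1 h2 with ho | ⟨⟨b, hb⟩, e, he⟩
  · refine (isC1SurfaceAt_of_mem_openDisc ho).congr_image ?_
    have hfar : ∀ᶠ q in 𝓝 p, ∀ j, j ≠ i → q ∉ disc (T.A j) (T.B j) := by
      refine eventually_all.2 fun j => ?_
      by_cases hj : j = i
      · exact Eventually.of_forall fun q h => absurd hj h
      have hnot : p ∉ disc (T.A j) (T.B j) := fun hpj => by
        rcases mem_disc_cases hpj h1 h2 with ho' | ⟨⟨b, hb⟩, e, he⟩
        · exact disjoint_left.1 (T.disjoint hj) ho' ho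
        · obtain ⟨h3, -⟩ := T.vertex hj (e := e) (e' := b)
            (by rw [← he]; exact (T.A i).interior_subset ho.2.2.2.2)
            (by rw [← hb]; exact (T.B i).interior_subset ho.2.2.2.1)
          exact TArc.notMem_interior_of_eq (he.trans h3) ho.2.2.2.2
      filter_upwards [(isClosed_disc _ _).isOpen_compl.mem_nhds hnot] with q hq _ using hq
    filter_upwards [hfar] with q hq
    rw [mem_surf]
    refine ⟨fun h => ⟨i, h⟩, fun ⟨j, hj⟩ => ?_⟩
    by_cases h : j = i
    · exact h ▸ hj
    · exact absurd hj (hq j h)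
  · exact T.isC1SurfaceAt_of_base hp hpe h2 (Or.inr ⟨(i, e), he.symm, b, hb⟩)

theorem toE4_mem_sphere3 {q : ℂ × ℂ} : toE4 q ∈ sphere3 ↔ q ∈ sphereC := by
  have h : ‖toE4 q‖ ^ 2 = ‖q.1‖ ^ 2 + ‖q.2‖ ^ 2 := by
    rw [EuclideanSpace.norm_sq_eq, Fin.sum_univ_four, Complex.sq_norm, Complex.sq_norm,
      Complex.normSq_apply, Complex.normSq_apply]
    simp [toE4]
    ring
  rw [sphere3, mem_sphere_zero_iff_norm, sphereC, mem_ofPred_eq, ← h]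
  constructor
  · intro h; rw [h]; norm_num
  · intro h; nlinarith [norm_nonneg (toE4 q)]

/-- The surface lies in a `C¹` surface, relative to which it is bounded by the edge. -/
theorem exists_surface : ∃ M, IsC1Surface M ∧ toE4 '' T.surf ⊆ M ∧
    relInterior M (toE4 '' T.surf) = toE4 '' T.surf \ toE4 '' T.edge := by
  obtain ⟨c, hc, hsep⟩ := T.exists_separation
  have hclosed : ∀ S : Set (ℂ × ℂ), IsClosed S → IsClosed (toE4 '' S) :=
    fun S hS => toE4L.toHomeomorph.isClosedMap S hS
  refine exists_isC1Surface (E := toE4 '' T.exts c) (T.isCompact_surf.image continuous_toE4) ?_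
    (hclosed _ T.isClosed_edge) (image_mono T.edge_subset) (hclosed _ (T.isClosed_exts c)) ?_
    ?_ ?_ ?_ ?_
  · rintro _ ⟨q, hq, rfl⟩
    exact toE4_mem_sphere3.2 (T.surf_subset hq)
  · rintro _ ⟨q, hq, rfl⟩
    exact toE4_mem_sphere3.2 (T.exts_subset c hq)
  · rintro _ ⟨q, hq, rfl⟩ hqe
    exact T.isC1SurfaceAt_of_notMem_edge hq fun h => hqe ⟨q, h, rfl⟩
  · rintro _ ⟨q, hq, rfl⟩
    rw [← image_union]
    exact (T.isContinuedAt hc hsep hq).1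
  · rintro _ ⟨q, hq, rfl⟩
    rw [eventually_toE4_iff]
    simpa only [toE4_mem_image] using (T.isContinuedAt hc hsep hq).2.1
  · rintro _ ⟨q, hq, rfl⟩
    rw [← image_sdiff (f := toE4) toE4L.injective]
    exact mem_closure_image continuous_toE4.continuousAt (T.isContinuedAt hc hsep hq).2.2

end TileSystem

/-! ### The boundary of a surface with corners -/

/-- A surface inside a surface is a neighbourhood of each of its points. -/
theorem mem_nhdsWithin_of_isC1SurfaceAt {M F : Set E4} {p : E4} (hM : IsC1SurfaceAt M p)
    (hF : IsC1SurfaceAt F p) (hFM : F ⊆ M) (hp : p ∈ F) : F ∈ 𝓝[M] p := by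
  obtain ⟨U, V, f, hU, hpU, hV, hf, hinj, hemb, him⟩ := hM
  obtain ⟨U', V', g, hU', hpU', hV', hg, hinj', -, him'⟩ := hF
  obtain ⟨x₀, hx₀, hfx₀⟩ : p ∈ f '' V := him ▸ ⟨hFM hp, hpU⟩
  obtain ⟨y₀, hy₀, hgy₀⟩ : p ∈ g '' V' := him' ▸ ⟨hp, hpU'⟩
  have key : ∀ N ∈ 𝓝 x₀, ∀ᶠ q in 𝓝 p, q ∈ M → ∃ x ∈ N, f x = q := by
    intro N hN
    have h1 : (Subtype.val ⁻¹' N : Set V) ∈ 𝓝 (⟨x₀, hx₀⟩ : V) :=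
      continuous_subtype_val.continuousAt.preimage_mem_nhds hN
    rw [hemb.toIsInducing.nhds_eq_comap, mem_comap] at h1
    obtain ⟨O, hO, hON⟩ := h1
    change O ∈ 𝓝 (f x₀) at hO
    rw [hfx₀] at hO
    filter_upwards [hO, hU.mem_nhds hpU] with q h2 h3 h4
    obtain ⟨x, hx, rfl⟩ : q ∈ f '' V := him ▸ ⟨h4, h3⟩
    exact ⟨x, @hON ⟨x, hx⟩ h2, rfl⟩
  have hfc : ContDiffAt ℝ 1 f x₀ := hf.contDiffAt (hV.mem_nhds hx₀)
  have hgc : ContDiffAt ℝ 1 g y₀ := hg.contDiffAt (hV'.mem_nhds hy₀)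
  have hfd := (hfc.differentiableAt (by simp)).hasFDerivAt
  have hgd := (hgc.differentiableAt (by simp)).hasFDerivAt
  -- A linear left inverse π of the differential of f gives a map π ∘ f of the plane with identity
  -- differential. Its local inverse k makes k ∘ π a C¹ left inverse of the chart f.
  obtain ⟨π₀, hπ₀⟩ := LinearMap.exists_leftInverse_of_injective
    (fderiv ℝ f x₀ : EuclideanSpace ℝ (Fin 2) →ₗ[ℝ] E4) (LinearMap.ker_eq_bot.2 (hinj x₀ hx₀))
  let π : E4 →L[ℝ] EuclideanSpace ℝ (Fin 2) := π₀.toContinuousLinearMap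
  have hπ : π.comp (fderiv ℝ f x₀) = ContinuousLinearMap.id ℝ _ := by
    ext1 v
    exact congrArg (fun L => L v) hπ₀
  have hh : ContDiffAt ℝ 1 (π ∘ f) x₀ := π.contDiff.contDiffAt.comp x₀ hfc
  have hhd : HasFDerivAt (π ∘ f) ((ContinuousLinearEquiv.refl ℝ (EuclideanSpace ℝ (Fin 2)) :
      EuclideanSpace ℝ (Fin 2) ≃L[ℝ] _) : EuclideanSpace ℝ (Fin 2) →L[ℝ] _) x₀ := by
    have := π.hasFDerivAt.comp x₀ hfd
    rw [hπ] at this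
    exact this
  have hstrict := hh.hasStrictFDerivAt' hhd (by simp)
  have hleft := hstrict.eventually_left_inverse
  have hk : ContDiffAt ℝ 1 (hstrict.localInverse (π ∘ f) _ x₀) ((π ∘ f) x₀) :=
    hh.to_localInverse hhd (by simp)
  have hk0 := hstrict.localInverse_apply_image
  set k := hstrict.localInverse (π ∘ f) _ x₀
  -- The parametrization g read in the chart f. Its differential is an injective endomorphism of the
  -- plane, hence onto, so ξ maps neighbourhoods of y₀ onto neighbourhoods of x₀.
  let ξ : EuclideanSpace ℝ (Fin 2) → EuclideanSpace ℝ (Fin 2) := fun y => k (π (g y))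
  have hξ0 : ξ y₀ = x₀ := by
    simp only [ξ, hgy₀]
    rw [← hfx₀]
    exact hk0
  have hξc : ContDiffAt ℝ 1 ξ y₀ := by
    have h1 : ContDiffAt ℝ 1 k (π (g y₀)) := by
      rw [hgy₀, ← hfx₀]
      exact hk
    exact h1.comp y₀ (π.contDiff.contDiffAt.comp y₀ hgc)
  have hgt : Tendsto g (𝓝 y₀) (𝓝 p) := hgy₀ ▸ hgc.continuousAt.tendsto
  have hfξ : ∀ᶠ y in 𝓝 y₀, f (ξ y) = g y := by
    filter_upwards [hgt.eventually (key _ hleft), hV'.mem_nhds hy₀] with y h1 h2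
    have h3 : g y ∈ F := (him' ▸ mem_image_of_mem g h2 : g y ∈ F ∩ U').1
    obtain ⟨x, hx, hxg⟩ := h1 (hFM h3)
    have h4 : k (π (f x)) = x := hx
    simp only [ξ, ← hxg, h4]
  have hξs := hξc.hasStrictFDerivAt (by simp)
  have hcomp : (fderiv ℝ f x₀).comp (fderiv ℝ ξ y₀) = fderiv ℝ g y₀ := by
    have h1 : HasFDerivAt f (fderiv ℝ f x₀) (ξ y₀) := hξ0.symm ▸ hfd
    have h2 := h1.comp y₀ hξs.hasFDerivAt
    exact (h2.congr_of_eventuallyEq (hfξ.mono fun y hy => hy.symm)).unique hgd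
  have hξinj : Function.Injective (fderiv ℝ ξ y₀) := by
    have h1 := hinj' y₀ hy₀
    rw [← hcomp] at h1
    exact Function.Injective.of_comp h1
  have hξsurj : Function.Surjective (fderiv ℝ ξ y₀) :=
    (LinearMap.injective_iff_surjective
      (f := (fderiv ℝ ξ y₀ : EuclideanSpace ℝ (Fin 2) →ₗ[ℝ] _))).1 hξinj
  have hmap : map ξ (𝓝 y₀) = 𝓝 x₀ := by
    rw [← hξ0]
    exact hξs.map_nhds_eq_of_surj (LinearMap.range_eq_top.2 hξsurj)
  have hN : {x | f x ∈ F} ∈ 𝓝 x₀ := by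
    rw [← hmap, mem_map]
    filter_upwards [hfξ, hV'.mem_nhds hy₀] with y h1 h2
    rw [mem_preimage, mem_ofPred_eq, h1]
    exact (him' ▸ mem_image_of_mem g h2 : g y ∈ F ∩ U').1
  rw [← eventually_mem_set, eventually_nhdsWithin_iff]
  filter_upwards [key _ hN] with q hq hqM
  obtain ⟨x, hx, rfl⟩ := hq hqM
  exact hx

theorem surfaceBoundary_eq {M F : Set E4} (hM : IsC1Surface M) (hF : F ⊆ M) :
    surfaceBoundary F = F \ relInterior M F := by
  ext p
  refine and_congr_right fun hp => not_congr ⟨fun h => ?_, fun h => ?_⟩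
  · exact ⟨hp, mem_nhdsWithin_of_isC1SurfaceAt (hM.2 p (hF hp)) h hF hp⟩
  · refine (hM.2 p (hF hp)).congr ?_
    have h1 := h.2
    rw [← eventually_mem_set, eventually_nhdsWithin_iff] at h1
    filter_upwards [h1] with q hq
    exact ⟨hq, fun h => hF h⟩

/-! ### Curves without cusps -/

theorem hasDerivWithinAt_of_tendsto {γ : ℝ → E4} (hc : ContinuousAt γ 0) {u : E4} (hu : u ≠ 0) :
    (Tendsto (deriv γ) (𝓝[<] 0) (𝓝 u) → HasDerivWithinAt γ u (Iic 0) 0) ∧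
    (Tendsto (deriv γ) (𝓝[>] 0) (𝓝 u) → HasDerivWithinAt γ u (Ici 0) 0) := by
  have key : ∀ x, deriv γ x ≠ 0 → DifferentiableAt ℝ γ x := fun x hx => by
    by_contra h
    exact hx (deriv_zero_of_not_differentiableAt h)
  constructor
  · intro h
    refine hasDerivWithinAt_Iic_of_tendsto_deriv (s := {x | deriv γ x ≠ 0})
      (fun x hx => (key x hx).differentiableWithinAt) hc.continuousWithinAt ?_ h
    exact h.eventually (isOpen_ne.mem_nhds hu)
  · intro h
    refine hasDerivWithinAt_Ici_of_tendsto_deriv (s := {x | deriv γ x ≠ 0})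
      (fun x hx => (key x hx).differentiableWithinAt) hc.continuousWithinAt ?_ h
    exact h.eventually (isOpen_ne.mem_nhds hu)

/-- A set on which some linear coordinate is a good parameter has no cusp. -/
theorem not_hasCuspAt_of_linear {K : Set E4} {p : E4} (L : E4 →L[ℝ] ℝ) {c : ℝ} (hc : 0 < c)
    {N : Set E4} (hN : N ∈ 𝓝 p) (h1 : ∀ q ∈ N, q ∈ K → c * ‖q - p‖ ≤ |L (q - p)|)
    (h2 : InjOn L (K ∩ N)) : ¬ HasCuspAt K p := by
  rintro ⟨U, γ, -, hγ, hinj, him, h0, u, hu, hl, hr⟩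
  have hγ0 : ContinuousAt γ 0 := hγ.continuousAt (Ioo_mem_nhds (by norm_num) (by norm_num))
  have hev : ∀ᶠ s in 𝓝 (0 : ℝ), γ s ∈ N := hγ0.eventually (by rwa [h0])
  obtain ⟨ε', hε', hball⟩ := Metric.eventually_nhds_iff.1 hev
  set ε := min ε' 1
  have hε : 0 < ε := lt_min hε' one_pos
  have hmem : ∀ s ∈ Ioo (-ε) ε, s ∈ Ioo (-1 : ℝ) 1 ∧ γ s ∈ N ∧ γ s ∈ K := by
    intro s hs
    have h3 : |s| < ε := abs_lt.2 hs
    have h4 : s ∈ Ioo (-1 : ℝ) 1 := abs_lt.1 (h3.trans_le (min_le_right _ _))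
    refine ⟨h4, hball ?_, (him ▸ mem_image_of_mem γ h4 : γ s ∈ K ∩ U).1⟩
    rw [Real.dist_eq, sub_zero]
    exact h3.trans_le (min_le_left _ _)
  have h0m : (0 : ℝ) ∈ Ioo (-ε) ε := ⟨neg_lt_zero.2 hε, hε⟩
  have hfc : ContinuousOn (L ∘ γ) (Ioo (-ε) ε) :=
    L.continuous.comp_continuousOn (hγ.mono fun s hs => (hmem s hs).1)
  have hfi : InjOn (L ∘ γ) (Ioo (-ε) ε) := fun s hs t ht hst =>
    hinj (hmem s hs).1 (hmem t ht).1
      (h2 ⟨(hmem s hs).2.2, (hmem s hs).2.1⟩ ⟨(hmem t ht).2.2, (hmem t ht).2.1⟩ hst)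
  have dl := (hasDerivWithinAt_of_tendsto hγ0 hu).1 hl
  have dr := (hasDerivWithinAt_of_tendsto hγ0 (neg_ne_zero.2 hu)).2 hr
  have hIio : Iic (0 : ℝ) \ {0} = Iio 0 := by ext x; simp [lt_iff_le_and_ne]
  have hIoi : Ici (0 : ℝ) \ {0} = Ioi 0 := by ext x; simp [lt_iff_le_and_ne, eq_comm]
  have fl : Tendsto (slope (L ∘ γ) 0) (𝓝[<] 0) (𝓝 (L u)) := by
    have := L.hasFDerivAt.comp_hasDerivWithinAt 0 dl
    rwa [hasDerivWithinAt_iff_tendsto_slope, hIio] at this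
  have fr : Tendsto (slope (L ∘ γ) 0) (𝓝[>] 0) (𝓝 (L (-u))) := by
    have := L.hasFDerivAt.comp_hasDerivWithinAt 0 dr
    rwa [hasDerivWithinAt_iff_tendsto_slope, hIoi] at this
  have nl : ∀ᶠ s in 𝓝[<] (0 : ℝ), s ∈ Ioo (-ε) ε ∧ s < 0 := by
    filter_upwards [mem_nhdsWithin_of_mem_nhds (Ioo_mem_nhds h0m.1 h0m.2), self_mem_nhdsWithin]
      with s h3 h4 using ⟨h3, h4⟩
  have nr : ∀ᶠ s in 𝓝[>] (0 : ℝ), s ∈ Ioo (-ε) ε ∧ 0 < s := by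
    filter_upwards [mem_nhdsWithin_of_mem_nhds (Ioo_mem_nhds h0m.1 h0m.2), self_mem_nhdsWithin]
      with s h3 h4 using ⟨h3, h4⟩
  -- The function L ∘ γ is continuous and injective, hence strictly monotone, so its one-sided
  -- derivatives L u and -L u at 0 cannot have opposite signs.
  have hLu : L u = 0 := by
    rw [map_neg] at fr
    rcases hfc.strictMonoOn_of_injOn_Ioo (by linarith : -ε < ε) hfi with hm | hm
    · have h3 : 0 ≤ L u := ge_of_tendsto fl <| nl.mono fun s hs => by
        rw [slope_def_field]
        exact div_nonneg_of_nonpos (sub_nonpos.2 (hm hs.1 h0m hs.2).le) (by linarith [hs.2])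
      have h4 : 0 ≤ -L u := ge_of_tendsto fr <| nr.mono fun s hs => by
        rw [slope_def_field]
        exact div_nonneg (sub_nonneg.2 (hm h0m hs.1 hs.2).le) (by linarith [hs.2])
      linarith
    · have h3 : L u ≤ 0 := le_of_tendsto fl <| nl.mono fun s hs => by
        rw [slope_def_field]
        exact div_nonpos_of_nonneg_of_nonpos (sub_nonneg.2 (hm hs.1 h0m hs.2).le)
          (by linarith [hs.2])
      have h4 : -L u ≤ 0 := le_of_tendsto fr <| nr.mono fun s hs => by
        rw [slope_def_field]
        exact div_nonpos_of_nonpos_of_nonneg (sub_nonpos.2 (hm h0m hs.1 hs.2).le)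
          (by linarith [hs.2])
      linarith
  have gl : Tendsto (slope γ 0) (𝓝[<] 0) (𝓝 u) := by
    have := dl
    rwa [hasDerivWithinAt_iff_tendsto_slope, hIio] at this
  -- The lower bound for |L| on chords of the curve at p passes to the limit of their slopes and
  -- contradicts L u = 0.
  have hle : c * ‖u‖ ≤ |L u| := by
    refine le_of_tendsto_of_tendsto (gl.norm.const_mul c)
      ((L.continuous.tendsto u).comp gl).abs ?_
    filter_upwards [nl] with s hs
    obtain ⟨-, h4, h5⟩ := hmem s hs.1
    have h6 := h1 _ h4 h5
    rw [Function.comp_apply, slope_def_module, sub_zero, h0, map_smul, norm_smul, smul_eq_mul,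
      abs_mul, norm_inv, Real.norm_eq_abs, abs_inv, mul_left_comm]
    exact mul_le_mul_of_nonneg_left h6 (by positivity)
  rw [hLu, abs_zero] at hle
  have := mul_pos hc (norm_pos_iff.2 hu)
  linarith

/-! ### Arcs -/

/-- The point of the cone over an arc with the given distances from the two axes. -/
noncomputable def polar (v : Torus) (c s : ℝ) : E4 := toE4 (c * v.2.toCircle, s * v.1.toCircle)

theorem toE4_injective : Function.Injective toE4 := toE4L.injective

theorem polar_eq_polar {v v' : Torus} {c s c' s' : ℝ} (hc : 0 ≤ c) (hs : 0 ≤ s) (hc' : 0 ≤ c')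
    (hs' : 0 ≤ s') (h : polar v c s = polar v' c' s') :
    c = c' ∧ s = s' ∧ (0 < c → v.2 = v'.2) ∧ (0 < s → v.1 = v'.1) := by
  obtain ⟨h1, h2⟩ := Prod.mk.inj (toE4_injective h)
  have e1 : c = c' := by rw [← norm_mul_toCircle hc v.2, h1, norm_mul_toCircle hc']
  have e2 : s = s' := by rw [← norm_mul_toCircle hs v.1, h2, norm_mul_toCircle hs']
  refine ⟨e1, e2, fun h => ?_, fun h => ?_⟩
  · rw [← arg_mul_toCircle h v.2, h1, arg_mul_toCircle (e1 ▸ h)]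
  · rw [← arg_mul_toCircle h v.1, h2, arg_mul_toCircle (e2 ▸ h)]

theorem mem_arc {v : Torus} {x : E4} :
    x ∈ arc v ↔ ∃ c s : ℝ, 0 ≤ c ∧ 0 ≤ s ∧ c ^ 2 + s ^ 2 = 1 ∧ polar v c s = x := by
  have hpi := Real.pi_pos
  constructor
  · rintro ⟨⟨w, τ⟩, ⟨hw, h0, h1⟩, rfl⟩
    obtain rfl : w = v := hw
    simp only at h0 h1
    refine ⟨Real.cos (Real.pi * τ / 2), Real.sin (Real.pi * τ / 2), ?_, ?_,
      Real.cos_sq_add_sin_sq _, (joinMap_eq w τ).symm⟩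
    · exact Real.cos_nonneg_of_mem_Icc ⟨by nlinarith, by nlinarith⟩
    · exact Real.sin_nonneg_of_mem_Icc ⟨by positivity, by nlinarith⟩
  · rintro ⟨c, s, hc, hs, hcs, rfl⟩
    have hc1 : c ≤ 1 := by nlinarith
    refine ⟨(v, 2 / Real.pi * Real.arccos c), ⟨rfl, ?_, ?_⟩, ?_⟩
    · have := Real.arccos_nonneg c
      positivity
    · simp only
      have := Real.arccos_le_pi_div_two.2 hc
      rw [div_mul_eq_mul_div, div_le_one hpi]
      linarith
    · rw [joinMap_eq, show Real.pi * (2 / Real.pi * Real.arccos c) / 2 = Real.arccos c by field_simp,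
        Real.cos_arccos (by linarith) hc1, Real.sin_arccos,
        show 1 - c ^ 2 = s ^ 2 by linarith, Real.sqrt_sq hs, polar]

/-- A point with z₁ ≠ 0 determines φ, and a point with z₁ = 0 determines θ. -/
theorem eq_or_eq_of_mem_arc {v v' : Torus} {x : E4} (h : x ∈ arc v) (h' : x ∈ arc v') :
    v.1 = v'.1 ∨ v.2 = v'.2 := by
  obtain ⟨c, s, hc, hs, hcs, rfl⟩ := mem_arc.1 h
  obtain ⟨c', s', hc', hs', -, e⟩ := mem_arc.1 h'
  obtain ⟨-, -, h1, h2⟩ := polar_eq_polar hc hs hc' hs' e.symm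
  rcases hc.eq_or_lt with rfl | h0
  · exact Or.inl (h2 (by by_contra h; have : s = 0 := by linarith
                         subst this; norm_num at hcs))
  · exact Or.inr (h1 h0)

theorem isClosed_arc (v : Torus) : IsClosed (arc v) :=
  ((isCompact_singleton.prod isCompact_Icc).image continuous_joinMap).isClosed

theorem TileSystem.link_free {ι : Type} (T : TileSystem ι) : link T.free = toE4 '' T.edge := by
  ext x
  simp only [link, mem_iUnion, exists_prop, mem_arc]
  constructor
  · rintro ⟨v, hv, c, s, hc, hs, hcs, rfl⟩
    refine ⟨_, ⟨?_, v, hv, mul_toCircle_mem_sector hc (mem_singleton v.2),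
      mul_toCircle_mem_sector hs (mem_singleton v.1)⟩, rfl⟩
    rw [sphereC, mem_ofPred_eq]
    simp only
    rw [norm_mul_toCircle hc, norm_mul_toCircle hs, hcs]
  · rintro ⟨q, ⟨hq, v, hv, h1, h2⟩, rfl⟩
    refine ⟨v, hv, ‖q.1‖, ‖q.2‖, norm_nonneg _, norm_nonneg _, hq, ?_⟩
    have key : ∀ {z : ℂ} {φ : Real.Angle}, z ∈ sector {φ} → (‖z‖ * φ.toCircle : ℂ) = z := by
      rintro z φ (rfl | h)
      · simp
      · obtain rfl : (z.arg : Real.Angle) = φ := h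
        exact (eq_norm_mul_toCircle z).symm
    rw [polar, key h1, key h2]

theorem inner_polar (v v' : Torus) (c s c' s' : ℝ) : inner ℝ (polar v c s) (polar v' c' s') =
    c * c' * (v.2 - v'.2).cos + s * s' * (v.1 - v'.1).cos := by
  simp only [polar, toE4, PiLp.inner_apply, Fin.sum_univ_four, Real.Angle.coe_toCircle,
    sub_eq_add_neg, Real.Angle.cos_add, Real.Angle.cos_neg, Real.Angle.sin_neg]
  simp
  ring

theorem combine_polar (v : Torus) (a b c s c' s' : ℝ) : a • polar v c s + b • polar v c' s' =
    polar v (a * c + b * c') (a * s + b * s') := by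
  simp only [polar, ← toE4L_apply, ← map_smul, ← map_add]
  congr 1
  refine Prod.ext ?_ ?_ <;> simp <;> ring

/-! ### Curves made of arcs have no cusps -/

/-- Near p the set lies on two arcs of great circles leaving p in the directions D₁ and D₂. The
functional ⟨D₂ - D₁, ·⟩ vanishes at p and is -(b d) on the first arc and b d on the second, with d =
1 - ⟨D₁, D₂⟩ > 0. Hence it is a linear coordinate as in `not_hasCuspAt_of_linear`. -/
theorem not_hasCuspAt_of_branches {K : Set E4} {p D₁ D₂ : E4} (hp : ‖p‖ = 1) (h1 : ‖D₁‖ = 1)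
    (h2 : ‖D₂‖ = 1) (o1 : inner ℝ p D₁ = 0) (o2 : inner ℝ p D₂ = 0) (hne : D₁ ≠ D₂)
    (h : ∀ᶠ q in 𝓝 p, q ∈ K → ∃ a b : ℝ, 0 ≤ b ∧ a ^ 2 + b ^ 2 = 1 ∧
      (q = a • p + b • D₁ ∨ q = a • p + b • D₂)) : ¬ HasCuspAt K p := by
  set d : ℝ := 1 - inner ℝ D₁ D₂ with hd
  have hdpos : 0 < d := sub_pos.2 ((inner_lt_one_iff_real_of_norm_eq_one h1 h2).2 hne)
  have s1 : inner ℝ D₁ D₁ = (1 : ℝ) := by rw [real_inner_self_eq_norm_sq, h1, one_pow]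
  have s2 : inner ℝ D₂ D₂ = (1 : ℝ) := by rw [real_inner_self_eq_norm_sq, h2, one_pow]
  have sp : inner ℝ p p = (1 : ℝ) := by rw [real_inner_self_eq_norm_sq, hp, one_pow]
  let L : E4 →L[ℝ] ℝ := innerSL ℝ (D₂ - D₁)
  have L1 : ∀ a b : ℝ, L (a • p + b • D₁) = -(b * d) := fun a b => by
    simp only [L, innerSL_apply_apply, inner_add_right, inner_smul_right, inner_sub_left, s1,
      real_inner_comm p D₁, real_inner_comm p D₂, real_inner_comm D₁ D₂, o1, o2, hd]
    ring
  have L2 : ∀ a b : ℝ, L (a • p + b • D₂) = b * d := fun a b => by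
    simp only [L, innerSL_apply_apply, inner_add_right, inner_smul_right, inner_sub_left, s2,
      real_inner_comm p D₁, real_inner_comm p D₂, o1, o2, hd]
    ring
  have Lp : L p = 0 := by simpa using L2 1 0
  have hpos : ∀ᶠ q in 𝓝 p, 0 < inner ℝ p q := by
    have : Continuous fun q : E4 => (inner ℝ p q : ℝ) := by fun_prop
    exact this.continuousAt.eventually (lt_mem_nhds (sp.symm ▸ one_pos : (0 : ℝ) < inner ℝ p p))
  have pa : ∀ (a b : ℝ) (D : E4), inner ℝ p D = (0 : ℝ) → inner ℝ p (a • p + b • D) = a :=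
    fun a b D hD => by simp [inner_add_right, inner_smul_right, hD, hp]
  have nrm : ∀ (a b : ℝ) (D : E4), inner ℝ p D = (0 : ℝ) → ‖D‖ = 1 → 0 ≤ b → a ^ 2 + b ^ 2 = 1 →
      0 < a → ‖a • p + b • D - p‖ ≤ 2 * b := fun a b D hD hD1 hb hab ha => by
    refine abs_le_of_sq_le_sq' ?_ (by positivity) |>.2
    have e : a • p + b • D - p = (a - 1) • p + b • D := by module
    rw [e, norm_add_sq_real, norm_smul, norm_smul, inner_smul_left, inner_smul_right, hD, hp, hD1]
    simp only [mul_one, mul_zero, add_zero, Real.norm_eq_abs, sq_abs]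
    nlinarith
  refine not_hasCuspAt_of_linear L (c := d / 2) (by positivity) (h.and hpos) ?_ ?_
  · rintro q ⟨hq, hq0⟩ hK
    obtain ⟨a, b, hb, hab, rfl | rfl⟩ := hq hK
    · rw [map_sub, Lp, L1, sub_zero, abs_neg, abs_of_nonneg (by positivity)]
      rw [pa _ _ _ o1] at hq0
      nlinarith [nrm a b D₁ o1 h1 hb hab hq0]
    · rw [map_sub, Lp, L2, sub_zero, abs_of_nonneg (by positivity)]
      rw [pa _ _ _ o2] at hq0
      nlinarith [nrm a b D₂ o2 h2 hb hab hq0]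
  · rintro q ⟨hK, hq, hq0⟩ q' ⟨hK', hq', hq0'⟩ hL
    obtain ⟨a, b, hb, hab, hh⟩ := hq hK
    obtain ⟨a', b', hb', hab', hh'⟩ := hq' hK'
    have ha : 0 < a := by rcases hh with rfl | rfl <;> [rwa [pa _ _ _ o1] at hq0; rwa [pa _ _ _ o2] at hq0]
    have ha' : 0 < a' := by
      rcases hh' with rfl | rfl <;> [rwa [pa _ _ _ o1] at hq0'; rwa [pa _ _ _ o2] at hq0']
    have haa : b = b' → a = a' := fun h => by
      subst h
      nlinarith
    rcases hh with rfl | rfl <;> rcases hh' with rfl | rfl <;> simp only [L1, L2] at hL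
    · have e : b = b' := mul_right_cancel₀ hdpos.ne' (by linarith)
      rw [haa e, e]
    · have e : b = 0 := by nlinarith
      have e' : b' = 0 := by nlinarith
      rw [haa (e.trans e'.symm), e, e', zero_smul, zero_smul]
    · have e : b = 0 := by nlinarith
      have e' : b' = 0 := by nlinarith
      rw [haa (e.trans e'.symm), e, e', zero_smul, zero_smul]
    · have e : b = b' := mul_right_cancel₀ hdpos.ne' (by linarith)
      rw [haa e, e]

theorem norm_polar {v : Torus} {c s : ℝ} (h : c ^ 2 + s ^ 2 = 1) : ‖polar v c s‖ = 1 := by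
  have := inner_polar v v c s c s
  rw [real_inner_self_eq_norm_sq] at this
  simp only [sub_self, Real.Angle.cos_zero, mul_one] at this
  nlinarith [norm_nonneg (polar v c s)]

theorem eventually_mem_link {R : Set Torus} (hR : R.Finite) (p : E4) :
    ∀ᶠ q in 𝓝 p, q ∈ link R → ∃ v ∈ R, p ∈ arc v ∧ q ∈ arc v := by
  have hcl : IsClosed (⋃ v ∈ {v ∈ R | p ∉ arc v}, arc v) :=
    (hR.subset (sep_subset _ _)).isClosed_biUnion fun v _ => isClosed_arc v
  filter_upwards [hcl.isOpen_compl.mem_nhds (by simp : p ∈ _)] with q hq hqR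
  simp only [link, mem_iUnion, exists_prop] at hqR
  obtain ⟨v, hv, hqv⟩ := hqR
  refine ⟨v, hv, ?_, hqv⟩
  by_contra h
  exact hq (mem_biUnion (show v ∈ {v ∈ R | p ∉ arc v} from ⟨hv, h⟩) hqv)

theorem exists_pair_of_encard {R S : Set Torus} {v : Torus} (hv : v ∈ R ∩ S)
    (h : (R ∩ S).encard = 0 ∨ (R ∩ S).encard = 2) : ∃ w, w ≠ v ∧ R ∩ S = {v, w} := by
  rcases h with h | h
  · rw [encard_eq_zero] at h
    exact absurd hv (h ▸ notMem_empty v)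
  · obtain ⟨x, y, hxy, he⟩ := encard_eq_two.1 h
    rw [he] at hv ⊢
    rcases hv with rfl | rfl
    · exact ⟨y, hxy.symm, rfl⟩
    · exact ⟨x, hxy, pair_comm _ _⟩

/-- At a point with z₁ = 0 the two arcs belong to the two vertices on one meridian, and their
directions are distinct because these vertices have different φ; the case z₂ = 0 is similar. At an
inner point of an arc the two directions are opposite. -/
theorem not_hasCuspAt_of_subset_link {R : Set Torus} (hR : IsLinkDiagram R) {K : Set E4}
    (hK : K ⊆ link R) {p : E4} (hp : p ∈ K) : ¬ HasCuspAt K p := by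
  have hpR := hK hp
  simp only [link, mem_iUnion, exists_prop, mem_arc] at hpR
  obtain ⟨v, hv, c, s, hc, hs, hcs, rfl⟩ := hpR
  have hev := eventually_mem_link hR.1 (polar v c s)
  rcases hc.eq_or_lt with rfl | hc0
  · obtain rfl : s = 1 := by nlinarith
    obtain ⟨w, hwv, he⟩ := exists_pair_of_encard (S := {x | x.1 = v.1}) ⟨hv, rfl⟩ (hR.2.1 v.1)
    have hw : w.1 = v.1 := (he ▸ mem_insert_of_mem _ rfl : w ∈ R ∩ {x | x.1 = v.1}).2
    refine not_hasCuspAt_of_branches (D₁ := polar v 1 0) (D₂ := polar w 1 0)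
      (norm_polar (by norm_num)) (norm_polar (by norm_num)) (norm_polar (by norm_num))
      (by simp [inner_polar]) (by simp [inner_polar]) (fun h => hwv ?_) ?_
    · have h1 := polar_eq_polar zero_le_one le_rfl zero_le_one le_rfl h
      exact (Prod.ext hw.symm (h1.2.2.1 one_pos)).symm
    · filter_upwards [hev] with q hq hqK
      obtain ⟨v', hv', h1, h2⟩ := hq (hK hqK)
      obtain ⟨c', s', hc', hs', hcs', e'⟩ := mem_arc.1 h1
      obtain ⟨c, s, hc, hs, hcs, rfl⟩ := mem_arc.1 h2
      obtain ⟨-, -, -, h4⟩ := polar_eq_polar le_rfl zero_le_one hc' hs' e'.symm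
      have h5 : v' ∈ R ∩ {x | x.1 = v.1} := ⟨hv', (h4 one_pos).symm⟩
      refine ⟨s, c, hc, by linarith, ?_⟩
      rw [he] at h5
      rcases h5 with rfl | rfl
      · left
        rw [combine_polar]
        congr 1 <;> ring
      · right
        have : polar v 0 1 = polar v' 0 1 := by simp [polar, hw]
        rw [this, combine_polar]
        congr 1 <;> ring
  rcases hs.eq_or_lt with rfl | hs0
  · obtain rfl : c = 1 := by nlinarith
    obtain ⟨w, hwv, he⟩ := exists_pair_of_encard (S := {x | x.2 = v.2}) ⟨hv, rfl⟩ (hR.2.2 v.2)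
    have hw : w.2 = v.2 := (he ▸ mem_insert_of_mem _ rfl : w ∈ R ∩ {x | x.2 = v.2}).2
    refine not_hasCuspAt_of_branches (D₁ := polar v 0 1) (D₂ := polar w 0 1)
      (norm_polar (by norm_num)) (norm_polar (by norm_num)) (norm_polar (by norm_num))
      (by simp [inner_polar]) (by simp [inner_polar]) (fun h => hwv ?_) ?_
    · have h1 := polar_eq_polar le_rfl zero_le_one le_rfl zero_le_one h
      exact (Prod.ext (h1.2.2.2 one_pos) hw.symm).symm
    · filter_upwards [hev] with q hq hqK
      obtain ⟨v', hv', h1, h2⟩ := hq (hK hqK)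
      obtain ⟨c', s', hc', hs', hcs', e'⟩ := mem_arc.1 h1
      obtain ⟨c, s, hc, hs, hcs, rfl⟩ := mem_arc.1 h2
      obtain ⟨-, -, h4, -⟩ := polar_eq_polar zero_le_one le_rfl hc' hs' e'.symm
      have h5 : v' ∈ R ∩ {x | x.2 = v.2} := ⟨hv', (h4 one_pos).symm⟩
      refine ⟨c, s, hs, by linarith, ?_⟩
      rw [he] at h5
      rcases h5 with rfl | rfl
      · left
        rw [combine_polar]
        congr 1 <;> ring
      · right
        have : polar v 1 0 = polar v' 1 0 := by simp [polar, hw]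
        rw [this, combine_polar]
        congr 1 <;> ring
  · refine not_hasCuspAt_of_branches (D₁ := polar v (-s) c) (D₂ := polar v s (-c))
      (norm_polar hcs) (norm_polar (by linarith)) (norm_polar (by linarith))
      (by simp [inner_polar]; ring) (by simp [inner_polar]; ring) (fun h => ?_) ?_
    · have h1 := inner_polar v v (-s) c (-s) c
      rw (occs := .pos [2]) [h] at h1
      rw [inner_polar] at h1
      simp only [sub_self, Real.Angle.cos_zero] at h1
      nlinarith
    · filter_upwards [hev] with q hq hqK
      obtain ⟨v', hv', h1, h2⟩ := hq (hK hqK)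
      obtain ⟨c', s', hc', hs', hcs', e'⟩ := mem_arc.1 h1
      obtain ⟨c₁, s₁, hc₁, hs₁, hcs₁, rfl⟩ := mem_arc.1 h2
      obtain ⟨-, -, h3, h4⟩ := polar_eq_polar hc hs hc' hs' e'.symm
      obtain rfl : v = v' := Prod.ext (h4 hs0) (h3 hc0)
      have e : (c * c₁ + s * s₁) ^ 2 + (c * s₁ - s * c₁) ^ 2 = 1 := by
        calc _ = (c ^ 2 + s ^ 2) * (c₁ ^ 2 + s₁ ^ 2) := by ring
          _ = 1 := by rw [hcs, hcs₁, one_mul]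
      have e1 : (c * c₁ + s * s₁) * c - (c * s₁ - s * c₁) * s = c₁ := by
        linear_combination c₁ * hcs
      have e2 : (c * c₁ + s * s₁) * s + (c * s₁ - s * c₁) * c = s₁ := by
        linear_combination s₁ * hcs
      rcases le_total 0 (c * s₁ - s * c₁) with h0 | h0
      · refine ⟨_, _, h0, e, Or.inl ?_⟩
        rw [combine_polar]
        congr 1 <;> linarith
      · refine ⟨c * c₁ + s * s₁, -(c * s₁ - s * c₁), by linarith, by rw [neg_sq]; exact e, Or.inr ?_⟩
        rw [combine_polar]
        congr 1 <;> linarith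

/-! ### Closed chains of arcs -/

theorem joinMap_eq_smul (v : Torus) (τ : ℝ) : joinMap (v, τ) =
    Real.cos (Real.pi * τ / 2) • polar v 1 0 + Real.sin (Real.pi * τ / 2) • polar v 0 1 := by
  rw [joinMap_eq, combine_polar]
  simp [polar]

theorem contDiff_joinMap_affine (v : Torus) (a b : ℝ) :
    ContDiff ℝ ∞ fun s => joinMap (v, a * s + b) := by
  simp only [joinMap_eq_smul]
  fun_prop

theorem deriv_joinMap_affine_ne_zero (v : Torus) {a : ℝ} (ha : a ≠ 0) (b s : ℝ) :
    deriv (fun s => joinMap (v, a * s + b)) s ≠ 0 := by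
  have h : HasDerivAt (fun s => Real.pi * (a * s + b) / 2) (Real.pi * a / 2) s := by
    have := ((((hasDerivAt_id s).const_mul a).add_const b).const_mul Real.pi).div_const 2
    simpa using this
  have h1 := (h.cos.smul_const (polar v 1 0)).add (h.sin.smul_const (polar v 0 1))
  have h2 : (fun s => joinMap (v, a * s + b)) = (fun y => Real.cos (Real.pi * (a * y + b) / 2) •
      polar v 1 0) + fun y => Real.sin (Real.pi * (a * y + b) / 2) • polar v 0 1 :=
    funext fun s => joinMap_eq_smul v _
  rw [h2, h1.deriv, combine_polar]
  intro h0
  have h3 := congrArg (fun x => inner ℝ x x) h0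
  simp only [inner_polar, sub_self, Real.Angle.cos_zero, inner_self_eq_zero.2] at h3
  have h4 : Real.pi * a / 2 ≠ 0 := by have := Real.pi_ne_zero; positivity
  have h5 := Real.sin_sq_add_cos_sq (Real.pi * (a * s + b) / 2)
  refine h4 (pow_eq_zero_iff two_ne_zero |>.1 ?_)
  linear_combination h3 - (Real.pi * a / 2) ^ 2 * h5

theorem joinMap_one_eq {v v' : Torus} (h : v.1 = v'.1) : joinMap (v, 1) = joinMap (v', 1) := by
  simp [joinMap_eq, h]

theorem joinMap_zero_eq {v v' : Torus} (h : v.2 = v'.2) : joinMap (v, 0) = joinMap (v', 0) := by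
  simp [joinMap_eq, h]

theorem joinMap_inj {v v' : Torus} {τ τ' : ℝ} (hτ : τ ∈ Icc (0 : ℝ) 1) (hτ' : τ' ∈ Icc (0 : ℝ) 1)
    (h : joinMap (v, τ) = joinMap (v', τ')) :
    τ = τ' ∧ (τ < 1 → v.2 = v'.2) ∧ (0 < τ → v.1 = v'.1) := by
  have hpi := Real.pi_pos
  have hm : ∀ {t : ℝ}, t ∈ Icc (0 : ℝ) 1 → Real.pi * t / 2 ∈ Icc 0 (Real.pi / 2) := fun {t} ht =>
    ⟨by have := ht.1; positivity, by nlinarith [ht.2]⟩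
  have hc : ∀ {t : ℝ}, t ∈ Icc (0 : ℝ) 1 → 0 ≤ Real.cos (Real.pi * t / 2) := fun ht =>
    Real.cos_nonneg_of_mem_Icc ⟨by linarith [(hm ht).1], (hm ht).2⟩
  have hs : ∀ {t : ℝ}, t ∈ Icc (0 : ℝ) 1 → 0 ≤ Real.sin (Real.pi * t / 2) := fun ht =>
    Real.sin_nonneg_of_mem_Icc ⟨(hm ht).1, by linarith [(hm ht).2]⟩
  rw [joinMap_eq, joinMap_eq] at h
  obtain ⟨h1, -, h3, h4⟩ := polar_eq_polar (hc hτ) (hs hτ) (hc hτ') (hs hτ') h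
  refine ⟨?_, fun h => h3 ?_, fun h => h4 ?_⟩
  · have := Real.injOn_cos ⟨(hm hτ).1, by linarith [(hm hτ).2]⟩
      ⟨(hm hτ').1, by linarith [(hm hτ').2]⟩ h1
    have h5 : Real.pi * τ = Real.pi * τ' := by linarith
    exact mul_left_cancel₀ hpi.ne' h5
  · exact Real.cos_pos_of_mem_Ioo ⟨by linarith [(hm hτ).1], by nlinarith⟩
  · exact Real.sin_pos_of_pos_of_lt_pi (by positivity) (by linarith [(hm hτ).2])

/-- The `k`-th edge of a chain of arcs, traversed during the time from `k` to `k + 1`. -/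
noncomputable def chainEdge (e : ℕ → Torus) (k : ℕ) (u : ℝ) : E4 :=
  -- Even edges run from τ = 0 to τ = 1 and odd ones back, so consecutive edges meet alternately at
  -- τ = 1, where only θ matters, and at τ = 0, where only φ matters.
  joinMap (e k, if Even k then u - k else k + 1 - u)

/-- The parametrization of a chain of arcs. -/
noncomputable def chain (e : ℕ → Torus) (u : ℝ) : E4 := chainEdge e ⌊u⌋₊ u

/-- The arcs of `e 0, …, e (n - 1)` form a closed chain, with the odd and the even ends of
consecutive arcs glued to each other. -/
structure IsClosedChain (n : ℕ) (e : ℕ → Torus) : Prop where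
  pos : 0 < n
  even : Even n
  fst_succ : ∀ k, Even k → (e (k + 1)).1 = (e k).1
  snd_succ : ∀ k, ¬ Even k → (e (k + 1)).2 = (e k).2
  closed : e n = e 0
  injOn : InjOn e (Iio n)
  injOn_snd : InjOn (fun k => (e k).2) {k | k < n ∧ Even k}
  injOn_fst : InjOn (fun k => (e k).1) {k | k < n ∧ ¬ Even k}

theorem chain_eq_of_mem_Ico {e : ℕ → Torus} {k : ℕ} {u : ℝ} (h : u ∈ Ico (k : ℝ) (k + 1)) :
    chain e u = chainEdge e k u := by
  rw [chain, (Nat.floor_eq_iff (k.cast_nonneg.trans h.1)).2 h]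

theorem continuous_chainEdge (e : ℕ → Torus) (k : ℕ) : Continuous (chainEdge e k) := by
  refine continuous_joinMap.comp (continuous_const.prodMk ?_)
  split_ifs <;> fun_prop

theorem arc_eq_image_chainEdge (e : ℕ → Torus) (k : ℕ) :
    chainEdge e k '' Icc (k : ℝ) (k + 1) = arc (e k) := by
  apply Subset.antisymm
  · rintro _ ⟨u, hu, rfl⟩
    refine ⟨_, ⟨mem_singleton (e k), ?_⟩, rfl⟩
    simp only
    split_ifs <;> constructor <;> linarith [hu.1, hu.2]
  · rintro _ ⟨⟨v, τ⟩, ⟨hv, hτ⟩, rfl⟩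
    obtain rfl : v = e k := hv
    simp only at hτ
    by_cases hk : Even k
    · refine ⟨k + τ, ⟨by linarith [hτ.1], by linarith [hτ.2]⟩, ?_⟩
      simp [chainEdge, hk]
    · refine ⟨k + 1 - τ, ⟨by linarith [hτ.2], by linarith [hτ.1]⟩, ?_⟩
      simp [chainEdge, hk]

namespace IsClosedChain

variable {n : ℕ} {e : ℕ → Torus}

theorem chainEdge_succ (h : IsClosedChain n e) (k : ℕ) : chainEdge e (k + 1) (k + 1 : ℕ) = chainEdge e k (k + 1 : ℕ) := by
  by_cases hk : Even k
  · simp only [chainEdge, hk, Nat.even_add_one, not_true, if_true, if_false, Nat.cast_add,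
      Nat.cast_one, add_sub_cancel_left]
    exact joinMap_one_eq (h.fst_succ k hk)
  · simp only [chainEdge, hk, Nat.even_add_one, not_false_iff, if_true, if_false, Nat.cast_add,
      Nat.cast_one, sub_self]
    exact joinMap_zero_eq (h.snd_succ k hk)

theorem chain_eq (h : IsClosedChain n e) {k : ℕ} {u : ℝ} (hu : u ∈ Icc (k : ℝ) (k + 1)) : chain e u = chainEdge e k u := by
  rcases hu.2.eq_or_lt with rfl | hlt
  · have h1 := h.chainEdge_succ k
    push_cast at h1
    rw [← h1]
    refine chain_eq_of_mem_Ico ⟨?_, ?_⟩ <;> push_cast <;> linarith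
  · exact chain_eq_of_mem_Ico ⟨hu.1, hlt⟩

theorem continuousOn_chain (h : IsClosedChain n e) (m : ℕ) : ContinuousOn (chain e) (Icc (0 : ℝ) m) := by
  induction m with
  | zero => simp
  | succ m ih =>
    push_cast
    rw [← Icc_union_Icc_eq_Icc (b := (m : ℝ)) m.cast_nonneg (by linarith)]
    exact ih.union_of_isClosed ((continuous_chainEdge e m).continuousOn.congr
      fun u hu => h.chain_eq hu) isClosed_Icc isClosed_Icc

theorem chain_zero_eq (h : IsClosedChain n e) : chain e 0 = chain e n := by
  have h0 := h.chain_eq (k := 0) (u := 0) (by simp)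
  have h1 := h.chain_eq (k := n) (u := n) (by simp)
  rw [h0, h1]
  simp [chainEdge, h.even, h.closed]

/-- Equal points have equal τ. On the half-open time interval of an edge τ < 1 if it is even and τ >
0 if it is odd. So two even edges have the same φ, two odd ones the same θ, and edges of different
parity the same vertex. -/
theorem injOn_chain (h : IsClosedChain n e) : InjOn (chain e) (Ico (0 : ℝ) n) := by
  intro u hu u' hu' heq
  have hk : ∀ {u : ℝ}, u ∈ Ico (0 : ℝ) n → ⌊u⌋₊ < n := fun hu => (Nat.floor_lt hu.1).2 hu.2
  have hf : ∀ {u : ℝ}, u ∈ Ico (0 : ℝ) n → (⌊u⌋₊ : ℝ) ≤ u ∧ u < ⌊u⌋₊ + 1 := fun hu =>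
    ⟨Nat.floor_le hu.1, Nat.lt_floor_add_one _⟩
  have kk := hk hu
  have kk' := hk hu'
  have ff := hf hu
  have ff' := hf hu'
  simp only [chain, chainEdge] at heq
  set k := ⌊u⌋₊
  set k' := ⌊u'⌋₊
  have hmem : ∀ (j : ℕ) (x : ℝ), (j : ℝ) ≤ x ∧ x < j + 1 →
      (if Even j then x - j else j + 1 - x) ∈ Icc (0 : ℝ) 1 := fun j x hx => by
    split_ifs <;> constructor <;> linarith [hx.1, hx.2]
  obtain ⟨e1, e2, e3⟩ := joinMap_inj (hmem k u ff) (hmem k' u' ff') heq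
  have fin : k = k' → u = u' := fun hh => by
    rw [← hh] at e1
    split_ifs at e1 <;> linarith
  by_cases he : Even k <;> by_cases he' : Even k' <;>
    simp only [he, he', if_true, if_false] at e1 e2 e3
  · exact fin (h.injOn_snd ⟨kk, he⟩ ⟨kk', he'⟩ (e2 (by linarith)))
  · exact fin (h.injOn kk kk' (Prod.ext (e3 (by linarith)) (e2 (by linarith))))
  · exact fin (h.injOn kk kk' (Prod.ext (e3 (by linarith)) (e2 (by linarith))))
  · exact fin (h.injOn_fst ⟨kk, he⟩ ⟨kk', he'⟩ (e3 (by linarith)))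

theorem image_chain (h : IsClosedChain n e) (m : ℕ) (hm : 0 < m) : chain e '' Icc (0 : ℝ) m = ⋃ k < m, arc (e k) := by
  induction m, hm using Nat.le_induction with
  | base =>
    have := arc_eq_image_chainEdge e 0
    rw [← image_congr fun u hu => h.chain_eq hu] at this
    simpa using this
  | succ m hm ih =>
    push_cast
    rw [← Icc_union_Icc_eq_Icc (b := (m : ℝ)) m.cast_nonneg (by linarith), image_union, ih,
      image_congr fun u hu => h.chain_eq hu, arc_eq_image_chainEdge, biUnion_lt_succ]

theorem isPiecewiseSmoothSimpleClosedCurve (h : IsClosedChain n e) :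
    IsPiecewiseSmoothSimpleClosedCurve (⋃ k < n, arc (e k)) := by
  have hn : (0 : ℝ) < n := Nat.cast_pos.2 h.pos
  have him : (fun s : ℝ => n * s) '' Icc (0 : ℝ) 1 = Icc (0 : ℝ) n := by
    rw [image_mul_left_Icc hn.le zero_le_one]
    simp
  refine ⟨fun s => chain e (n * s), ?_, ?_, ?_, ?_, n, fun i => i / n, ?_, ?_, ?_, fun i => ?_⟩
  · exact (h.continuousOn_chain n).comp (by fun_prop) fun s hs => him ▸ mem_image_of_mem _ hs
  · simpa using h.chain_zero_eq
  · intro s hs s' hs' heq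
    have hm : ∀ {s : ℝ}, s ∈ Ico (0 : ℝ) 1 → (n : ℝ) * s ∈ Ico (0 : ℝ) n := fun hs =>
      ⟨by have := hs.1; positivity, by nlinarith [hs.2]⟩
    exact mul_left_cancel₀ hn.ne' (h.injOn_chain (hm hs) (hm hs') heq)
  · rw [← h.image_chain n h.pos, ← him, image_image]
  · intro i j hij
    exact div_lt_div_of_pos_right (by exact_mod_cast hij) hn
  · simp
  · simp [hn.ne']
  · have hlt : ((i : ℕ) : ℝ) / n < ((i : ℕ) + 1) / n := div_lt_div_of_pos_right (by linarith) hn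
    have hI : ∃ a b : ℝ, a ≠ 0 ∧ ∀ s ∈ Icc (((i : ℕ) : ℝ) / n) (((i : ℕ) + 1) / n),
        chain e (n * s) = joinMap (e i, a * s + b) := by
      have hs : ∀ s ∈ Icc (((i : ℕ) : ℝ) / n) (((i : ℕ) + 1) / n),
          n * s ∈ Icc ((i : ℕ) : ℝ) ((i : ℕ) + 1) := fun s hs =>
        ⟨by have := (div_le_iff₀' hn).1 hs.1; exact this, (le_div_iff₀' hn).1 hs.2⟩
      by_cases hi : Even (i : ℕ)
      · refine ⟨n, -(i : ℕ), hn.ne', fun s h1 => ?_⟩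
        rw [h.chain_eq (hs s h1), chainEdge, if_pos hi, sub_eq_add_neg]
      · refine ⟨-n, (i : ℕ) + 1, neg_ne_zero.2 hn.ne', fun s h1 => ?_⟩
        rw [h.chain_eq (hs s h1), chainEdge, if_neg hi]
        congr 2
        ring
    obtain ⟨a, b, ha, hI⟩ := hI
    simp only [Fin.val_castSucc, Fin.val_succ, Nat.cast_add, Nat.cast_one]
    refine ⟨(contDiff_joinMap_affine (e i) a b).contDiffOn.congr hI, fun s hs => ?_⟩
    rw [derivWithin_congr hI (hI s hs), DifferentiableAt.derivWithin
      ((contDiff_joinMap_affine (e i) a b).differentiable (by simp) s) (uniqueDiffOn_Icc hlt s hs)]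
    exact deriv_joinMap_affine_ne_zero (e i) ha b s

end IsClosedChain

/-! ### The components of a link -/

/-- The dihedral relation: conjugation by a inverts b a. -/
theorem mul_zpow_of_involutive {α : Type*} {a b : Equiv.Perm α} (ha : a * a = 1) (hb : b * b = 1)
    (m : ℤ) : a * (b * a) ^ m = (b * a) ^ (-m) * a := by
  have ha' : a⁻¹ = a := inv_eq_of_mul_eq_one_left ha
  have hb' : b⁻¹ = b := inv_eq_of_mul_eq_one_left hb
  have h1 : a * (b * a) * a⁻¹ = (b * a)⁻¹ := by
    rw [mul_inv_rev, ha', hb', mul_assoc, mul_assoc, ha, mul_one]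
  rw [zpow_neg, ← inv_zpow, ← h1, conj_zpow, inv_mul_cancel_right]

/-- With σ = b a, the equality σ^m x = a x implies a σ^j x = σ^(m - j) x for all j. If m = 2j, then
σ^j x is fixed by a; if m = 2j + 1, then a σ^j x is fixed by b. -/
theorem zpow_apply_ne {α : Type*} {a b : Equiv.Perm α} (ha : a * a = 1) (hb : b * b = 1)
    (fa : ∀ x, a x ≠ x) (fb : ∀ x, b x ≠ x) (m : ℤ) (x : α) : ((b * a) ^ m) x ≠ a x := by
  intro h
  have key : ∀ j : ℤ, a (((b * a) ^ j) x) = ((b * a) ^ (-j + m)) x := fun j => by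
    rw [← Equiv.Perm.mul_apply, mul_zpow_of_involutive ha hb, Equiv.Perm.mul_apply, ← h,
      ← Equiv.Perm.mul_apply, ← zpow_add]
  obtain ⟨j, rfl | rfl⟩ := Int.even_or_odd' m
  · refine fa (((b * a) ^ j) x) ?_
    rw [key]
    congr 2
    ring
  · refine fb (a (((b * a) ^ j) x)) ?_
    rw [← Equiv.Perm.mul_apply b a, ← Equiv.Perm.mul_apply, ← zpow_one_add, key]
    congr 2
    ring

/-- The set of points that can be reached from `v` by two involutions `a` and `b`. -/
def reach {α : Type*} (a b : Equiv.Perm α) (v : α) : Set α :=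
  {w | ∃ m : ℤ, w = ((b * a) ^ m) v ∨ a w = ((b * a) ^ m) v}

section Reach

variable {α : Type*} {a b : Equiv.Perm α}

theorem mem_reach_self (v : α) : v ∈ reach a b v := ⟨0, Or.inl rfl⟩

theorem fst_mem_reach (ha : a * a = 1) {v w : α} (h : w ∈ reach a b v) : a w ∈ reach a b v := by
  obtain ⟨m, h | h⟩ := h
  · refine ⟨m, Or.inr ?_⟩
    rw [← Equiv.Perm.mul_apply, ha, Equiv.Perm.one_apply, h]
  · exact ⟨m, Or.inl h⟩

theorem snd_mem_reach (ha : a * a = 1) (hb : b * b = 1) {v w : α} (h : w ∈ reach a b v) :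
    b w ∈ reach a b v := by
  obtain ⟨m, h | h⟩ := h
  · refine ⟨-1 + m, Or.inr ?_⟩
    rw [zpow_add, Equiv.Perm.mul_apply, ← h, ← Equiv.Perm.mul_apply, zpow_neg_one, mul_inv_rev,
      inv_eq_of_mul_eq_one_left ha, inv_eq_of_mul_eq_one_left hb]
  · refine ⟨1 + m, Or.inl ?_⟩
    rw [zpow_add, Equiv.Perm.mul_apply, ← h, zpow_one, Equiv.Perm.mul_apply, ← Equiv.Perm.mul_apply a,
      ha, Equiv.Perm.one_apply]

theorem mem_reach_symm (ha : a * a = 1) (hb : b * b = 1) {v w : α} (h : w ∈ reach a b v) :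
    v ∈ reach a b w := by
  obtain ⟨m, h | h⟩ := h
  · refine ⟨-m, Or.inl ?_⟩
    rw [h, ← Equiv.Perm.mul_apply, ← zpow_add, neg_add_cancel, zpow_zero, Equiv.Perm.one_apply]
  · refine ⟨m, Or.inr ?_⟩
    have h1 : v = ((b * a) ^ (-m)) (a w) := by
      rw [h, ← Equiv.Perm.mul_apply, ← zpow_add, neg_add_cancel, zpow_zero, Equiv.Perm.one_apply]
    rw [h1, ← Equiv.Perm.mul_apply, mul_zpow_of_involutive ha hb, neg_neg, Equiv.Perm.mul_apply,
      ← Equiv.Perm.mul_apply a, ha, Equiv.Perm.one_apply]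

theorem mem_reach_trans (ha : a * a = 1) (hb : b * b = 1) {u v w : α} (h : w ∈ reach a b v)
    (h' : u ∈ reach a b w) : u ∈ reach a b v := by
  have hz : ∀ (j : ℤ) {x : α}, x ∈ reach a b v → ((b * a) ^ j) x ∈ reach a b v := by
    rintro j x ⟨m, h | h⟩
    · exact ⟨j + m, Or.inl (by rw [h, zpow_add, Equiv.Perm.mul_apply])⟩
    · refine ⟨-j + m, Or.inr ?_⟩
      rw [← Equiv.Perm.mul_apply, mul_zpow_of_involutive ha hb, Equiv.Perm.mul_apply, h, zpow_add,
        Equiv.Perm.mul_apply]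
  obtain ⟨j, rfl | h1⟩ := h'
  · exact hz j h
  · have := fst_mem_reach ha (hz j h)
    rwa [← h1, ← Equiv.Perm.mul_apply, ha, Equiv.Perm.one_apply] at this

theorem reach_eq (ha : a * a = 1) (hb : b * b = 1) {v w : α} (h : w ∈ reach a b v) :
    reach a b w = reach a b v :=
  Subset.antisymm (fun _ h1 => mem_reach_trans ha hb h h1)
    fun _ h1 => mem_reach_trans ha hb (mem_reach_symm ha hb h) h1

end Reach

/-- The involution exchanges the two vertices on each meridian or longitude, according to the
coordinate π. -/
theorem exists_partner {R : Set Torus} {π : Torus → Real.Angle}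
    (h : ∀ θ, {v ∈ R | π v = θ}.encard = 0 ∨ {v ∈ R | π v = θ}.encard = 2) :
    ∃ a : Equiv.Perm R, a * a = 1 ∧ (∀ v, a v ≠ v) ∧ (∀ v, π (a v) = π v) ∧
      ∀ v w : R, π w = π v → w = v ∨ w = a v := by
  have key : ∀ v : R, ∃ w : R, w ≠ v ∧ π w = π v ∧ ∀ u : R, π u = π v → u = v ∨ u = w := by
    rintro ⟨v, hv⟩
    obtain ⟨w, hwv, he⟩ := exists_pair_of_encard (S := {x | π x = π v}) ⟨hv, rfl⟩ (h (π v))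
    have hw : w ∈ R ∩ {x | π x = π v} := he ▸ mem_insert_of_mem _ rfl
    refine ⟨⟨w, hw.1⟩, fun h => hwv (congrArg Subtype.val h), hw.2, fun u hu => ?_⟩
    have : (u : Torus) ∈ R ∩ {x | π x = π v} := ⟨u.2, hu⟩
    rw [he] at this
    exact this.imp (fun h => Subtype.ext h) fun h => Subtype.ext h
  choose f f1 f2 f3 using key
  have hf : Function.Involutive f := fun v =>
    (f3 v (f (f v)) ((f2 _).trans (f2 v))).resolve_right (f1 _)
  exact ⟨hf.toPerm, Equiv.ext hf, f1, f2, f3⟩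

/-- Applying a and b in turn to v gives σ^l v at the even places 2l and a σ^l v at the odd places,
with σ = b a. By `zpow_apply_ne` the two families have no common elements, so the chain is simple
and closes up after twice the period of v under σ. -/
theorem exists_isClosedChain {R : Set Torus} (hR : R.Finite) {a b : Equiv.Perm R} (ha : a * a = 1)
    (hb : b * b = 1) (fa : ∀ v, a v ≠ v) (fb : ∀ v, b v ≠ v)
    (a1 : ∀ v, (a v : Torus).1 = (v : Torus).1) (b1 : ∀ v, (b v : Torus).2 = (v : Torus).2)
    (a2 : ∀ v w : R, (w : Torus).1 = (v : Torus).1 → w = v ∨ w = a v)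
    (b2 : ∀ v w : R, (w : Torus).2 = (v : Torus).2 → w = v ∨ w = b v) (v : R) :
    ∃ n e, IsClosedChain n e ∧ ⋃ k < n, arc (e k) = ⋃ w ∈ reach a b v, arc w := by
  have : Finite R := hR
  set σ := b * a with hσ
  set N := Function.minimalPeriod (fun x => σ • x) v with hN
  have hNpos : 0 < N := Function.minimalPeriod_pos_of_mem_periodicPts
    (Function.Injective.mem_periodicPts (MulAction.injective σ) v)
  have hinj : ∀ i < N, ∀ j < N, (σ ^ i) v = (σ ^ j) v → i = j := fun i hi j hj hij => by
    refine Function.iterate_injOn_Iio_minimalPeriod (f := fun x => σ • x) (x := v) hi hj ?_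
    simp only [smul_iterate]
    exact hij
  have hna : ∀ i j : ℕ, (σ ^ i) v ≠ a ((σ ^ j) v) := fun i j h => by
    refine zpow_apply_ne ha hb fa fb ((i : ℤ) - j) ((σ ^ j) v) ?_
    rw [← h, ← zpow_natCast, ← zpow_natCast, ← Equiv.Perm.mul_apply, ← zpow_add, sub_add_cancel]
  have hnb : ∀ i j : ℕ, (σ ^ i) v ≠ b ((σ ^ j) v) := fun i j h => by
    refine zpow_apply_ne ha hb fa fb (-1 + i - j : ℤ) ((σ ^ j) v) ?_
    rw [← zpow_natCast, ← Equiv.Perm.mul_apply, ← zpow_add, sub_add_cancel, zpow_add, zpow_natCast,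
      Equiv.Perm.mul_apply, h, zpow_neg_one, mul_inv_rev, inv_eq_of_mul_eq_one_left ha,
      inv_eq_of_mul_eq_one_left hb, Equiv.Perm.mul_apply, ← Equiv.Perm.mul_apply b b, hb]
    rfl
  have hper : (σ ^ N) v = v := (MulAction.pow_smul_eq_iff_minimalPeriod_dvd (a := σ) (b := v)).2 dvd_rfl
  let e : ℕ → R := fun k => if Even k then (σ ^ (k / 2)) v else a ((σ ^ (k / 2)) v)
  have hhalf : ∀ {k k' : ℕ}, (Even k ↔ Even k') → k / 2 = k' / 2 → k = k' := fun {k k'} h h' => by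
    rw [Nat.even_iff, Nat.even_iff] at h
    omega
  refine ⟨2 * N, fun k => e k, ⟨by omega, even_two_mul N, fun k hk => ?_, fun k hk => ?_, ?_, ?_, ?_, ?_⟩,
    ?_⟩
  · have hk' : (k + 1) / 2 = k / 2 := by obtain ⟨l, rfl⟩ := hk; omega
    simp only [e, hk, Nat.even_add_one, not_true, if_true, if_false, hk', a1]
  · have hk' : (k + 1) / 2 = 1 + k / 2 := by rw [Nat.not_even_iff] at hk; omega
    simp only [e, hk, Nat.even_add_one, not_false_iff, if_true, if_false, hk', pow_add, pow_one,
      Equiv.Perm.mul_apply, hσ, b1]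
  · simp [e, hper]
  · intro k hk k' hk' h
    have hk2 : k / 2 < N := by have : k < 2 * N := hk; omega
    have hk2' : k' / 2 < N := by have : k' < 2 * N := hk'; omega
    have h := Subtype.ext h
    by_cases h1 : Even k <;> by_cases h2 : Even k' <;> simp only [e, h1, h2, if_true, if_false] at h
    · exact hhalf (by tauto) (hinj _ hk2 _ hk2' h)
    · exact absurd h (hna _ _)
    · exact absurd h.symm (hna _ _)
    · exact hhalf (by tauto) (hinj _ hk2 _ hk2' (a.injective h))
  · rintro k ⟨hk, h1⟩ k' ⟨hk', h2⟩ h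
    simp only [e, h1, h2, if_true] at h
    rcases b2 _ _ h with h | h
    · exact hhalf (by tauto) (hinj _ (by omega) _ (by omega) h)
    · exact absurd h (hnb _ _)
  · rintro k ⟨hk, h1⟩ k' ⟨hk', h2⟩ h
    simp only [e, h1, h2, if_false, a1] at h
    rcases a2 _ _ h with h | h
    · exact hhalf (by tauto) (hinj _ (by omega) _ (by omega) h)
    · exact absurd h (hna _ _)
  · apply Subset.antisymm
    · refine iUnion₂_subset fun k hk => ?_
      have : e k ∈ reach a b v := by
        simp only [e]
        split_ifs
        · exact ⟨(k / 2 : ℕ), Or.inl (by rw [zpow_natCast])⟩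
        · refine fst_mem_reach ha ⟨(k / 2 : ℕ), Or.inl (by rw [zpow_natCast])⟩
      exact subset_biUnion_of_mem (u := fun w : R => arc w) this
    · refine iUnion₂_subset fun w hw => ?_
      have hz : ∀ m : ℤ, ∃ l < N, (σ ^ m) v = (σ ^ l) v := fun m => by
        have h0 : (0 : ℤ) < N := by exact_mod_cast hNpos
        have h1 := Int.emod_nonneg m h0.ne'
        have h2 := Int.emod_lt_of_pos m h0
        refine ⟨(m % N).toNat, by omega, ?_⟩
        rw [← zpow_natCast, Int.toNat_of_nonneg h1]
        exact (MulAction.zpow_smul_mod_minimalPeriod σ v m).symm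
      obtain ⟨m, h | h⟩ := hw
      · obtain ⟨l, hl, h1⟩ := hz m
        have : e (2 * l) = w := by simp [e, h, ← hσ, h1]
        rw [← this]
        exact subset_biUnion_of_mem (u := fun k : ℕ => arc (e k)) (show 2 * l < 2 * N by omega)
      · obtain ⟨l, hl, h1⟩ := hz m
        have : e (2 * l + 1) = w := by
          have h3 : (2 * l + 1) / 2 = l := by omega
          have h2 : ¬ Even (2 * l + 1) := by simp
          simp only [e, if_neg h2, h3, ← h1]
          rw [← h, ← Equiv.Perm.mul_apply, ha, Equiv.Perm.one_apply]
        rw [← this]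
        exact subset_biUnion_of_mem (u := fun k : ℕ => arc (e k)) (show 2 * l + 1 < 2 * N by omega)

/-- The link associated with a rectangular diagram is a union of disjoint simple closed curves. -/
theorem IsLinkDiagram.exists_curves {R : Set Torus} (hR : IsLinkDiagram R) : ∃ 𝒞 : Set (Set E4),
    𝒞.Finite ∧ 𝒞.PairwiseDisjoint id ∧ (∀ K ∈ 𝒞, IsPiecewiseSmoothSimpleClosedCurve K) ∧
      ⋃₀ 𝒞 = link R := by
  obtain ⟨a, ha, fa, a1, a2⟩ := exists_partner hR.2.1
  obtain ⟨b, hb, fb, b1, b2⟩ := exists_partner hR.2.2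
  have : Finite R := hR.1
  refine ⟨range fun v : R => ⋃ w ∈ reach a b v, arc w, finite_range _, ?_, ?_, ?_⟩
  · rintro _ ⟨v, rfl⟩ _ ⟨v', rfl⟩ hne
    refine disjoint_left.2 fun x hx hx' => hne ?_
    simp only [id, mem_iUnion, exists_prop] at hx hx'
    obtain ⟨w, hw, hxw⟩ := hx
    obtain ⟨w', hw', hxw'⟩ := hx'
    -- Arcs with a common point have a common coordinate, so their vertices are equal or exchanged
    -- by one of the involutions.
    have : w ∈ reach a b v' := by
      rcases eq_or_eq_of_mem_arc hxw hxw' with h | h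
      · rcases a2 w' w h with rfl | rfl
        exacts [hw', fst_mem_reach ha hw']
      · rcases b2 w' w h with rfl | rfl
        exacts [hw', snd_mem_reach ha hb hw']
    simp only [← reach_eq ha hb hw, ← reach_eq ha hb this]
  · rintro _ ⟨v, rfl⟩
    obtain ⟨n, e, h, he⟩ := exists_isClosedChain hR.1 ha hb fa fb a1 b1 a2 b2 v
    simp only [← he]
    exact h.isPiecewiseSmoothSimpleClosedCurve
  · apply Subset.antisymm
    · rintro x ⟨_, ⟨v, rfl⟩, hx⟩
      simp only [mem_iUnion, exists_prop] at hx
      obtain ⟨w, -, hxw⟩ := hx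
      exact mem_biUnion w.2 hxw
    · intro x hx
      simp only [link, mem_iUnion, exists_prop] at hx
      obtain ⟨v, hv, hx⟩ := hx
      exact ⟨_, ⟨⟨v, hv⟩, rfl⟩, mem_biUnion (mem_reach_self _) hx⟩

/-! ### Proof of the proposition. -/

theorem TileSystem.isSurfaceWithCorners {ι : Type} [Finite ι] (T : TileSystem ι) :
    IsSurfaceWithCorners (toE4 '' T.surf) ∧ surfaceBoundary (toE4 '' T.surf) = link T.free := by
  obtain ⟨M, hM, hsub, hint⟩ := T.exists_surface
  have hlink := T.link_free
  have hdiff : toE4 '' T.surf \ relInterior M (toE4 '' T.surf) = link T.free := by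
    rw [hint, hlink, sdiff_sdiff_right_self]
    exact inter_eq_self_of_subset_right (image_mono T.edge_subset)
  refine ⟨?_, by rw [surfaceBoundary_eq hM hsub, hdiff]⟩
  obtain ⟨𝒞, hfin, hdisj, hcurve, hun⟩ := T.isLinkDiagram_free.exists_curves
  refine ⟨M, 𝒞, hM, hsub, T.isCompact_surf.image continuous_toE4, ?_, hfin, hdisj, hcurve,
    fun K hK p hp => ?_, hdiff.trans hun.symm⟩
  · rw [hint, ← image_sdiff toE4_injective]
    exact (image_mono T.surf_subset_closure).trans
      (image_closure_subset_closure_image continuous_toE4)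
  · exact not_hasCuspAt_of_subset_link T.isLinkDiagram_free
      ((subset_sUnion_of_mem hK).trans hun.subset) hp

end RectSurface

theorem mainTheorem6 (P : RectSurface.SurfaceDiagram) :
    RectSurface.IsSurfaceWithCorners P.surface ∧
    RectSurface.IsLinkDiagram P.boundary ∧
    RectSurface.surfaceBoundary P.surface = RectSurface.link P.boundary := by
  obtain ⟨h1, h2⟩ := P.system.isSurfaceWithCorners
  rw [P.surface_eq, ← P.system_free]
  exact ⟨h1, P.system.isLinkDiagram_free, h2⟩
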